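/- **Setting.** Let $n,l\in\mathbb N$, $d\in\mathbb N_0$, $p\in(0,\infty)$, $q,r\in(0,\infty]$, $\alpha_1,\alpha_2\in\mathbb R$, $\alpha_3\ge 0$, $A\ge 1$. A weight is a measurable function with values in $(0,\infty)$. Put $Q_{k,m}=\prod_{i=1}^n(\frac{m_i}{2^k},\frac{m_i+1}{2^k})$ for $k\in\mathbb N_0$, $m\in\mathbb Z^n$, and $I^n=(-1,1)^n$. All sums below have the usual modification when an exponent is $\infty$. *The weights.* Let $\{s_k\}_{k\ge0}$ be a sequence of weights on $\mathbb R^n$ in $^{\rm loc}Y^{\alpha_3}_{\alpha_1,\alpha_2}$: there is $C_1>0$ with $C_1^{-1}2^{\alpha_1(k-j)}\le s_k(x)/s_j(x)\le C_12^{\alpha_2(k-j)}$ for all $0\le j\le k$ and $x\in\mathbb R^n$, and $s_k(x)\le2^{\alpha_3}s_k(y)$ whenever $|x-y|\le2^{-k}$. Put $s_{k,m}=\|s_k|L_p(Q_{k,m})\|$. Let $\gamma$ be a weight on $\mathbb R^{n+d}$ such that $w=\gamma^p$ is in $A^{\rm loc}_\infty(\mathbb R^{n+d})$: $w$ is locally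 integrable and, for some $a>0$, $\alpha\in(0,1)$, $K<\infty$, one has $w(Q)\le K\,w(F)$ for all axis-parallel cubes $Q$ of side at most $a$ and all measurable $F\subset Q$ with $|F|\ge\alpha|Q|$, where $w(E)=\int_E w\,dx$. Put $\widehat\gamma_{k,m}=\|\gamma|L_p(\Xi_{k,m})\|$, where $\Xi_{k,m}=Q_{k,m}\times(2^{-k}B^d\setminus2^{-k-1}B^d)$, $B^d$ being the unit ball of $\mathbb R^d$ ($\Xi_{k,m}=Q_{k,m}$ if $d=0$). *The exponents.* Let $\delta_1(\gamma)$ be the supremum of all $\delta\ge0$ such that, for some $C$, $$\sum_{Q_{j,m'}\subset Q_{k,m}}\widehat\gamma_{j,m'}^{\,p}\le C2^{(k-j)d\delta}\,\widehat\gamma_{k,m}^{\,p}\qquad\text{for all }0\le k\le j,\ m\in\mathbb Z^n ,$$ with $d\,\delta_1(\gamma):=0$ if $d=0$. Let $\delta_2(\gamma)$ be the supremum of all $\delta'\ge0$ such that, for some $C$, $$\sum_{Q\in G}\widehat\gamma_{Q}^{\,p}\le C\Bigl(\frac{|\bigcup_{Q\in G}Q|}{|Q_{k,m}|}\Bigr)^{\delta'}\sum_{Q_{j,m'}\subset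 Q_{k,m}}\widehat\gamma_{j,m'}^{\,p}$$ for all $0\le k\le j$, $m\in\mathbb Z^n$ and all sets $G$ of cubes $Q_{j,m'}\subset Q_{k,m}$, where $\widehat\gamma_Q:=\widehat\gamma_{j,m'}$ for $Q=Q_{j,m'}$. *The space.* Put $\Delta^l(h)\varphi(x)=\sum_{j=0}^l\binom lj(-1)^{l+j}\varphi(x+jh)$, and for a cube $Q$ of side $a$ $$\delta^l_r(Q)\varphi=\Bigl(a^{-2n}\int_{aI^n}\int_Q|\Delta^l(h)\varphi(x)|^r\,dx\,dh\Bigr)^{1/r}.$$ Let $t_{k,m}=s_{k,m}\widehat\gamma_{k,m}$, and let $\{t_k\}$ be any sequence of weights on $\mathbb R^n$ with $\|t_k|L_p(Q_{k,m})\|=t_{k,m}$ for all $k,m$. The space $\widetilde B^l_{p,q,r}(\mathbb R^n,\{t_{k,m}\})$ consists of all real $\varphi\in L_r^{\rm loc}(\mathbb R^n)$ with finite $$\|\varphi|\widetilde B^l_{p,q,r}\|=\Bigl(\sum_{k\ge1}\bigl\|t_k\,\delta^l_r(\cdot+2^{-k}I^n)\varphi\,|L_p(\mathbb R^n)\bigr\|^q\Bigr)^{1/q}+\Bigl(\int_{\mathbb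 R^n}t_0(x)^p\,\|\varphi|L_r(x+I^n)\|^p\,dx\Bigr)^{1/p}.$$ *Splines.* Let $N^{l-1}(x)=\frac1{(l-1)!}\sum_{j=0}^l(-1)^j\binom lj(x-j)_+^{l-1}$ be the $B$-spline of degree $l-1$ with knots $0,\dots,l$, normalised so that its integer translates sum to $1$ (with $(x-j)_+^0=1$ for $x\ge j$ and $0$ otherwise), let $N^{l-1}_{k,m}(x)=\prod_{i=1}^nN^{l-1}(2^kx_i-m_i)$, and let $\Sigma^{l-1}_k$ be the set of all sums $\sum_{m}\beta_mN^{l-1}_{k,m}$ with real $\beta_m$. Put $$s^l_k(\varphi)=\inf_{S\in\Sigma_k^{l-1}}\Bigl(\sum_mt_{k,m}^p\,2^{\frac{knp}r}\|\varphi-S|L_r(Q_{k,m})\|^p\Bigr)^{1/p}\ (k\ge0),\qquad s^l_{-1}(\varphi)=\Bigl(\sum_mt_{0,m}^p\|\varphi|L_r(Q_{0,m})\|^p\Bigr)^{1/p}.$$ *Quasi-interpolants.* For each $k,m$ let $P_{k,m}$ be a polynomial of degree $<l$ in each variable with $\|\varphi-P_{k,m}|L_r(Q_{k,m})\|\le A\inf_R\|\varphi-R|L_r(Q_{k,m})\|$,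 the infimum being over all polynomials $R$ of degree $<l$ in each variable. With $g_k=\sum_mP_{k,m}\chi_{Q_{k,m}}$, $\xi_{k,m}$ the centre of $Q_{k,m}$, with $i$-th coordinate $\xi_{k,m_i}=(m_i+\frac12)2^{-k}$, and $\psi_{\mu}(x)=\prod_{j=1}^{l-1}(\frac{\mu+j}{2^k}-x)$ for $\mu\in\mathbb Z$, put $$T^{l-1}_k(\varphi,r)=\sum_m\Bigl(\sum_{0\le\nu_1,\dots,\nu_n\le l-1}\ \prod_{i=1}^n\frac{(-1)^{l-1-\nu_i}}{(l-1)!}\psi_{m_i}^{(l-1-\nu_i)}(\xi_{k,m_i})\;D^\nu g_k(\xi_{k,m})\Bigr)N^{l-1}_{k,m}.$$ **Corollary 4.1.** Suppose that $\alpha_2<\lambda+\dfrac{d\,\delta_1(\gamma)}p$, where $\lambda=\min\bigl\{l,\ l-1+\frac{\delta_2(\gamma)}p\bigr\}$. Then $\varphi\in L_r^{\rm loc}(\mathbb R^n)$ lies in $\widetilde B^l_{p,q,r}(\mathbb R^n,\{t_{k,m}\})$ if and only if $$N_1(\varphi,l):=\Bigl(\sum_{k=-1}^\infty s^l_k(\varphi)^q\Bigr)^{1/q}<\infty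 .$$ Moreover, $N_1(\varphi,l)\sim N_2(\varphi,l)\sim\|\varphi|\widetilde B^l_{p,q,r}\|$, where $$N_2(\varphi,l):=\Bigl(\sum_{k=0}^\infty\Bigl(\sum_mt^p_{k,m}\,2^{\frac{knp}r}\|\varphi-T^{l-1}_k(\varphi,r)|L_r(Q_{k,m})\|^p\Bigr)^{q/p}\Bigr)^{1/q}+s^l_{-1}(\varphi),$$ and the constants in the equivalences do not depend on $\varphi$, on the choice of the polynomials $P_{k,m}$ (for fixed $A$), or on the choice of $\{t_k\}$ with the given $\{t_{k,m}\}$. -/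

import Mathlib

open MeasureTheory
open scoped ENNReal NNReal

noncomputable section

namespace VarBesov

/-! ### Cubes, weights, sequence norms

The space `ℝⁿ` is `Fin n → ℝ` with Lebesgue measure; the Euclidean norm is written out where it is
needed. All (quasi-)norms take values in `[0, ∞]`. -/

/-- The Euclidean norm on `ℝ^ι` (the norm instance on a function type is the sup norm). -/
def euclNorm {ι : Type} [Fintype ι] (x : ι → ℝ) : ℝ := Real.sqrt (∑ i, x i ^ 2)

/-- The open cube with centre `c`, side length `a` and sides parallel to the axes. -/
def cube {ι : Type} (c : ι → ℝ) (a : ℝ) : Set (ι → ℝ) := {x | ∀ i, |x i - c i| < a / 2}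

/-- The open dyadic cube `∏ᵢ (mᵢ / 2^k, (mᵢ + 1) / 2^k)`. -/
def dyadicCube {n : ℕ} (k : ℕ) (m : Fin n → ℤ) : Set (Fin n → ℝ) :=
  {x | ∀ i, (m i : ℝ) / 2 ^ k < x i ∧ x i < ((m i : ℝ) + 1) / 2 ^ k}

/-- The centre of the dyadic cube. -/
def dyadicCentre {n : ℕ} (k : ℕ) (m : Fin n → ℤ) : Fin n → ℝ :=
  fun i => ((m i : ℝ) + 1 / 2) / 2 ^ k

/-- A weight: a measurable function with values in `(0, ∞)`. -/
def IsWeight {ι : Type} (w : (ι → ℝ) → ℝ) : Prop := Measurable w ∧ ∀ x, 0 < w x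

/-- The `l_q` (quasi-)norm of a family in `[0, ∞]`, for `0 < q ≤ ∞`. -/
def lqNorm {ι : Type} (q : ℝ≥0∞) (a : ι → ℝ≥0∞) : ℝ≥0∞ :=
  if q = ∞ then ⨆ i, a i else (∑' i, a i ^ q.toReal) ^ (1 / q.toReal)

/-- `φ ∈ L_r^loc(ℝⁿ)`. -/
def MemLpLoc {n : ℕ} (φ : (Fin n → ℝ) → ℝ) (r : ℝ≥0∞) : Prop :=
  ∀ K : Set (Fin n → ℝ), IsCompact K → MemLp φ r (volume.restrict K)

/-- The local class `A_∞^loc` on `ℝ^ι`: on all cubes `Q` of side at most some `a > 0`, the ratio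
`w(Q) / w(F)` is bounded, uniformly in `F ⊆ Q` with `|F| ≥ α |Q|`, for some `α ∈ (0, 1)`. -/
def AInftyLoc {ι : Type} [Fintype ι] (w : (ι → ℝ) → ℝ) : Prop :=
  LocallyIntegrable w volume ∧
  ∃ a : ℝ, 0 < a ∧ ∃ α : ℝ, 0 < α ∧ α < 1 ∧ ∃ K : ℝ,
    ∀ (c : ι → ℝ) (b : ℝ), 0 < b → b ≤ a →
      ∀ F : Set (ι → ℝ), MeasurableSet F → F ⊆ cube c b →
        α * volume.real (cube c b) ≤ volume.real F →
          ∫ x in cube c b, w x ≤ K * ∫ x in F, w x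

/-- The class `^loc Y^{α₃}_{α₁,α₂}` of weight sequences on `ℝⁿ`. -/
def LocY {n : ℕ} (α₁ α₂ α₃ : ℝ) (s : ℕ → (Fin n → ℝ) → ℝ) : Prop :=
  (∀ k, IsWeight (s k)) ∧
  (∃ C₁ : ℝ, 0 < C₁ ∧ ∀ j k : ℕ, j ≤ k → ∀ x,
    1 / C₁ * (2 : ℝ) ^ (α₁ * ((k : ℝ) - j)) ≤ s k x / s j x ∧
    s k x / s j x ≤ C₁ * (2 : ℝ) ^ (α₂ * ((k : ℝ) - j))) ∧
  (∀ (k : ℕ) (x y : Fin n → ℝ), euclNorm (x - y) ≤ 1 / 2 ^ k → s k x ≤ (2 : ℝ) ^ α₃ * s k y)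

/-- The multiple sequence `‖t_k | L_p(Q_{k,m})‖`, `p`-associated with a weight sequence. -/
def assoc {n : ℕ} (p : ℝ≥0∞) (t : ℕ → (Fin n → ℝ) → ℝ) (k : ℕ) (m : Fin n → ℤ) : ℝ≥0∞ :=
  eLpNorm (t k) p (volume.restrict (dyadicCube k m))

/-! ### The multiple sequence generated by a weight on `ℝ^{n+d}` -/

/-- The layer `Q_{k,m} × (2^{-k} B^d \ 2^{-k-1} B^d)`; for `d = 0` it is the cube `Q_{k,m}`. The
coordinates of `ℝ^{n+d}` are indexed by `Fin n ⊕ Fin d`. -/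
def layer {n : ℕ} (d k : ℕ) (m : Fin n → ℤ) : Set (Fin n ⊕ Fin d → ℝ) :=
  {z | (fun i => z (Sum.inl i)) ∈ dyadicCube k m ∧
    (d = 0 ∨ (euclNorm (fun i => z (Sum.inr i)) < 1 / 2 ^ k ∧
      1 / 2 ^ (k + 1) ≤ euclNorm (fun i => z (Sum.inr i))))}

/-- The multiple sequence `‖γ | L_p(layer)‖` generated by `γ`. -/
def gammaHat {n d : ℕ} (p : ℝ≥0∞) (γ : (Fin n ⊕ Fin d → ℝ) → ℝ) (k : ℕ) (m : Fin n → ℤ) : ℝ≥0∞ :=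
  eLpNorm γ p (volume.restrict (layer d k m))

/-- The exponent `δ` satisfies the decay estimate between the layers `k ≤ j`, with a constant
independent of `k`, `j` and the cube. -/
def DecayExponent {n d : ℕ} (p : ℝ≥0∞) (γ : (Fin n ⊕ Fin d → ℝ) → ℝ) (δ : ℝ) : Prop :=
  ∃ C : ℝ, 0 < C ∧ ∀ k j : ℕ, k ≤ j → ∀ m : Fin n → ℤ,
    (∑' m' : {m' : Fin n → ℤ // dyadicCube j m' ⊆ dyadicCube k m},
        gammaHat p γ j m'.1 ^ p.toReal) ≤
      ENNReal.ofReal (C * (2 : ℝ) ^ (((k : ℝ) - j) * d * δ)) * gammaHat p γ k m ^ p.toReal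

/-- The exponent `δ'` satisfies the absolute continuity estimate for arbitrary families `G` of
dyadic subcubes of generation `j` of a dyadic cube of generation `k`, with a constant independent of
`k`, `j`, the cube and `G`. -/
def SubsetExponent {n d : ℕ} (p : ℝ≥0∞) (γ : (Fin n ⊕ Fin d → ℝ) → ℝ) (δ' : ℝ) : Prop :=
  ∃ C : ℝ, 0 < C ∧ ∀ k j : ℕ, k ≤ j → ∀ (m : Fin n → ℤ) (G : Finset (Fin n → ℤ)),
    (∀ m' ∈ G, dyadicCube j m' ⊆ dyadicCube k m) →
    (∑ m' ∈ G, gammaHat p γ j m' ^ p.toReal) ≤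
      ENNReal.ofReal
          (C * (volume.real (⋃ m' ∈ G, dyadicCube j m') / volume.real (dyadicCube k m)) ^ δ') *
        ∑' m' : {m' : Fin n → ℤ // dyadicCube j m' ⊆ dyadicCube k m},
          gammaHat p γ j m'.1 ^ p.toReal

/-- `δ₁(γ)`. For `d ≥ 1` and `γ^p ∈ A_∞^loc` the set is nonempty and bounded; for `d = 0` the value
plays no role, because `δ₁` is used only through the product `d * δ₁`. -/
def delta₁ {n d : ℕ} (p : ℝ≥0∞) (γ : (Fin n ⊕ Fin d → ℝ) → ℝ) : ℝ :=
  sSup {δ | 0 ≤ δ ∧ DecayExponent p γ δ}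

/-- `δ₂(γ)`. For `n ≥ 1` and `γ^p ∈ A_∞^loc` the set is bounded by `1`; it always contains `0`. -/
def delta₂ {n d : ℕ} (p : ℝ≥0∞) (γ : (Fin n ⊕ Fin d → ℝ) → ℝ) : ℝ :=
  sSup {δ | 0 ≤ δ ∧ SubsetExponent p γ δ}

/-! ### The Besov-type space of variable smoothness -/

/-- The difference `Δ^l(h) g (x)`. -/
def diff {n : ℕ} (l : ℕ) (h : Fin n → ℝ) (g : (Fin n → ℝ) → ℝ) (x : Fin n → ℝ) : ℝ :=
  ∑ j ∈ Finset.range (l + 1), (l.choose j : ℝ) * (-1) ^ (l + j) * g (x + (j : ℝ) • h)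

/-- `δ^l_r(Q) g` for the cube `Q` with centre `c` and side `a`: the `L_r` (quasi-)norm of
`(h, x) ↦ Δ^l(h) g (x)` over `(-a, a)ⁿ × Q` with respect to Lebesgue measure divided by `a^{2n}`. -/
def avgDiff {n : ℕ} (l : ℕ) (r : ℝ≥0∞) (g : (Fin n → ℝ) → ℝ) (c : Fin n → ℝ) (a : ℝ) : ℝ≥0∞ :=
  eLpNorm (fun z : (Fin n → ℝ) × (Fin n → ℝ) => diff l z.1 g z.2) r
    ((ENNReal.ofReal (a ^ (2 * n)))⁻¹ •
      (volume.restrict (cube (0 : Fin n → ℝ) (2 * a))).prod (volume.restrict (cube c a)))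

/-- The (quasi-)norm of `φ` in `B̃^l_{p,q,r}(ℝⁿ, {t_k})`; the cube `x + 2^{-k} (-1,1)ⁿ` has centre
`x` and side `2 / 2^k`, and the sum runs over `k ≥ 1`. -/
def besovNorm {n : ℕ} (l : ℕ) (p q r : ℝ≥0∞) (t : ℕ → (Fin n → ℝ) → ℝ)
    (φ : (Fin n → ℝ) → ℝ) : ℝ≥0∞ :=
  lqNorm q (fun k : ℕ =>
      eLpNorm (fun x => ENNReal.ofReal (t (k + 1) x) * avgDiff l r φ x (2 / 2 ^ (k + 1)))
        p volume) +
    eLpNorm (fun x => ENNReal.ofReal (t 0 x) * eLpNorm φ r (volume.restrict (cube x 2))) p volume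

/-- `φ ∈ B̃^l_{p,q,r}(ℝⁿ, {t_k})`. -/
def MemBesov {n : ℕ} (l : ℕ) (p q r : ℝ≥0∞) (t : ℕ → (Fin n → ℝ) → ℝ)
    (φ : (Fin n → ℝ) → ℝ) : Prop :=
  MemLpLoc φ r ∧ besovNorm l p q r t φ < ∞

/-! ### Splines and quasi-interpolants -/

/-- The normalised cardinal `B`-spline `N^{l-1}` of degree `l - 1` with knots `0, 1, …, l`, i.e.
`l` times the divided difference at the knots of the truncated power `(· - t)_+^{l-1}`:
`N^{l-1}(t) = 1/(l-1)! * ∑_j (-1)^j (l choose j) (t - j)_+^{l-1}`. -/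
def bspline (l : ℕ) (t : ℝ) : ℝ :=
  1 / ((l - 1).factorial : ℝ) *
    ∑ j ∈ Finset.range (l + 1),
      (-1) ^ j * (l.choose j : ℝ) * (if (j : ℝ) ≤ t then (t - j) ^ (l - 1) else 0)

/-- The tensor product `B`-spline `N^{l-1}_{k,m}`. -/
def bsplineCube {n : ℕ} (l k : ℕ) (m : Fin n → ℤ) (x : Fin n → ℝ) : ℝ :=
  ∏ i, bspline l (2 ^ k * (x i - (m i : ℝ) / 2 ^ k))

/-- The spline with coefficients `β` (a locally finite sum). -/
def splineOf {n : ℕ} (l k : ℕ) (β : (Fin n → ℤ) → ℝ) (x : Fin n → ℝ) : ℝ :=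
  ∑' m : Fin n → ℤ, β m * bsplineCube l k m x

/-- The set `Σ^{l-1}_k` of all splines. -/
def splineSpace (n l k : ℕ) : Set ((Fin n → ℝ) → ℝ) := Set.range (splineOf l k)

/-- The mixed partial derivative `D^ν f`. -/
def multiDeriv {n : ℕ} (ν : Fin n → ℕ) (f : (Fin n → ℝ) → ℝ) : (Fin n → ℝ) → ℝ :=
  (List.finRange n).foldr
    (fun i g => (fun (g' : (Fin n → ℝ) → ℝ) x => lineDeriv ℝ g' x (Pi.single i 1))^[ν i] g) f

/-- The one-dimensional coefficient `a_{k,m,ν}` of the quasi-interpolant, with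
`ψ_m(t) = ∏_{j=1}^{l-1} ((m + j)/2^k - t)`. -/
def quasiCoeff₁ (l k : ℕ) (m : ℤ) (ν : ℕ) : ℝ :=
  (-1) ^ (l - 1 - ν) / ((l - 1).factorial : ℝ) *
    iteratedDeriv (l - 1 - ν)
      (fun t : ℝ => ∏ j ∈ Finset.Icc 1 (l - 1), (((m : ℝ) + (j : ℝ)) / 2 ^ k - t))
      (((m : ℝ) + 1 / 2) / 2 ^ k)

/-- The functional `α_{k,m}(f)`. -/
def quasiCoeff {n : ℕ} (l k : ℕ) (m : Fin n → ℤ) (f : (Fin n → ℝ) → ℝ) : ℝ :=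
  ∑ ν : Fin n → Fin l,
    (∏ i, quasiCoeff₁ l k (m i) (ν i)) * multiDeriv (fun i => (ν i : ℕ)) f (dyadicCentre k m)

/-- The quasi-interpolant `Q^{l-1}_k(f)`. -/
def quasiInterpolant {n : ℕ} (l k : ℕ) (f : (Fin n → ℝ) → ℝ) : (Fin n → ℝ) → ℝ :=
  splineOf l k (fun m => quasiCoeff l k m f)

/-- `P` has degree `< l` in each variable and is an almost best approximation to `φ` in the
`L_r(Q)`-metric, with constant `A`, among all polynomials of degree `< l` in each variable. -/
def IsAlmostBest {n : ℕ} (l : ℕ) (r : ℝ≥0∞) (A : ℝ) (φ : (Fin n → ℝ) → ℝ)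
    (Q : Set (Fin n → ℝ)) (P : MvPolynomial (Fin n) ℝ) : Prop :=
  (∀ i, P.degreeOf i < l) ∧
  eLpNorm (fun x => φ x - MvPolynomial.eval x P) r (volume.restrict Q) ≤
    ENNReal.ofReal A *
      ⨅ R ∈ {R : MvPolynomial (Fin n) ℝ | ∀ i, R.degreeOf i < l},
        eLpNorm (fun x => φ x - MvPolynomial.eval x R) r (volume.restrict Q)

/-- The piecewise polynomial `g_k = ∑_m P_m χ_{Q_{k,m}}`. -/
def piecewisePoly {n : ℕ} (k : ℕ) (P : (Fin n → ℤ) → MvPolynomial (Fin n) ℝ) (x : Fin n → ℝ) : ℝ :=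
  ∑' m : Fin n → ℤ, (dyadicCube k m).indicator (fun y => MvPolynomial.eval y (P m)) x

/-- `T^{l-1}_k(φ, r)`, for the chosen local almost best approximations `P` to `φ`. -/
def quasiApprox {n : ℕ} (l k : ℕ) (P : (Fin n → ℤ) → MvPolynomial (Fin n) ℝ) :
    (Fin n → ℝ) → ℝ :=
  quasiInterpolant l k (piecewisePoly k P)

/-! ### The functionals `N₁` and `N₂` for a multiple sequence `τ` -/

/-- `(∑_m τ_{k,m}^p (2^{kn/r} ‖φ - S | L_r(Q_{k,m})‖)^p)^{1/p}`. -/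
def approxError {n : ℕ} (p r : ℝ≥0∞) (τ : ℕ → (Fin n → ℤ) → ℝ≥0∞) (k : ℕ)
    (φ S : (Fin n → ℝ) → ℝ) : ℝ≥0∞ :=
  lqNorm p (fun m : Fin n → ℤ => τ k m * ((2 : ℝ≥0∞) ^ ((k : ℝ) * n * (r⁻¹).toReal) *
    eLpNorm (fun x => φ x - S x) r (volume.restrict (dyadicCube k m))))

/-- `s_{-1} = (∑_m τ_{0,m}^p ‖φ | L_r(Q_{0,m})‖^p)^{1/p}`. -/
def initialTerm {n : ℕ} (p r : ℝ≥0∞) (τ : ℕ → (Fin n → ℤ) → ℝ≥0∞) (φ : (Fin n → ℝ) → ℝ) : ℝ≥0∞ :=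
  lqNorm p (fun m : Fin n → ℤ => τ 0 m * eLpNorm φ r (volume.restrict (dyadicCube 0 m)))

/-- The best weighted spline approximation `s^l_k`, `k ≥ 0`. -/
def bestSpline {n : ℕ} (l : ℕ) (p r : ℝ≥0∞) (τ : ℕ → (Fin n → ℤ) → ℝ≥0∞) (k : ℕ)
    (φ : (Fin n → ℝ) → ℝ) : ℝ≥0∞ :=
  ⨅ S ∈ splineSpace n l k, approxError p r τ k φ S

/-- `N₁(φ, l)`: the `l_q` (quasi-)norm of `s_{-1}, s_0, s_1, …`. -/
def N₁ {n : ℕ} (l : ℕ) (p q r : ℝ≥0∞) (τ : ℕ → (Fin n → ℤ) → ℝ≥0∞)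
    (φ : (Fin n → ℝ) → ℝ) : ℝ≥0∞ :=
  lqNorm q (fun j : ℕ => match j with
    | 0 => initialTerm p r τ φ
    | k + 1 => bestSpline l p r τ k φ)

/-- `N₂(φ, l)`, for the chosen local almost best approximations `P k m` to `φ` on `Q_{k,m}`. -/
def N₂ {n : ℕ} (l : ℕ) (p q r : ℝ≥0∞) (τ : ℕ → (Fin n → ℤ) → ℝ≥0∞)
    (P : ℕ → (Fin n → ℤ) → MvPolynomial (Fin n) ℝ) (φ : (Fin n → ℝ) → ℝ) : ℝ≥0∞ :=
  lqNorm q (fun k : ℕ => approxError p r τ k φ (quasiApprox l k (P k))) + initialTerm p r τ φ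

end VarBesov

end

set_option autoImplicit false

noncomputable section

namespace VarBesov

/-! ### Quasi-norm estimates for `eLpNorm` -/

lemma exists_coe_eq {D : ℝ≥0∞} (h : D ≠ ∞) : ∃ C : ℝ≥0, (C : ℝ≥0∞) = D :=
  ⟨D.toNNReal, ENNReal.coe_toNNReal h⟩

lemma map_restrict_le {α β : Type*} [MeasurableSpace α] [MeasurableSpace β] {μ : Measure α}
    {ν : Measure β} {T : α → β} (hT : Measurable T) (hmap : μ.map T ≤ ν) {A : Set α} {B : Set β}
    (hAB : Set.MapsTo T A B) : (μ.restrict A).map T ≤ ν.restrict B := by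
  refine Measure.le_iff.2 fun s hs => ?_
  rw [Measure.map_apply hT hs, Measure.restrict_apply (hT hs), Measure.restrict_apply hs]
  calc μ (T ⁻¹' s ∩ A) ≤ μ (T ⁻¹' (s ∩ B)) := measure_mono fun x hx => ⟨hx.1, hAB hx.2⟩
    _ ≤ μ.map T (s ∩ B) := Measure.le_map_apply hT.aemeasurable _
    _ ≤ ν (s ∩ B) := hmap _

lemma eLpNorm_comp_restrict_le {α β : Type*} [MeasurableSpace α] [MeasurableSpace β]
    {μ : Measure α} {ν : Measure β} {T : α → β} (hT : Measurable T) (hmap : μ.map T ≤ ν)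
    {A : Set α} {B : Set β} (hAB : Set.MapsTo T A B) {f : β → ℝ} (hf : Measurable f) (r : ℝ≥0∞) :
    eLpNorm (fun x => f (T x)) r (μ.restrict A) ≤ eLpNorm f r (ν.restrict B) := by
  have h := eLpNorm_map_measure (p := r) (μ := μ.restrict A) (g := f) (f := T)
    hf.aestronglyMeasurable hT.aemeasurable
  have h2 : eLpNorm (fun x => f (T x)) r (μ.restrict A) = eLpNorm f r ((μ.restrict A).map T) :=
    h.symm
  rw [h2]
  exact eLpNorm_mono_measure _ (map_restrict_le hT hmap hAB)

/-- A constant for the quasi-triangle inequality with `N` summands. -/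
def quasiC (r : ℝ≥0∞) (N : ℕ) : ℝ≥0 := (max 1 (ENNReal.LpAddConst r).toNNReal) ^ N

lemma one_le_quasiC (r : ℝ≥0∞) (N : ℕ) : 1 ≤ quasiC r N := one_le_pow₀ (le_max_left _ _)

lemma quasiC_mono (r : ℝ≥0∞) {N N' : ℕ} (h : N ≤ N') : quasiC r N ≤ quasiC r N' :=
  pow_le_pow_right₀ (le_max_left _ _) h

lemma lpAddConst_le_quasiC_one (r : ℝ≥0∞) : ENNReal.LpAddConst r ≤ quasiC r 1 := by
  rw [quasiC, pow_one, ← ENNReal.coe_toNNReal (ENNReal.LpAddConst_lt_top r).ne]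
  exact_mod_cast le_max_right _ _

lemma eLpNorm_sum_le_quasi {α ι : Type*} [MeasurableSpace α] (μ : Measure α) (r : ℝ≥0∞)
    (s : Finset ι) (f : ι → α → ℝ) (hf : ∀ i ∈ s, AEStronglyMeasurable (f i) μ) :
    eLpNorm (fun x => ∑ i ∈ s, f i x) r μ ≤ quasiC r s.card * ∑ i ∈ s, eLpNorm (f i) r μ := by
  classical
  induction s using Finset.induction_on with
  | empty => simp
  | insert a s ha ih =>
    have hs := ih fun i hi => hf i (Finset.mem_insert_of_mem hi)
    simp only [Finset.sum_insert ha, Finset.card_insert_of_notMem ha]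
    have h1 : eLpNorm (fun x => f a x + ∑ i ∈ s, f i x) r μ ≤
        ENNReal.LpAddConst r * (eLpNorm (f a) r μ + eLpNorm (fun x => ∑ i ∈ s, f i x) r μ) :=
      eLpNorm_add_le' (hf a (Finset.mem_insert_self _ _))
        (Finset.aestronglyMeasurable_fun_sum _ fun i hi => hf i (Finset.mem_insert_of_mem hi)) r
    have hq : (quasiC r (s.card + 1) : ℝ≥0∞) = quasiC r 1 * quasiC r s.card := by
      rw [← ENNReal.coe_mul, quasiC, quasiC, quasiC, ← pow_add, add_comm]
    have h3 : (1 : ℝ≥0∞) ≤ quasiC r s.card := by exact_mod_cast one_le_quasiC r _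
    calc _ ≤ _ := h1
      _ ≤ quasiC r 1 * (eLpNorm (f a) r μ + quasiC r s.card * ∑ i ∈ s, eLpNorm (f i) r μ) := by
          gcongr; exact lpAddConst_le_quasiC_one r
      _ ≤ quasiC r 1 * (quasiC r s.card * eLpNorm (f a) r μ +
            quasiC r s.card * ∑ i ∈ s, eLpNorm (f i) r μ) := by
          gcongr
          exact le_mul_of_one_le_left zero_le h3
      _ = _ := by rw [hq, mul_assoc, mul_add]; ring

lemma eLpNorm_const_mul_real {α : Type*} [MeasurableSpace α] (μ : Measure α) (r : ℝ≥0∞) (c : ℝ)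
    (f : α → ℝ) : eLpNorm (fun x => c * f x) r μ = ENNReal.ofReal |c| * eLpNorm f r μ := by
  have h := eLpNorm_const_smul c f r μ
  rw [← Real.norm_eq_abs, ofReal_norm]
  exact h

/-- The main tool: a pointwise bound by a finite sum gives a bound of quasi-norms. -/
lemma eLpNorm_le_of_abs_le_sum {α ι : Type*} [MeasurableSpace α] {μ : Measure α} (r : ℝ≥0∞)
    (s : Finset ι) {g : α → ℝ} (a : ι → ℝ) {f : ι → α → ℝ} (ha : ∀ i ∈ s, 0 ≤ a i)
    (hf : ∀ i ∈ s, AEStronglyMeasurable (f i) μ)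
    (h : ∀ᵐ x ∂μ, |g x| ≤ ∑ i ∈ s, a i * |f i x|) :
    eLpNorm g r μ ≤ quasiC r s.card * ∑ i ∈ s, ENNReal.ofReal (a i) * eLpNorm (f i) r μ := by
  calc eLpNorm g r μ ≤ eLpNorm (fun x => ∑ i ∈ s, a i * |f i x|) r μ :=
        eLpNorm_mono_ae_real (by simpa only [Real.norm_eq_abs] using h)
    _ ≤ quasiC r s.card * ∑ i ∈ s, eLpNorm (fun x => a i * |f i x|) r μ := by
        refine eLpNorm_sum_le_quasi μ r s (fun i x => a i * |f i x|) fun i hi => ?_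
        exact ((hf i hi).norm).const_mul (a i)
    _ = _ := by
        congr 1
        refine Finset.sum_congr rfl fun i hi => ?_
        rw [eLpNorm_const_mul_real, abs_of_nonneg (ha i hi)]
        congr 1
        exact eLpNorm_norm (f i)

lemma eLpNorm_add_le_quasi {α : Type*} [MeasurableSpace α] {μ : Measure α} (r : ℝ≥0∞)
    {f g : α → ℝ} (hf : AEStronglyMeasurable f μ) (hg : AEStronglyMeasurable g μ) :
    eLpNorm (fun x => f x + g x) r μ ≤ quasiC r 1 * (eLpNorm f r μ + eLpNorm g r μ) :=
  (eLpNorm_add_le' hf hg r).trans (by gcongr; exact lpAddConst_le_quasiC_one r)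

lemma eLpNorm_sub_le_quasi {α : Type*} [MeasurableSpace α] {μ : Measure α} (r : ℝ≥0∞)
    {f g : α → ℝ} (hf : AEStronglyMeasurable f μ) (hg : AEStronglyMeasurable g μ) :
    eLpNorm (fun x => f x - g x) r μ ≤ quasiC r 1 * (eLpNorm f r μ + eLpNorm g r μ) := by
  have := eLpNorm_add_le_quasi r hf hg.neg
  simpa only [sub_eq_add_neg, Pi.neg_apply, eLpNorm_neg] using this

/-- If all slices are bounded below, so is the norm over the product. -/
lemma le_eLpNorm_prod {α β : Type*} [MeasurableSpace α] [MeasurableSpace β] {μ : Measure α}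
    {ν : Measure β} [SFinite μ] [SFinite ν] (hν : ν ≠ 0) {r : ℝ≥0∞} (hr : r ≠ 0) {F : α × β → ℝ}
    (hF : Measurable F) {X : ℝ≥0∞} (h : ∀ᵐ b ∂ν, X ≤ eLpNorm (fun a => F (a, b)) r μ) :
    ν Set.univ ^ (1 / r.toReal) * X ≤ eLpNorm F r (μ.prod ν) := by
  rcases eq_or_ne r ∞ with rfl | hr'
  · simp only [ENNReal.toReal_top, div_zero, ENNReal.rpow_zero, one_mul, eLpNorm_exponent_top] at h ⊢
    have h1 : ∀ᵐ z ∂(μ.prod ν), ‖F z‖ₑ ≤ eLpNormEssSup F (μ.prod ν) := enorm_ae_le_eLpNormEssSup _ _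
    have h2 : ∀ᵐ z ∂(ν.prod μ), ‖F z.swap‖ₑ ≤ eLpNormEssSup F (μ.prod ν) := by
      exact Measure.measurePreserving_swap.quasiMeasurePreserving.ae h1
    have : (ae ν).NeBot := ae_neBot.2 hν
    obtain ⟨b, hb, hb'⟩ := ((Measure.ae_ae_of_ae_prod h2).and h).exists
    exact hb'.trans (eLpNormEssSup_le_of_ae_enorm_bound hb)
  · have hr0 : 0 < r.toReal := ENNReal.toReal_pos hr hr'
    simp only [eLpNorm_eq_lintegral_rpow_enorm_toReal hr hr'] at h ⊢
    rw [← ENNReal.rpow_le_rpow_iff hr0, ENNReal.mul_rpow_of_nonneg _ _ hr0.le,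
      ← ENNReal.rpow_mul, ← ENNReal.rpow_mul, one_div, inv_mul_cancel₀ hr0.ne', ENNReal.rpow_one,
      ENNReal.rpow_one, lintegral_prod_symm' _ (by fun_prop)]
    calc ν Set.univ * X ^ r.toReal = ∫⁻ b, X ^ r.toReal ∂ν := by rw [lintegral_const, mul_comm]
      _ ≤ _ := by
        refine lintegral_mono_ae (h.mono fun b hb => ?_)
        have := ENNReal.rpow_le_rpow hb hr0.le
        rwa [← ENNReal.rpow_mul, one_div, inv_mul_cancel₀ hr0.ne', ENNReal.rpow_one] at this

/-- If all slices are bounded above, so is the norm over the product. -/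
lemma eLpNorm_prod_le {α β : Type*} [MeasurableSpace α] [MeasurableSpace β] {μ : Measure α}
    {ν : Measure β} [SFinite μ] [SFinite ν] {r : ℝ≥0∞} (hr : r ≠ 0) {F : α × β → ℝ}
    (hF : Measurable F) {X : ℝ≥0∞} (h : ∀ᵐ b ∂ν, eLpNorm (fun a => F (a, b)) r μ ≤ X) :
    eLpNorm F r (μ.prod ν) ≤ ν Set.univ ^ (1 / r.toReal) * X := by
  rcases eq_or_ne r ∞ with rfl | hr'
  · simp only [ENNReal.toReal_top, div_zero, ENNReal.rpow_zero, one_mul, eLpNorm_exponent_top] at h ⊢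
    refine eLpNormEssSup_le_of_ae_enorm_bound ?_
    have hm : MeasurableSet {z : β × α | ‖F z.swap‖ₑ ≤ X} := by
      apply measurableSet_le <;> fun_prop
    have : ∀ᵐ z ∂(ν.prod μ), ‖F z.swap‖ₑ ≤ X := by
      rw [Measure.ae_prod_iff_ae_ae hm]
      filter_upwards [h] with b hb
      filter_upwards [enorm_ae_le_eLpNormEssSup (fun a => F (a, b)) μ] with a ha
      exact ha.trans hb
    rw [← Measure.prod_swap]
    refine (ae_map_iff measurable_swap.aemeasurable ?_).2 this
    apply measurableSet_le <;> fun_prop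
  · have hr0 : 0 < r.toReal := ENNReal.toReal_pos hr hr'
    simp only [eLpNorm_eq_lintegral_rpow_enorm_toReal hr hr'] at h ⊢
    rw [← ENNReal.rpow_le_rpow_iff hr0, ENNReal.mul_rpow_of_nonneg _ _ hr0.le,
      ← ENNReal.rpow_mul, ← ENNReal.rpow_mul, one_div, inv_mul_cancel₀ hr0.ne', ENNReal.rpow_one,
      ENNReal.rpow_one, lintegral_prod_symm' _ (by fun_prop)]
    calc _ ≤ ∫⁻ b, X ^ r.toReal ∂ν := by
          refine lintegral_mono_ae (h.mono fun b hb => ?_)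
          have := ENNReal.rpow_le_rpow hb hr0.le
          rwa [← ENNReal.rpow_mul, one_div, inv_mul_cancel₀ hr0.ne', ENNReal.rpow_one] at this
      _ = _ := by rw [lintegral_const, mul_comm]

/-! ### Polynomials of degree `< l` in each variable -/

/-- The alternating coefficients of the difference of order `l`. -/
def dcoef (l j : ℕ) : ℝ := (l.choose j : ℝ) * (-1) ^ (l + j)

lemma diff_eq {n : ℕ} (l : ℕ) (h : Fin n → ℝ) (g : (Fin n → ℝ) → ℝ) (x : Fin n → ℝ) :
    diff l h g x = ∑ j ∈ Finset.range (l + 1), dcoef l j * g (x + (j : ℝ) • h) := rfl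

lemma dcoef_last (l : ℕ) : dcoef l l = 1 := by
  simp [dcoef, ← two_mul]

lemma abs_dcoef_le (l j : ℕ) : |dcoef l j| ≤ 2 ^ l := by
  rw [dcoef, abs_mul, abs_pow, abs_neg, abs_one, one_pow, mul_one, Nat.abs_cast]
  exact_mod_cast Nat.choose_le_two_pow l j

lemma sum_dcoef_eval_eq_zero {l : ℕ} {P : Polynomial ℝ} (hP : P.natDegree < l) (x t : ℝ) :
    ∑ j ∈ Finset.range (l + 1), dcoef l j * P.eval (x + j * t) = 0 := by
  set q : Polynomial ℝ := P.comp (Polynomial.C t * Polynomial.X + Polynomial.C x) with hq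
  have hdeg : q.natDegree < l := by
    refine lt_of_le_of_lt ?_ hP
    rw [hq]
    refine Polynomial.natDegree_comp_le.trans ?_
    calc _ ≤ P.natDegree * 1 := Nat.mul_le_mul_left _ Polynomial.natDegree_linear_le
      _ = _ := mul_one _
  have h := congrFun (Polynomial.fwdDiff_iter_eq_zero_of_degree_lt hdeg) 0
  rw [fwdDiff_iter_eq_sum_shift] at h
  simp only [Pi.zero_apply] at h
  rw [← h]
  refine Finset.sum_congr rfl fun j hj => ?_
  have hj' : j ≤ l := Nat.lt_succ_iff.1 (Finset.mem_range.1 hj)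
  have : ((-1 : ℝ)) ^ (l + j) = (-1) ^ (l - j) := by
    obtain ⟨k, rfl⟩ := Nat.exists_eq_add_of_le hj'
    rw [show j + k + j = 2 * j + k by ring, pow_add, pow_mul]
    simp
  simp [dcoef, this, hq]
  ring_nf

/-- The polynomial with coefficients `c`, of degree `< l` in each variable. -/
def tpoly {n l : ℕ} (c : (Fin n → Fin l) → ℝ) (x : Fin n → ℝ) : ℝ :=
  ∑ a, c a * ∏ i, x i ^ (a i : ℕ)

lemma continuous_tpoly {n l : ℕ} (c : (Fin n → Fin l) → ℝ) : Continuous (tpoly c) := by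
  unfold tpoly; fun_prop

lemma measurable_tpoly {n l : ℕ} (c : (Fin n → Fin l) → ℝ) : Measurable (tpoly c) :=
  (continuous_tpoly c).measurable

lemma tpoly_sub {n l : ℕ} (c d : (Fin n → Fin l) → ℝ) (x : Fin n → ℝ) :
    tpoly (c - d) x = tpoly c x - tpoly d x := by
  simp [tpoly, sub_mul, Finset.sum_sub_distrib]

lemma tpoly_add {n l : ℕ} (c d : (Fin n → Fin l) → ℝ) (x : Fin n → ℝ) :
    tpoly (c + d) x = tpoly c x + tpoly d x := by
  simp [tpoly, add_mul, Finset.sum_add_distrib]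

lemma tpoly_smul {n l : ℕ} (s : ℝ) (c : (Fin n → Fin l) → ℝ) (x : Fin n → ℝ) :
    tpoly (s • c) x = s * tpoly c x := by
  simp [tpoly, Finset.mul_sum, mul_assoc]

lemma tpoly_zero {n l : ℕ} (x : Fin n → ℝ) : tpoly (0 : (Fin n → Fin l) → ℝ) x = 0 := by
  simp [tpoly]

lemma tpoly_sum {n l : ℕ} {ι : Type*} (s : Finset ι) (c : ι → (Fin n → Fin l) → ℝ)
    (x : Fin n → ℝ) : tpoly (∑ i ∈ s, c i) x = ∑ i ∈ s, tpoly (c i) x := by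
  simp only [tpoly, Finset.sum_apply, Finset.sum_mul]
  exact Finset.sum_comm

lemma tpoly_prod {n l : ℕ} (p : Fin n → Polynomial ℝ) (hp : ∀ i, (p i).natDegree < l)
    (x : Fin n → ℝ) :
    tpoly (fun a : Fin n → Fin l => ∏ i, (p i).coeff (a i)) x = ∏ i, (p i).eval (x i) := by
  have h : ∀ i, (p i).eval (x i) = ∑ j : Fin l, (p i).coeff j * x i ^ (j : ℕ) := fun i => by
    rw [Polynomial.eval_eq_sum_range' (hp i), Finset.sum_range]
  simp_rw [h]
  rw [Finset.prod_univ_sum, Fintype.piFinset_univ]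
  simp [tpoly, Finset.prod_mul_distrib]

/-- The coefficients of `x ↦ tpoly c (s x + v)`. -/
def affC {n l : ℕ} (s : ℝ) (v : Fin n → ℝ) (c : (Fin n → Fin l) → ℝ) : (Fin n → Fin l) → ℝ :=
  ∑ a, c a • fun b : Fin n → Fin l =>
    ∏ i, ((Polynomial.C s * Polynomial.X + Polynomial.C (v i)) ^ (a i : ℕ)).coeff (b i)

lemma tpoly_affC {n l : ℕ} (s : ℝ) (v : Fin n → ℝ) (c : (Fin n → Fin l) → ℝ) (x : Fin n → ℝ) :
    tpoly (affC s v c) x = tpoly c (fun i => s * x i + v i) := by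
  rw [affC, tpoly_sum, tpoly]
  refine Finset.sum_congr rfl fun a _ => ?_
  rw [tpoly_smul, tpoly_prod]
  · simp
  · intro i
    refine lt_of_le_of_lt ?_ (a i).2
    refine Polynomial.natDegree_pow_le.trans ?_
    calc _ ≤ (a i : ℕ) * 1 := Nat.mul_le_mul_left _ Polynomial.natDegree_linear_le
      _ = _ := mul_one _

/-- The coefficients of the translate `x ↦ tpoly c (x + v)`. -/
def shiftC {n l : ℕ} (v : Fin n → ℝ) (c : (Fin n → Fin l) → ℝ) : (Fin n → Fin l) → ℝ := affC 1 v c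

lemma tpoly_shiftC {n l : ℕ} (v : Fin n → ℝ) (c : (Fin n → Fin l) → ℝ) (x : Fin n → ℝ) :
    tpoly (shiftC v c) x = tpoly c (x + v) := by
  rw [shiftC, tpoly_affC]; congr 1; ext i; simp

/-- The polynomial as an element of `MvPolynomial`. -/
def toMv {n l : ℕ} (c : (Fin n → Fin l) → ℝ) : MvPolynomial (Fin n) ℝ :=
  ∑ a, MvPolynomial.monomial (Finsupp.equivFunOnFinite.symm fun i => (a i : ℕ)) (c a)

lemma eval_toMv {n l : ℕ} (c : (Fin n → Fin l) → ℝ) (x : Fin n → ℝ) :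
    MvPolynomial.eval x (toMv c) = tpoly c x := by
  simp [toMv, tpoly, MvPolynomial.eval_monomial, Finsupp.prod_fintype]

lemma coeff_toMv {n l : ℕ} (c : (Fin n → Fin l) → ℝ) (d : Fin n →₀ ℕ) :
    (toMv c).coeff d = ∑ a, if (Finsupp.equivFunOnFinite.symm fun i => (a i : ℕ)) = d then c a
      else 0 := by
  classical
  simp [toMv, MvPolynomial.coeff_sum, MvPolynomial.coeff_monomial]

lemma coeff_toMv_self {n l : ℕ} (c : (Fin n → Fin l) → ℝ) (a : Fin n → Fin l) :
    (toMv c).coeff (Finsupp.equivFunOnFinite.symm fun i => (a i : ℕ)) = c a := by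
  rw [coeff_toMv, Finset.sum_eq_single a]
  · simp
  · intro b _ hb
    rw [if_neg]
    intro h
    apply hb
    ext i
    exact DFunLike.congr_fun h i
  · simp

lemma degreeOf_toMv {n l : ℕ} (hl : 1 ≤ l) (c : (Fin n → Fin l) → ℝ) (i : Fin n) :
    (toMv c).degreeOf i < l := by
  rw [MvPolynomial.degreeOf_lt_iff hl]
  intro d hd
  rw [MvPolynomial.mem_support_iff, coeff_toMv] at hd
  obtain ⟨a, -, ha⟩ := Finset.exists_ne_zero_of_sum_ne_zero hd
  have : (Finsupp.equivFunOnFinite.symm fun i => (a i : ℕ)) = d := by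
    by_contra h
    simp [h] at ha
  rw [← this]
  exact (a i).2

lemma exists_toMv {n l : ℕ} {P : MvPolynomial (Fin n) ℝ} (hl : 1 ≤ l)
    (hP : ∀ i, P.degreeOf i < l) : ∃ c : (Fin n → Fin l) → ℝ, P = toMv c := by
  refine ⟨fun a => P.coeff (Finsupp.equivFunOnFinite.symm fun i => (a i : ℕ)), ?_⟩
  ext d
  by_cases hd : d ∈ P.support
  · have h : ∀ i, d i < l := fun i => (MvPolynomial.degreeOf_lt_iff hl).1 (hP i) d hd
    have hda : d = Finsupp.equivFunOnFinite.symm fun i => (((⟨d i, h i⟩ : Fin l)) : ℕ) := by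
      ext i; simp
    conv_rhs => rw [hda]
    rw [coeff_toMv_self _ (fun i => ⟨d i, h i⟩), ← hda]
  · rw [coeff_toMv, MvPolynomial.notMem_support_iff.1 hd]
    symm
    refine Finset.sum_eq_zero fun a _ => ?_
    split_ifs with h
    · rw [h]; exact MvPolynomial.notMem_support_iff.1 hd
    · rfl

/-- The coefficients are determined by the values on a grid. -/
lemma exists_norm_le_sum_tpoly_grid (n l : ℕ) (hl : 1 ≤ l) {θ : ℝ} (hθ : 0 < θ) :
    ∃ C : ℝ, 0 ≤ C ∧ ∀ c : (Fin n → Fin l) → ℝ,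
      ‖c‖ ≤ C * ∑ b : Fin n → Fin l, |tpoly c (fun i => θ * (b i : ℕ))| := by
  classical
  let L : ((Fin n → Fin l) → ℝ) →ₗ[ℝ] ((Fin n → Fin l) → ℝ) :=
    { toFun := fun c b => tpoly c (fun i => θ * (b i : ℕ))
      map_add' := fun c d => by ext b; simp [tpoly_add]
      map_smul' := fun s c => by ext b; simp [tpoly_smul] }
  have hL : LinearMap.ker L = ⊥ := by
    rw [LinearMap.ker_eq_bot']
    intro c hc
    have h0 : toMv c = 0 := by
      refine MvPolynomial.eq_zero_of_eval_zero_at_prod_finset (toMv c)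
        (fun _ => Finset.univ.image fun j : Fin l => θ * ((j : ℕ) : ℝ)) ?_ ?_
      · intro i
        rw [Finset.card_image_of_injective _ (fun a b hab => by
          have := mul_left_cancel₀ hθ.ne' hab
          exact Fin.ext (by exact_mod_cast this)), Finset.card_univ, Fintype.card_fin]
        exact degreeOf_toMv hl c i
      · intro x hx
        have : ∀ i, ∃ j : Fin l, θ * ((j : ℕ) : ℝ) = x i := fun i => by
          have := hx i
          simpa using this
        choose b hb using this
        rw [eval_toMv]
        have h := congrFun hc b
        have hxb : x = fun i => θ * ((b i : ℕ) : ℝ) := by ext i; exact (hb i).symm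
        rw [hxb]
        exact h
    ext a
    rw [← coeff_toMv_self c a, h0]
    simp
  obtain ⟨K, -, hK⟩ := L.exists_antilipschitzWith hL
  refine ⟨K, K.2, fun c => ?_⟩
  have h1 := hK.le_mul_dist c 0
  rw [dist_zero_right, map_zero, dist_zero_right] at h1
  refine h1.trans (mul_le_mul_of_nonneg_left ?_ K.2)
  refine (pi_norm_le_iff_of_nonneg (Finset.sum_nonneg fun _ _ => abs_nonneg _)).2 fun b => ?_
  exact Finset.single_le_sum (f := fun b : Fin n → Fin l => |tpoly c (fun i => θ * (b i : ℕ))|)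
    (fun _ _ => abs_nonneg _) (Finset.mem_univ b)

lemma exists_norm_shiftC_le (n l : ℕ) (B : ℝ) :
    ∃ C : ℝ, 0 ≤ C ∧ ∀ v : Fin n → ℝ, (∀ i, |v i| ≤ B) → ∀ c : (Fin n → Fin l) → ℝ,
      ‖shiftC v c‖ ≤ C * ‖c‖ := by
  set D : ℝ := (2 * max 1 B) ^ l with hD
  have hD0 : 0 ≤ D := by positivity
  refine ⟨∑ _a : Fin n → Fin l, D ^ n, by positivity, fun v hv c => ?_⟩
  refine (pi_norm_le_iff_of_nonneg (by positivity)).2 fun b => ?_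
  rw [shiftC, affC, Finset.sum_apply, Finset.sum_mul]
  refine (norm_sum_le _ _).trans (Finset.sum_le_sum fun a _ => ?_)
  rw [Pi.smul_apply, norm_smul, mul_comm]
  refine mul_le_mul ?_ (norm_le_pi_norm c a) (norm_nonneg _) (by positivity)
  rw [norm_prod]
  calc _ ≤ ∏ _i : Fin n, D := by
        refine Finset.prod_le_prod (fun _ _ => norm_nonneg _) fun i _ => ?_
        rw [Polynomial.C_1, one_mul, Polynomial.coeff_X_add_C_pow, norm_mul, norm_pow,
          Real.norm_eq_abs, hD, mul_pow, mul_comm]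
        refine mul_le_mul ?_ ?_ (by positivity) (by positivity)
        · simp only [RCLike.norm_natCast]
          calc (((a i : ℕ).choose (b i) : ℕ) : ℝ) ≤ 2 ^ (a i : ℕ) := by
                exact_mod_cast Nat.choose_le_two_pow _ _
            _ ≤ 2 ^ l := pow_le_pow_right₀ (by norm_num) (a i).2.le
        · calc |v i| ^ ((a i : ℕ) - (b i : ℕ)) ≤ (max 1 B) ^ ((a i : ℕ) - (b i : ℕ)) :=
                pow_le_pow_left₀ (abs_nonneg _) ((hv i).trans (le_max_right _ _)) _
            _ ≤ (max 1 B) ^ l := pow_le_pow_right₀ (le_max_left _ _)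
                ((Nat.sub_le _ _).trans (a i).2.le)
    _ = D ^ n := by simp

lemma exists_abs_tpoly_le (n l : ℕ) (B : ℝ) :
    ∃ C : ℝ, 0 ≤ C ∧ ∀ x : Fin n → ℝ, (∀ i, |x i| ≤ B) → ∀ c : (Fin n → Fin l) → ℝ,
      |tpoly c x| ≤ C * ‖c‖ := by
  refine ⟨∑ _a : Fin n → Fin l, ((max 1 B) ^ l) ^ n, by positivity, fun x hx c => ?_⟩
  rw [tpoly, Finset.sum_mul]
  refine (Finset.abs_sum_le_sum_abs _ _).trans (Finset.sum_le_sum fun a _ => ?_)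
  rw [abs_mul, mul_comm, Finset.abs_prod]
  refine mul_le_mul ?_ (norm_le_pi_norm c a) (abs_nonneg _) (by positivity)
  calc _ ≤ ∏ _i : Fin n, (max 1 B) ^ l := by
        refine Finset.prod_le_prod (fun _ _ => abs_nonneg _) fun i _ => ?_
        rw [abs_pow]
        exact (pow_le_pow_left₀ (abs_nonneg _) ((hx i).trans (le_max_right _ _)) _).trans
          (pow_le_pow_right₀ (le_max_left _ _) (a i).2.le)
    _ = _ := by simp

/-- The open box with lower corner `v` and side `θ`. -/
def box {n : ℕ} (v : Fin n → ℝ) (θ : ℝ) : Set (Fin n → ℝ) := {x | ∀ i, v i < x i ∧ x i < v i + θ}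

lemma box_eq_pi {n : ℕ} (v : Fin n → ℝ) (θ : ℝ) :
    box v θ = Set.univ.pi fun i => Set.Ioo (v i) (v i + θ) := by
  ext x; simp [box, Set.mem_pi]

lemma measurableSet_box {n : ℕ} (v : Fin n → ℝ) (θ : ℝ) : MeasurableSet (box v θ) := by
  rw [box_eq_pi]; exact MeasurableSet.univ_pi fun _ => measurableSet_Ioo

lemma volume_box {n : ℕ} (v : Fin n → ℝ) (θ : ℝ) :
    volume (box v θ) = ENNReal.ofReal θ ^ n := by
  rw [box_eq_pi, Real.volume_pi_Ioo]; simp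

lemma le_mul_of_mul_le_mul {a V C X : ℝ≥0∞} (hV : V ≠ 0) (hV' : V ≠ ∞) (h : V * a ≤ C * X) :
    a ≤ (C * V⁻¹) * X := by
  calc a = V⁻¹ * (V * a) := by rw [← mul_assoc, ENNReal.inv_mul_cancel hV hV', one_mul]
    _ ≤ V⁻¹ * (C * X) := by gcongr
    _ = _ := by ring

lemma map_add_right_le {n : ℕ} (v : Fin n → ℝ) :
    (volume : Measure (Fin n → ℝ)).map (fun x => x + v) ≤ volume :=
  (map_add_right_eq_self _ v).le

lemma exists_norm_le_sum_tpoly_shift (n l : ℕ) (hl : 1 ≤ l) {θ : ℝ} (hθ : 0 < θ) (B : ℝ) :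
    ∃ C : ℝ, 0 ≤ C ∧ ∀ y : Fin n → ℝ, (∀ i, |y i| ≤ B) → ∀ c : (Fin n → Fin l) → ℝ,
      ‖c‖ ≤ ∑ b : Fin n → Fin l, C * |tpoly c (y + fun i => θ * (b i : ℕ))| := by
  obtain ⟨C₁, hC₁, h₁⟩ := exists_norm_le_sum_tpoly_grid n l hl hθ
  obtain ⟨C₂, hC₂, h₂⟩ := exists_norm_shiftC_le n l B
  refine ⟨C₂ * C₁, by positivity, fun y hy c => ?_⟩
  have e : c = shiftC (-y) (shiftC y c) := by
    by_contra hne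
    have hsub : tpoly (c - shiftC (-y) (shiftC y c)) = 0 := by
      ext x; simp [tpoly_sub, tpoly_shiftC]
    have := h₁ (c - shiftC (-y) (shiftC y c))
    rw [hsub] at this
    simp only [Pi.zero_apply, abs_zero, Finset.sum_const_zero, mul_zero] at this
    exact hne (sub_eq_zero.1 (norm_le_zero_iff.1 this))
  calc ‖c‖ = ‖shiftC (-y) (shiftC y c)‖ := by rw [← e]
    _ ≤ C₂ * ‖shiftC y c‖ := h₂ _ (fun i => by simpa using hy i) _
    _ ≤ C₂ * (C₁ * ∑ b : Fin n → Fin l, |tpoly (shiftC y c) (fun i => θ * (b i : ℕ))|) := by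
        gcongr; exact h₁ _
    _ = _ := by
        rw [← mul_assoc, Finset.mul_sum]
        refine Finset.sum_congr rfl fun b _ => ?_
        rw [tpoly_shiftC, add_comm]

lemma eLpNorm_const_box {n : ℕ} {r : ℝ≥0∞} (hr : r ≠ 0) (v : Fin n → ℝ) {θ : ℝ} (hθ : 0 < θ)
    (a : ℝ) : eLpNorm (fun _ : Fin n → ℝ => a) r (volume.restrict (box v θ)) =
      (ENNReal.ofReal θ ^ n) ^ (1 / r.toReal) * ENNReal.ofReal |a| := by
  have hne : volume.restrict (box v θ) ≠ 0 := by
    rw [Ne, Measure.restrict_eq_zero, volume_box]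
    exact pow_ne_zero _ (by simpa using hθ)
  rw [eLpNorm_const _ hr hne, Measure.restrict_apply_univ, volume_box, mul_comm,
    ← Real.norm_eq_abs, ← ofReal_norm]

lemma ofReal_pow_rpow_ne_zero {θ : ℝ} (hθ : 0 < θ) (n : ℕ) (e : ℝ) :
    (ENNReal.ofReal θ ^ n) ^ e ≠ 0 := by
  rw [Ne, ENNReal.rpow_eq_zero_iff]
  rintro (h | h)
  · exact pow_ne_zero _ (by simpa using hθ) h.1
  · exact ENNReal.pow_ne_top ENNReal.ofReal_ne_top h.1

lemma ofReal_pow_rpow_ne_top {θ : ℝ} (n : ℕ) {e : ℝ} (he : 0 ≤ e) :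
    (ENNReal.ofReal θ ^ n) ^ e ≠ ∞ :=
  ENNReal.rpow_ne_top_of_nonneg he (ENNReal.pow_ne_top ENNReal.ofReal_ne_top)

/-- The coefficients are bounded by the `L_r` (quasi-)norm over any box of given side. -/
lemma exists_norm_le_eLpNorm_tpoly (n l : ℕ) (hl : 1 ≤ l) {r : ℝ≥0∞} (hr : r ≠ 0) {θ : ℝ}
    (hθ : 0 < θ) (B : ℝ) :
    ∃ C : ℝ≥0, ∀ v : Fin n → ℝ, (∀ i, |v i| ≤ B) → ∀ c : (Fin n → Fin l) → ℝ,
      ENNReal.ofReal ‖c‖ ≤ C * eLpNorm (tpoly c) r (volume.restrict (box v θ)) := by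
  have hl0 : (0 : ℝ) < l := by exact_mod_cast hl
  have hθ'0 : 0 < θ / l := div_pos hθ hl0
  obtain ⟨C, hC, h⟩ := exists_norm_le_sum_tpoly_shift n l hl hθ'0 (B + θ)
  have hV0 := ofReal_pow_rpow_ne_zero hθ'0 n (1 / r.toReal)
  have hV1 := ofReal_pow_rpow_ne_top (θ := θ / l) n (e := 1 / r.toReal) (by positivity)
  have key : ∀ v : Fin n → ℝ, (∀ i, |v i| ≤ B) → ∀ c : (Fin n → Fin l) → ℝ,
      (ENNReal.ofReal (θ / l) ^ n) ^ (1 / r.toReal) * ENNReal.ofReal ‖c‖ ≤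
        quasiC r (Finset.univ : Finset (Fin n → Fin l)).card * (∑ _b : Fin n → Fin l,
          ENNReal.ofReal C) * eLpNorm (tpoly c) r (volume.restrict (box v θ)) := by
    intro v hv c
    have hconst := eLpNorm_const_box hr v hθ'0 ‖c‖
    rw [abs_norm] at hconst
    rw [← hconst]
    refine (eLpNorm_le_of_abs_le_sum r Finset.univ (fun _ => C) (fun _ _ => hC)
      (f := fun (b : Fin n → Fin l) y => tpoly c (y + fun i => θ / l * (b i : ℕ))) (fun b _ =>
        ((measurable_tpoly c).comp (measurable_add_const _)).aestronglyMeasurable) ?_).trans ?_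
    · refine (ae_restrict_iff' (measurableSet_box _ _)).2
        (Filter.Eventually.of_forall fun y hy => ?_)
      rw [abs_norm]
      refine h y (fun i => ?_) c
      have h1 := hy i
      have h2 := abs_le.1 (hv i)
      have h3 : θ / l ≤ θ := div_le_self hθ.le (by exact_mod_cast hl)
      rw [abs_le]; constructor <;> linarith
    · rw [mul_assoc, Finset.sum_mul]
      gcongr with b _
      refine eLpNorm_comp_restrict_le (measurable_add_const _) (map_add_right_le _) ?_
        (measurable_tpoly c) r
      intro y hy i
      have h1 := hy i
      have hb : ((b i : ℕ) : ℝ) + 1 ≤ l := by exact_mod_cast (b i).2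
      have h3 : θ / l * ((b i : ℕ) : ℝ) + θ / l ≤ θ := by
        have : θ / l * (((b i : ℕ) : ℝ) + 1) ≤ θ / l * l := by gcongr
        rw [div_mul_cancel₀ _ hl0.ne'] at this
        linarith
      have h4 : 0 ≤ θ / l * ((b i : ℕ) : ℝ) := by positivity
      simp only [Pi.add_apply]
      constructor <;> linarith
  have hD : (quasiC r (Finset.univ : Finset (Fin n → Fin l)).card : ℝ≥0∞) *
      (∑ _b : Fin n → Fin l, ENNReal.ofReal C) *
        ((ENNReal.ofReal (θ / l) ^ n) ^ (1 / r.toReal))⁻¹ ≠ ∞ :=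
    ENNReal.mul_ne_top (ENNReal.mul_ne_top ENNReal.coe_ne_top
      (ENNReal.sum_ne_top.2 fun _ _ => ENNReal.ofReal_ne_top)) (ENNReal.inv_ne_top.2 hV0)
  obtain ⟨D, hD⟩ := exists_coe_eq hD
  refine ⟨D, fun v hv c => ?_⟩
  rw [hD]
  exact le_mul_of_mul_le_mul hV0 hV1 (key v hv c)

lemma diff_single_tpoly {n l : ℕ} (c : (Fin n → Fin l) → ℝ) (i : Fin n) (t : ℝ) (x : Fin n → ℝ) :
    diff l (Pi.single i t) (tpoly c) x = 0 := by
  classical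
  simp only [diff_eq, tpoly, Finset.mul_sum]
  rw [Finset.sum_comm]
  refine Finset.sum_eq_zero fun a _ => ?_
  have h := sum_dcoef_eval_eq_zero (P := (Polynomial.X ^ (a i : ℕ) : Polynomial ℝ)) (l := l)
    (by rw [Polynomial.natDegree_X_pow]; exact (a i).2) (x i) t
  simp only [Polynomial.eval_pow, Polynomial.eval_X] at h
  have h2 : ∀ j : ℕ, ∏ k, (x + (j : ℝ) • (Pi.single i t : Fin n → ℝ)) k ^ (a k : ℕ) =
      (x i + j * t) ^ (a i : ℕ) * ∏ k ∈ Finset.univ.erase i, x k ^ (a k : ℕ) := fun j => by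
    rw [← Finset.mul_prod_erase _ _ (Finset.mem_univ i)]
    congr 1
    · simp
    · refine Finset.prod_congr rfl fun k hk => ?_
      simp [Finset.ne_of_mem_erase hk]
  simp only [h2]
  calc _ = c a * (∏ k ∈ Finset.univ.erase i, x k ^ (a k : ℕ)) *
        ∑ j ∈ Finset.range (l + 1), dcoef l j * (x i + j * t) ^ (a i : ℕ) := by
        rw [Finset.mul_sum]
        exact Finset.sum_congr rfl fun j _ => by ring
    _ = 0 := by rw [h, mul_zero]

/-! ### Differences with a fixed step are controlled by averaged differences -/

/-- The open unit cube. -/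
def ucube (n : ℕ) : Set (Fin n → ℝ) := box 0 1

lemma mem_ucube {n : ℕ} {x : Fin n → ℝ} : x ∈ ucube n ↔ ∀ i, 0 < x i ∧ x i < 1 := by
  simp [ucube, box]

lemma measurableSet_ucube (n : ℕ) : MeasurableSet (ucube n) := measurableSet_box _ _

lemma dcoef_zero_mul_self (l : ℕ) : dcoef l 0 * dcoef l 0 = 1 := by
  simp [dcoef, ← mul_pow]

lemma abs_dcoef_zero (l : ℕ) : |dcoef l 0| = 1 := by
  simp [dcoef]

lemma dcoef_sub {l j : ℕ} (hj : j ≤ l) : dcoef l (l - j) = (-1) ^ l * dcoef l j := by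
  rw [dcoef, dcoef, Nat.choose_symm hj, mul_left_comm, ← pow_add]
  congr 1
  obtain ⟨k, rfl⟩ := Nat.exists_eq_add_of_le hj
  rw [Nat.add_sub_cancel_left, show j + k + (j + k + j) = 2 * (j + j) + (k + k) - j by omega]
  rw [show 2 * (j + j) + (k + k) - j = 2 * (j + k) + j by omega,
    show j + k + k = 2 * k + j by omega, pow_add, pow_add, pow_mul, pow_mul]
  simp

lemma diff_reverse {n : ℕ} (l : ℕ) (w : Fin n → ℝ) (f : (Fin n → ℝ) → ℝ) (x : Fin n → ℝ) :
    diff l w f x = (-1) ^ l * diff l (-w) f (x + (l : ℝ) • w) := by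
  rw [diff_eq, diff_eq, ← Finset.sum_range_reflect, Finset.mul_sum]
  refine Finset.sum_congr rfl fun j hj => ?_
  have hj' : j ≤ l := Nat.lt_succ_iff.1 (Finset.mem_range.1 hj)
  rw [show l + 1 - 1 - j = l - j by omega, dcoef_sub hj', mul_assoc, Nat.cast_sub hj']
  congr 3
  ext i
  simp only [Pi.add_apply, Pi.smul_apply, smul_eq_mul, Pi.neg_apply]
  ring

lemma sum_diff_comm {n : ℕ} (l : ℕ) (f : (Fin n → ℝ) → ℝ) (y h u v : Fin n → ℝ) :
    ∑ i ∈ Finset.range (l + 1), dcoef l i * diff l (u + (i : ℝ) • v) f (y + (i : ℝ) • h) =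
      ∑ j ∈ Finset.range (l + 1), dcoef l j * diff l (h + (j : ℝ) • v) f (y + (j : ℝ) • u) := by
  simp only [diff_eq, Finset.mul_sum]
  rw [Finset.sum_comm]
  refine Finset.sum_congr rfl fun j _ => Finset.sum_congr rfl fun i _ => ?_
  rw [mul_left_comm]
  congr 3
  ext k
  simp only [Pi.add_apply, Pi.smul_apply, smul_eq_mul]
  ring

/-- A difference with a prescribed step, in terms of differences with perturbed steps. -/
lemma abs_diff_le_sum {n : ℕ} {l : ℕ} (hl : 1 ≤ l) (f : (Fin n → ℝ) → ℝ) (y h u : Fin n → ℝ) :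
    |diff l h f y| ≤ ∑ k ∈ Finset.range (2 * l + 1), (2 : ℝ) ^ l *
      |if k ≤ l then diff l (((k : ℝ) / l) • h + (-(1 + k : ℝ)) • u) f (y + (l * (1 + k) : ℝ) • u)
        else diff l ((1 - ((k - l : ℕ) : ℝ) / l) • h + ((k - l : ℕ) : ℝ) • u) f
          (y + ((k - l : ℕ) : ℝ) • u)| := by
  have hl0 : (l : ℝ) ≠ 0 := by exact_mod_cast (by omega : l ≠ 0)
  set v : Fin n → ℝ := u - (1 / l : ℝ) • h with hv
  have h1 := sum_diff_comm l f y h u v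
  rw [Finset.sum_range_succ' (fun j => dcoef l j * diff l (h + (j : ℝ) • v) f (y + (j : ℝ) • u))]
    at h1
  simp only [Nat.cast_zero, zero_smul, add_zero] at h1
  have h2 : diff l h f y = dcoef l 0 *
      (∑ i ∈ Finset.range (l + 1), dcoef l i * diff l (u + (i : ℝ) • v) f (y + (i : ℝ) • h) -
        ∑ j ∈ Finset.range l, dcoef l (j + 1) *
          diff l (h + ((j + 1 : ℕ) : ℝ) • v) f (y + ((j + 1 : ℕ) : ℝ) • u)) := by
    rw [h1, add_sub_cancel_left, ← mul_assoc, dcoef_zero_mul_self, one_mul]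
  rw [h2, abs_mul, abs_dcoef_zero, one_mul]
  rw [sub_eq_add_neg]
  refine (abs_add_le _ _).trans ?_
  rw [abs_neg]
  rw [show 2 * l + 1 = (l + 1) + l by omega, Finset.sum_range_add _ (l + 1) l]
  refine add_le_add ?_ ?_
  · refine (Finset.abs_sum_le_sum_abs _ _).trans (Finset.sum_le_sum fun i hi => ?_)
    have hi' : i ≤ l := Nat.lt_succ_iff.1 (Finset.mem_range.1 hi)
    rw [if_pos hi', abs_mul, diff_reverse l (u + (i : ℝ) • v), abs_mul, abs_pow, abs_neg, abs_one,
      one_pow, one_mul]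
    refine mul_le_mul (abs_dcoef_le l i) (le_of_eq ?_) (abs_nonneg _) (by positivity)
    congr 2
    · ext k
      simp only [hv, Pi.add_apply, Pi.neg_apply, Pi.smul_apply, Pi.sub_apply, smul_eq_mul]
      ring
    · ext k
      simp only [hv, Pi.add_apply, Pi.smul_apply, Pi.sub_apply, smul_eq_mul]
      field_simp
      ring
  · refine (Finset.abs_sum_le_sum_abs _ _).trans (Finset.sum_le_sum fun j hj => ?_)
    rw [if_neg (by omega), abs_mul, show l + 1 + j - l = j + 1 by omega]
    refine mul_le_mul (abs_dcoef_le l _) (le_of_eq ?_) (abs_nonneg _) (by positivity)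
    congr 2
    ext k
    simp only [hv, Pi.add_apply, Pi.smul_apply, Pi.sub_apply, smul_eq_mul]
    ring

lemma map_skew_le {n : ℕ} (κ : Fin n → ℝ) {α : ℝ} (hα : 1 ≤ |α|) (β : ℝ) :
    ((volume : Measure (Fin n → ℝ)).prod (volume : Measure (Fin n → ℝ))).map
      (fun p => (κ + α • p.2, p.1 + β • p.2)) ≤ volume.prod volume := by
  have hα0 : α ≠ 0 := by rintro rfl; simp at hα; linarith
  have hshear : MeasurePreserving (fun p : (Fin n → ℝ) × (Fin n → ℝ) => (p.1, p.2 + β • p.1))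
      (volume.prod volume) (volume.prod volume) := by
    refine MeasurePreserving.skew_product (g := fun u y => y + β • u) (MeasurePreserving.id volume)
      (by fun_prop) ?_
    exact Filter.Eventually.of_forall fun u => map_add_right_eq_self _ _
  have hswap : MeasurePreserving (Prod.swap : (Fin n → ℝ) × (Fin n → ℝ) → _)
      (volume.prod volume) (volume.prod volume) := Measure.measurePreserving_swap
  have h1 := hshear.comp hswap
  have hdil : (volume : Measure (Fin n → ℝ)).map (fun u => κ + α • u) ≤ volume := by
    have e : (fun u : Fin n → ℝ => κ + α • u) = (fun u => κ + u) ∘ (fun u => α • u) := rfl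
    rw [e, ← Measure.map_map (by fun_prop) (by fun_prop), Measure.map_addHaar_smul _ hα0,
      Measure.map_smul, map_add_left_eq_self]
    refine Measure.le_iff.2 fun s _ => ?_
    rw [Measure.smul_apply, smul_eq_mul]
    refine mul_le_of_le_one_left' ?_
    rw [← ENNReal.ofReal_one]
    refine ENNReal.ofReal_le_ofReal ?_
    rw [abs_inv, abs_pow]
    exact inv_le_one_of_one_le₀ (one_le_pow₀ hα)
  have e : (fun p : (Fin n → ℝ) × (Fin n → ℝ) => (κ + α • p.2, p.1 + β • p.2)) =
      Prod.map (fun u => κ + α • u) id ∘ ((fun p : (Fin n → ℝ) × (Fin n → ℝ) =>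
        (p.1, p.2 + β • p.1)) ∘ Prod.swap) := rfl
  rw [e, ← Measure.map_map (by fun_prop) h1.measurable, h1.map_eq,
    ← Measure.map_prod_map _ _ (by fun_prop) measurable_id, Measure.map_id]
  exact Measure.prod_mono hdil le_rfl

lemma measurable_diff_prod {n : ℕ} (l : ℕ) {f : (Fin n → ℝ) → ℝ} (hf : Measurable f) :
    Measurable fun z : (Fin n → ℝ) × (Fin n → ℝ) => diff l z.1 f z.2 := by
  simp only [diff_eq]
  fun_prop

lemma measurable_diff {n : ℕ} (l : ℕ) (h : Fin n → ℝ) {f : (Fin n → ℝ) → ℝ} (hf : Measurable f) :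
    Measurable (diff l h f) := by
  have : diff l h f = fun x => diff l h f x := rfl
  rw [this]
  simp only [diff_eq]
  fun_prop

/-- Differences with any fixed step are controlled by averaged differences over a cube of side `2`
whose centre lies in the unit cube. -/
lemma exists_eLpNorm_diff_le_avgDiff (n l : ℕ) (hl : 1 ≤ l) {r : ℝ≥0∞} (hr : r ≠ 0) :
    ∃ C : ℝ≥0, ∀ f : (Fin n → ℝ) → ℝ, Measurable f → ∀ x ∈ ucube n, ∀ h : Fin n → ℝ,
      (∀ i, |h i| ≤ 1) →
        eLpNorm (diff l h f) r (volume.restrict (ucube n)) ≤ C * avgDiff l r f x 2 := by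
  have hl0 : (1 : ℝ) ≤ l := by exact_mod_cast hl
  set ε : ℝ := 1 / (4 * l ^ 2) with hε
  have hε0 : 0 < ε := by positivity
  have hε1 : 4 * (l * (l * ε)) = 1 := by rw [hε]; field_simp
  have hle : l * ε ≤ l * (l * ε) := by
    have : 0 ≤ l * ε := by positivity
    nlinarith
  have hε2 : ε ≤ l * ε := by nlinarith
  have hc : (ENNReal.ofReal ((2 : ℝ) ^ (2 * n)))⁻¹ ≠ 0 := ENNReal.inv_ne_zero.2 ENNReal.ofReal_ne_top
  have hc' : (ENNReal.ofReal ((2 : ℝ) ^ (2 * n)))⁻¹ ≠ ∞ :=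
    ENNReal.inv_ne_top.2 (by simp)
  set c := ((ENNReal.ofReal ((2 : ℝ) ^ (2 * n)))⁻¹) ^ (1 / r).toReal with hcdef
  have hc0 : c ≠ 0 := by
    rw [hcdef, Ne, ENNReal.rpow_eq_zero_iff]
    rintro (h | h)
    · exact hc h.1
    · exact hc' h.1
  have hV0 := ofReal_pow_rpow_ne_zero hε0 n (1 / r.toReal)
  have hV1 := ofReal_pow_rpow_ne_top (θ := ε) n (e := 1 / r.toReal) (by positivity)
  have key : ∀ f : (Fin n → ℝ) → ℝ, Measurable f → ∀ x ∈ ucube n, ∀ h : Fin n → ℝ,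
      (∀ i, |h i| ≤ 1) → (ENNReal.ofReal ε ^ n) ^ (1 / r.toReal) *
        eLpNorm (diff l h f) r (volume.restrict (ucube n)) ≤
        (quasiC r (2 * l + 1) * ∑ _k ∈ Finset.range (2 * l + 1),
          ENNReal.ofReal (2 ^ l) * c⁻¹) * avgDiff l r f x 2 := by
    intro f hf x hx h hh
    rw [mem_ucube] at hx
    set v : Fin n → ℝ := fun k => if x k ≤ 1 / 2 then -ε else 0 with hv
    have hu : ∀ u ∈ box v ε, ∀ k, (x k ≤ 1 / 2 → -ε < u k ∧ u k < 0) ∧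
        (1 / 2 < x k → 0 < u k ∧ u k < ε) := by
      intro u hu k
      have := hu k
      simp only [hv] at this
      constructor
      · intro hk
        rw [if_pos hk] at this
        constructor <;> linarith [this.1, this.2]
      · intro hk
        rw [if_neg (by linarith)] at this
        constructor <;> linarith [this.1, this.2]
    have hV : (volume.restrict (box v ε)) Set.univ = ENNReal.ofReal ε ^ n := by
      rw [Measure.restrict_apply_univ, volume_box]
    have h1 := le_eLpNorm_prod (μ := volume.restrict (ucube n)) (ν := volume.restrict (box v ε))
      (by rw [Ne, Measure.restrict_eq_zero, volume_box]; exact pow_ne_zero _ (by simpa using hε0))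
      hr (F := fun p => diff l h f p.1) ((measurable_diff l h hf).comp measurable_fst)
      (X := eLpNorm (diff l h f) r (volume.restrict (ucube n)))
      (Filter.Eventually.of_forall fun _ => le_rfl)
    rw [hV] at h1
    refine h1.trans ?_
    set Φ : ℕ → (Fin n → ℝ) × (Fin n → ℝ) → ℝ := fun k p =>
      if k ≤ l then diff l (((k : ℝ) / l) • h + (-(1 + k : ℝ)) • p.2) f
          (p.1 + (l * (1 + k) : ℝ) • p.2)
        else diff l ((1 - ((k - l : ℕ) : ℝ) / l) • h + ((k - l : ℕ) : ℝ) • p.2) f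
          (p.1 + ((k - l : ℕ) : ℝ) • p.2) with hΦ
    have hG := measurable_diff_prod l hf
    have hΦm : ∀ k, Measurable (Φ k) := by
      intro k
      by_cases hk : k ≤ l
      · simp only [hΦ, if_pos hk]
        exact hG.comp (g := fun z : (Fin n → ℝ) × (Fin n → ℝ) => diff l z.1 f z.2)
          (f := fun p : (Fin n → ℝ) × (Fin n → ℝ) => (((k : ℝ) / l) • h + (-(1 + k : ℝ)) • p.2,
            p.1 + (l * (1 + k) : ℝ) • p.2)) (by fun_prop)
      · simp only [hΦ, if_neg hk]
        exact hG.comp (g := fun z : (Fin n → ℝ) × (Fin n → ℝ) => diff l z.1 f z.2)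
          (f := fun p : (Fin n → ℝ) × (Fin n → ℝ) =>
            ((1 - ((k - l : ℕ) : ℝ) / l) • h + ((k - l : ℕ) : ℝ) • p.2,
            p.1 + ((k - l : ℕ) : ℝ) • p.2)) (by fun_prop)
    have h2 := eLpNorm_le_of_abs_le_sum (μ := (volume.restrict (ucube n)).prod
        (volume.restrict (box v ε))) r (Finset.range (2 * l + 1)) (g := fun p => diff l h f p.1)
      (fun _ => (2 : ℝ) ^ l) (f := Φ) (fun _ _ => by positivity)
      (fun k _ => (hΦm k).aestronglyMeasurable)
      (Filter.Eventually.of_forall fun p => abs_diff_le_sum hl f p.1 h p.2)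
    refine h2.trans ?_
    rw [Finset.card_range, mul_assoc, Finset.sum_mul]
    refine mul_le_mul' le_rfl (Finset.sum_le_sum fun k hk => ?_)
    rw [mul_assoc]
    refine mul_le_mul' le_rfl ?_
    have havg : avgDiff l r f x 2 = c * eLpNorm (fun z : (Fin n → ℝ) × (Fin n → ℝ) =>
        diff l z.1 f z.2) r ((volume.prod volume).restrict
          (cube (0 : Fin n → ℝ) (2 * 2) ×ˢ cube x 2)) := by
      rw [avgDiff, eLpNorm_smul_measure_of_ne_zero hc, Measure.prod_restrict, smul_eq_mul]
    rw [havg, ← mul_assoc, ENNReal.inv_mul_cancel hc0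
      (ENNReal.rpow_ne_top_of_nonneg ENNReal.toReal_nonneg hc'), one_mul, Measure.prod_restrict]
    have hkl : (k : ℝ) < 2 * l + 1 := by exact_mod_cast Finset.mem_range.1 hk
    by_cases hkl' : k ≤ l
    · have hk1 : (k : ℝ) ≤ l := by exact_mod_cast hkl'
      have hk2 : (k : ℝ) / l ≤ 1 := by rw [div_le_one (by linarith)]; exact hk1
      have hk3 : 0 ≤ (k : ℝ) / l := by positivity
      have hk0 : (0 : ℝ) ≤ k := by positivity
      simp only [hΦ, if_pos hkl']
      refine eLpNorm_comp_restrict_le (f := fun z : (Fin n → ℝ) × (Fin n → ℝ) => diff l z.1 f z.2)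
        (T := fun p : (Fin n → ℝ) × (Fin n → ℝ) => (((k : ℝ) / l) • h + (-(1 + k : ℝ)) • p.2,
            p.1 + (l * (1 + k) : ℝ) • p.2)) (by fun_prop) (map_skew_le _ ?_ _) ?_ hG r
      · rw [abs_neg, abs_of_nonneg (by positivity)]; linarith
      · rintro ⟨y, u⟩ ⟨hy, hu'⟩
        have hy' := mem_ucube.1 hy
        refine ⟨fun i => ?_, fun i => ?_⟩
        · have h3 := hu u hu' i
          have h4 := abs_le.1 (hh i)
          have hui : |u i| ≤ ε := by
            rcases le_or_gt (x i) (1 / 2) with h5 | h5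
            · rw [abs_le]; constructor <;> linarith [(h3.1 h5).1, (h3.1 h5).2]
            · rw [abs_le]; constructor <;> linarith [(h3.2 h5).1, (h3.2 h5).2]
          have e1 : |(k : ℝ) / l * h i| ≤ 1 := by
            rw [abs_mul, abs_of_nonneg hk3]
            exact mul_le_one₀ hk2 (abs_nonneg _) (hh i)
          have e2 : |(-(1 + k : ℝ)) * u i| ≤ 1 / 2 := by
            rw [abs_mul, abs_neg, abs_of_nonneg (by positivity : (0 : ℝ) ≤ 1 + k)]
            calc (1 + k : ℝ) * |u i| ≤ (1 + l) * ε := by gcongr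
              _ ≤ 1 / 2 := by nlinarith
          have : |(k : ℝ) / l * h i + (-(1 + k : ℝ)) * u i| < 2 * 2 / 2 :=
            (abs_add_le _ _).trans_lt (by linarith)
          simpa using this
        · have h3 := hu u hu' i
          have h4 := hy' i
          have h5 := hx i
          have e2 : (l * (1 + k) : ℝ) * ε ≤ 1 / 2 := by
            calc (l * (1 + k) : ℝ) * ε ≤ (l * (1 + l)) * ε := by gcongr
              _ = l * ε + l * (l * ε) := by ring
              _ ≤ 1 / 2 := by linarith
          have e3 : (0 : ℝ) ≤ l * (1 + k) := by positivity
          have : |y i + (l * (1 + k) : ℝ) * u i - x i| < 2 / 2 := by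
            rw [abs_lt]
            rcases le_or_gt (x i) (1 / 2) with h6 | h6
            · have := h3.1 h6
              constructor <;> nlinarith
            · have := h3.2 h6
              constructor <;> nlinarith
          simpa using this
    · push Not at hkl'
      obtain ⟨j, rfl⟩ := Nat.exists_eq_add_of_lt hkl'
      simp only [hΦ, if_neg (show ¬ (l + j + 1 ≤ l) by omega)]
      rw [show l + j + 1 - l = j + 1 by omega]
      set m : ℝ := ((j + 1 : ℕ) : ℝ) with hm
      have hm1 : 1 ≤ m := by rw [hm]; exact_mod_cast Nat.succ_pos j
      have hml : m ≤ l := by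
        rw [hm]; exact_mod_cast (by have := Finset.mem_range.1 hk; omega : j + 1 ≤ l)
      have hk2 : m / l ≤ 1 := by rw [div_le_one (by linarith)]; exact hml
      have hk3 : 0 ≤ m / l := by positivity
      refine eLpNorm_comp_restrict_le (f := fun z : (Fin n → ℝ) × (Fin n → ℝ) => diff l z.1 f z.2)
        (T := fun p : (Fin n → ℝ) × (Fin n → ℝ) => ((1 - m / l) • h + m • p.2,
            p.1 + m • p.2)) (by fun_prop) (map_skew_le _ ?_ _) ?_ hG r
      · rw [abs_of_nonneg (by positivity)]; exact hm1
      · rintro ⟨y, u⟩ ⟨hy, hu'⟩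
        have hy' := mem_ucube.1 hy
        have hmε : m * ε ≤ 1 / 2 := by
          calc m * ε ≤ l * ε := by gcongr
            _ ≤ 1 / 2 := by linarith
        refine ⟨fun i => ?_, fun i => ?_⟩
        · have h3 := hu u hu' i
          have hui : |u i| ≤ ε := by
            rcases le_or_gt (x i) (1 / 2) with h5 | h5
            · rw [abs_le]; constructor <;> linarith [(h3.1 h5).1, (h3.1 h5).2]
            · rw [abs_le]; constructor <;> linarith [(h3.2 h5).1, (h3.2 h5).2]
          have e1 : |(1 - m / l) * h i| ≤ 1 := by
            rw [abs_mul, abs_of_nonneg (by linarith)]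
            exact mul_le_one₀ (by linarith) (abs_nonneg _) (hh i)
          have e2 : |m * u i| ≤ 1 / 2 := by
            rw [abs_mul, abs_of_nonneg (by positivity : (0 : ℝ) ≤ m)]
            calc m * |u i| ≤ m * ε := by gcongr
              _ ≤ 1 / 2 := hmε
          have : |(1 - m / l) * h i + m * u i| < 2 * 2 / 2 :=
            (abs_add_le _ _).trans_lt (by linarith)
          simpa using this
        · have h3 := hu u hu' i
          have h4 := hy' i
          have h5 := hx i
          have : |y i + m * u i - x i| < 2 / 2 := by
            rw [abs_lt]
            rcases le_or_gt (x i) (1 / 2) with h6 | h6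
            · have := h3.1 h6
              constructor <;> nlinarith
            · have := h3.2 h6
              constructor <;> nlinarith
          simpa using this
  have hD : ((quasiC r (2 * l + 1) * ∑ _k ∈ Finset.range (2 * l + 1),
          ENNReal.ofReal (2 ^ l) * c⁻¹) * ((ENNReal.ofReal ε ^ n) ^ (1 / r.toReal))⁻¹ : ℝ≥0∞) ≠ ∞ :=
    ENNReal.mul_ne_top (ENNReal.mul_ne_top ENNReal.coe_ne_top (ENNReal.sum_ne_top.2 fun _ _ =>
      ENNReal.mul_ne_top ENNReal.ofReal_ne_top (ENNReal.inv_ne_top.2 hc0)))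
      (ENNReal.inv_ne_top.2 hV0)
  obtain ⟨D, hD⟩ := exists_coe_eq hD
  refine ⟨D, fun f hf x hx h hh => ?_⟩
  rw [hD]
  exact le_mul_of_mul_le_mul hV0 hV1 (key f hf x hx h hh)

/-! ### Discrete interpolation -/

/-- The Lagrange basis polynomials for the nodes `0, …, l - 1`. -/
def lag (l a : ℕ) : Polynomial ℝ := Lagrange.basis (Finset.range l) (fun i : ℕ => (i : ℝ)) a

lemma injOn_cast (l : ℕ) : Set.InjOn (fun i : ℕ => (i : ℝ)) (Finset.range l : Set ℕ) :=
  fun _ _ _ _ h => Nat.cast_injective h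

lemma natDegree_lag_lt {l a : ℕ} (ha : a < l) : (lag l a).natDegree < l := by
  rw [lag, Lagrange.natDegree_basis (injOn_cast l) (Finset.mem_range.2 ha), Finset.card_range]
  omega

lemma eval_eq_sum_lag {l : ℕ} {P : Polynomial ℝ} (hP : P.natDegree < l) (x : ℝ) :
    P.eval x = ∑ a ∈ Finset.range l, (lag l a).eval x * P.eval (a : ℝ) := by
  have hdeg : P.degree < (Finset.range l).card := by
    rw [Finset.card_range]
    exact lt_of_le_of_lt Polynomial.degree_le_natDegree (by exact_mod_cast hP)
  conv_lhs => rw [Lagrange.eq_interpolate (injOn_cast l) hdeg]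
  rw [Lagrange.interpolate_apply, Polynomial.eval_finsetSum]
  refine Finset.sum_congr rfl fun a _ => ?_
  rw [Polynomial.eval_mul, Polynomial.eval_C, mul_comm]; rfl

lemma exists_abs_lag_le (l : ℕ) (B : ℝ) : ∃ M : ℝ, 0 ≤ M ∧ ∀ x : ℝ, |x| ≤ B → ∀ a < l,
    |(lag l a).eval x| ≤ M := by
  have h : ∀ a, ∃ M : ℝ, ∀ x ∈ Set.Icc (-B) B, ‖(lag l a).eval x‖ ≤ M := fun a =>
    isCompact_Icc.exists_bound_of_continuousOn (lag l a).continuous.continuousOn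
  choose M hM using h
  refine ⟨∑ a ∈ Finset.range l, |M a|, Finset.sum_nonneg fun _ _ => abs_nonneg _,
    fun x hx a ha => ?_⟩
  exact ((hM a x (abs_le.1 hx)).trans (le_abs_self _)).trans
    (Finset.single_le_sum (f := fun a => |M a|) (fun _ _ => abs_nonneg _) (Finset.mem_range.2 ha))

lemma exists_lag_lipschitz (l : ℕ) (B : ℝ) : ∃ M : ℝ, 0 ≤ M ∧ ∀ x y : ℝ, |x| ≤ B → |y| ≤ B →
    ∀ a < l, |(lag l a).eval x - (lag l a).eval y| ≤ M * |x - y| := by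
  have h : ∀ a, ∃ M : ℝ, ∀ x ∈ Set.Icc (-B) B, ‖(lag l a).derivative.eval x‖ ≤ M := fun a =>
    isCompact_Icc.exists_bound_of_continuousOn (lag l a).derivative.continuous.continuousOn
  choose M hM using h
  refine ⟨∑ a ∈ Finset.range l, |M a|, Finset.sum_nonneg fun _ _ => abs_nonneg _,
    fun x y hx hy a ha => ?_⟩
  have h1 := (convex_Icc (-B) B).norm_image_sub_le_of_norm_hasDerivWithin_le
    (f := fun x => (lag l a).eval x) (f' := fun x => (lag l a).derivative.eval x) (C := M a)
    (fun z _ => ((lag l a).hasDerivAt z).hasDerivWithinAt) (fun z hz => hM a z hz)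
    (abs_le.1 hy) (abs_le.1 hx)
  refine h1.trans (mul_le_mul_of_nonneg_right ((le_abs_self _).trans ?_) (norm_nonneg _))
  exact Finset.single_le_sum (f := fun a => |M a|) (fun _ _ => abs_nonneg _)
    (Finset.mem_range.2 ha)

/-- The difference of order `l` of a sequence. -/
def seqDiff (l : ℕ) (g : ℕ → ℝ) (s : ℕ) : ℝ :=
  ∑ j ∈ Finset.range (l + 1), dcoef l j * g (s + j)

/-- The interpolation polynomial of a sequence at `0, …, l - 1`. -/
def interp (l : ℕ) (g : ℕ → ℝ) : Polynomial ℝ :=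
  ∑ a ∈ Finset.range l, Polynomial.C (g a) * lag l a

lemma natDegree_interp_lt {l : ℕ} (hl : 1 ≤ l) (g : ℕ → ℝ) : (interp l g).natDegree < l := by
  refine lt_of_le_of_lt (Polynomial.natDegree_sum_le_of_forall_le (n := l - 1) _ _ fun a ha => ?_)
    (by omega)
  have := natDegree_lag_lt (Finset.mem_range.1 ha)
  exact (Polynomial.natDegree_C_mul_le _ _).trans (by omega)

lemma interp_eval_node {l : ℕ} (g : ℕ → ℝ) {j : ℕ} (hj : j < l) :
    (interp l g).eval (j : ℝ) = g j := by
  rw [interp, Polynomial.eval_finsetSum, Finset.sum_eq_single j]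
  · rw [Polynomial.eval_mul, Polynomial.eval_C, lag,
      Lagrange.eval_basis_self (injOn_cast l) (Finset.mem_range.2 hj), mul_one]
  · intro b _ hb
    have := Lagrange.eval_basis_of_ne (v := fun i : ℕ => (i : ℝ)) hb (Finset.mem_range.2 hj)
    rw [Polynomial.eval_mul, lag, this, mul_zero]
  · intro h; exact absurd (Finset.mem_range.2 hj) h

lemma abs_sub_interp_le {l : ℕ} (hl : 1 ≤ l) (g : ℕ → ℝ) (j : ℕ) :
    |g j - (interp l g).eval (j : ℝ)| ≤ (1 + l * 2 ^ l : ℝ) ^ j *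
      ∑ s ∈ Finset.range (j + 1 - l), |seqDiff l g s| := by
  induction j using Nat.strong_induction_on with
  | _ j ih =>
    rcases lt_or_ge j l with hj | hj
    · rw [interp_eval_node g hj, sub_self, abs_zero]
      positivity
    · obtain ⟨k, rfl⟩ := Nat.exists_eq_add_of_le' hj
      set e : ℕ → ℝ := fun j => g j - (interp l g).eval (j : ℝ) with he
      set D : ℝ := 1 + l * 2 ^ l with hD
      have hD1 : 1 ≤ D := by rw [hD]; linarith [show (0 : ℝ) ≤ l * 2 ^ l by positivity]
      set S : ℝ := ∑ s ∈ Finset.range (k + l + 1 - l), |seqDiff l g s| with hS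
      have hS0 : 0 ≤ S := Finset.sum_nonneg fun _ _ => abs_nonneg _
      have h0 : ∑ i ∈ Finset.range (l + 1), dcoef l i * e (k + i) = seqDiff l g k := by
        have := sum_dcoef_eval_eq_zero (natDegree_interp_lt hl g) (k : ℝ) 1
        rw [seqDiff, ← sub_zero (∑ j ∈ Finset.range (l + 1), dcoef l j * g (k + j)), ← this,
          ← Finset.sum_sub_distrib]
        refine Finset.sum_congr rfl fun i _ => ?_
        rw [he]
        simp only
        push_cast
        rw [mul_one]; ring
      rw [Finset.sum_range_succ, dcoef_last, one_mul] at h0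
      have h1 : |e (k + l)| ≤ |seqDiff l g k| + ∑ i ∈ Finset.range l, 2 ^ l * |e (k + i)| := by
        have : e (k + l) = seqDiff l g k + -∑ i ∈ Finset.range l, dcoef l i * e (k + i) := by
          linarith
        rw [this]
        refine (abs_add_le _ _).trans (add_le_add le_rfl ?_)
        rw [abs_neg]
        refine (Finset.abs_sum_le_sum_abs _ _).trans (Finset.sum_le_sum fun i _ => ?_)
        rw [abs_mul]
        exact mul_le_mul_of_nonneg_right (abs_dcoef_le l i) (abs_nonneg _)
      have h2 : ∀ i ∈ Finset.range l, 2 ^ l * |e (k + i)| ≤ 2 ^ l * (D ^ (k + l - 1) * S) := by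
        intro i hi
        have hi' := Finset.mem_range.1 hi
        gcongr
        refine (ih (k + i) (by omega)).trans ?_
        exact mul_le_mul (pow_le_pow_right₀ hD1 (by omega))
          (Finset.sum_le_sum_of_subset_of_nonneg (Finset.range_mono (by omega))
            fun _ _ _ => abs_nonneg _) (Finset.sum_nonneg fun _ _ => abs_nonneg _) (by positivity)
      have h3 : |seqDiff l g k| ≤ D ^ (k + l - 1) * S := by
        have : |seqDiff l g k| ≤ S :=
          Finset.single_le_sum (f := fun s => |seqDiff l g s|) (fun _ _ => abs_nonneg _)
            (Finset.mem_range.2 (by omega))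
        exact this.trans (le_mul_of_one_le_left hS0 (one_le_pow₀ hD1))
      calc |e (k + l)| ≤ D ^ (k + l - 1) * S + ∑ _i ∈ Finset.range l, 2 ^ l * (D ^ (k + l - 1) * S) :=
            h1.trans (add_le_add h3 (Finset.sum_le_sum h2))
        _ = D ^ (k + l - 1 + 1) * S := by
            rw [Finset.sum_const, Finset.card_range, nsmul_eq_mul, hD]; ring
        _ = D ^ (k + l) * S := by rw [show k + l - 1 + 1 = k + l by omega]

/-- Interpolation at the nodes `i₀ + a K` inside a finite lattice. -/
lemma exists_abs_sub_sum_lag_le {l : ℕ} (hl : 1 ≤ l) {K : ℕ} (hK : 1 ≤ K) (J : ℕ) :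
    ∃ C : ℝ, 0 ≤ C ∧ ∀ (g : ℕ → ℝ) (J' t i₀ : ℕ), J' ≤ J → t ≤ J' → i₀ + (l - 1) * K ≤ J' →
      |g t - ∑ a ∈ Finset.range l, (lag l a).eval (((t : ℝ) - i₀) / K) * g (i₀ + a * K)| ≤
        C * ∑ s ∈ Finset.range (J' + 1 - l), |seqDiff l g s| := by
  obtain ⟨M, hM0, hM⟩ := exists_abs_lag_le l J
  set D : ℝ := 1 + l * 2 ^ l with hD
  have hD1 : 1 ≤ D := by rw [hD]; linarith [show (0 : ℝ) ≤ l * 2 ^ l by positivity]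
  refine ⟨D ^ J * (1 + l * M), by positivity, fun g J' t i₀ hJ ht hi => ?_⟩
  have hK0 : (1 : ℝ) ≤ K := by exact_mod_cast hK
  set S : ℝ := ∑ s ∈ Finset.range (J' + 1 - l), |seqDiff l g s| with hS
  have hS0 : 0 ≤ S := Finset.sum_nonneg fun _ _ => abs_nonneg _
  set e : ℕ → ℝ := fun j => g j - (interp l g).eval (j : ℝ) with he
  have he' : ∀ j ≤ J', |e j| ≤ D ^ J * S := by
    intro j hj
    exact (abs_sub_interp_le hl g j).trans (mul_le_mul (pow_le_pow_right₀ hD1 (by omega))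
      (Finset.sum_le_sum_of_subset_of_nonneg (Finset.range_mono (by omega))
        fun _ _ _ => abs_nonneg _) (Finset.sum_nonneg fun _ _ => abs_nonneg _) (by positivity))
  set q : Polynomial ℝ := (interp l g).comp (Polynomial.C (K : ℝ) * Polynomial.X +
    Polynomial.C (i₀ : ℝ)) with hq
  have hqd : q.natDegree < l := by
    refine lt_of_le_of_lt ?_ (natDegree_interp_lt hl g)
    refine Polynomial.natDegree_comp_le.trans ?_
    calc _ ≤ (interp l g).natDegree * 1 := Nat.mul_le_mul_left _ Polynomial.natDegree_linear_le
      _ = _ := mul_one _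
  have hqe : ∀ x, q.eval x = (interp l g).eval (K * x + i₀) := fun x => by simp [hq]
  have h1 := eval_eq_sum_lag hqd (((t : ℝ) - i₀) / K)
  simp only [hqe] at h1
  rw [mul_div_cancel₀ _ (by linarith : (K : ℝ) ≠ 0), sub_add_cancel] at h1
  have h2 : g t - ∑ a ∈ Finset.range l, (lag l a).eval (((t : ℝ) - i₀) / K) * g (i₀ + a * K) =
      e t + -∑ a ∈ Finset.range l, (lag l a).eval (((t : ℝ) - i₀) / K) * e (i₀ + a * K) := by
    simp only [he, mul_sub, Finset.sum_sub_distrib]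
    rw [h1]
    have : ∀ a : ℕ, (K : ℝ) * a + i₀ = ((i₀ + a * K : ℕ) : ℝ) := fun a => by push_cast; ring
    simp only [this]
    ring
  have harg : |((t : ℝ) - i₀) / K| ≤ J := by
    have h3 : (t : ℝ) ≤ J := by exact_mod_cast ht.trans hJ
    have h4 : (i₀ : ℝ) ≤ J := by exact_mod_cast (by omega : i₀ ≤ J)
    rw [abs_div, Nat.abs_cast]
    refine (div_le_self (abs_nonneg _) hK0).trans ?_
    rw [abs_le]
    constructor <;> linarith [show (0 : ℝ) ≤ t by positivity, show (0 : ℝ) ≤ i₀ by positivity]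
  rw [h2]
  refine (abs_add_le _ _).trans ?_
  rw [abs_neg]
  calc _ ≤ D ^ J * S + ∑ _a ∈ Finset.range l, M * (D ^ J * S) := by
        refine add_le_add (he' t ht) ((Finset.abs_sum_le_sum_abs _ _).trans
          (Finset.sum_le_sum fun a ha => ?_))
        rw [abs_mul]
        have ha' := Finset.mem_range.1 ha
        refine mul_le_mul (hM _ harg a ha') (he' _ ?_) (abs_nonneg _) hM0
        have : a * K ≤ (l - 1) * K := Nat.mul_le_mul_right _ (by omega)
        omega
    _ = _ := by rw [Finset.sum_const, Finset.card_range, nsmul_eq_mul]; ring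

/-! ### Further quasi-norm estimates -/

lemma eLpNorm_le_of_abs_le_sum_add {α ι κ : Type*} [MeasurableSpace α] {μ : Measure α} (r : ℝ≥0∞)
    (s : Finset ι) (t : Finset κ) {g : α → ℝ} (a : ι → ℝ) (b : κ → ℝ) {f : ι → α → ℝ}
    {h : κ → α → ℝ} (ha : ∀ i ∈ s, 0 ≤ a i) (hb : ∀ i ∈ t, 0 ≤ b i)
    (hf : ∀ i ∈ s, AEStronglyMeasurable (f i) μ) (hh : ∀ i ∈ t, AEStronglyMeasurable (h i) μ)
    (hle : ∀ᵐ x ∂μ, |g x| ≤ ∑ i ∈ s, a i * |f i x| + ∑ i ∈ t, b i * |h i x|) :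
    eLpNorm g r μ ≤ quasiC r 1 * (quasiC r s.card * ∑ i ∈ s, ENNReal.ofReal (a i) *
      eLpNorm (f i) r μ + quasiC r t.card * ∑ i ∈ t, ENNReal.ofReal (b i) * eLpNorm (h i) r μ) := by
  have h1 : AEStronglyMeasurable (fun x => ∑ i ∈ s, a i * |f i x|) μ :=
    Finset.aestronglyMeasurable_fun_sum _ fun i hi => (hf i hi).norm.const_mul _
  have h2 : AEStronglyMeasurable (fun x => ∑ i ∈ t, b i * |h i x|) μ :=
    Finset.aestronglyMeasurable_fun_sum _ fun i hi => (hh i hi).norm.const_mul _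
  calc eLpNorm g r μ ≤ eLpNorm (fun x => ∑ i ∈ s, a i * |f i x| + ∑ i ∈ t, b i * |h i x|) r μ :=
        eLpNorm_mono_ae_real (by simpa only [Real.norm_eq_abs] using hle)
    _ ≤ _ := eLpNorm_add_le_quasi r h1 h2
    _ ≤ _ := by
        gcongr
        · refine eLpNorm_le_of_abs_le_sum r s a ha hf (Filter.Eventually.of_forall fun x => ?_)
          rw [abs_of_nonneg (Finset.sum_nonneg fun i hi => mul_nonneg (ha i hi) (abs_nonneg _))]
        · refine eLpNorm_le_of_abs_le_sum r t b hb hh (Filter.Eventually.of_forall fun x => ?_)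
          rw [abs_of_nonneg (Finset.sum_nonneg fun i hi => mul_nonneg (hb i hi) (abs_nonneg _))]

lemma eLpNorm_restrict_le_sum {α ι : Type*} [MeasurableSpace α] {μ : Measure α} (r : ℝ≥0∞)
    (s : Finset ι) {A : Set α} {B : ι → Set α} (hA : MeasurableSet A)
    (hB : ∀ i ∈ s, MeasurableSet (B i)) (hAB : ∀ᵐ x ∂μ, x ∈ A → ∃ i ∈ s, x ∈ B i) {f : α → ℝ}
    (hf : Measurable f) :
    eLpNorm f r (μ.restrict A) ≤ quasiC r s.card * ∑ i ∈ s, eLpNorm f r (μ.restrict (B i)) := by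
  rw [← eLpNorm_indicator_eq_eLpNorm_restrict hA]
  have h := eLpNorm_le_of_abs_le_sum (μ := μ) r s (g := A.indicator f) (fun _ => 1)
    (f := fun i => (B i).indicator f) (fun _ _ => zero_le_one)
    (fun i hi => (hf.indicator (hB i hi)).aestronglyMeasurable) ?_
  · refine h.trans (le_of_eq ?_)
    congr 1
    refine Finset.sum_congr rfl fun i hi => ?_
    rw [ENNReal.ofReal_one, one_mul, eLpNorm_indicator_eq_eLpNorm_restrict (hB i hi)]
  · filter_upwards [hAB] with x hx
    have hnn : ∀ i ∈ s, 0 ≤ 1 * |(B i).indicator f x| := fun i _ => by positivity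
    by_cases hxA : x ∈ A
    · obtain ⟨i, hi, hxi⟩ := hx hxA
      refine le_trans ?_ (Finset.single_le_sum hnn hi)
      rw [Set.indicator_of_mem hxA, Set.indicator_of_mem hxi, one_mul]
    · rw [Set.indicator_of_notMem hxA, abs_zero]
      exact Finset.sum_nonneg hnn

lemma eLpNorm_restrict_union_le {α : Type*} [MeasurableSpace α] {μ : Measure α} (r : ℝ≥0∞)
    {A B C : Set α} (hA : MeasurableSet A) (hB : MeasurableSet B) (hC : MeasurableSet C)
    (hABC : A ⊆ B ∪ C) {f : α → ℝ} (hf : Measurable f) :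
    eLpNorm f r (μ.restrict A) ≤ quasiC r 2 * (eLpNorm f r (μ.restrict B) +
      eLpNorm f r (μ.restrict C)) := by
  have := eLpNorm_restrict_le_sum (μ := μ) r (Finset.univ : Finset Bool) (A := A)
    (B := fun b => if b then B else C) hA (by intro i _; cases i <;> simp [hB, hC])
    (Filter.Eventually.of_forall fun x hx => by
      rcases hABC hx with h | h
      · exact ⟨true, by simp, by simpa using h⟩
      · exact ⟨false, by simp, by simpa using h⟩) hf
  simpa using this

/-! ### Interpolation in one coordinate direction -/

lemma add_single_mem_ucube {n : ℕ} {x : Fin n → ℝ} (hx : x ∈ ucube n) {j : Fin n} {t : ℝ} :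
    x + Pi.single j t ∈ ucube n ↔ 0 < x j + t ∧ x j + t < 1 := by
  rw [mem_ucube] at *
  constructor
  · intro h; simpa using h j
  · intro h i
    rcases eq_or_ne i j with rfl | hij
    · simpa using h
    · simpa [hij] using hx i

/-- Points of the unit cube which stay in it when moved by `v` in direction `j`. -/
def stay {n : ℕ} (j : Fin n) (v : ℝ) : Set (Fin n → ℝ) :=
  {x | x ∈ ucube n ∧ x + Pi.single j v ∈ ucube n}

lemma mem_stay {n : ℕ} {j : Fin n} {v : ℝ} {x : Fin n → ℝ} :
    x ∈ stay j v ↔ x ∈ ucube n ∧ 0 < x j + v ∧ x j + v < 1 :=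
  and_congr_right fun h => add_single_mem_ucube h

lemma measurableSet_stay {n : ℕ} (j : Fin n) (v : ℝ) : MeasurableSet (stay j v) :=
  (measurableSet_ucube n).inter ((measurable_add_const _) (measurableSet_ucube n))

/-- All differences of order `l` in coordinate directions are bounded by `ε`. -/
def AxisDiffLE {n : ℕ} (l : ℕ) (r : ℝ≥0∞) (ψ : (Fin n → ℝ) → ℝ) (ε : ℝ≥0∞) : Prop :=
  ∀ (j : Fin n) (t : ℝ), |t| ≤ 1 →
    eLpNorm (diff l (Pi.single j t) ψ) r (volume.restrict (stay j (l * t))) ≤ ε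

lemma smul_single_real {n : ℕ} (s : ℝ) (j : Fin n) (t : ℝ) :
    s • (Pi.single j t : Fin n → ℝ) = Pi.single j (s * t) := by
  rw [← Pi.single_smul, smul_eq_mul]

lemma seqDiff_line {n : ℕ} (l : ℕ) (ψ : (Fin n → ℝ) → ℝ) (x : Fin n → ℝ) (j : Fin n) (v u : ℝ)
    (s : ℕ) : seqDiff l (fun s : ℕ => ψ (x + Pi.single j (s * v + u))) s =
      diff l (Pi.single j v) ψ (x + Pi.single j (s * v + u)) := by
  rw [seqDiff, diff_eq]
  refine Finset.sum_congr rfl fun i _ => ?_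
  rw [smul_single_real, add_assoc, ← Pi.single_add]
  congr 4
  push_cast; ring

lemma eLpNorm_translate_le {n : ℕ} {A B : Set (Fin n → ℝ)} (v : Fin n → ℝ)
    (hAB : ∀ x ∈ A, x + v ∈ B) {f : (Fin n → ℝ) → ℝ} (hf : Measurable f) (r : ℝ≥0∞) :
    eLpNorm (fun x => f (x + v)) r (volume.restrict A) ≤ eLpNorm f r (volume.restrict B) :=
  eLpNorm_comp_restrict_le (measurable_add_const _) (map_add_right_le v) hAB hf r

lemma measurable_comp_add {n : ℕ} {f : (Fin n → ℝ) → ℝ} (hf : Measurable f) (v : Fin n → ℝ) :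
    Measurable fun x => f (x + v) := hf.comp (measurable_add_const _)

lemma eval_zero_lag {l : ℕ} (hl : 1 ≤ l) (g : ℕ → ℝ) :
    ∑ a ∈ Finset.range l, (lag l a).eval 0 * g a = g 0 := by
  have h := interp_eval_node g (show 0 < l by omega)
  rw [interp, Polynomial.eval_finsetSum, Nat.cast_zero] at h
  rw [← h]
  refine Finset.sum_congr rfl fun a _ => ?_
  rw [Polynomial.eval_mul, Polynomial.eval_C, mul_comm]

lemma abs_shift_sub_le {n l K : ℕ} (hl : 1 ≤ l) (hK : 1 ≤ K) {Λ D : ℝ}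
    (hΛ : ∀ x y : ℝ, |x| ≤ 1 → |y| ≤ 1 → ∀ a < l, |(lag l a).eval x - (lag l a).eval y| ≤ Λ * |x - y|)
    (hD : ∀ (g : ℕ → ℝ) (J' t i₀ : ℕ), J' ≤ l * K → t ≤ J' → i₀ + (l - 1) * K ≤ J' →
      |g t - ∑ a ∈ Finset.range l, (lag l a).eval (((t : ℝ) - i₀) / K) * g (i₀ + a * K)| ≤
        D * ∑ s ∈ Finset.range (J' + 1 - l), |seqDiff l g s|)
    (ψ : (Fin n → ℝ) → ℝ) (j : Fin n) (v : ℝ) (x : Fin n → ℝ) :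
    |ψ (x + (Pi.single j v : Fin n → ℝ)) - ψ x| ≤
      ∑ a ∈ Finset.range l, (Λ * (1 / K)) * |ψ (x + (Pi.single j ((a * K : ℕ) * v) : Fin n → ℝ))| +
      ∑ s ∈ Finset.range (l * K + 1 - l), D * |diff l ((Pi.single j v : Fin n → ℝ)) ψ
        (x + (Pi.single j (s * v) : Fin n → ℝ))| := by
  have hK0 : (1 : ℝ) ≤ K := by exact_mod_cast hK
  have hlK : 1 ≤ l * K := Nat.mul_pos hl hK
  set g : ℕ → ℝ := fun s => ψ (x + Pi.single j (s * v + 0)) with hg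
  have h1 := hD g (l * K) 1 0 le_rfl hlK (by
    rw [zero_add]; exact Nat.mul_le_mul_right _ (by omega))
  have h0 : g 0 = ψ x := by simp [hg]
  have h2 : g 1 = ψ (x + Pi.single j v) := by simp [hg]
  have h3 : ∑ a ∈ Finset.range l, (lag l a).eval 0 * g (0 + a * K) = g 0 := by
    have := eval_zero_lag hl (fun a => g (0 + a * K))
    simpa using this
  rw [← h2, ← h0]
  have h4 : g 1 - g 0 = (g 1 - ∑ a ∈ Finset.range l,
      (lag l a).eval (((1 : ℕ) - (0 : ℕ) : ℝ) / K) * g (0 + a * K)) +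
      ∑ a ∈ Finset.range l, ((lag l a).eval (((1 : ℕ) - (0 : ℕ) : ℝ) / K) - (lag l a).eval 0) *
        g (0 + a * K) := by
    simp only [sub_mul, Finset.sum_sub_distrib]
    rw [h3]; ring
  rw [h4, add_comm (∑ a ∈ Finset.range l, Λ * _ * _)]
  refine (abs_add_le _ _).trans (add_le_add ?_ ?_)
  · refine h1.trans (le_of_eq ?_)
    rw [Finset.mul_sum]
    refine Finset.sum_congr rfl fun s _ => ?_
    rw [seqDiff_line, add_zero]
  · refine (Finset.abs_sum_le_sum_abs _ _).trans (Finset.sum_le_sum fun a ha => ?_)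
    rw [abs_mul]
    have h5 := hΛ (((1 : ℕ) - (0 : ℕ) : ℝ) / K) 0 (by
      rw [Nat.cast_one, Nat.cast_zero, sub_zero, abs_of_nonneg (by positivity)]
      exact div_le_one_of_le₀ hK0 (by linarith)) (by simp) a (Finset.mem_range.1 ha)
    rw [Nat.cast_one, Nat.cast_zero, sub_zero, sub_zero, abs_of_nonneg (a := 1 / (K : ℝ))
      (by positivity)] at h5
    simp only [hg, zero_add, add_zero, Nat.cast_one, Nat.cast_zero, sub_zero]
    exact mul_le_mul_of_nonneg_right h5 (abs_nonneg _)

lemma exists_eLpNorm_shift_sub_le_aux (n l : ℕ) (hl : 1 ≤ l) (r : ℝ≥0∞) :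
    ∃ C₁ : ℝ≥0, ∀ K : ℕ, 1 ≤ K → ∃ C₂ : ℝ≥0, ∀ (ψ : (Fin n → ℝ) → ℝ) (ε : ℝ≥0∞), Measurable ψ →
      AxisDiffLE l r ψ ε → ∀ (j : Fin n) (v : ℝ), |v| ≤ 1 →
        eLpNorm (fun x => ψ (x + Pi.single j v) - ψ x) r
          (volume.restrict (stay j ((l * K : ℕ) * v))) ≤
        C₁ * ENNReal.ofReal (1 / K) * eLpNorm ψ r (volume.restrict (ucube n)) + C₂ * ε := by
  obtain ⟨Λ, hΛ0, hΛ⟩ := exists_lag_lipschitz l 1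
  refine ⟨quasiC r 1 * (quasiC r l * (l * Λ.toNNReal)), fun K hK => ?_⟩
  obtain ⟨D, hD0, hD⟩ := exists_abs_sub_sum_lag_le hl hK (l * K)
  have hK0 : (1 : ℝ) ≤ K := by exact_mod_cast hK
  have hlK : 1 ≤ l * K := Nat.mul_pos hl hK
  refine ⟨quasiC r 1 * (quasiC r (l * K + 1 - l) * ((l * K + 1 - l : ℕ) * D.toNNReal)),
    fun ψ ε hψ hε j v hv => ?_⟩
  obtain ⟨A, hA⟩ : ∃ A, A = stay (n := n) j ((l * K : ℕ) * v) := ⟨_, rfl⟩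
  rw [← hA]
  have hin : ∀ x ∈ A, ∀ s : ℝ, 0 ≤ s → s ≤ (l * K : ℕ) → x + Pi.single j (s * v) ∈ ucube n := by
    intro x hx s hs0 hs1
    rw [hA, mem_stay] at hx
    rw [add_single_mem_ucube hx.1]
    have h1 := mem_ucube.1 hx.1 j
    rcases le_or_gt 0 v with hv0 | hv0
    · have : 0 ≤ s * v := by positivity
      have : s * v ≤ (l * K : ℕ) * v := by gcongr
      constructor <;> linarith [hx.2.2]
    · have : s * v ≤ 0 := mul_nonpos_of_nonneg_of_nonpos hs0 hv0.le
      have : (l * K : ℕ) * v ≤ s * v := mul_le_mul_of_nonpos_right hs1 hv0.le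
      constructor <;> linarith [hx.2.1]
  have hpt := abs_shift_sub_le hl hK hΛ hD ψ j v
  have hbound := eLpNorm_le_of_abs_le_sum_add (μ := volume.restrict A) r (Finset.range l)
    (Finset.range (l * K + 1 - l)) (fun _ => Λ * (1 / K)) (fun _ => D)
    (f := fun (a : ℕ) (x : Fin n → ℝ) => ψ (x + (Pi.single j ((a * K : ℕ) * v) : Fin n → ℝ)))
    (h := fun (s : ℕ) (x : Fin n → ℝ) => diff l ((Pi.single j v : Fin n → ℝ)) ψ (x + (Pi.single j (s * v) : Fin n → ℝ)))
    (g := fun x => ψ (x + (Pi.single j v : Fin n → ℝ)) - ψ x)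
    (fun _ _ => by positivity) (fun _ _ => hD0)
    (fun a _ => (measurable_comp_add hψ _).aestronglyMeasurable)
    (fun s _ => (measurable_comp_add (measurable_diff l _ hψ) _).aestronglyMeasurable)
    (Filter.Eventually.of_forall hpt)
  rw [Finset.card_range, Finset.card_range] at hbound
  refine hbound.trans ?_
  have hb1 : ∀ a ∈ Finset.range l, ENNReal.ofReal (Λ * (1 / K)) *
      eLpNorm (fun x => ψ (x + Pi.single j ((a * K : ℕ) * v))) r (volume.restrict A) ≤
      Λ.toNNReal * ENNReal.ofReal (1 / K) * eLpNorm ψ r (volume.restrict (ucube n)) := by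
    intro a ha
    rw [ENNReal.ofReal_mul hΛ0]
    refine mul_le_mul' le_rfl (eLpNorm_translate_le _ (fun x hx => hin x hx _ (by positivity) ?_) hψ r)
    exact_mod_cast Nat.mul_le_mul_right _ (Finset.mem_range.1 ha).le
  have hb2 : ∀ s ∈ Finset.range (l * K + 1 - l), ENNReal.ofReal D *
      eLpNorm (fun x => diff l (Pi.single j v) ψ (x + Pi.single j (s * v))) r
        (volume.restrict A) ≤ D.toNNReal * ε := by
    intro s hs
    refine mul_le_mul' le_rfl ((eLpNorm_translate_le _ (fun x hx => ?_) (measurable_diff l _ hψ)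
      r).trans (hε j v hv))
    have hs' := Finset.mem_range.1 hs
    refine ⟨hin x hx s (by positivity) (by exact_mod_cast (by omega : s ≤ l * K)), ?_⟩
    rw [add_assoc, ← Pi.single_add, ← add_mul]
    exact hin x hx _ (by positivity) (by exact_mod_cast (by omega : s + l ≤ l * K))
  calc _ ≤ (quasiC r 1 : ℝ≥0∞) * (quasiC r l * ∑ _a ∈ Finset.range l, Λ.toNNReal *
          ENNReal.ofReal (1 / K) * eLpNorm ψ r (volume.restrict (ucube n)) +
        quasiC r (l * K + 1 - l) * ∑ _s ∈ Finset.range (l * K + 1 - l), D.toNNReal * ε) := by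
        exact mul_le_mul' le_rfl (add_le_add (mul_le_mul' le_rfl (Finset.sum_le_sum hb1))
          (mul_le_mul' le_rfl (Finset.sum_le_sum hb2)))
    _ = _ := by
        simp only [Finset.sum_const, Finset.card_range, nsmul_eq_mul]
        push_cast
        ring

/-- Marchaud's inequality: small translations in a coordinate direction. -/
lemma exists_eLpNorm_shift_sub_le (n l : ℕ) (hl : 1 ≤ l) (r : ℝ≥0∞) :
    ∃ C₁ : ℝ≥0, ∀ K : ℕ, 1 ≤ K → ∃ C₂ : ℝ≥0, ∀ (ψ : (Fin n → ℝ) → ℝ) (ε : ℝ≥0∞), Measurable ψ →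
      AxisDiffLE l r ψ ε → ∀ (j : Fin n) (v : ℝ), |v| * (2 * (l * K)) ≤ 1 →
        eLpNorm (fun x => ψ (x + Pi.single j v) - ψ x) r (volume.restrict (stay j v)) ≤
        C₁ * ENNReal.ofReal (1 / K) * eLpNorm ψ r (volume.restrict (ucube n)) + C₂ * ε := by
  obtain ⟨C₁, h₁⟩ := exists_eLpNorm_shift_sub_le_aux n l hl r
  refine ⟨quasiC r 2 * (2 * C₁), fun K hK => ?_⟩
  obtain ⟨C₂, h₂⟩ := h₁ K hK
  refine ⟨quasiC r 2 * (2 * C₂), fun ψ ε hψ hε j v hv => ?_⟩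
  have hlK : (1 : ℝ) ≤ l * K := by exact_mod_cast Nat.mul_pos hl hK
  have hv1 : |v| ≤ 1 := by nlinarith [abs_nonneg v]
  have hm : Measurable fun x => ψ (x + Pi.single j v) - ψ x := (measurable_comp_add hψ _).sub hψ
  have hm' : Measurable fun x => ψ (x + Pi.single j (-v)) - ψ x :=
    (measurable_comp_add hψ _).sub hψ
  set B : Set (Fin n → ℝ) := (fun x => x + Pi.single j v) ⁻¹' stay j ((l * K : ℕ) * (-v)) with hB
  have hcov : stay j v ⊆ stay (n := n) j ((l * K : ℕ) * v) ∪ B := by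
    intro x hx
    have hx' := mem_stay.1 hx
    have hxj := mem_ucube.1 hx'.1 j
    set q : ℝ := (l * K : ℕ) * v with hq
    have hq1 : |q| ≤ 1 / 2 := by
      rw [hq, abs_mul, Nat.abs_cast]
      push_cast
      linarith
    have hq2 := abs_le.1 hq1
    have hB' : x ∈ B ↔ x + Pi.single j v ∈ ucube n ∧ 0 < x j + v - q ∧ x j + v - q < 1 := by
      rw [hB, Set.mem_preimage, mem_stay, mul_neg, ← hq]
      simp [← sub_eq_add_neg]
    rcases le_or_gt 0 v with hv0 | hv0
    · have hvq : v ≤ q := by rw [hq]; push_cast; nlinarith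
      rcases lt_or_ge (x j) (1 / 2) with h | h
      · left
        exact mem_stay.2 ⟨hx'.1, by linarith, by linarith⟩
      · right
        exact hB'.2 ⟨hx.2, by rcases hv0.eq_or_lt with h0 | h0
                              · have : q = 0 := by rw [hq, ← h0, mul_zero]
                                linarith
                              · linarith, by linarith⟩
    · have hvq : q ≤ v := by rw [hq]; push_cast; nlinarith
      rcases lt_or_ge (x j) (1 / 2) with h | h
      · right
        exact hB'.2 ⟨hx.2, by linarith, by linarith⟩
      · rcases eq_or_lt_of_le h with h' | h'
        · right
          exact hB'.2 ⟨hx.2, by linarith, by linarith⟩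
        · left
          exact mem_stay.2 ⟨hx'.1, by linarith, by linarith⟩
  refine (eLpNorm_restrict_union_le r (measurableSet_stay _ _) (measurableSet_stay _ _)
    ((measurable_add_const _) (measurableSet_stay _ _)) hcov hm).trans ?_
  have h3 := h₂ ψ ε hψ hε j v hv1
  have h4 := h₂ ψ ε hψ hε j (-v) (by rwa [abs_neg])
  have h5 : eLpNorm (fun x => ψ (x + Pi.single j v) - ψ x) r (volume.restrict B) ≤
      eLpNorm (fun x => ψ (x + Pi.single j (-v)) - ψ x) r
        (volume.restrict (stay j ((l * K : ℕ) * (-v)))) := by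
    refine le_trans (le_of_eq ?_) (eLpNorm_translate_le (A := B) (Pi.single j v)
      (fun x hx => hx) hm' r)
    rw [← eLpNorm_neg]
    congr 1
    ext x
    simp only [Pi.neg_apply, neg_sub]
    rw [add_assoc, ← Pi.single_add, add_neg_cancel, Pi.single_zero, add_zero]
  calc _ ≤ (quasiC r 2 : ℝ≥0∞) * ((C₁ * ENNReal.ofReal (1 / K) *
        eLpNorm ψ r (volume.restrict (ucube n)) + C₂ * ε) + (C₁ * ENNReal.ofReal (1 / K) *
        eLpNorm ψ r (volume.restrict (ucube n)) + C₂ * ε)) := by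
        gcongr
        exact h5.trans h4
    _ = _ := by push_cast; ring

/-- Interpolation in a coordinate direction at the nodes `x + (a / l) e_j`. -/
lemma exists_eLpNorm_sub_lag_le (n l : ℕ) (hl : 1 ≤ l) (r : ℝ≥0∞) :
    ∃ C₁ : ℝ≥0, ∀ K : ℕ, 1 ≤ K → ∃ C₂ : ℝ≥0, ∀ (ψ : (Fin n → ℝ) → ℝ) (ε : ℝ≥0∞), Measurable ψ →
      AxisDiffLE l r ψ ε → ∀ (j : Fin n) (w : ℝ), -(1 / l) < w → w < 1 →
        eLpNorm (fun x => ψ (x + Pi.single j w) -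
            ∑ a ∈ Finset.range l, (lag l a).eval (l * w) * ψ (x + Pi.single j ((a : ℝ) / l))) r
          (volume.restrict {x | x ∈ stay j w ∧ x j < 1 / l}) ≤
        C₁ * ENNReal.ofReal (1 / K) * eLpNorm ψ r (volume.restrict (ucube n)) + C₂ * ε := by
  obtain ⟨C₁, h₁⟩ := exists_eLpNorm_shift_sub_le n l hl r
  obtain ⟨Λ, hΛ0, hΛ⟩ := exists_lag_lipschitz l l
  refine ⟨quasiC r 1 * (C₁ + quasiC r 1 * (quasiC r l * (l * Λ.toNNReal))), fun K hK => ?_⟩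
  obtain ⟨C₂, h₂⟩ := h₁ K hK
  obtain ⟨D, hD0, hD⟩ := exists_abs_sub_sum_lag_le hl (show 1 ≤ 2 * K by omega) (2 * (l * K))
  set N : ℕ := 2 * (l * K) with hN
  have hK0 : (1 : ℝ) ≤ K := by exact_mod_cast hK
  have hl0 : (1 : ℝ) ≤ l := by exact_mod_cast hl
  have hN0 : (0 : ℝ) < N := by
    have : 1 ≤ l * K := Nat.mul_pos hl hK
    exact_mod_cast (by omega : 0 < N)
  have hNlK : (N : ℝ) = l * (2 * K) := by rw [hN]; push_cast; ring
  refine ⟨quasiC r 1 * (C₂ + quasiC r 1 * (quasiC r (N + 1) * ((N + 1 : ℕ) * D.toNNReal))),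
    fun ψ ε hψ hε j w hw0 hw1 => ?_⟩
  -- the lattice point next to `w`, in the direction of `0`
  obtain ⟨i, hi1, hi2, hi3⟩ : ∃ i : ℤ, |w - i / N| ≤ 1 / N ∧
      (0 ≤ w → 0 ≤ (i : ℝ) / N ∧ (i : ℝ) / N ≤ w) ∧ (w < 0 → w ≤ (i : ℝ) / N ∧ (i : ℝ) / N ≤ 0) := by
    rcases le_or_gt 0 w with h | h
    · refine ⟨⌊N * w⌋, ?_, fun _ => ⟨?_, ?_⟩, fun h' => absurd h (by linarith)⟩
      · have e1 := Int.floor_le (N * w)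
        have e2 := Int.lt_floor_add_one (N * w)
        have : w - (⌊N * w⌋ : ℝ) / N = (N * w - ⌊N * w⌋) / N := by field_simp
        rw [this, abs_of_nonneg (div_nonneg (by linarith) hN0.le)]
        gcongr; linarith
      · have : (0 : ℤ) ≤ ⌊N * w⌋ := Int.floor_nonneg.2 (by positivity)
        exact div_nonneg (by exact_mod_cast this) hN0.le
      · rw [div_le_iff₀ hN0, mul_comm]; exact Int.floor_le _
    · refine ⟨⌈N * w⌉, ?_, fun h' => absurd h (by linarith), fun _ => ⟨?_, ?_⟩⟩
      · have e1 := Int.le_ceil (N * w)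
        have e2 := Int.ceil_lt_add_one (N * w)
        have : w - (⌈N * w⌉ : ℝ) / N = -((⌈N * w⌉ - N * w) / N) := by field_simp; ring
        rw [this, abs_neg, abs_of_nonneg (div_nonneg (by linarith) hN0.le)]
        gcongr; linarith
      · rw [le_div_iff₀ hN0, mul_comm]; exact Int.le_ceil _
      · have : ⌈N * w⌉ ≤ 0 := Int.ceil_le.2 (by push_cast; nlinarith)
        exact div_nonpos_of_nonpos_of_nonneg (by exact_mod_cast this) hN0.le
  set v : ℝ := w - i / N with hv
  set i₀ : ℕ := (-i).toNat with hi₀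
  set t : ℕ := i.toNat with ht
  have hit : (t : ℝ) - i₀ = i := by
    have : (t : ℤ) - i₀ = i := by omega
    exact_mod_cast this
  set A : Set (Fin n → ℝ) := {x | x ∈ stay j w ∧ x j < 1 / l} with hA
  have hAm : MeasurableSet A :=
    (measurableSet_stay j w).inter (measurableSet_lt (measurable_pi_apply j) measurable_const)
  -- the lattice segment stays in the unit cube
  have hiN : -((2 * K : ℕ) : ℝ) < i ∧ (i : ℝ) < N := by
    have e1 : (N : ℝ) * (1 / l) = (2 * K : ℕ) := by rw [hNlK]; push_cast; field_simp
    rcases le_or_gt 0 w with h | h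
    · obtain ⟨h3, h4⟩ := hi2 h
      have h5 : (i : ℝ) ≤ w * N := (div_le_iff₀ hN0).1 h4
      have h6 : (0 : ℝ) ≤ i := by
        by_contra hneg
        push Not at hneg
        exact absurd h3 (not_le.2 (div_neg_of_neg_of_pos hneg hN0))
      constructor
      · have : (0 : ℝ) < (2 * K : ℕ) := by push_cast; linarith
        linarith
      · nlinarith
    · obtain ⟨h3, h4⟩ := hi3 h
      have h5 : w * N ≤ i := (le_div_iff₀ hN0).1 h3
      have h6 : (i : ℝ) ≤ 0 := by
        by_contra hneg
        push Not at hneg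
        exact absurd h4 (not_le.2 (div_pos hneg hN0))
      constructor
      · nlinarith
      · linarith
  have hiN1 : -((2 * K : ℕ) : ℤ) < i := by exact_mod_cast hiN.1
  have hiN2 : i < (N : ℤ) := by exact_mod_cast hiN.2
  set J' : ℕ := max t (i₀ + (l - 1) * (2 * K)) with hJ'
  have hlast : i₀ + (l - 1) * (2 * K) ≤ N := by
    have : (l - 1) * (2 * K) + 2 * K = N := by
      rw [← Nat.succ_mul, Nat.succ_eq_add_one, Nat.sub_add_cancel hl, hN]; ring
    omega
  have hJN : J' ≤ N := max_le (by omega) hlast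
  have hin : ∀ x ∈ A, ∀ s : ℕ, s ≤ J' → x + Pi.single j (s * (1 / N) + -(i₀ : ℝ) / N) ∈ ucube n := by
    intro x hx s hs
    have hx1 := mem_stay.1 hx.1
    have hxl : x j < 1 / l := hx.2
    have hxj := mem_ucube.1 hx1.1 j
    rw [add_single_mem_ucube hx1.1]
    have hs0 : 0 ≤ (s : ℝ) * (1 / N) := by positivity
    constructor
    · rcases le_or_gt 0 w with h | h
      · have : i₀ = 0 := by
          obtain ⟨h3, h4⟩ := hi2 h
          have : (0 : ℝ) ≤ i := by
            by_contra hneg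
            push Not at hneg
            exact absurd h3 (not_le.2 (div_neg_of_neg_of_pos hneg hN0))
          have : (0 : ℤ) ≤ i := by exact_mod_cast this
          omega
        rw [this]; simp only [Nat.cast_zero, neg_zero, zero_div]; linarith
      · obtain ⟨h3, h4⟩ := hi3 h
        have h5 : -(i₀ : ℝ) ≤ 0 := by simp
        have h6 : (i : ℝ) ≤ 0 := by
          by_contra hneg
          push Not at hneg
          exact absurd h4 (not_le.2 (div_pos hneg hN0))
        have h7 : i ≤ 0 := by exact_mod_cast h6
        have h8 : -(i₀ : ℝ) = i := by
          have : -(i₀ : ℤ) = i := by omega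
          exact_mod_cast this
        rw [h8]
        linarith [hx1.2.1]
    · have hsJ : (s : ℝ) ≤ J' := by exact_mod_cast hs
      have e : (s : ℝ) * (1 / N) + -(i₀ : ℝ) / N ≤ (J' : ℝ) * (1 / N) + -(i₀ : ℝ) / N := by gcongr
      refine lt_of_le_of_lt (add_le_add le_rfl e) ?_
      rcases le_total t (i₀ + (l - 1) * (2 * K)) with h | h
      · rw [hJ', max_eq_right h]
        have e2 : ((i₀ + (l - 1) * (2 * K) : ℕ) : ℝ) * (1 / N) + -(i₀ : ℝ) / N = 1 - 1 / l := by
          push_cast [Nat.cast_sub hl]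
          rw [hNlK]; field_simp; ring
        rw [e2]; linarith
      · rw [hJ', max_eq_left h]
        have e2 : (t : ℝ) * (1 / N) + -(i₀ : ℝ) / N = i / N := by rw [← hit]; ring
        rw [e2]
        rcases le_or_gt 0 w with h' | h'
        · linarith [(hi2 h').2, hx1.2.2]
        · linarith [(hi3 h').2, hxj.2]
  have hpt : ∀ x : Fin n → ℝ, |ψ (x + (Pi.single j w : Fin n → ℝ)) - ∑ a ∈ Finset.range l, (lag l a).eval (l * w) *
        ψ (x + (Pi.single j ((a : ℝ) / l) : Fin n → ℝ)) - (ψ (x + (Pi.single j ((i : ℝ) / N) : Fin n → ℝ) + (Pi.single j v : Fin n → ℝ)) -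
          ψ (x + (Pi.single j ((i : ℝ) / N) : Fin n → ℝ)))| ≤
      ∑ a ∈ Finset.range l, (Λ * (1 / K)) * |ψ (x + (Pi.single j ((a : ℝ) / l) : Fin n → ℝ))| +
      ∑ s ∈ Finset.range (J' + 1 - l), D * |diff l ((Pi.single j (1 / N) : Fin n → ℝ)) ψ
        (x + (Pi.single j (s * (1 / N) + -(i₀ : ℝ) / N) : Fin n → ℝ))| := by
    intro x
    set g : ℕ → ℝ := fun s => ψ (x + Pi.single j (s * (1 / N) + -(i₀ : ℝ) / N)) with hg
    have h1 := hD g J' t i₀ hJN (le_max_left _ _) (le_max_right _ _)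
    have hnode : ∀ a : ℕ, g (i₀ + a * (2 * K)) = ψ (x + Pi.single j ((a : ℝ) / l)) := by
      intro a
      simp only [hg]
      congr 3
      push_cast
      rw [hNlK]; field_simp; ring
    have hgt : g t = ψ (x + Pi.single j ((i : ℝ) / N)) := by
      simp only [hg]
      congr 3
      rw [← hit]; ring
    have hwv : x + Pi.single j ((i : ℝ) / N) + Pi.single j v = x + Pi.single j w := by
      rw [add_assoc, ← Pi.single_add, hv, add_sub_cancel]
    simp only [hnode, hgt, hit] at h1
    rw [hwv]
    have h4 : ψ (x + Pi.single j w) - ∑ a ∈ Finset.range l, (lag l a).eval (l * w) *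
        ψ (x + Pi.single j ((a : ℝ) / l)) - (ψ (x + Pi.single j w) -
          ψ (x + Pi.single j ((i : ℝ) / N))) = (ψ (x + Pi.single j ((i : ℝ) / N)) -
        ∑ a ∈ Finset.range l, (lag l a).eval ((i : ℝ) / (2 * K : ℕ)) *
          ψ (x + Pi.single j ((a : ℝ) / l))) +
        ∑ a ∈ Finset.range l, ((lag l a).eval ((i : ℝ) / (2 * K : ℕ)) - (lag l a).eval (l * w)) *
          ψ (x + Pi.single j ((a : ℝ) / l)) := by
      simp only [sub_mul, Finset.sum_sub_distrib]
      ring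
    rw [h4, add_comm (∑ a ∈ Finset.range l, Λ * _ * _)]
    refine (abs_add_le _ _).trans (add_le_add ?_ ?_)
    · refine h1.trans (le_of_eq ?_)
      rw [Finset.mul_sum]
      refine Finset.sum_congr rfl fun s _ => ?_
      rw [seqDiff_line]
    · refine (Finset.abs_sum_le_sum_abs _ _).trans (Finset.sum_le_sum fun a ha => ?_)
      rw [abs_mul]
      refine mul_le_mul_of_nonneg_right ?_ (abs_nonneg _)
      have hK2 : (0 : ℝ) < (2 * K : ℕ) := by push_cast; linarith
      have e1 : |(i : ℝ) / (2 * K : ℕ)| ≤ l := by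
        rw [abs_div, Nat.abs_cast, div_le_iff₀ hK2, abs_le]
        have : (l : ℝ) * (2 * K : ℕ) = N := by rw [hNlK]; push_cast; ring
        rw [this]
        have : ((2 * K : ℕ) : ℝ) ≤ N := by rw [← this]; nlinarith
        constructor <;> linarith [hiN.1, hiN.2]
      have e2 : |(l : ℝ) * w| ≤ l := by
        rw [abs_mul, Nat.abs_cast]
        refine mul_le_of_le_one_right (by linarith) ?_
        have : 1 / (l : ℝ) ≤ 1 := div_le_one_of_le₀ hl0 (by linarith)
        rw [abs_le]; constructor <;> linarith
      refine (hΛ _ _ e1 e2 a (Finset.mem_range.1 ha)).trans ?_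
      refine mul_le_mul_of_nonneg_left ?_ hΛ0
      have e3 : (i : ℝ) / (2 * K : ℕ) - l * w = -(l * v) := by
        rw [hv, hNlK]; push_cast; field_simp; ring
      rw [e3, abs_neg, abs_mul, Nat.abs_cast]
      calc (l : ℝ) * |v| ≤ l * (1 / N) := by gcongr
        _ = 1 / 2 * (1 / K) := by rw [hNlK]; field_simp
        _ ≤ 1 * (1 / K) := by gcongr; norm_num
        _ = _ := one_mul _
  have hm1 : Measurable fun x => ψ (x + Pi.single j v) - ψ x := (measurable_comp_add hψ _).sub hψ
  have hm1' := measurable_comp_add hm1 (Pi.single j ((i : ℝ) / N))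
  have hmF : Measurable fun x : Fin n → ℝ => ψ (x + Pi.single j w) -
      ∑ a ∈ Finset.range l, (lag l a).eval (l * w) * ψ (x + Pi.single j ((a : ℝ) / l)) :=
    (measurable_comp_add hψ (Pi.single j w)).sub
      (Finset.measurable_fun_sum _ fun a _ =>
        (measurable_comp_add hψ (Pi.single j ((a : ℝ) / l))).const_mul _)
  have hbound := eLpNorm_le_of_abs_le_sum_add (μ := volume.restrict A) r (Finset.range l)
    (Finset.range (J' + 1 - l))
    (fun _ => Λ * (1 / K)) (fun _ => D) (f := fun (a : ℕ) (x : Fin n → ℝ) => ψ (x + (Pi.single j ((a : ℝ) / l) : Fin n → ℝ)))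
    (h := fun (s : ℕ) (x : Fin n → ℝ) => diff l (Pi.single j (1 / (N : ℝ)) : Fin n → ℝ) ψ
      (x + (Pi.single j (s * (1 / N) + -(i₀ : ℝ) / N) : Fin n → ℝ)))
    (fun _ _ => by positivity) (fun _ _ => hD0)
    (fun a _ => (measurable_comp_add hψ _).aestronglyMeasurable)
    (fun s _ => (measurable_comp_add (measurable_diff l _ hψ) _).aestronglyMeasurable)
    (Filter.Eventually.of_forall hpt)
  rw [Finset.card_range, Finset.card_range] at hbound
  have hb1 : ∀ a ∈ Finset.range l, ENNReal.ofReal (Λ * (1 / K)) *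
      eLpNorm (fun x => ψ (x + Pi.single j ((a : ℝ) / l))) r (volume.restrict A) ≤
      Λ.toNNReal * ENNReal.ofReal (1 / K) * eLpNorm ψ r (volume.restrict (ucube n)) := by
    intro a ha
    rw [ENNReal.ofReal_mul hΛ0]
    refine mul_le_mul' le_rfl (eLpNorm_translate_le _ (fun x hx => ?_) hψ r)
    have hx1 := mem_stay.1 hx.1
    have hxl : x j < 1 / l := hx.2
    have hxj := mem_ucube.1 hx1.1 j
    have ha' : (a : ℝ) + 1 ≤ l := by exact_mod_cast Finset.mem_range.1 ha
    rw [add_single_mem_ucube hx1.1]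
    have e0 : 0 ≤ (a : ℝ) / l := by positivity
    have e1 : (a : ℝ) / l + 1 / l ≤ 1 := by
      rw [← add_div]; exact div_le_one_of_le₀ ha' (by linarith)
    constructor <;> linarith
  have hb2 : ∀ s ∈ Finset.range (J' + 1 - l), ENNReal.ofReal D *
      eLpNorm (fun x => diff l (Pi.single j (1 / N)) ψ (x + Pi.single j (s * (1 / N) + -(i₀ : ℝ) / N))) r
        (volume.restrict A) ≤ D.toNNReal * ε := by
    intro s hs
    have hN1 : (1 : ℝ) ≤ N := by rw [hNlK]; nlinarith
    refine mul_le_mul' le_rfl ((eLpNorm_translate_le _ (fun x hx => ?_) (measurable_diff l _ hψ)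
      r).trans (hε j (1 / N) (by
        rw [abs_of_nonneg (by positivity)]; exact div_le_one_of_le₀ hN1 (by linarith))))
    have hs' := Finset.mem_range.1 hs
    refine ⟨hin x hx s (by omega), ?_⟩
    have := hin x hx (s + l) (by omega)
    rw [add_assoc, ← Pi.single_add]
    have e : (s : ℝ) * (1 / N) + -(i₀ : ℝ) / N + l * (1 / N) =
        ((s + l : ℕ) : ℝ) * (1 / N) + -(i₀ : ℝ) / N := by push_cast; ring
    rw [e]; exact this
  have hb3 : eLpNorm (fun x => ψ (x + Pi.single j ((i : ℝ) / N) + Pi.single j v) -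
      ψ (x + Pi.single j ((i : ℝ) / N))) r (volume.restrict A) ≤
      C₁ * ENNReal.ofReal (1 / K) * eLpNorm ψ r (volume.restrict (ucube n)) + C₂ * ε := by
    have hvN : |v| * (2 * (l * K)) ≤ 1 := by
      calc |v| * (2 * (l * K)) ≤ 1 / N * (2 * (l * K)) := by gcongr
        _ = 1 := by rw [hNlK]; field_simp
    refine (eLpNorm_translate_le (A := A) (B := stay j v) (Pi.single j ((i : ℝ) / N))
      (fun x hx => ?_) hm1 r).trans (h₂ ψ ε hψ hε j v hvN)
    refine ⟨?_, ?_⟩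
    · have := hin x hx t (le_max_left _ _)
      convert this using 3
      rw [← hit]; ring
    · rw [add_assoc, ← Pi.single_add, hv, add_sub_cancel]
      exact hx.1.2
  have hJ'1 : J' + 1 - l ≤ N + 1 := by omega
  have hfin : eLpNorm (fun x => ψ (x + Pi.single j w) - ∑ a ∈ Finset.range l,
      (lag l a).eval (l * w) * ψ (x + Pi.single j ((a : ℝ) / l))) r (volume.restrict A) ≤
      quasiC r 1 * (eLpNorm (fun x => ψ (x + Pi.single j ((i : ℝ) / N) + Pi.single j v) -
      ψ (x + Pi.single j ((i : ℝ) / N))) r (volume.restrict A) +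
      eLpNorm (fun x => ψ (x + Pi.single j w) - ∑ a ∈ Finset.range l, (lag l a).eval (l * w) *
        ψ (x + Pi.single j ((a : ℝ) / l)) - (ψ (x + Pi.single j ((i : ℝ) / N) + Pi.single j v) -
          ψ (x + Pi.single j ((i : ℝ) / N)))) r (volume.restrict A)) := by
    have := eLpNorm_add_le_quasi (μ := volume.restrict A) r hm1'.aestronglyMeasurable
      (hmF.sub hm1').aestronglyMeasurable
    refine le_trans (le_of_eq ?_) this
    congr 1
    ext x
    simp only [Pi.sub_apply]
    ring
  refine hfin.trans ?_
  calc _ ≤ (quasiC r 1 : ℝ≥0∞) * ((C₁ * ENNReal.ofReal (1 / K) *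
        eLpNorm ψ r (volume.restrict (ucube n)) + C₂ * ε) +
        quasiC r 1 * (quasiC r l * ∑ _a ∈ Finset.range l, Λ.toNNReal *
          ENNReal.ofReal (1 / K) * eLpNorm ψ r (volume.restrict (ucube n)) +
        quasiC r (N + 1) * ∑ _s ∈ Finset.range (N + 1), D.toNNReal * ε)) := by
        refine mul_le_mul' le_rfl (add_le_add hb3 (hbound.trans ?_))
        refine mul_le_mul' le_rfl (add_le_add ?_ ?_)
        · exact mul_le_mul' le_rfl (Finset.sum_le_sum hb1)
        · refine mul_le_mul' (by exact_mod_cast quasiC_mono r hJ'1) ((Finset.sum_le_sum hb2).trans ?_)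
          exact Finset.sum_le_sum_of_subset_of_nonneg (Finset.range_mono hJ'1)
            fun _ _ _ => zero_le
    _ = _ := by
        simp only [Finset.sum_const, Finset.card_range, nsmul_eq_mul]
        push_cast
        ring

/-! ### Whitney's theorem on the unit cube -/

/-- Lagrange interpolation in the `j`-th variable at the nodes `y + a / l`, `a < l`. -/
def lagAt {n : ℕ} (l : ℕ) (j : Fin n) (y : ℝ) (g : (Fin n → ℝ) → ℝ) (x : Fin n → ℝ) : ℝ :=
  ∑ a ∈ Finset.range l, (lag l a).eval (l * (x j - y)) * g (Function.update x j (y + (a : ℝ) / l))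

lemma measurable_update_const {n : ℕ} (j : Fin n) (c : ℝ) :
    Measurable fun x : Fin n → ℝ => Function.update x j c := by
  refine measurable_pi_lambda _ fun i => ?_
  rcases eq_or_ne i j with rfl | h
  · simp
  · simpa [h] using measurable_pi_apply i

lemma measurable_polynomial_eval (P : Polynomial ℝ) : Measurable fun x : ℝ => P.eval x :=
  P.continuous.measurable

lemma measurable_lagAt {n : ℕ} (l : ℕ) (j : Fin n) (y : ℝ) {g : (Fin n → ℝ) → ℝ}
    (hg : Measurable g) : Measurable (lagAt l j y g) := by
  refine Finset.measurable_fun_sum _ fun a _ => ?_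
  refine Measurable.mul ?_ (hg.comp (measurable_update_const _ _))
  have hj : Measurable fun x : Fin n → ℝ => (l : ℝ) * (x j - y) :=
    by fun_prop
  exact (measurable_polynomial_eval _).comp hj

lemma measurable_single {n : ℕ} {α : Type*} [MeasurableSpace α] (j : Fin n) {f : α → ℝ}
    (hf : Measurable f) : Measurable fun a => (Pi.single j (f a) : Fin n → ℝ) := by
  refine measurable_pi_lambda _ fun i => ?_
  rcases eq_or_ne i j with rfl | h
  · simpa only [Pi.single_eq_same] using hf
  · simp [h]

lemma map_update_skew_le {n : ℕ} (j : Fin n) :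
    ((volume : Measure (Fin n → ℝ)).prod (volume : Measure ℝ)).map
      (fun p => (p.1 + (Pi.single j (-(p.1 j - p.2)) : Fin n → ℝ), p.1 j - p.2)) ≤
      volume.prod volume := by
  have h1 : MeasurePreserving (fun p : (Fin n → ℝ) × ℝ => (id p.1, p.1 j - p.2))
      (volume.prod volume) (volume.prod volume) :=
    (MeasurePreserving.id volume).skew_product (g := fun (z : Fin n → ℝ) (y : ℝ) => z j - y)
      (((measurable_pi_apply j).comp measurable_fst).sub measurable_snd)
      (Filter.Eventually.of_forall fun z => (Measure.measurePreserving_sub_left volume (z j)).map_eq)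
  have hs : Measurable fun p : ℝ × (Fin n → ℝ) => p.2 + (Pi.single j (-p.1) : Fin n → ℝ) := by
    exact measurable_snd.add (measurable_single j measurable_fst.neg)
  have h2 : MeasurePreserving (fun p : ℝ × (Fin n → ℝ) =>
      (id p.1, p.2 + (Pi.single j (-p.1) : Fin n → ℝ)))
      (volume.prod volume) (volume.prod volume) :=
    (MeasurePreserving.id volume).skew_product
      (g := fun (w : ℝ) (z : Fin n → ℝ) => z + (Pi.single j (-w) : Fin n → ℝ)) hs
      (Filter.Eventually.of_forall fun w => map_add_right_eq_self volume _)
  have h3 := (Measure.measurePreserving_swap (μ := (volume : Measure ℝ))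
    (ν := (volume : Measure (Fin n → ℝ)))).comp (h2.comp
      ((Measure.measurePreserving_swap (μ := (volume : Measure (Fin n → ℝ)))
        (ν := (volume : Measure ℝ))).comp h1))
  exact h3.map_eq.le

lemma measurable_update_skew {n : ℕ} (j : Fin n) :
    Measurable fun p : (Fin n → ℝ) × ℝ =>
      (p.1 + (Pi.single j (-(p.1 j - p.2)) : Fin n → ℝ), p.1 j - p.2) := by
  have hd : Measurable fun p : (Fin n → ℝ) × ℝ => p.1 j - p.2 :=
    ((measurable_pi_apply j).comp measurable_fst).sub measurable_snd
  exact Measurable.prodMk (measurable_fst.add (measurable_single j hd.neg)) hd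

lemma measurable_add_single_prod {n : ℕ} (j : Fin n) {f : (Fin n → ℝ) → ℝ} (hf : Measurable f) :
    Measurable fun p : (Fin n → ℝ) × ℝ => f (p.1 + (Pi.single j p.2 : Fin n → ℝ)) := by
  exact hf.comp (measurable_fst.add (measurable_single j measurable_snd))

/-- Stability of the interpolation error under a perturbation of the interpolated function. -/
lemma exists_eLpNorm_sub_lag_perturb_le (n l : ℕ) (hl : 1 ≤ l) (r : ℝ≥0∞) :
    ∃ C : ℝ≥0, ∀ (ψ g : (Fin n → ℝ) → ℝ), Measurable ψ → Measurable g → ∀ (j : Fin n) (w : ℝ),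
      -(1 / l) < w → w < 1 → ∀ B : ℝ≥0∞,
      eLpNorm (fun x => ψ (x + (Pi.single j w : Fin n → ℝ)) -
            ∑ a ∈ Finset.range l, (lag l a).eval (l * w) *
              ψ (x + (Pi.single j ((a : ℝ) / l) : Fin n → ℝ))) r
          (volume.restrict {x | x ∈ stay j w ∧ x j < 1 / l}) ≤ B →
      eLpNorm (fun x => ψ x - g x) r (volume.restrict (ucube n)) ≤ B →
      eLpNorm (fun x => ψ (x + (Pi.single j w : Fin n → ℝ)) -
            ∑ a ∈ Finset.range l, (lag l a).eval (l * w) *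
              g (x + (Pi.single j ((a : ℝ) / l) : Fin n → ℝ))) r
          (volume.restrict {x | x ∈ stay j w ∧ x j < 1 / l}) ≤ C * B := by
  obtain ⟨M, hM0, hM⟩ := exists_abs_lag_le l l
  refine ⟨quasiC r 1 * (1 + quasiC r l * (l * M.toNNReal)),
    fun ψ g hψ hg j w hw0 hw1 B h1 h2 => ?_⟩
  have hl0 : (1 : ℝ) ≤ l := by exact_mod_cast hl
  have e2 : |(l : ℝ) * w| ≤ l := by
    rw [abs_mul, Nat.abs_cast]
    refine mul_le_of_le_one_right (by linarith) ?_
    have : 1 / (l : ℝ) ≤ 1 := div_le_one_of_le₀ hl0 (by linarith)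
    rw [abs_le]; constructor <;> linarith
  have hd : Measurable fun x => ψ x - g x := hψ.sub hg
  have m1 : Measurable fun x : Fin n → ℝ => ψ (x + (Pi.single j w : Fin n → ℝ)) -
      ∑ a ∈ Finset.range l, (lag l a).eval (l * w) *
        ψ (x + (Pi.single j ((a : ℝ) / l) : Fin n → ℝ)) :=
    (measurable_comp_add hψ _).sub (Finset.measurable_fun_sum _ fun a _ =>
      (measurable_comp_add hψ (Pi.single j ((a : ℝ) / l))).const_mul _)
  have m2 : ∀ a : ℕ, Measurable fun x : Fin n → ℝ => ψ (x + (Pi.single j ((a : ℝ) / l) : Fin n → ℝ)) -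
      g (x + (Pi.single j ((a : ℝ) / l) : Fin n → ℝ)) := fun a =>
    measurable_comp_add hd (Pi.single j ((a : ℝ) / l))
  have m3 : Measurable fun x : Fin n → ℝ => ∑ a ∈ Finset.range l, (lag l a).eval (l * w) *
      (ψ (x + (Pi.single j ((a : ℝ) / l) : Fin n → ℝ)) -
        g (x + (Pi.single j ((a : ℝ) / l) : Fin n → ℝ))) :=
    Finset.measurable_fun_sum _ fun a _ => (m2 a).const_mul _
  have h3 : eLpNorm (fun x : Fin n → ℝ => ∑ a ∈ Finset.range l, (lag l a).eval (l * w) *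
      (ψ (x + (Pi.single j ((a : ℝ) / l) : Fin n → ℝ)) -
        g (x + (Pi.single j ((a : ℝ) / l) : Fin n → ℝ)))) r
      (volume.restrict {x | x ∈ stay j w ∧ x j < 1 / l}) ≤
      quasiC r l * ∑ _a ∈ Finset.range l, ENNReal.ofReal M * B := by
    have := eLpNorm_le_of_abs_le_sum (μ := volume.restrict {x | x ∈ stay j w ∧ x j < 1 / l}) r
      (Finset.range l) (fun _ => M)
      (f := fun (a : ℕ) (x : Fin n → ℝ) => ψ (x + (Pi.single j ((a : ℝ) / l) : Fin n → ℝ)) -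
        g (x + (Pi.single j ((a : ℝ) / l) : Fin n → ℝ)))
      (g := fun x : Fin n → ℝ => ∑ a ∈ Finset.range l, (lag l a).eval (l * w) *
      (ψ (x + (Pi.single j ((a : ℝ) / l) : Fin n → ℝ)) -
        g (x + (Pi.single j ((a : ℝ) / l) : Fin n → ℝ))))
      (fun _ _ => hM0) (fun a _ => (m2 a).aestronglyMeasurable)
      (Filter.Eventually.of_forall fun x => (Finset.abs_sum_le_sum_abs _ _).trans
        (Finset.sum_le_sum fun a ha => by
          rw [abs_mul]
          exact mul_le_mul_of_nonneg_right (hM _ e2 a (Finset.mem_range.1 ha)) (abs_nonneg _)))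
    rw [Finset.card_range] at this
    refine this.trans (mul_le_mul' le_rfl (Finset.sum_le_sum fun a ha => mul_le_mul' le_rfl ?_))
    refine (eLpNorm_translate_le (Pi.single j ((a : ℝ) / l)) (fun x hx => ?_) hd r).trans h2
    have hx1 := mem_stay.1 hx.1
    have hxl : x j < 1 / l := hx.2
    have hxj := mem_ucube.1 hx1.1 j
    have ha' : (a : ℝ) + 1 ≤ l := by exact_mod_cast Finset.mem_range.1 ha
    rw [add_single_mem_ucube hx1.1]
    have e0 : 0 ≤ (a : ℝ) / l := by positivity
    have e1 : (a : ℝ) / l + 1 / l ≤ 1 := by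
      rw [← add_div]; exact div_le_one_of_le₀ ha' (by linarith)
    constructor <;> linarith
  have h4 := eLpNorm_add_le_quasi (μ := volume.restrict {x | x ∈ stay j w ∧ x j < 1 / l}) r
    m1.aestronglyMeasurable m3.aestronglyMeasurable
  refine le_trans (le_of_eq ?_) (h4.trans ((mul_le_mul' le_rfl (add_le_add h1 h3)).trans
    (le_of_eq ?_)))
  · congr 1
    ext x
    simp only [mul_sub, Finset.sum_sub_distrib]
    ring
  · simp only [Finset.sum_const, Finset.card_range, nsmul_eq_mul]
    push_cast
    rw [ENNReal.ofReal]
    ring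

/-- The bound on the interpolation errors of all small cells gives an interpolation in the `j`-th
variable which is good on the whole cube. -/
lemma exists_lagAt_sub_le (n l : ℕ) (hl : 1 ≤ l) {r : ℝ≥0∞} (hr : r ≠ 0) :
    ∃ C : ℝ≥0, ∀ (ψ g : (Fin n → ℝ) → ℝ), Measurable ψ → Measurable g → ∀ (j : Fin n) (B : ℝ≥0∞),
      B ≠ 0 → (∀ w : ℝ, -(1 / l) < w → w < 1 →
      eLpNorm (fun x => ψ (x + (Pi.single j w : Fin n → ℝ)) -
            ∑ a ∈ Finset.range l, (lag l a).eval (l * w) *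
              ψ (x + (Pi.single j ((a : ℝ) / l) : Fin n → ℝ))) r
          (volume.restrict {x | x ∈ stay j w ∧ x j < 1 / l}) ≤ B) →
      eLpNorm (fun x => ψ x - g x) r (volume.restrict (ucube n)) ≤ B →
      ∃ y : ℝ, eLpNorm (fun x => ψ x - lagAt l j y g x) r (volume.restrict (ucube n)) ≤ C * B := by
  obtain ⟨C₀, h₀⟩ := exists_eLpNorm_sub_lag_perturb_le n l hl r
  have hl0 : (1 : ℝ) ≤ l := by exact_mod_cast hl
  have hl1 : (0 : ℝ) < 1 / l := by positivity
  set V : ℝ≥0∞ := ((volume : Measure ℝ).restrict (Set.Ioo 0 (1 / (l : ℝ)))) Set.univ ^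
    (1 / r.toReal) with hV
  set W : ℝ≥0∞ := ((volume : Measure ℝ).restrict (Set.Ioo (-(1 / (l : ℝ))) 1)) Set.univ ^
    (1 / r.toReal) with hW
  have hV0 : V ≠ 0 := by
    rw [hV, Measure.restrict_apply_univ, Real.volume_Ioo]
    exact (ENNReal.rpow_pos (by simpa using hl1) ENNReal.ofReal_ne_top).ne'
  have hVt : V ≠ ∞ := by
    rw [hV, Measure.restrict_apply_univ, Real.volume_Ioo]
    exact ENNReal.rpow_ne_top_of_nonneg (by positivity) ENNReal.ofReal_ne_top
  have hWt : W ≠ ∞ := by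
    rw [hW, Measure.restrict_apply_univ, Real.volume_Ioo]
    exact ENNReal.rpow_ne_top_of_nonneg (by positivity) ENNReal.ofReal_ne_top
  obtain ⟨D, hD⟩ := exists_coe_eq (D := W * C₀ * V⁻¹)
    (ENNReal.mul_ne_top (ENNReal.mul_ne_top hWt ENNReal.coe_ne_top) (ENNReal.inv_ne_top.2 hV0))
  refine ⟨D + 1, fun ψ g hψ hg j B hB h1 h2 => ?_⟩
  rcases eq_or_ne B ∞ with rfl | hBt
  · refine ⟨0, le_trans le_top (le_of_eq ?_)⟩
    rw [ENNReal.mul_top (by simp)]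
  by_contra hcon
  push Not at hcon
  set S : Set ((Fin n → ℝ) × ℝ) := {p | p.1 ∈ stay j p.2 ∧ p.1 j < 1 / l} with hS
  set F₀ : (Fin n → ℝ) × ℝ → ℝ := fun p => ψ (p.1 + (Pi.single j p.2 : Fin n → ℝ)) -
      ∑ a ∈ Finset.range l, (lag l a).eval (l * p.2) *
        g (p.1 + (Pi.single j ((a : ℝ) / l) : Fin n → ℝ)) with hF₀
  have hSm : MeasurableSet S := by
    have e : S = {p : (Fin n → ℝ) × ℝ | p.1 ∈ ucube n} ∩ ({p : (Fin n → ℝ) × ℝ | 0 < p.1 j + p.2} ∩ {p | p.1 j + p.2 < 1}) ∩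
        {p | p.1 j < 1 / l} := by
      ext p
      simp only [hS, Set.mem_ofPred_eq, mem_stay, Set.mem_inter_iff]
    have hj : Measurable fun p : (Fin n → ℝ) × ℝ => p.1 j :=
      (measurable_pi_apply j).comp measurable_fst
    rw [e]
    exact ((measurable_fst (measurableSet_ucube n)).inter
      ((measurableSet_lt measurable_const (hj.add measurable_snd)).inter
        (measurableSet_lt (hj.add measurable_snd) measurable_const))).inter
      (measurableSet_lt hj measurable_const)
  have hF₀m : Measurable F₀ := by
    refine (measurable_add_single_prod j hψ).sub (Finset.measurable_fun_sum _ fun a _ => ?_)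
    exact ((measurable_polynomial_eval _).comp (measurable_snd.const_mul _)).mul
      ((measurable_comp_add hg _).comp measurable_fst)
  have hF : Measurable (S.indicator F₀) := hF₀m.indicator hSm
  have hup : eLpNorm (S.indicator F₀) r
      ((volume : Measure (Fin n → ℝ)).prod ((volume : Measure ℝ).restrict
        (Set.Ioo (-(1 / (l : ℝ))) 1))) ≤ W * (C₀ * B) := by
    refine eLpNorm_prod_le hr hF ?_
    refine (ae_restrict_iff' measurableSet_Ioo).2 (Filter.Eventually.of_forall fun w hw => ?_)
    have e : (fun x => S.indicator F₀ (x, w)) = {x | x ∈ stay j w ∧ x j < 1 / l}.indicator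
        fun x => F₀ (x, w) := by
      ext x; rfl
    have hme : MeasurableSet {x : Fin n → ℝ | x ∈ stay j w ∧ x j < 1 / l} :=
      (measurableSet_stay j w).inter (measurableSet_lt (measurable_pi_apply j) measurable_const)
    rw [e, eLpNorm_indicator_eq_eLpNorm_restrict hme]
    exact h₀ ψ g hψ hg j w hw.1 hw.2 B (h1 w hw.1 hw.2) h2
  set T : (Fin n → ℝ) × ℝ → (Fin n → ℝ) × ℝ := fun p =>
    (p.1 + (Pi.single j (-(p.1 j - p.2)) : Fin n → ℝ), p.1 j - p.2) with hT
  have hmaps : Set.MapsTo T (ucube n ×ˢ Set.Ioo 0 (1 / (l : ℝ)))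
      (Set.univ ×ˢ Set.Ioo (-(1 / (l : ℝ))) 1) := by
    rintro ⟨z, y⟩ ⟨hz, hy⟩
    have := mem_ucube.1 hz j
    simp only [Set.mem_Ioo] at hy
    refine ⟨trivial, ?_, ?_⟩ <;> simp only [hT] <;> linarith
  have hcomp := eLpNorm_comp_restrict_le (measurable_update_skew j) (map_update_skew_le j) hmaps hF r
  rw [← Measure.prod_restrict, ← Measure.prod_restrict, Measure.restrict_univ] at hcomp
  have hlow := le_eLpNorm_prod (μ := volume.restrict (ucube n))
    (ν := (volume : Measure ℝ).restrict (Set.Ioo 0 (1 / (l : ℝ)))) (r := r)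
    (F := fun p => S.indicator F₀ (T p)) (X := (D + 1 : ℝ≥0) * B)
    (by
      intro h
      have : (volume : Measure ℝ).restrict (Set.Ioo 0 (1 / (l : ℝ))) Set.univ = 0 := by rw [h]; simp
      rw [Measure.restrict_apply_univ, Real.volume_Ioo] at this
      simp at this
      linarith) hr (hF.comp (measurable_update_skew j)) ?_
  · have h5 := le_mul_of_mul_le_mul (C := W * C₀) (X := B) hV0 hVt
      (hlow.trans (hcomp.trans (hup.trans (le_of_eq (mul_assoc _ _ _).symm))))
    rw [← hD] at h5
    have h6 : ((D + 1 : ℝ≥0) : ℝ≥0∞) * B = D * B + B := by push_cast; ring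
    rw [h6] at h5
    exact absurd h5 (not_le.2 (ENNReal.lt_add_right (ENNReal.mul_ne_top ENNReal.coe_ne_top hBt) hB))
  · refine (ae_restrict_iff' measurableSet_Ioo).2 (Filter.Eventually.of_forall fun y hy => ?_)
    refine (hcon y).le.trans (le_of_eq ?_)
    refine eLpNorm_congr_ae ((ae_restrict_iff' (measurableSet_ucube n)).2
      (Filter.Eventually.of_forall fun z hz => ?_))
    have hupd : ∀ c : ℝ, z + (Pi.single j (-(z j - y)) : Fin n → ℝ) + (Pi.single j c : Fin n → ℝ) =
        Function.update z j (y + c) := by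
      intro c
      ext i
      rcases eq_or_ne i j with rfl | h
      · simp
      · simp [h]
    have hzj := mem_ucube.1 hz j
    have hmem : T (z, y) ∈ S := by
      have e0 : z + (Pi.single j (-(z j - y)) : Fin n → ℝ) ∈ ucube n := by
        have hl2 : 1 / (l : ℝ) ≤ 1 := div_le_one_of_le₀ hl0 (by linarith)
        rw [add_single_mem_ucube hz]
        constructor <;> linarith [hy.1, hy.2]
      have ey : (z + (Pi.single j (-(z j - y)) : Fin n → ℝ)) j = y := by simp
      refine ⟨mem_stay.2 ⟨e0, ?_, ?_⟩, ?_⟩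
      · simp only [hT]; rw [ey]; linarith
      · simp only [hT]; rw [ey]; linarith
      · simp only [hT]; rw [ey]; exact hy.2
    simp only [Set.indicator_of_mem hmem]
    simp only [hF₀, hT, lagAt, hupd]
    rw [add_sub_cancel, Function.update_eq_self]

/-- `g` arises from `ψ` by replacing the dependence on the variables in `L` by a polynomial one. -/
def IsPartialPoly {n : ℕ} (l : ℕ) (L : Finset (Fin n)) (ψ g : (Fin n → ℝ) → ℝ) : Prop :=
  ∃ (ι : Type) (_ : Fintype ι) (q : ι → Fin n → Polynomial ℝ) (v : ι → Fin n → ℝ),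
    (∀ i k, (q i k).natDegree < l) ∧ ∀ x, g x = ∑ i, (∏ k ∈ L, (q i k).eval (x k)) *
      ψ (fun k => if k ∈ L then v i k else x k)

lemma IsPartialPoly.lagAt {n l : ℕ} {L : Finset (Fin n)} {ψ g : (Fin n → ℝ) → ℝ}
    (h : IsPartialPoly l L ψ g) {j : Fin n} (hj : j ∉ L) (y : ℝ) :
    IsPartialPoly l (insert j L) ψ (lagAt l j y g) := by
  obtain ⟨ι, _, q, v, hq, hg⟩ := h
  refine ⟨Fin l × ι, inferInstance, fun i => Function.update (q i.2) j
    ((lag l i.1).comp (Polynomial.C (l : ℝ) * (Polynomial.X - Polynomial.C y))),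
    fun i => Function.update (v i.2) j (y + ((i.1 : ℕ) : ℝ) / l), fun i k => ?_, fun x => ?_⟩
  · rcases eq_or_ne k j with rfl | hk
    · simp only [Function.update_self]
      refine lt_of_le_of_lt Polynomial.natDegree_comp_le ?_
      have h1 := natDegree_lag_lt i.1.2
      have h2 : (Polynomial.C (l : ℝ) * (Polynomial.X - Polynomial.C y)).natDegree ≤ 1 :=
        (Polynomial.natDegree_C_mul_le _ _).trans (Polynomial.natDegree_X_sub_C_le y)
      exact lt_of_le_of_lt ((Nat.mul_le_mul_left _ h2).trans (by rw [mul_one])) h1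
    · simp only [Function.update_of_ne hk]; exact hq _ _
  · rw [VarBesov.lagAt, Finset.sum_range, Fintype.sum_prod_type]
    refine Finset.sum_congr rfl fun a _ => ?_
    rw [hg, Finset.mul_sum]
    refine Finset.sum_congr rfl fun i _ => ?_
    rw [Finset.prod_insert hj]
    simp only [Function.update_self]
    rw [mul_assoc]
    have e1 : ((lag l (a : ℕ)).comp (Polynomial.C (l : ℝ) * (Polynomial.X - Polynomial.C y))).eval
        (x j) = (lag l a).eval (l * (x j - y)) := by simp [Polynomial.eval_comp]
    have e2 : ∀ k ∈ L, (Function.update (q i) j ((lag l (a : ℕ)).comp (Polynomial.C (l : ℝ) *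
        (Polynomial.X - Polynomial.C y))) k).eval (x k) = (q i k).eval
          (Function.update x j (y + ((a : ℕ) : ℝ) / l) k) := by
      intro k hk
      have : k ≠ j := fun h => hj (h ▸ hk)
      simp [this]
    rw [e1, Finset.prod_congr rfl e2]
    congr 3
    ext k
    rcases eq_or_ne k j with rfl | hk
    · simp [hj]
    · simp [hk]

lemma exists_isPartialPoly_sub_le (n l : ℕ) (hl : 1 ≤ l) {r : ℝ≥0∞} (hr : r ≠ 0)
    (L : Finset (Fin n)) :
    ∃ C : ℝ≥0, ∀ (ψ : (Fin n → ℝ) → ℝ), Measurable ψ → ∀ (B : ℝ≥0∞), B ≠ 0 →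
      (∀ (j : Fin n) (w : ℝ), -(1 / l) < w → w < 1 →
      eLpNorm (fun x => ψ (x + (Pi.single j w : Fin n → ℝ)) -
            ∑ a ∈ Finset.range l, (lag l a).eval (l * w) *
              ψ (x + (Pi.single j ((a : ℝ) / l) : Fin n → ℝ))) r
          (volume.restrict {x | x ∈ stay j w ∧ x j < 1 / l}) ≤ B) →
      ∃ g, Measurable g ∧ IsPartialPoly l L ψ g ∧
        eLpNorm (fun x => ψ x - g x) r (volume.restrict (ucube n)) ≤ C * B := by
  induction L using Finset.induction_on with
  | empty =>
    refine ⟨0, fun ψ hψ B _ _ => ⟨ψ, hψ, ⟨Unit, inferInstance, fun _ _ => 0, fun _ _ => 0,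
      fun _ _ => by simpa using Nat.pos_of_ne_zero (by omega), fun x => by simp⟩, by simp⟩⟩
  | insert j L hj ih =>
    obtain ⟨C, hC⟩ := ih
    obtain ⟨C', hC'⟩ := exists_lagAt_sub_le n l hl hr
    refine ⟨C' * (1 + C), fun ψ hψ B hB h => ?_⟩
    obtain ⟨g, hg, hgL, hgB⟩ := hC ψ hψ B hB h
    have hle : B ≤ (1 + C : ℝ≥0∞) * B := le_mul_of_one_le_left zero_le (by simp)
    obtain ⟨y, hy⟩ := hC' ψ g hψ hg j ((1 + C : ℝ≥0∞) * B)
      (fun h0 => hB (le_antisymm (hle.trans h0.le) zero_le))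
      (fun w h1 h2 => (h j w h1 h2).trans hle)
      (hgB.trans (mul_le_mul' (by simp) le_rfl))
    refine ⟨lagAt l j y g, measurable_lagAt l j y hg, hgL.lagAt hj y, hy.trans (le_of_eq ?_)⟩
    push_cast; ring

lemma IsPartialPoly.exists_tpoly {n l : ℕ} {ψ g : (Fin n → ℝ) → ℝ}
    (h : IsPartialPoly l Finset.univ ψ g) : ∃ c : (Fin n → Fin l) → ℝ, g = tpoly c := by
  obtain ⟨ι, _, q, v, hq, hg⟩ := h
  refine ⟨∑ i, ψ (v i) • fun a : Fin n → Fin l => ∏ k, (q i k).coeff (a k), ?_⟩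
  ext x
  rw [hg, tpoly_sum]
  refine Finset.sum_congr rfl fun i _ => ?_
  rw [tpoly_smul, tpoly_prod _ (hq i), mul_comm]
  simp

lemma AxisDiffLE.sub_tpoly {n l : ℕ} {r : ℝ≥0∞} {ψ : (Fin n → ℝ) → ℝ} {ε : ℝ≥0∞}
    (h : AxisDiffLE l r ψ ε) (c : (Fin n → Fin l) → ℝ) :
    AxisDiffLE l r (fun x => ψ x - tpoly c x) ε := by
  intro j t ht
  have e : diff l (Pi.single j t) (fun x => ψ x - tpoly c x) = diff l (Pi.single j t) ψ := by
    ext x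
    have h1 := diff_single_tpoly c j t x
    rw [diff_eq] at h1 ⊢
    rw [diff_eq]
    simp only [mul_sub, Finset.sum_sub_distrib]
    rw [h1, sub_zero]
  rw [e]; exact h j t ht

lemma eLpNorm_tpoly_le (n l : ℕ) (r : ℝ≥0∞) : ∃ C : ℝ≥0, ∀ c : (Fin n → Fin l) → ℝ,
    eLpNorm (tpoly c) r (volume.restrict (ucube n)) ≤ C * ENNReal.ofReal ‖c‖ := by
  obtain ⟨M, hM0, hM⟩ := exists_abs_tpoly_le n l 1
  have hfin : eLpNorm (fun _ : Fin n → ℝ => (1 : ℝ)) r (volume.restrict (ucube n)) ≠ ∞ := by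
    have : IsFiniteMeasure (volume.restrict (ucube n)) := ⟨by
      rw [Measure.restrict_apply_univ, ucube, volume_box]
      simp⟩
    exact (memLp_const (1 : ℝ)).2.ne
  obtain ⟨V, hV⟩ := exists_coe_eq hfin
  refine ⟨M.toNNReal * V, fun c => ?_⟩
  have : eLpNorm (tpoly c) r (volume.restrict (ucube n)) ≤
      eLpNorm (fun _ : Fin n → ℝ => M * ‖c‖ * 1) r (volume.restrict (ucube n)) := by
    refine eLpNorm_mono_ae_real ((ae_restrict_iff' (measurableSet_ucube n)).2
      (Filter.Eventually.of_forall fun x hx => ?_))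
    rw [Real.norm_eq_abs, mul_one]
    exact hM x (fun i => by
      have := mem_ucube.1 hx i
      rw [abs_of_pos this.1]; exact this.2.le) c
  refine this.trans (le_of_eq ?_)
  rw [eLpNorm_const_mul_real, abs_of_nonneg (by positivity), ENNReal.ofReal_mul hM0, ← hV]
  push_cast
  rw [ENNReal.ofReal]
  ring

lemma exists_eLpNorm_sub_tpoly_le_two_mul (n l : ℕ) (hl : 1 ≤ l) {r : ℝ≥0∞} (hr : r ≠ 0) :
    ∀ ψ : (Fin n → ℝ) → ℝ, Measurable ψ → ∃ c : (Fin n → Fin l) → ℝ, ∀ c' : (Fin n → Fin l) → ℝ,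
      eLpNorm (fun x => ψ x - tpoly c x) r (volume.restrict (ucube n)) ≤
        2 * eLpNorm (fun x => ψ x - tpoly c' x) r (volume.restrict (ucube n)) := by
  obtain ⟨C₁, h₁⟩ := exists_norm_le_eLpNorm_tpoly n l hl hr one_pos 0
  obtain ⟨C₂, h₂⟩ := eLpNorm_tpoly_le n l r
  intro ψ hψ
  set nrm : ((Fin n → Fin l) → ℝ) → ℝ≥0∞ := fun c =>
    eLpNorm (fun x => ψ x - tpoly c x) r (volume.restrict (ucube n)) with hnrm
  have hm : ∀ c : (Fin n → Fin l) → ℝ, Measurable fun x => ψ x - tpoly c x := fun c => hψ.sub (measurable_tpoly c)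
  set E : ℝ≥0∞ := ⨅ c, nrm c with hE
  rcases eq_or_ne E 0 with h0 | h0
  · -- coefficients of approximating polynomials converge
    have hex : ∀ i : ℕ, ∃ c, nrm c < ((1 / 2 : ℝ≥0) ^ i : ℝ≥0) := by
      intro i
      refine iInf_lt_iff.1 (h0.trans_lt ?_)
      exact_mod_cast (by positivity : (0 : ℝ≥0) < (1 / 2) ^ i)
    choose c hc using hex
    have hdist : ∀ i i' : ℕ, ENNReal.ofReal ‖c i - c i'‖ ≤
        C₁ * (quasiC r 1 * (nrm (c i) + nrm (c i'))) := by
      intro i i'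
      refine (h₁ 0 (by simp) _).trans (mul_le_mul' le_rfl ?_)
      have := eLpNorm_sub_le_quasi (μ := volume.restrict (ucube n)) r
        (hm (c i')).aestronglyMeasurable (hm (c i)).aestronglyMeasurable
      rw [add_comm] at this
      refine le_trans (le_of_eq ?_) this
      congr 1
      ext x
      rw [tpoly_sub]; ring
    set D : ℝ := C₁ * (quasiC r 1 * 2) with hD
    have hcauchy : CauchySeq c := by
      refine cauchySeq_of_le_geometric (1 / 2) (C₁ * (quasiC r 1 * 2)) (by norm_num) fun i => ?_
      rw [dist_eq_norm]
      have h3 : ENNReal.ofReal ‖c i - c (i + 1)‖ ≤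
          ENNReal.ofReal (C₁ * (quasiC r 1 * 2) * (1 / 2) ^ i) := by
        refine (hdist i (i + 1)).trans ?_
        have h4 : (1 / 2 : ℝ≥0) ^ (i + 1) ≤ (1 / 2) ^ i :=
          pow_le_pow_of_le_one zero_le one_half_lt_one.le (Nat.le_succ i)
        have h5 : nrm (c (i + 1)) ≤ ((1 / 2 : ℝ≥0) ^ i : ℝ≥0) :=
          (hc (i + 1)).le.trans (ENNReal.coe_le_coe.2 h4)
        calc _ ≤ (C₁ : ℝ≥0∞) * (quasiC r 1 * (((1 / 2 : ℝ≥0) ^ i : ℝ≥0) + ((1 / 2 : ℝ≥0) ^ i : ℝ≥0))) :=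
              mul_le_mul' le_rfl (mul_le_mul' le_rfl (add_le_add (hc i).le h5))
          _ = ((C₁ * (quasiC r 1 * 2) * (1 / 2) ^ i : ℝ≥0) : ℝ≥0∞) := by push_cast; ring
          _ = _ := by
            rw [← ENNReal.ofReal_coe_nnreal]; congr 1
      exact (ENNReal.ofReal_le_ofReal_iff (by positivity)).1 h3
    obtain ⟨c₀, hc₀⟩ := cauchySeq_tendsto_of_complete hcauchy
    have hz : nrm c₀ = 0 := by
      have hb : ∀ i, nrm c₀ ≤ quasiC r 1 * (nrm (c i) + C₂ * ENNReal.ofReal ‖c i - c₀‖) := by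
        intro i
        have := eLpNorm_add_le_quasi (μ := volume.restrict (ucube n)) r
          (hm (c i)).aestronglyMeasurable (measurable_tpoly (c i - c₀)).aestronglyMeasurable
        refine le_trans (le_of_eq ?_) (this.trans (mul_le_mul' le_rfl (add_le_add le_rfl (h₂ _))))
        simp only [hnrm]
        congr 1
        ext x
        rw [tpoly_sub]; ring
      have hlim : Filter.Tendsto (fun i => (quasiC r 1 : ℝ≥0∞) * (((1 / 2 : ℝ≥0) ^ i : ℝ≥0) +
          C₂ * ENNReal.ofReal ‖c i - c₀‖)) Filter.atTop (nhds (quasiC r 1 * (0 + C₂ * 0))) := by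
        refine ENNReal.Tendsto.const_mul (Filter.Tendsto.add ?_ (ENNReal.Tendsto.const_mul ?_
          (Or.inr ENNReal.coe_ne_top))) (Or.inr ENNReal.coe_ne_top)
        · have : Filter.Tendsto (fun i : ℕ => (1 / 2 : ℝ≥0) ^ i) Filter.atTop (nhds 0) :=
            NNReal.tendsto_pow_atTop_nhds_zero_of_lt_one one_half_lt_one
          exact ENNReal.tendsto_coe.2 this
        · have h6 : Filter.Tendsto (fun i => ‖c i - c₀‖) Filter.atTop (nhds 0) :=
            tendsto_iff_norm_sub_tendsto_zero.1 hc₀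
          simpa using ENNReal.tendsto_ofReal h6
      have := ge_of_tendsto' hlim fun i => (hb i).trans (mul_le_mul' le_rfl
        (add_le_add (hc i).le le_rfl))
      simpa using this
    exact ⟨c₀, fun c' => by rw [show eLpNorm (fun x => ψ x - tpoly c₀ x) r
      (volume.restrict (ucube n)) = 0 from hz]; exact zero_le⟩
  · rcases eq_or_ne E ∞ with ht | ht
    · refine ⟨0, fun c' => ?_⟩
      have : nrm c' = ∞ := top_unique (ht ▸ iInf_le nrm c')
      rw [show eLpNorm (fun x => ψ x - tpoly c' x) r (volume.restrict (ucube n)) = ∞ from this]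
      simp
    · have hlt : E < 2 * E := by
        rw [two_mul]; exact ENNReal.lt_add_right ht h0
      obtain ⟨c, hc⟩ := iInf_lt_iff.1 (hE ▸ hlt)
      exact ⟨c, fun c' => hc.le.trans (by
        exact mul_le_mul' le_rfl (iInf_le nrm c'))⟩

/-- **Whitney's theorem** in `L_r` of the unit cube, `0 < r ≤ ∞`. -/
theorem exists_tpoly_sub_le (n l : ℕ) (hl : 1 ≤ l) {r : ℝ≥0∞} (hr : r ≠ 0) :
    ∃ C : ℝ≥0, ∀ ψ : (Fin n → ℝ) → ℝ, Measurable ψ →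
      eLpNorm ψ r (volume.restrict (ucube n)) ≠ ∞ → ∀ ε : ℝ≥0∞, AxisDiffLE l r ψ ε →
      ∃ c : (Fin n → Fin l) → ℝ,
        eLpNorm (fun x => ψ x - tpoly c x) r (volume.restrict (ucube n)) ≤ C * ε := by
  have h₀ := exists_eLpNorm_sub_tpoly_le_two_mul n l hl hr
  obtain ⟨C₁, h₁⟩ := exists_eLpNorm_sub_lag_le n l hl r
  obtain ⟨C, hC⟩ := exists_isPartialPoly_sub_le n l hl hr (Finset.univ : Finset (Fin n))
  obtain ⟨K, hK⟩ := exists_nat_gt (4 * C * C₁ : ℝ≥0)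
  have hK1 : 1 ≤ K := Nat.one_le_iff_ne_zero.2 fun h => by simp [h] at hK
  obtain ⟨C₂, h₂⟩ := h₁ K hK1
  refine ⟨2 * (2 * C * C₂), fun ψ hψ hfin ε hε => ?_⟩
  obtain ⟨c₀, hc₀⟩ := h₀ ψ hψ
  refine ⟨c₀, ?_⟩
  set E : ℝ≥0∞ := ⨅ c : (Fin n → Fin l) → ℝ,
    eLpNorm (fun x => ψ x - tpoly c x) r (volume.restrict (ucube n)) with hE
  have hEfin : E ≠ ∞ := ne_top_of_le_ne_top hfin ((iInf_le _ 0).trans (by simp [tpoly_zero]))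
  have hc₀E : eLpNorm (fun x => ψ x - tpoly c₀ x) r (volume.restrict (ucube n)) ≤ 2 * E := by
    rw [hE, ENNReal.mul_iInf_of_ne two_ne_zero ENNReal.ofNat_ne_top]
    exact le_iInf fun c' => hc₀ c'
  have key : ∀ B : ℝ≥0∞, B ≠ 0 → C₁ * ENNReal.ofReal (1 / K) * (2 * E) + C₂ * ε ≤ B →
      E ≤ C * B := by
    intro B hB hle
    obtain ⟨g, hg, hgp, hgB⟩ := hC (fun x => ψ x - tpoly c₀ x) (hψ.sub (measurable_tpoly c₀)) B hB
      (fun j w hw0 hw1 => ((h₂ _ ε (hψ.sub (measurable_tpoly c₀)) (hε.sub_tpoly c₀) j w hw0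
        hw1).trans (add_le_add (mul_le_mul' le_rfl hc₀E) le_rfl)).trans hle)
    obtain ⟨c, rfl⟩ := hgp.exists_tpoly
    refine (iInf_le _ (c₀ + c)).trans (le_trans (le_of_eq ?_) hgB)
    congr 1
    ext x
    rw [tpoly_add]; ring
  have key2 : E ≤ C * (C₁ * ENNReal.ofReal (1 / K) * (2 * E) + C₂ * ε) := by
    refine ENNReal.le_of_forall_pos_le_add fun θ hθ _ => ?_
    have h3 : (0 : ℝ≥0) < θ / (C + 1) := by positivity
    refine (key (C₁ * ENNReal.ofReal (1 / K) * (2 * E) + C₂ * ε + ((θ / (C + 1) : ℝ≥0) : ℝ≥0∞))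
      (fun h => h3.ne' (by simpa using (add_eq_zero.1 h).2)) le_self_add).trans ?_
    rw [mul_add]
    refine add_le_add le_rfl ?_
    have h4 : C * (θ / (C + 1)) ≤ θ := by
      rw [← mul_div_assoc, div_le_iff₀ (by positivity), mul_comm]
      gcongr
      exact le_self_add
    exact_mod_cast h4
  have hK0 : (0 : ℝ≥0) < K := by exact_mod_cast hK1
  have h5 : (4 * C * C₁ : ℝ≥0∞) * ENNReal.ofReal (1 / K) ≤ 1 := by
    have e : ENNReal.ofReal (1 / K) = ((1 / K : ℝ≥0) : ℝ≥0∞) := by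
      rw [← ENNReal.ofReal_coe_nnreal]; simp
    rw [e]
    have : 4 * C * C₁ * (1 / K) ≤ 1 := by
      rw [mul_one_div]
      exact div_le_one_of_le₀ hK.le hK0.le
    exact_mod_cast this
  have h6 : E + E ≤ E + 2 * C * C₂ * ε := by
    calc E + E = 2 * E := (two_mul E).symm
      _ ≤ 2 * (C * (C₁ * ENNReal.ofReal (1 / K) * (2 * E) + C₂ * ε)) := mul_le_mul' le_rfl key2
      _ = (4 * C * C₁ : ℝ≥0∞) * ENNReal.ofReal (1 / K) * E + 2 * C * C₂ * ε := by ring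
      _ ≤ 1 * E + 2 * C * C₂ * ε := add_le_add (mul_le_mul' h5 le_rfl) le_rfl
      _ = _ := by rw [one_mul]
  have h7 := (ENNReal.add_le_add_iff_left hEfin).1 h6
  calc _ ≤ 2 * E := hc₀E
    _ ≤ 2 * (2 * C * C₂ * ε) := mul_le_mul' le_rfl h7
    _ = _ := by push_cast; ring

/-! ### Local polynomial approximation by averaged differences -/

lemma exists_tpoly_sub_le_avgDiff (n l : ℕ) (hl : 1 ≤ l) {r : ℝ≥0∞} (hr : r ≠ 0) :
    ∃ C : ℝ≥0, ∀ f : (Fin n → ℝ) → ℝ, Measurable f →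
      eLpNorm f r (volume.restrict (ucube n)) ≠ ∞ → ∃ c : (Fin n → Fin l) → ℝ, ∀ x ∈ ucube n,
        eLpNorm (fun x => f x - tpoly c x) r (volume.restrict (ucube n)) ≤
          C * avgDiff l r f x 2 := by
  obtain ⟨C₁, h₁⟩ := exists_tpoly_sub_le n l hl hr
  obtain ⟨C₂, h₂⟩ := exists_eLpNorm_diff_le_avgDiff n l hl hr
  refine ⟨C₁ * C₂, fun f hf hfin => ?_⟩
  set ε : ℝ≥0∞ := ⨆ (j : Fin n) (t : ℝ) (_ : |t| ≤ 1),
    eLpNorm (diff l (Pi.single j t) f) r (volume.restrict (stay j (l * t))) with hε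
  obtain ⟨c, hc⟩ := h₁ f hf hfin ε fun j t ht => by
    rw [hε]
    exact le_iSup_of_le j (le_iSup_of_le t (le_iSup_of_le ht le_rfl))
  refine ⟨c, fun x hx => hc.trans ?_⟩
  rw [ENNReal.coe_mul, mul_assoc]
  refine mul_le_mul' le_rfl (iSup_le fun j => iSup_le fun t => iSup_le fun ht => ?_)
  refine (eLpNorm_mono_measure _ (Measure.restrict_mono (fun y hy => hy.1) le_rfl)).trans
    (h₂ f hf x hx _ fun i => ?_)
  rcases eq_or_ne i j with rfl | h
  · simpa using ht
  · simp [h]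

lemma tpoly_injective {n l : ℕ} (hl : 1 ≤ l) {c d : (Fin n → Fin l) → ℝ}
    (h : ∀ x, tpoly c x = tpoly d x) : c = d := by
  obtain ⟨C, hC0, hC⟩ := exists_norm_le_sum_tpoly_grid n l hl one_pos
  have h1 := hC (c - d)
  simp only [tpoly_sub, h, sub_self, abs_zero, Finset.sum_const_zero, mul_zero] at h1
  exact sub_eq_zero.1 (norm_le_zero_iff.1 h1)

lemma shiftC_sub {n l : ℕ} (hl : 1 ≤ l) (v : Fin n → ℝ) (c d : (Fin n → Fin l) → ℝ) :
    shiftC v (c - d) = shiftC v c - shiftC v d :=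
  tpoly_injective hl fun x => by simp only [tpoly_shiftC, tpoly_sub]

lemma shiftC_shiftC {n l : ℕ} (hl : 1 ≤ l) (v w : Fin n → ℝ) (c : (Fin n → Fin l) → ℝ) :
    shiftC v (shiftC w c) = shiftC (w + v) c :=
  tpoly_injective hl fun x => by simp only [tpoly_shiftC]; rw [add_assoc, add_comm v w]

lemma shiftC_zero {n l : ℕ} (hl : 1 ≤ l) (c : (Fin n → Fin l) → ℝ) : shiftC 0 c = c :=
  tpoly_injective hl fun x => by simp only [tpoly_shiftC, add_zero]

lemma mem_box {n : ℕ} {v : Fin n → ℝ} {θ : ℝ} {x : Fin n → ℝ} :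
    x ∈ box v θ ↔ ∀ i, v i < x i ∧ x i < v i + θ := by
  rw [box_eq_pi]; simp [Set.mem_pi]

/-- Good polynomial approximations on adjacent cubes are close to each other. -/
lemma exists_norm_sub_shiftC_le (n l : ℕ) (hl : 1 ≤ l) {r : ℝ≥0∞} (hr : r ≠ 0) :
    ∃ C : ℝ≥0, ∀ f : (Fin n → ℝ) → ℝ, Measurable f → ∀ (i : Fin n) (c c' : (Fin n → Fin l) → ℝ),
      ∀ x ∈ ucube n, ENNReal.ofReal ‖c' - shiftC (Pi.single i 1) c‖ ≤
        C * (avgDiff l r f x 2 +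
          eLpNorm (fun x => f x - tpoly c x) r (volume.restrict (ucube n)) +
          eLpNorm (fun x => f (x + (Pi.single i 1 : Fin n → ℝ)) - tpoly c' x) r
            (volume.restrict (ucube n))) := by
  have hl0 : (1 : ℝ) ≤ l := by exact_mod_cast hl
  have hl1 : (0 : ℝ) < 1 / l := by positivity
  have hl2 : 1 / (l : ℝ) ≤ 1 := div_le_one_of_le₀ hl0 (by linarith)
  obtain ⟨C₁, h₁⟩ := exists_norm_le_eLpNorm_tpoly n l hl hr hl1 0
  obtain ⟨C₂, h₂⟩ := exists_eLpNorm_diff_le_avgDiff n l hl hr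
  refine ⟨C₁ * (quasiC r 1 * (quasiC r l * (l * 2 ^ l) + quasiC r 2 * (C₂ + 1))),
    fun f hf i c c' x hx => ?_⟩
  obtain ⟨u, hu⟩ : ∃ u : (Fin n → ℝ) → ℝ, u = fun x => f x - tpoly c x := ⟨_, rfl⟩
  obtain ⟨u', hu'⟩ : ∃ u' : (Fin n → ℝ) → ℝ,
    u' = fun x => f (x + (Pi.single i 1 : Fin n → ℝ)) - tpoly c' x := ⟨_, rfl⟩
  have hum : Measurable u := hu ▸ hf.sub (measurable_tpoly c)
  have hum' : Measurable u' := hu' ▸ (measurable_comp_add hf _).sub (measurable_tpoly c')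
  rw [← hu, ← hu']
  have hsub : box (0 : Fin n → ℝ) (1 / l) ⊆ ucube n := fun y hy => by
    rw [mem_box] at hy
    rw [mem_ucube]
    intro k
    have := hy k
    simp only [Pi.zero_apply, zero_add] at this
    exact ⟨this.1, by linarith [this.2]⟩
  have hpt : ∀ y : Fin n → ℝ, |tpoly (c' - shiftC (Pi.single i 1) c) y| ≤
      ∑ a ∈ Finset.range l, 2 ^ l * |u (y + (Pi.single i ((a : ℝ) / l) : Fin n → ℝ))| +
      ∑ s ∈ Finset.range 2, 1 *
        |if s = 0 then diff l (Pi.single i (1 / (l : ℝ)) : Fin n → ℝ) f y else u' y| := by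
    intro y
    have e1 : diff l (Pi.single i (1 / (l : ℝ)) : Fin n → ℝ) f y =
        ∑ a ∈ Finset.range l, dcoef l a * u (y + (Pi.single i ((a : ℝ) / l) : Fin n → ℝ)) +
          (f (y + (Pi.single i 1 : Fin n → ℝ)) - tpoly c (y + (Pi.single i 1 : Fin n → ℝ))) := by
      have h3 := diff_single_tpoly c i (1 / (l : ℝ)) y
      have h4 : diff l (Pi.single i (1 / (l : ℝ)) : Fin n → ℝ) f y =
          diff l (Pi.single i (1 / (l : ℝ)) : Fin n → ℝ) f y -
            diff l (Pi.single i (1 / (l : ℝ)) : Fin n → ℝ) (tpoly c) y := by rw [h3, sub_zero]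
      rw [h4, diff_eq, diff_eq, ← Finset.sum_sub_distrib, Finset.sum_range_succ, dcoef_last]
      have h5 : ∀ a : ℕ, ((a : ℝ) • (Pi.single i (1 / (l : ℝ)) : Fin n → ℝ)) =
          Pi.single i ((a : ℝ) / l) := fun a => by rw [smul_single_real, mul_one_div]
      simp only [h5, hu]
      rw [div_self (by linarith : (l : ℝ) ≠ 0)]
      congr 1
      · exact Finset.sum_congr rfl fun a _ => by ring
      · ring
    have e2 : tpoly (c' - shiftC (Pi.single i 1) c) y =
        diff l (Pi.single i (1 / (l : ℝ)) : Fin n → ℝ) f y - u' y -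
        ∑ a ∈ Finset.range l, dcoef l a * u (y + (Pi.single i ((a : ℝ) / l) : Fin n → ℝ)) := by
      rw [e1, tpoly_sub, tpoly_shiftC, hu']; ring
    rw [e2, add_comm (∑ a ∈ Finset.range l, _)]
    have e3 := abs_sub (diff l (Pi.single i (1 / (l : ℝ)) : Fin n → ℝ) f y - u' y)
      (∑ a ∈ Finset.range l, dcoef l a * u (y + (Pi.single i ((a : ℝ) / l) : Fin n → ℝ)))
    refine e3.trans (add_le_add ?_ ?_)
    · simp only [Finset.sum_range_succ, Finset.sum_range_zero, one_mul, zero_add, if_true,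
        one_ne_zero, if_false]
      exact abs_sub _ _
    · refine (Finset.abs_sum_le_sum_abs _ _).trans (Finset.sum_le_sum fun a _ => ?_)
      rw [abs_mul]
      exact mul_le_mul_of_nonneg_right (abs_dcoef_le l a) (abs_nonneg _)
  have hdm := measurable_diff l (Pi.single i (1 / (l : ℝ)) : Fin n → ℝ) hf
  have hbound := eLpNorm_le_of_abs_le_sum_add (μ := volume.restrict (box (0 : Fin n → ℝ) (1 / l))) r
    (Finset.range l) (Finset.range 2) (fun _ => 2 ^ l) (fun _ => 1)
    (g := tpoly (c' - shiftC (Pi.single i 1) c))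
    (f := fun (a : ℕ) (y : Fin n → ℝ) => u (y + (Pi.single i ((a : ℝ) / l) : Fin n → ℝ)))
    (h := fun (s : ℕ) (y : Fin n → ℝ) =>
      if s = 0 then diff l (Pi.single i (1 / (l : ℝ)) : Fin n → ℝ) f y else u' y)
    (fun _ _ => by positivity) (fun _ _ => by positivity)
    (fun a _ => (measurable_comp_add hum _).aestronglyMeasurable)
    (fun s _ => by
      split_ifs
      · exact hdm.aestronglyMeasurable
      · exact hum'.aestronglyMeasurable)
    (Filter.Eventually.of_forall hpt)
  rw [Finset.card_range, Finset.card_range] at hbound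
  have hb1 : ∀ a ∈ Finset.range l, ENNReal.ofReal (2 ^ l) *
      eLpNorm (fun y : Fin n → ℝ => u (y + (Pi.single i ((a : ℝ) / l) : Fin n → ℝ))) r
        (volume.restrict (box (0 : Fin n → ℝ) (1 / l))) ≤
      2 ^ l * eLpNorm u r (volume.restrict (ucube n)) := by
    intro a ha
    refine mul_le_mul' (le_of_eq ?_) (eLpNorm_translate_le _ (fun y hy => ?_) hum r)
    · rw [ENNReal.ofReal_pow (by norm_num)]; simp
    · have hy0 := hsub hy
      have hyi := (mem_box.1 hy) i
      simp only [Pi.zero_apply, zero_add] at hyi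
      have ha' : (a : ℝ) + 1 ≤ l := by exact_mod_cast Finset.mem_range.1 ha
      rw [add_single_mem_ucube hy0]
      have e0 : 0 ≤ (a : ℝ) / l := by positivity
      have e1 : (a : ℝ) / l + 1 / l ≤ 1 := by
        rw [← add_div]; exact div_le_one_of_le₀ ha' (by linarith)
      constructor <;> linarith
  have hb2 : eLpNorm (diff l (Pi.single i (1 / (l : ℝ)) : Fin n → ℝ) f) r
      (volume.restrict (box (0 : Fin n → ℝ) (1 / l))) ≤ C₂ * avgDiff l r f x 2 := by
    refine (eLpNorm_mono_measure _ (Measure.restrict_mono hsub le_rfl)).trans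
      (h₂ f hf x hx _ fun k => ?_)
    rcases eq_or_ne k i with rfl | h
    · rw [Pi.single_eq_same, abs_of_pos hl1]; exact hl2
    · simp [h]
  have hb3 : eLpNorm u' r (volume.restrict (box (0 : Fin n → ℝ) (1 / l))) ≤
      eLpNorm u' r (volume.restrict (ucube n)) :=
    eLpNorm_mono_measure _ (Measure.restrict_mono hsub le_rfl)
  obtain ⟨X, hX⟩ : ∃ X, X = avgDiff l r f x 2 + eLpNorm u r (volume.restrict (ucube n)) +
    eLpNorm u' r (volume.restrict (ucube n)) := ⟨_, rfl⟩
  have hXa : avgDiff l r f x 2 ≤ X := hX ▸ le_add_right le_self_add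
  have hXu : eLpNorm u r (volume.restrict (ucube n)) ≤ X := hX ▸ le_add_right le_add_self
  have hXu' : eLpNorm u' r (volume.restrict (ucube n)) ≤ X := hX ▸ le_add_self
  rw [← hX]
  refine (h₁ 0 (by simp) _).trans ((mul_le_mul' le_rfl (hbound.trans (mul_le_mul' le_rfl
    (add_le_add (mul_le_mul' le_rfl (Finset.sum_le_sum fun a ha => (hb1 a ha).trans
      (mul_le_mul' le_rfl hXu))) (mul_le_mul' le_rfl
      (?_ : _ ≤ C₂ * X + X)))))).trans (le_of_eq ?_))
  · simp only [Finset.sum_range_succ, Finset.sum_range_zero, zero_add, if_true,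
        one_ne_zero, if_false, ENNReal.ofReal_one, one_mul]
    exact add_le_add (hb2.trans (mul_le_mul' le_rfl hXa)) (hb3.trans hXu')
  · simp only [Finset.sum_const, Finset.card_range, nsmul_eq_mul]
    push_cast
    ring

/-- From adjacent cubes to cubes at bounded distance. -/
lemma exists_norm_sub_shiftC_chain (n l : ℕ) (hl : 1 ≤ l) (N : ℕ) :
    ∃ C : ℝ≥0, ∀ (c : (Fin n → ℤ) → (Fin n → Fin l) → ℝ) (D : (Fin n → ℤ) → ℝ≥0∞),
      (∀ m i, ENNReal.ofReal ‖c (m + Pi.single i 1) - shiftC (Pi.single i 1) (c m)‖ ≤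
        D m + D (m + Pi.single i 1)) →
      ∀ (m : Fin n → ℤ) (a : Fin n → Fin (N + 1)),
        ENNReal.ofReal ‖c (m + fun i => ((a i : ℕ) : ℤ)) - shiftC (fun i => ((a i : ℕ) : ℝ)) (c m)‖ ≤
          C * ∑ b : Fin n → Fin (N + 1), D (m + fun i => ((b i : ℕ) : ℤ)) := by
  obtain ⟨K, hK0, hK⟩ := exists_norm_shiftC_le n l 1
  obtain ⟨Q, hQ⟩ : ∃ Q : ℝ≥0, Q = 1 + K.toNNReal := ⟨_, rfl⟩
  have hQ1 : 1 ≤ Q := hQ ▸ le_self_add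
  have hKQ : K.toNNReal ≤ Q := hQ ▸ le_add_self
  refine ⟨2 * (n * N) * Q ^ (n * N), fun c D hD m a => ?_⟩
  set S : ℝ≥0∞ := ∑ b : Fin n → Fin (N + 1), D (m + fun i => ((b i : ℕ) : ℤ)) with hS
  have hDS : ∀ b : Fin n → ℕ, (∀ i, b i ≤ N) → D (m + fun i => (b i : ℤ)) ≤ S := by
    intro b hb
    exact Finset.single_le_sum (f := fun b : Fin n → Fin (N + 1) => D (m + fun i => ((b i : ℕ) : ℤ)))
      (fun _ _ => zero_le) (Finset.mem_univ (fun i => (⟨b i, by have := hb i; omega⟩ : Fin (N + 1))))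
  have key : ∀ (s : ℕ) (a : Fin n → ℕ), (∀ i, a i ≤ N) → ∑ i, a i = s →
      ENNReal.ofReal ‖c (m + fun i => (a i : ℤ)) - shiftC (fun i => (a i : ℝ)) (c m)‖ ≤
        ((2 * s * Q ^ s : ℝ≥0) : ℝ≥0∞) * S := by
    intro s
    induction s with
    | zero =>
      intro a ha hs
      have ha0 : ∀ i, a i = 0 := fun i => (Finset.sum_eq_zero_iff.1 hs) i (Finset.mem_univ i)
      have e1 : (fun i => (a i : ℤ)) = 0 := by ext i; simp [ha0]
      have e2 : (fun i => (a i : ℝ)) = 0 := by ext i; simp [ha0]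
      rw [e1, e2, add_zero, shiftC_zero hl]
      simp
    | succ s ih =>
      intro a ha hs
      obtain ⟨i, hi⟩ : ∃ i, a i ≠ 0 := by
        by_contra h
        push Not at h
        simp [h] at hs
      obtain ⟨a', ha'⟩ : ∃ a' : Fin n → ℕ, a' = Function.update a i (a i - 1) := ⟨_, rfl⟩
      have hupd : a = a' + Pi.single i 1 := by
        ext k
        rcases eq_or_ne k i with rfl | hk
        · simp [ha']; omega
        · simp [ha', hk]
      have h1 : ∀ k, a' k ≤ N := fun k => by
        have h2 : a k = a' k + (Pi.single i 1 : Fin n → ℕ) k := congrFun hupd k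
        have := ha k
        omega
      have h2 : ∑ k, a' k = s := by
        have h3 : ∑ k, a k = ∑ k, a' k + 1 := by
          rw [hupd]; simp [Finset.sum_add_distrib]
        omega
      have e1 : (m + fun k => (a k : ℤ)) = (m + fun k => (a' k : ℤ)) + Pi.single i 1 := by
        rw [hupd, add_assoc]
        congr 1
        ext k
        rcases eq_or_ne k i with rfl | hk
        · simp
        · simp [hk]
      have e2 : (fun k => (a k : ℝ)) = (fun k => (a' k : ℝ)) + Pi.single i 1 := by
        rw [hupd]
        ext k
        rcases eq_or_ne k i with rfl | hk
        · simp
        · simp [hk]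
      have e3 : c (m + fun k => (a k : ℤ)) - shiftC (fun k => (a k : ℝ)) (c m) =
          (c ((m + fun k => (a' k : ℤ)) + Pi.single i 1) -
            shiftC (Pi.single i 1) (c (m + fun k => (a' k : ℤ)))) +
          shiftC (Pi.single i 1) (c (m + fun k => (a' k : ℤ)) - shiftC (fun k => (a' k : ℝ)) (c m)) := by
        rw [shiftC_sub hl, shiftC_shiftC hl, ← e1, ← e2]
        abel
      have h4 := hD (m + fun k => (a' k : ℤ)) i
      rw [← e1] at h4
      have h5 : ENNReal.ofReal ‖shiftC (Pi.single i 1) (c (m + fun k => (a' k : ℤ)) -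
          shiftC (fun k => (a' k : ℝ)) (c m))‖ ≤ Q * (((2 * s * Q ^ s : ℝ≥0) : ℝ≥0∞) * S) := by
        refine (ENNReal.ofReal_le_ofReal (hK (Pi.single i 1) (fun k => ?_) _)).trans ?_
        · rcases eq_or_ne k i with rfl | hk
          · simp
          · simp [hk]
        · rw [ENNReal.ofReal_mul hK0]
          exact mul_le_mul' (ENNReal.coe_le_coe.2 hKQ) (ih a' h1 h2)
      rw [e3]
      have h6 := (ENNReal.ofReal_le_ofReal (norm_add_le (c ((m + fun k => (a' k : ℤ)) +
        Pi.single i 1) - shiftC (Pi.single i 1) (c (m + fun k => (a' k : ℤ))))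
        (shiftC (Pi.single i 1) (c (m + fun k => (a' k : ℤ)) -
          shiftC (fun k => (a' k : ℝ)) (c m))))).trans ENNReal.ofReal_add_le
      rw [← e1] at h6 ⊢
      refine h6.trans ((add_le_add (h4.trans (add_le_add (hDS a' h1) (hDS a ha))) h5).trans ?_)
      have h7 : (2 + Q * (2 * s * Q ^ s) : ℝ≥0) ≤ 2 * (s + 1 : ℕ) * Q ^ (s + 1) := by
        have : (1 : ℝ≥0) ≤ Q ^ (s + 1) := one_le_pow₀ hQ1
        calc (2 + Q * (2 * s * Q ^ s) : ℝ≥0) = 2 * 1 + 2 * s * Q ^ (s + 1) := by ring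
          _ ≤ 2 * Q ^ (s + 1) + 2 * s * Q ^ (s + 1) := by gcongr
          _ = _ := by push_cast; ring
      calc S + S + Q * (((2 * s * Q ^ s : ℝ≥0) : ℝ≥0∞) * S)
          = ((2 + Q * (2 * s * Q ^ s) : ℝ≥0) : ℝ≥0∞) * S := by push_cast; ring
        _ ≤ _ := mul_le_mul' (ENNReal.coe_le_coe.2 h7) le_rfl
  have hs : ∑ i, (a i : ℕ) ≤ n * N := by
    refine (Finset.sum_le_sum fun i _ => Nat.le_of_lt_succ (a i).2).trans ?_
    simp
  refine (key _ (fun i => (a i : ℕ)) (fun i => Nat.le_of_lt_succ (a i).2) rfl).trans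
    (mul_le_mul' (ENNReal.coe_le_coe.2 ?_) le_rfl)
  refine mul_le_mul' (mul_le_mul' le_rfl ?_) (pow_le_pow_right₀ hQ1 hs)
  exact_mod_cast hs

/-! ### Cardinal `B`-splines of one variable -/

open Polynomial in
/-- The polynomial `∏_{j=1}^{l-1} (j - X)`. -/
def knotPoly (l : ℕ) : Polynomial ℝ := ∏ j ∈ Finset.Icc 1 (l - 1), (C (j : ℝ) - X)

lemma eval_knotPoly (l : ℕ) (y : ℝ) :
    (knotPoly l).eval y = ∏ j ∈ Finset.Icc 1 (l - 1), ((j : ℝ) - y) := by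
  simp [knotPoly, Polynomial.eval_prod]

lemma natDegree_knotPoly_lt {l : ℕ} (hl : 1 ≤ l) : (knotPoly l).natDegree < l := by
  have h : (knotPoly l).natDegree ≤ ∑ _j ∈ Finset.Icc 1 (l - 1), 1 := by
    refine (Polynomial.natDegree_prod_le _ _).trans (Finset.sum_le_sum fun j _ => ?_)
    rw [← neg_sub, Polynomial.natDegree_neg]
    exact Polynomial.natDegree_X_sub_C_le _
  simp at h
  omega

lemma eval_knotPoly_eq_zero {l : ℕ} {i : ℤ} (h1 : 1 ≤ i) (h2 : i < l) :
    (knotPoly l).eval (i : ℝ) = 0 := by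
  rw [eval_knotPoly]
  refine Finset.prod_eq_zero (i := i.toNat) (Finset.mem_Icc.2 ⟨by omega, by omega⟩) ?_
  have : ((i.toNat : ℤ) : ℝ) = i := by rw [Int.toNat_of_nonneg (by omega)]
  rw [← Int.cast_natCast, this, sub_self]

lemma eval_zero_knotPoly (l : ℕ) : (knotPoly l).eval 0 = ((l - 1).factorial : ℝ) := by
  rw [eval_knotPoly, ← Finset.prod_range_add_one_eq_factorial, Finset.range_eq_Ico,
    Finset.prod_Ico_add' (fun j : ℕ => j) 0 (l - 1) 1]
  push_cast
  refine Finset.prod_congr ?_ fun j _ => sub_zero _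
  ext j; simp

/-- The de Boor–Fix functional of the `B`-spline with knots `0, …, l`, at the centre of `[0, 1]`. -/
def lam (l : ℕ) : Polynomial ℝ →ₗ[ℝ] ℝ :=
  ∑ ν ∈ Finset.range l, ((-1) ^ (l - 1 - ν) / ((l - 1).factorial : ℝ) *
    (Polynomial.derivative^[l - 1 - ν] (knotPoly l)).eval (1 / 2)) •
      ((Polynomial.leval (1 / 2 : ℝ)) ∘ₗ (Polynomial.derivative ^ ν))

lemma lam_apply (l : ℕ) (P : Polynomial ℝ) :
    lam l P = ∑ ν ∈ Finset.range l, ((-1) ^ (l - 1 - ν) / ((l - 1).factorial : ℝ) *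
      (Polynomial.derivative^[l - 1 - ν] (knotPoly l)).eval (1 / 2)) *
        (Polynomial.derivative^[ν] P).eval (1 / 2) := by
  simp [lam, LinearMap.sum_apply, Module.End.pow_apply, Polynomial.leval_apply]

lemma eval_eq_sum_iterate_derivative {l : ℕ} {P : Polynomial ℝ} (hP : P.natDegree < l) (x y : ℝ) :
    P.eval y = ∑ μ ∈ Finset.range l,
      (Polynomial.derivative^[μ] P).eval x / (μ.factorial : ℝ) * (y - x) ^ μ := by
  have h1 : P.eval y = (Polynomial.taylor x P).eval (y - x) := by
    rw [Polynomial.taylor_eval, sub_add_cancel]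
  rw [h1, Polynomial.eval_eq_sum_range' (n := l) (by rwa [Polynomial.natDegree_taylor])]
  refine Finset.sum_congr rfl fun μ _ => ?_
  have h2 : Polynomial.derivative^[μ] P = μ.factorial • Polynomial.hasseDeriv μ P := by
    rw [← Polynomial.factorial_smul_hasseDeriv]; rfl
  have : (μ.factorial : ℝ) ≠ 0 := by positivity
  rw [Polynomial.taylor_coeff, h2, Polynomial.eval_smul, nsmul_eq_mul]
  field_simp

open Polynomial in
lemma lam_X_add_C_pow {l : ℕ} (hl : 1 ≤ l) (y : ℝ) :
    lam l ((X + C y) ^ (l - 1)) = (knotPoly l).eval (-y) := by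
  rw [lam_apply, eval_eq_sum_iterate_derivative (natDegree_knotPoly_lt hl) (1 / 2) (-y),
    ← Finset.sum_range_reflect]
  refine Finset.sum_congr rfl fun μ hμ => ?_
  have hμ' := Finset.mem_range.1 hμ
  have e1 : l - 1 - (l - 1 - μ) = μ := by omega
  rw [e1, iterate_derivative_X_add_pow, e1]
  have h2 : (((l - 1).descFactorial (l - 1 - μ) : ℕ) : ℝ) * (μ.factorial : ℝ) =
      ((l - 1).factorial : ℝ) := by
    have := Nat.factorial_mul_descFactorial (show l - 1 - μ ≤ l - 1 by omega)
    rw [e1] at this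
    exact_mod_cast (mul_comm _ _).trans this
  have h3 : (μ.factorial : ℝ) ≠ 0 := by positivity
  have h4 : ((l - 1).factorial : ℝ) ≠ 0 := by positivity
  have h5 : (-y - 1 / 2 : ℝ) ^ μ = (-1) ^ μ * (1 / 2 + y) ^ μ := by
    rw [← mul_pow]; congr 1; ring
  simp only [nsmul_eq_mul, eval_mul, eval_natCast, eval_pow, eval_add, eval_X, eval_C]
  rw [h5, ← h2]
  have h6 : (((l - 1).descFactorial (l - 1 - μ) : ℕ) : ℝ) ≠ 0 := by
    intro h; rw [h, zero_mul] at h2; exact h4 h2.symm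
  field_simp

open Polynomial in
/-- The polynomial with which `bspline l (· + a)` coincides on `[0, 1)`. -/
def piece (l a : ℕ) : Polynomial ℝ :=
  C (1 / ((l - 1).factorial : ℝ)) * ∑ j ∈ Finset.range (l + 1),
    C (if j ≤ a then (-1) ^ j * (l.choose j : ℝ) else 0) * (X + C ((a : ℝ) - j)) ^ (l - 1)

lemma eval_piece (l a : ℕ) (u : ℝ) : (piece l a).eval u =
    1 / ((l - 1).factorial : ℝ) * ∑ j ∈ Finset.range (l + 1),
      (if j ≤ a then (-1) ^ j * (l.choose j : ℝ) else 0) * (u + ((a : ℝ) - j)) ^ (l - 1) := by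
  simp [piece, Polynomial.eval_finsetSum]

lemma natDegree_piece_lt {l : ℕ} (hl : 1 ≤ l) (a : ℕ) : (piece l a).natDegree < l := by
  refine lt_of_le_of_lt (Polynomial.natDegree_C_mul_le _ _)
    (lt_of_le_of_lt (Polynomial.natDegree_sum_le_of_forall_le _ _ (n := l - 1) fun j _ => ?_)
      (by omega))
  refine (Polynomial.natDegree_C_mul_le _ _).trans ((Polynomial.natDegree_pow_le).trans ?_)
  rw [Polynomial.natDegree_X_add_C, mul_one]

lemma bspline_add_natCast (l a : ℕ) {u : ℝ} (h0 : 0 ≤ u) (h1 : u < 1) :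
    bspline l (u + a) = (piece l a).eval u := by
  rw [bspline, eval_piece]
  congr 1
  refine Finset.sum_congr rfl fun j _ => ?_
  have : ((j : ℝ) ≤ u + a) ↔ j ≤ a := by
    constructor
    · intro h
      by_contra hlt
      push Not at hlt
      have : (a : ℝ) + 1 ≤ j := by exact_mod_cast hlt
      linarith
    · intro h
      have : (j : ℝ) ≤ a := by exact_mod_cast h
      linarith
  by_cases h : j ≤ a
  · rw [if_pos (this.2 h), if_pos h, add_sub_assoc]
  · rw [if_neg (fun h' => h (this.1 h')), if_neg h]; ring

lemma neg_one_pow_mul_choose (l j : ℕ) :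
    (-1) ^ j * (l.choose j : ℝ) = (-1) ^ l * dcoef l j := by
  rw [dcoef, pow_add]
  have : ((-1 : ℝ) ^ l) * (-1) ^ l = 1 := by rw [← mul_pow]; simp
  linear_combination (-(l.choose j : ℝ) * (-1) ^ j) * this

lemma piece_eq_zero {l a : ℕ} (hl : 1 ≤ l) (ha : l ≤ a) (u : ℝ) : (piece l a).eval u = 0 := by
  rw [eval_piece]
  have h1 : ∀ j ∈ Finset.range (l + 1), (if j ≤ a then (-1) ^ j * (l.choose j : ℝ) else 0) *
      (u + ((a : ℝ) - j)) ^ (l - 1) =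
      (-1) ^ l * (dcoef l j * ((Polynomial.X : Polynomial ℝ) ^ (l - 1)).eval (u + a + j * (-1))) := by
    intro j hj
    rw [if_pos ((Nat.lt_succ_iff.1 (Finset.mem_range.1 hj)).trans ha), neg_one_pow_mul_choose]
    simp only [Polynomial.eval_pow, Polynomial.eval_X]
    rw [mul_assoc]; congr 3; ring
  rw [Finset.sum_congr rfl h1, ← Finset.mul_sum, sum_dcoef_eval_eq_zero (by simp; omega)]
  simp

lemma bspline_of_neg {l : ℕ} {t : ℝ} (ht : t < 0) : bspline l t = 0 := by
  rw [bspline, Finset.sum_eq_zero, mul_zero]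
  intro j _
  rw [if_neg, mul_zero]
  push Not
  exact ht.trans_le (by positivity)

lemma bspline_of_ge {l : ℕ} (hl : 1 ≤ l) {t : ℝ} (ht : (l : ℝ) ≤ t) : bspline l t = 0 := by
  have h0 : 0 ≤ t := le_trans (by positivity) ht
  have h1 : t = (t - ⌊t⌋₊) + ⌊t⌋₊ := by ring
  rw [h1, bspline_add_natCast l _ (sub_nonneg.2 (Nat.floor_le h0))
    (by linarith [Nat.lt_floor_add_one t]), piece_eq_zero hl]
  exact Nat.le_floor ht

lemma lam_piece {l : ℕ} (hl : 1 ≤ l) {a : ℕ} (ha : a < l) :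
    lam l (piece l a) = if a = 0 then 1 else 0 := by
  have hf : ((l - 1).factorial : ℝ) ≠ 0 := by positivity
  have h1 : lam l (piece l a) = 1 / ((l - 1).factorial : ℝ) * ∑ j ∈ Finset.range (l + 1),
      (if j ≤ a then (-1) ^ j * (l.choose j : ℝ) else 0) * (knotPoly l).eval (-((a : ℝ) - j)) := by
    rw [piece, ← Polynomial.smul_eq_C_mul, map_smul, map_sum, smul_eq_mul]
    congr 1
    refine Finset.sum_congr rfl fun j _ => ?_
    rw [← Polynomial.smul_eq_C_mul, map_smul, smul_eq_mul, lam_X_add_C_pow hl]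
  rw [h1]
  split_ifs with h0
  · subst h0
    rw [Finset.sum_eq_single 0]
    · simp [eval_zero_knotPoly, hf]
    · intro j _ hj
      rw [if_neg (by omega), zero_mul]
    · simp
  · have h2 : ∀ j ∈ Finset.range (l + 1), (if j ≤ a then (-1) ^ j * (l.choose j : ℝ) else 0) *
        (knotPoly l).eval (-((a : ℝ) - j)) =
        (-1) ^ l * (dcoef l j * (knotPoly l).eval (-(a : ℝ) + j * 1)) := by
      intro j hj
      have hj' := Finset.mem_range.1 hj
      have e : -((a : ℝ) - j) = -(a : ℝ) + j * 1 := by ring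
      rw [e]
      split_ifs with h
      · rw [neg_one_pow_mul_choose, mul_assoc]
      · have e2 : -(a : ℝ) + j * 1 = ((j - a : ℤ) : ℝ) := by push_cast; ring
        rw [e2, eval_knotPoly_eq_zero (by omega) (by omega)]; simp
    rw [Finset.sum_congr rfl h2, ← Finset.mul_sum, sum_dcoef_eval_eq_zero (natDegree_knotPoly_lt hl)]
    simp

/-- The inverse of the triangular system that expresses the pieces by powers. -/
lemma sum_knotPoly_choose {l : ℕ} {i q : ℕ} (hi : i < l) (hq : q < l) :
    ∑ j ∈ Finset.range (l + 1), (if i + j < l then (-1) ^ j * (l.choose j : ℝ) *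
      (knotPoly l).eval (((i + j : ℕ) : ℝ) - q) else 0) =
      if i = q then ((l - 1).factorial : ℝ) else 0 := by
  have hl : 1 ≤ l := by omega
  have hcast : ∀ j : ℕ, (((i + j : ℕ) : ℝ) - q) = ((i + j - q : ℤ) : ℝ) := fun j => by push_cast; ring
  rcases lt_trichotomy i q with h | h | h
  · rw [if_neg h.ne]
    have h2 : ∀ j ∈ Finset.range (l + 1), (if i + j < l then (-1) ^ j * (l.choose j : ℝ) *
        (knotPoly l).eval (((i + j : ℕ) : ℝ) - q) else 0) =
        (-1) ^ l * (dcoef l j * (knotPoly l).eval (((i : ℝ) - q) + j * 1)) := by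
      intro j hj
      have hj' := Finset.mem_range.1 hj
      have e : ((i : ℝ) - q) + j * 1 = ((i + j : ℕ) : ℝ) - q := by push_cast; ring
      rw [e]
      split_ifs with h'
      · rw [neg_one_pow_mul_choose, mul_assoc]
      · rw [hcast, eval_knotPoly_eq_zero (by omega) (by omega)]; simp
    rw [Finset.sum_congr rfl h2, ← Finset.mul_sum, sum_dcoef_eval_eq_zero (natDegree_knotPoly_lt hl)]
    simp
  · subst h
    rw [if_pos rfl, Finset.sum_eq_single 0]
    · simp [hi, eval_zero_knotPoly]
    · intro j hj hj0
      split_ifs with h'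
      · rw [hcast, eval_knotPoly_eq_zero (by omega) (by omega), mul_zero]
      · rfl
    · simp
  · rw [if_neg h.ne']
    refine Finset.sum_eq_zero fun j hj => ?_
    split_ifs with h'
    · rw [hcast, eval_knotPoly_eq_zero (by omega) (by omega), mul_zero]
    · rfl

/-- Marsden's identity on the cell `[0, 1)`. -/
lemma sum_knotPoly_mul_piece {l : ℕ} (hl : 1 ≤ l) (u q : ℝ) :
    ∑ a ∈ Finset.range l, (knotPoly l).eval ((a : ℝ) - q) * (piece l a).eval u =
      (u + q) ^ (l - 1) := by
  have hf : ((l - 1).factorial : ℝ) ≠ 0 := by positivity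
  have hnat : ∀ q : ℕ, q < l → ∑ a ∈ Finset.range l, (knotPoly l).eval ((a : ℝ) - q) *
      (piece l a).eval u = (u + q) ^ (l - 1) := by
    intro q hq
    have h1 : ∀ a ∈ Finset.range l, (knotPoly l).eval ((a : ℝ) - q) * (piece l a).eval u =
        ∑ j ∈ Finset.range (l + 1), ∑ i ∈ Finset.range l, if i + j = a then
          1 / ((l - 1).factorial : ℝ) * ((-1) ^ j * (l.choose j : ℝ) *
            (knotPoly l).eval (((i + j : ℕ) : ℝ) - q)) * (u + i) ^ (l - 1) else 0 := by
      intro a ha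
      have ha' := Finset.mem_range.1 ha
      rw [eval_piece, mul_left_comm, Finset.mul_sum, Finset.mul_sum]
      refine Finset.sum_congr rfl fun j _ => ?_
      split_ifs with h
      · rw [Finset.sum_eq_single (a - j)]
        · rw [if_pos (by omega), Nat.sub_add_cancel h, Nat.cast_sub h]; ring
        · intro i _ hi
          rw [if_neg (by omega)]
        · intro h'; exact absurd (Finset.mem_range.2 (by omega)) h'
      · rw [Finset.sum_eq_zero, zero_mul, mul_zero, mul_zero]
        intro i _
        rw [if_neg (by omega)]
    rw [Finset.sum_congr rfl h1, Finset.sum_comm]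
    have h2 : ∀ j ∈ Finset.range (l + 1), ∑ a ∈ Finset.range l, ∑ i ∈ Finset.range l,
        (if i + j = a then 1 / ((l - 1).factorial : ℝ) * ((-1) ^ j * (l.choose j : ℝ) *
            (knotPoly l).eval (((i + j : ℕ) : ℝ) - q)) * (u + i) ^ (l - 1) else 0) =
        ∑ i ∈ Finset.range l, 1 / ((l - 1).factorial : ℝ) * (u + i) ^ (l - 1) *
          (if i + j < l then (-1) ^ j * (l.choose j : ℝ) *
            (knotPoly l).eval (((i + j : ℕ) : ℝ) - q) else 0) := by
      intro j _
      rw [Finset.sum_comm]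
      refine Finset.sum_congr rfl fun i _ => ?_
      rw [Finset.sum_ite_eq]
      simp only [Finset.mem_range]
      split_ifs
      · ring
      · ring
    rw [Finset.sum_congr rfl h2, Finset.sum_comm]
    have h3 : ∀ i ∈ Finset.range l, ∑ j ∈ Finset.range (l + 1), 1 / ((l - 1).factorial : ℝ) *
        (u + i) ^ (l - 1) * (if i + j < l then (-1) ^ j * (l.choose j : ℝ) *
            (knotPoly l).eval (((i + j : ℕ) : ℝ) - q) else 0) =
        if i = q then (u + q) ^ (l - 1) else 0 := by
      intro i hi
      rw [← Finset.mul_sum, sum_knotPoly_choose (Finset.mem_range.1 hi) hq]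
      split_ifs with h
      · rw [h]; field_simp
      · simp
    rw [Finset.sum_congr rfl h3, Finset.sum_ite_eq', if_pos (Finset.mem_range.2 hq)]
  obtain ⟨L, hL⟩ : ∃ L : Polynomial ℝ, L = ∑ a ∈ Finset.range l,
    Polynomial.C ((piece l a).eval u) * (knotPoly l).comp (Polynomial.C (a : ℝ) - Polynomial.X) :=
    ⟨_, rfl⟩
  have hLe : ∀ q : ℝ, L.eval q = ∑ a ∈ Finset.range l, (knotPoly l).eval ((a : ℝ) - q) *
      (piece l a).eval u := fun q => by
    simp [hL, Polynomial.eval_finsetSum, Polynomial.eval_comp, mul_comm]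
  have hLd : L.natDegree < l := by
    rw [hL]
    refine lt_of_le_of_lt (Polynomial.natDegree_sum_le_of_forall_le _ _ (n := l - 1) fun a _ => ?_)
      (by omega)
    refine (Polynomial.natDegree_C_mul_le _ _).trans (Polynomial.natDegree_comp_le.trans ?_)
    have h1 : (Polynomial.C (a : ℝ) - Polynomial.X).natDegree ≤ 1 := by
      rw [← neg_sub, Polynomial.natDegree_neg]; exact Polynomial.natDegree_X_sub_C_le _
    have h2 := natDegree_knotPoly_lt hl
    calc _ ≤ (l - 1) * 1 := Nat.mul_le_mul (by omega) h1
      _ = _ := mul_one _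
  have hR : ((Polynomial.X + Polynomial.C u) ^ (l - 1) : Polynomial ℝ).natDegree < l := by
    refine lt_of_le_of_lt Polynomial.natDegree_pow_le ?_
    rw [Polynomial.natDegree_X_add_C]; omega
  have h4 := eval_eq_sum_lag hLd q
  have h5 := eval_eq_sum_lag hR q
  rw [← hLe, h4]
  have h6 : (u + q) ^ (l - 1) = ((Polynomial.X + Polynomial.C u) ^ (l - 1) : Polynomial ℝ).eval q := by
    simp [add_comm]
  rw [h6, h5]
  refine Finset.sum_congr rfl fun a ha => ?_
  rw [hLe, hnat a (Finset.mem_range.1 ha)]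
  simp [add_comm]

/-- Reproduction of polynomials on a cell. -/
lemma eval_add_eq_sum_lam {l : ℕ} {P : Polynomial ℝ} (hP : P.natDegree < l) (u q : ℝ) :
    P.eval (u + q) = ∑ a ∈ Finset.range l,
      lam l (P.comp (Polynomial.X + Polynomial.C (q - a))) * (piece l a).eval u := by
  have hl : 1 ≤ l := by omega
  obtain ⟨F, hF⟩ : ∃ F : Polynomial ℝ →ₗ[ℝ] ℝ, ∀ P, F P = P.eval (u + q) - ∑ a ∈ Finset.range l,
      lam l (P.comp (Polynomial.X + Polynomial.C (q - a))) * (piece l a).eval u := by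
    refine ⟨{
      toFun := fun P => P.eval (u + q) - ∑ a ∈ Finset.range l,
        lam l (P.comp (Polynomial.X + Polynomial.C (q - a))) * (piece l a).eval u
      map_add' := fun P Q => ?_
      map_smul' := fun s P => ?_ }, fun P => rfl⟩
    · simp only [Polynomial.eval_add, Polynomial.add_comp, map_add, add_mul, Finset.sum_add_distrib]
      ring
    · simp only [Polynomial.eval_smul, Polynomial.smul_comp, map_smul, smul_eq_mul, mul_assoc,
        ← Finset.mul_sum, RingHom.id_apply]
      ring
  have hpow : ∀ y : ℝ, F ((Polynomial.X + Polynomial.C y) ^ (l - 1)) = 0 := by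
    intro y
    rw [hF, sub_eq_zero]
    have h1 := sum_knotPoly_mul_piece hl u (q + y)
    simp only [Polynomial.eval_pow, Polynomial.eval_add, Polynomial.eval_X, Polynomial.eval_C]
    rw [add_assoc, ← h1]
    refine Finset.sum_congr rfl fun a _ => ?_
    have : ((Polynomial.X + Polynomial.C y) ^ (l - 1) : Polynomial ℝ).comp
        (Polynomial.X + Polynomial.C (q - a)) =
        (Polynomial.X + Polynomial.C (q - a + y)) ^ (l - 1) := by
      simp [add_assoc]
    rw [this, lam_X_add_C_pow hl]
    congr 2; ring
  have hmon : ∀ b : ℕ, b < l → F (Polynomial.X ^ b) = 0 := by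
    obtain ⟨G, hG⟩ : ∃ G : Polynomial ℝ, G = ∑ b ∈ Finset.range (l - 1 + 1),
      Polynomial.C (F (Polynomial.X ^ b) * ((l - 1).choose b : ℝ)) * Polynomial.X ^ (l - 1 - b) :=
      ⟨_, rfl⟩
    have hG0 : G = 0 := by
      refine Polynomial.funext fun y => ?_
      rw [Polynomial.eval_zero, ← hpow y, add_pow, map_sum, hG, Polynomial.eval_finsetSum]
      refine Finset.sum_congr rfl fun b _ => ?_
      have e : (Polynomial.X ^ b * Polynomial.C y ^ (l - 1 - b) * ((l - 1).choose b : Polynomial ℝ)) =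
          (y ^ (l - 1 - b) * ((l - 1).choose b : ℝ)) • (Polynomial.X ^ b : Polynomial ℝ) := by
        rw [Polynomial.smul_eq_C_mul]
        simp only [map_mul, map_pow, map_natCast]
        ring
      rw [e, map_smul, smul_eq_mul]
      simp only [Polynomial.eval_mul, Polynomial.eval_C, Polynomial.eval_pow, Polynomial.eval_X]
      ring
    intro b hb
    have h1 : G.coeff (l - 1 - b) = F (Polynomial.X ^ b) * ((l - 1).choose b : ℝ) := by
      rw [hG, Polynomial.finsetSum_coeff, Finset.sum_eq_single b]
      · rw [Polynomial.coeff_C_mul, Polynomial.coeff_X_pow, if_pos rfl, mul_one]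
      · intro b' hb' hne
        have := Finset.mem_range.1 hb'
        rw [Polynomial.coeff_C_mul, Polynomial.coeff_X_pow, if_neg (by omega), mul_zero]
      · intro h; exact absurd (Finset.mem_range.2 (by omega)) h
    rw [hG0, Polynomial.coeff_zero] at h1
    have h2 : ((l - 1).choose b : ℝ) ≠ 0 := by
      exact_mod_cast (Nat.choose_pos (by omega : b ≤ l - 1)).ne'
    exact (mul_eq_zero.1 h1.symm).resolve_right h2
  have : F P = 0 := by
    rw [P.as_sum_range' l hP, map_sum]
    refine Finset.sum_eq_zero fun b hb => ?_
    rw [← Polynomial.C_mul_X_pow_eq_monomial, ← Polynomial.smul_eq_C_mul, map_smul,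
      hmon b (Finset.mem_range.1 hb), smul_zero]
  rw [hF, sub_eq_zero] at this
  exact this

/-- The two-scale relation. -/
lemma bspline_refine (l : ℕ) (t : ℝ) :
    bspline l t = ∑ j ∈ Finset.range (l + 1), ((l.choose j : ℝ) / 2 ^ (l - 1)) *
      bspline l (2 * t - j) := by
  obtain ⟨T, hT⟩ : ∃ T : ℝ → ℝ, ∀ x, T x = if 0 ≤ x then x ^ (l - 1) else 0 := ⟨_, fun _ => rfl⟩
  have hN : ∀ t, bspline l t = 1 / ((l - 1).factorial : ℝ) * ∑ i ∈ Finset.range (l + 1),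
      (-1) ^ i * (l.choose i : ℝ) * T (t - i) := by
    intro t
    rw [bspline]
    congr 1
    refine Finset.sum_congr rfl fun i _ => ?_
    rw [hT]
    simp only [sub_nonneg]
  have hT2 : ∀ x, T x = 1 / 2 ^ (l - 1) * T (2 * x) := by
    intro x
    rw [hT, hT]
    by_cases h : 0 ≤ x
    · rw [if_pos h, if_pos (by linarith), mul_pow]; field_simp
    · rw [if_neg h, if_neg (by linarith), mul_zero]
  obtain ⟨G, hG⟩ : ∃ G : Polynomial ℝ →ₗ[ℝ] ℝ, ∀ s : ℕ, G (Polynomial.X ^ s) = T (2 * t - s) := by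
    refine ⟨Polynomial.lsum fun s => LinearMap.mulRight ℝ (T (2 * t - s)), fun s => ?_⟩
    rw [Polynomial.lsum_apply, ← Polynomial.monomial_one_right_eq_X_pow, Polynomial.sum_monomial_index]
    · simp
    · simp
  have hA : ((1 - Polynomial.X) ^ l : Polynomial ℝ) = ∑ i ∈ Finset.range (l + 1),
      ((-1) ^ i * (l.choose i : ℝ)) • (Polynomial.X ^ i : Polynomial ℝ) := by
    rw [sub_eq_neg_add, add_pow]
    refine Finset.sum_congr rfl fun i _ => ?_
    rw [Polynomial.smul_eq_C_mul, neg_pow]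
    simp only [map_mul, map_pow, map_natCast, map_neg, map_one, one_pow]
    ring
  have hB : ((1 + Polynomial.X) ^ l : Polynomial ℝ) = ∑ j ∈ Finset.range (l + 1),
      (l.choose j : ℝ) • (Polynomial.X ^ j : Polynomial ℝ) := by
    rw [add_comm, add_pow]
    refine Finset.sum_congr rfl fun i _ => ?_
    rw [Polynomial.smul_eq_C_mul]
    simp only [map_natCast, one_pow]
    ring
  have hC : ((1 - Polynomial.X ^ 2) ^ l : Polynomial ℝ) = ∑ i ∈ Finset.range (l + 1),
      ((-1) ^ i * (l.choose i : ℝ)) • (Polynomial.X ^ (2 * i) : Polynomial ℝ) := by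
    rw [sub_eq_neg_add, add_pow]
    refine Finset.sum_congr rfl fun i _ => ?_
    rw [Polynomial.smul_eq_C_mul, neg_pow, ← pow_mul]
    simp only [map_mul, map_pow, map_natCast, map_neg, map_one, one_pow]
    ring
  have hABC : ((1 - Polynomial.X) ^ l * (1 + Polynomial.X) ^ l : Polynomial ℝ) =
      (1 - Polynomial.X ^ 2) ^ l := by
    rw [← mul_pow]; congr 1; ring
  have h1 := congrArg G hABC
  rw [hA, hB, hC, Finset.sum_mul_sum, map_sum, map_sum] at h1
  simp only [map_sum, smul_mul_smul_comm, ← pow_add, map_smul, hG, smul_eq_mul] at h1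
  have h2 : ∀ i ∈ Finset.range (l + 1), (-1) ^ i * (l.choose i : ℝ) * T (t - i) =
      1 / 2 ^ (l - 1) * ((-1) ^ i * (l.choose i : ℝ) * T (2 * t - (2 * i : ℕ))) := by
    intro i _
    rw [hT2 (t - i)]
    have : 2 * (t - i) = 2 * t - (2 * i : ℕ) := by push_cast; ring
    rw [this]; ring
  rw [hN, Finset.sum_congr rfl h2, ← Finset.mul_sum, ← h1, Finset.sum_comm]
  simp only [hN, Finset.mul_sum]
  refine Finset.sum_congr rfl fun j _ => Finset.sum_congr rfl fun i _ => ?_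
  have : 2 * t - ((i + j : ℕ) : ℝ) = 2 * t - j - i := by push_cast; ring
  rw [this]; ring

/-! ### Differences of products and of `B`-splines -/

/-- The differences of order at most `p` of the sequence `f` on the window `[s, s + p]` are bounded
by `C ρ^i`. -/
def WindowBound (p s : ℕ) (ρ C : ℝ) (f : ℕ → ℝ) : Prop :=
  ∀ i ≤ p, ∀ s', s ≤ s' → s' + i ≤ s + p → |(fwdDiff 1)^[i] f s'| ≤ C * ρ ^ i

lemma WindowBound.mono {p p' s s' : ℕ} {ρ C : ℝ} {f : ℕ → ℝ} (h : WindowBound p s ρ C f)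
    (hs : s ≤ s') (hp : s' + p' ≤ s + p) : WindowBound p' s' ρ C f :=
  fun i hi t ht ht' => h i (by omega) t (by omega) (by omega)

lemma abs_fwdDiff_mul_le (p : ℕ) : ∀ (s : ℕ) (ρ Cf Cg : ℝ) (f g : ℕ → ℝ), 0 ≤ ρ → 0 ≤ Cf → 0 ≤ Cg →
    WindowBound p s ρ Cf f → WindowBound p s ρ Cg g →
    |(fwdDiff 1)^[p] (fun t => f t * g t) s| ≤ 2 ^ p * Cf * Cg * ρ ^ p := by
  induction p with
  | zero =>
    intro s ρ Cf Cg f g hρ hCf hCg hf hg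
    have h1 := hf 0 le_rfl s le_rfl le_rfl
    have h2 := hg 0 le_rfl s le_rfl le_rfl
    simp only [Function.iterate_zero, id, pow_zero, mul_one, one_mul] at *
    rw [abs_mul]
    exact mul_le_mul h1 h2 (abs_nonneg _) hCf
  | succ p ih =>
    intro s ρ Cf Cg f g hρ hCf hCg hf hg
    have e : fwdDiff 1 (fun t => f t * g t) =
        (fun t => fwdDiff 1 f t * g (t + 1)) + fun t => f t * fwdDiff 1 g t := by
      ext t; simp only [fwdDiff, Pi.add_apply]; ring
    have hg1 : ∀ i t, (fwdDiff 1)^[i] (fun t => g (t + 1)) t = (fwdDiff 1)^[i] g (t + 1) := by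
      intro i
      induction i with
      | zero => intro t; rfl
      | succ i ih' =>
        intro t
        rw [Function.iterate_succ_apply', Function.iterate_succ_apply', fwdDiff, fwdDiff, ih', ih']
    rw [Function.iterate_succ_apply, e, fwdDiff_iter_add, Pi.add_apply]
    have h1 := ih s ρ (Cf * ρ) Cg (fwdDiff 1 f) (fun t => g (t + 1)) hρ (by positivity) hCg
      (fun i hi s' h1 h2 => by
        have := hf (i + 1) (by omega) s' h1 (by omega)
        rw [Function.iterate_succ_apply] at this
        exact this.trans (le_of_eq (by ring)))
      (fun i hi s' h1 h2 => by
        rw [hg1]; exact hg i (by omega) (s' + 1) (by omega) (by omega))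
    have h2 := ih s ρ Cf (Cg * ρ) f (fwdDiff 1 g) hρ hCf (by positivity)
      (fun i hi s' h1 h2 => hf i (by omega) s' h1 (by omega))
      (fun i hi s' h1 h2 => by
        have := hg (i + 1) (by omega) s' h1 (by omega)
        rw [Function.iterate_succ_apply] at this
        exact this.trans (le_of_eq (by ring)))
    refine (abs_add_le _ _).trans ((add_le_add h1 h2).trans (le_of_eq ?_))
    ring

lemma WindowBound.mul {p s : ℕ} {ρ Cf Cg : ℝ} {f g : ℕ → ℝ} (hρ : 0 ≤ ρ) (hCf : 0 ≤ Cf)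
    (hCg : 0 ≤ Cg) (hf : WindowBound p s ρ Cf f) (hg : WindowBound p s ρ Cg g) :
    WindowBound p s ρ (2 ^ p * Cf * Cg) (fun t => f t * g t) := by
  intro i hi s' h1 h2
  refine (abs_fwdDiff_mul_le i s' ρ Cf Cg f g hρ hCf hCg (hf.mono h1 h2) (hg.mono h1 h2)).trans ?_
  gcongr
  norm_num

lemma windowBound_one {p s : ℕ} {ρ : ℝ} (hρ : 0 ≤ ρ) : WindowBound p s ρ 1 (fun _ => 1) := by
  intro i _ s' _ _
  cases i with
  | zero => simp
  | succ i =>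
    have h1 : fwdDiff 1 (fun _ : ℕ => (1 : ℝ)) = fun _ => 0 := by ext; simp [fwdDiff]
    have h2 : ∀ i, (fwdDiff 1)^[i] (fun _ : ℕ => (0 : ℝ)) = fun _ => 0 := by
      intro i
      induction i with
      | zero => rfl
      | succ i ih => rw [Function.iterate_succ_apply', ih]; ext; simp [fwdDiff]
    rw [Function.iterate_succ_apply, h1, h2]
    simp only [abs_zero]; positivity

lemma WindowBound.prod {ι : Type*} {p s : ℕ} {ρ C : ℝ} {f : ι → ℕ → ℝ} (hρ : 0 ≤ ρ) (hC : 0 ≤ C)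
    (S : Finset ι) (hf : ∀ i ∈ S, WindowBound p s ρ C (f i)) :
    WindowBound p s ρ ((2 ^ p * C) ^ S.card) (fun t => ∏ i ∈ S, f i t) := by
  classical
  induction S using Finset.induction_on with
  | empty => simpa using windowBound_one hρ
  | insert i S hi ih =>
    have h1 := WindowBound.mul hρ hC (by positivity) (hf i (Finset.mem_insert_self _ _))
      (ih fun k hk => hf k (Finset.mem_insert_of_mem hk))
    rw [Finset.card_insert_of_notMem hi]
    have e : (fun t => ∏ k ∈ insert i S, f k t) = fun t => f i t * ∏ k ∈ S, f k t := by
      ext t; rw [Finset.prod_insert hi]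
    rw [e, pow_succ, mul_comm _ (2 ^ p * C)]
    exact h1

lemma diff_eq_fwdDiff {n : ℕ} (l : ℕ) (h : Fin n → ℝ) (g : (Fin n → ℝ) → ℝ) (x : Fin n → ℝ) :
    diff l h g x = (fwdDiff 1)^[l] (fun s : ℕ => g (x + (s : ℝ) • h)) 0 := by
  rw [diff, fwdDiff_iter_eq_sum_shift]
  refine Finset.sum_congr rfl fun j hj => ?_
  have hj' : j ≤ l := Nat.lt_succ_iff.1 (Finset.mem_range.1 hj)
  have e : (-1 : ℝ) ^ (l + j) = (-1) ^ (l - j) := by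
    have : l + j = (l - j) + 2 * j := by omega
    rw [this, pow_add, pow_mul]; simp
  have e2 : ((0 + j • 1 : ℕ) : ℝ) = j := by simp
  rw [e, zsmul_eq_mul, e2]
  push_cast
  ring

/-- The truncated power `x_+^q`. -/
def truncPow (q : ℕ) (x : ℝ) : ℝ := if 0 ≤ x then x ^ q else 0

lemma bspline_eq_truncPow (l : ℕ) (t : ℝ) : bspline l t = ∑ j ∈ Finset.range (l + 1),
    (1 / ((l - 1).factorial : ℝ) * ((-1) ^ j * (l.choose j : ℝ))) * truncPow (l - 1) (t - j) := by
  rw [bspline, Finset.mul_sum]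
  refine Finset.sum_congr rfl fun j _ => ?_
  rw [truncPow]
  simp only [sub_nonneg]
  ring

lemma abs_truncPow_le (q : ℕ) (x : ℝ) : |truncPow q x| ≤ |x| ^ q := by
  rw [truncPow]
  split_ifs
  · rw [abs_pow]
  · rw [abs_zero]; positivity

lemma truncPow_succ (q : ℕ) (x : ℝ) : truncPow (q + 1) x = max x 0 ^ (q + 1) := by
  rw [truncPow]
  split_ifs with h
  · rw [max_eq_left h]
  · rw [max_eq_right (le_of_not_ge h)]; simp

lemma continuous_truncPow_succ (q : ℕ) : Continuous (truncPow (q + 1)) := by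
  have : truncPow (q + 1) = fun x => max x 0 ^ (q + 1) := funext (truncPow_succ q)
  rw [this]; fun_prop

lemma hasDerivAt_truncPow (q : ℕ) (x : ℝ) :
    HasDerivAt (truncPow (q + 2)) ((q + 2 : ℕ) * truncPow (q + 1) x) x := by
  have hne : ∀ y : ℝ, y ≠ 0 → HasDerivAt (truncPow (q + 2)) ((q + 2 : ℕ) * truncPow (q + 1) y) y := by
    intro y hy
    rcases hy.lt_or_gt with h | h
    · have h1 : truncPow (q + 1) y = 0 := by rw [truncPow, if_neg (not_le.2 h)]
      rw [h1, mul_zero]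
      refine (hasDerivAt_const y (0 : ℝ)).congr_of_eventuallyEq ?_
      filter_upwards [Iio_mem_nhds h] with z hz
      rw [truncPow, if_neg (not_le.2 hz)]
    · have h1 : truncPow (q + 1) y = y ^ (q + 1) := by rw [truncPow, if_pos h.le]
      rw [h1]
      have h2 := hasDerivAt_pow (q + 2) y
      refine h2.congr_of_eventuallyEq ?_
      filter_upwards [Ioi_mem_nhds h] with z hz
      rw [truncPow, if_pos (le_of_lt hz)]
  by_cases hx : x = 0
  · subst hx
    exact hasDerivAt_of_hasDerivAt_of_ne (fun y hy => hne y hy)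
      (continuous_truncPow_succ (q + 1)).continuousAt
      ((continuous_const.mul (continuous_truncPow_succ q)).continuousAt)
  · exact hne x hx

lemma exists_abs_fwdDiff_truncPow_le (q : ℕ) : ∀ B : ℝ, ∃ C : ℝ, 0 ≤ C ∧ ∀ p ≤ q, ∀ t h : ℝ,
    |t| ≤ B → |h| ≤ 1 → |(fwdDiff h)^[p] (truncPow q) t| ≤ C * |h| ^ p := by
  have hmvt : ∀ (f : ℝ → ℝ) (t h : ℝ), |f (t + h) - f t| = |fwdDiff h f t| := fun f t h => rfl
  induction q with
  | zero =>
    refine fun B => ⟨1, zero_le_one, fun p hp t h _ _ => ?_⟩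
    obtain rfl : p = 0 := by omega
    simpa using abs_truncPow_le 0 t
  | succ q ih =>
    intro B
    obtain ⟨C, hC0, hC⟩ := ih (|B| + 1)
    refine ⟨|B| ^ (q + 1) + (1 + (q + 1 : ℕ) * C), by positivity, fun p hp t h ht hh => ?_⟩
    have htB : |t| ≤ |B| := ht.trans (le_abs_self B)
    cases p with
    | zero =>
      simp only [Function.iterate_zero, id, pow_zero, mul_one]
      refine (abs_truncPow_le _ _).trans ((pow_le_pow_left₀ (abs_nonneg _) htB _).trans ?_)
      have : 0 ≤ 1 + (q + 1 : ℕ) * C := by positivity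
      linarith
    | succ p =>
      rw [Function.iterate_succ_apply']
      suffices hs : |fwdDiff h ((fwdDiff h)^[p] (truncPow (q + 1))) t| ≤
          (1 + (q + 1 : ℕ) * C) * |h| ^ (p + 1) by
        refine hs.trans (mul_le_mul_of_nonneg_right ?_ (by positivity))
        have : 0 ≤ |B| ^ (q + 1) := by positivity
        linarith
      cases q with
      | zero =>
        obtain rfl : p = 0 := by omega
        simp only [Function.iterate_zero, id, zero_add, pow_one]
        rw [← hmvt, truncPow_succ, truncPow_succ, zero_add, pow_one, pow_one]
        have h1 : |max (t + h) 0 - max t 0| ≤ |h| := by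
          have := abs_max_sub_max_le_abs (t + h) t 0
          simpa using this
        have h2 : 0 ≤ ((1 : ℕ) : ℝ) * C * |h| := by positivity
        linarith
      | succ q =>
        have hd : ∀ y, HasDerivAt ((fwdDiff h)^[p] (truncPow (q + 1 + 1)))
            ((q + 2 : ℕ) * (fwdDiff h)^[p] (truncPow (q + 1)) y) y := by
          intro y
          have e : (fwdDiff h)^[p] (truncPow (q + 1 + 1)) = fun y => ∑ k ∈ Finset.range (p + 1),
              (((-1 : ℤ) ^ (p - k) * p.choose k : ℤ) : ℝ) * truncPow (q + 2) (y + k • h) := by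
            ext y
            rw [fwdDiff_iter_eq_sum_shift]
            exact Finset.sum_congr rfl fun k _ => by rw [zsmul_eq_mul]
          rw [e, fwdDiff_iter_eq_sum_shift, Finset.mul_sum]
          refine HasDerivAt.fun_sum fun k _ => ?_
          have h3 := ((hasDerivAt_truncPow q (y + k • h)).comp_add_const y (k • h)).const_mul
            (((-1 : ℤ) ^ (p - k) * p.choose k : ℤ) : ℝ)
          rw [zsmul_eq_mul, mul_left_comm]
          exact h3
        have h4 := (convex_Icc (-(|B| + 1)) (|B| + 1)).norm_image_sub_le_of_norm_hasDerivWithin_le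
          (f := (fwdDiff h)^[p] (truncPow (q + 1 + 1)))
          (f' := fun y => (q + 2 : ℕ) * (fwdDiff h)^[p] (truncPow (q + 1)) y)
          (C := (q + 2 : ℕ) * (C * |h| ^ p)) (x := t) (y := t + h)
          (fun y _ => (hd y).hasDerivWithinAt)
          (fun y hy => by
            rw [Real.norm_eq_abs, abs_mul, Nat.abs_cast]
            exact mul_le_mul_of_nonneg_left (hC p (by omega) y h (abs_le.2 hy) hh) (by positivity))
          (abs_le.1 (by linarith)) (abs_le.1 ((abs_add_le _ _).trans (by linarith)))
        rw [Real.norm_eq_abs, Real.norm_eq_abs, add_sub_cancel_left] at h4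
        refine h4.trans ?_
        have h5 : (0 : ℝ) ≤ |h| ^ (p + 1) := by positivity
        calc _ = ((q + 1 + 1 : ℕ) * C) * |h| ^ (p + 1) := by ring
          _ ≤ _ := mul_le_mul_of_nonneg_right (by linarith) h5

lemma exists_abs_fwdDiff_bspline_le {l : ℕ} (hl : 1 ≤ l) : ∃ C : ℝ, 0 ≤ C ∧ ∀ p < l, ∀ t h : ℝ,
    |h| ≤ 1 → |(fwdDiff h)^[p] (bspline l) t| ≤ C * |h| ^ p := by
  obtain ⟨C, hC0, hC⟩ := exists_abs_fwdDiff_truncPow_le (l - 1) (3 * l)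
  refine ⟨∑ j ∈ Finset.range (l + 1),
    |1 / ((l - 1).factorial : ℝ) * ((-1) ^ j * (l.choose j : ℝ))| * C,
    Finset.sum_nonneg fun _ _ => by positivity, fun p hp t h hh => ?_⟩
  by_cases ht : |t| ≤ 2 * l
  · have e : (fwdDiff h)^[p] (bspline l) t = ∑ j ∈ Finset.range (l + 1),
        (1 / ((l - 1).factorial : ℝ) * ((-1) ^ j * (l.choose j : ℝ))) *
          (fwdDiff h)^[p] (truncPow (l - 1)) (t - j) := by
      rw [fwdDiff_iter_eq_sum_shift]
      simp only [fwdDiff_iter_eq_sum_shift, bspline_eq_truncPow, zsmul_eq_mul, Finset.mul_sum]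
      rw [Finset.sum_comm]
      refine Finset.sum_congr rfl fun j _ => Finset.sum_congr rfl fun k _ => ?_
      have : t + k • h - j = t - j + k • h := by ring
      rw [this]; ring
    rw [e, Finset.sum_mul]
    refine (Finset.abs_sum_le_sum_abs _ _).trans (Finset.sum_le_sum fun j hj => ?_)
    rw [abs_mul, mul_assoc]
    refine mul_le_mul_of_nonneg_left (hC p (by omega) _ _ ?_ hh) (abs_nonneg _)
    have hj' : (j : ℝ) ≤ l := by exact_mod_cast Nat.lt_succ_iff.1 (Finset.mem_range.1 hj)
    have hj0 : (0 : ℝ) ≤ j := by positivity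
    have := abs_le.1 ht
    rw [abs_le]; constructor <;> linarith
  · have e : (fwdDiff h)^[p] (bspline l) t = 0 := by
      rw [fwdDiff_iter_eq_sum_shift]
      refine Finset.sum_eq_zero fun k hk => ?_
      have hk' : (k : ℝ) + 1 ≤ l := by
        have := Finset.mem_range.1 hk
        exact_mod_cast (by omega : k + 1 ≤ l)
      have hk0 : (0 : ℝ) ≤ k := by positivity
      have h1 : |(k : ℝ) * h| ≤ k := by
        rw [abs_mul, Nat.abs_cast]; exact mul_le_of_le_one_right hk0 hh
      have h2 := abs_le.1 h1
      rw [nsmul_eq_mul]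
      have : bspline l (t + k * h) = 0 := by
        rcases le_or_gt 0 t with h0 | h0
        · rw [abs_of_nonneg h0] at ht
          exact bspline_of_ge hl (by linarith)
        · rw [abs_of_neg h0] at ht
          exact bspline_of_neg (by linarith)
      rw [this, smul_zero]
    rw [e, abs_zero]
    exact mul_nonneg (Finset.sum_nonneg fun _ _ => by positivity) (by positivity)

lemma fwdDiff_line (f : ℝ → ℝ) (t h : ℝ) (p : ℕ) : ∀ s : ℕ,
    (fwdDiff 1)^[p] (fun s : ℕ => f (t + s * h)) s = (fwdDiff h)^[p] f (t + s * h) := by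
  intro s
  rw [fwdDiff_iter_eq_sum_shift, fwdDiff_iter_eq_sum_shift]
  refine Finset.sum_congr rfl fun k _ => ?_
  congr 2
  simp only [nsmul_eq_mul, Nat.cast_add, mul_one, Nat.cast_id]
  ring

lemma exists_abs_diff_prod_bspline_le (n : ℕ) {l : ℕ} (hl : 1 ≤ l) : ∃ C : ℝ, 0 ≤ C ∧
    ∀ (x v h : Fin n → ℝ) (ρ : ℝ), 0 ≤ ρ → ρ ≤ 1 → (∀ i, |h i| ≤ ρ) →
      |diff l h (fun y => ∏ i, bspline l (y i - v i)) x| ≤ C * ρ ^ (l - 1) := by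
  obtain ⟨C, hC0, hC⟩ := exists_abs_fwdDiff_bspline_le hl
  refine ⟨2 * (2 ^ (l - 1) * C) ^ n, by positivity, fun x v h ρ hρ0 hρ1 hh => ?_⟩
  have h1 : ∀ s, WindowBound (l - 1) s ρ ((2 ^ (l - 1) * C) ^ (Finset.univ : Finset (Fin n)).card)
      (fun t : ℕ => ∏ i, bspline l ((x i - v i) + t * h i)) := by
    intro s
    refine WindowBound.prod hρ0 hC0 _ fun i _ p hp s' _ _ => ?_
    rw [fwdDiff_line]
    refine (hC p (by omega) _ _ ((hh i).trans hρ1)).trans ?_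
    exact mul_le_mul_of_nonneg_left (pow_le_pow_left₀ (abs_nonneg _) (hh i) p) hC0
  have e : (fun s : ℕ => ∏ i, bspline l ((x + (s : ℝ) • h) i - v i)) =
      fun t : ℕ => ∏ i, bspline l ((x i - v i) + t * h i) := by
    ext s
    refine Finset.prod_congr rfl fun i _ => ?_
    congr 1
    simp only [Pi.add_apply, Pi.smul_apply, smul_eq_mul]; ring
  rw [diff_eq_fwdDiff, e]
  have e4 : ∀ F : ℕ → ℝ, (fwdDiff 1)^[l] F 0 = (fwdDiff 1)^[l - 1] F 1 - (fwdDiff 1)^[l - 1] F 0 := by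
    obtain ⟨l', rfl⟩ : ∃ l', l = l' + 1 := ⟨l - 1, by omega⟩
    intro F
    rw [Function.iterate_succ_apply']
    rfl
  rw [e4]
  have h2 := h1 0 (l - 1) le_rfl 0 le_rfl le_rfl
  have h3 := h1 1 (l - 1) le_rfl 1 le_rfl le_rfl
  rw [Finset.card_univ, Fintype.card_fin] at h2 h3
  refine (abs_sub _ _).trans ((add_le_add h3 h2).trans (le_of_eq ?_))
  ring

lemma abs_diff_sum_le {n : ℕ} {ι : Type*} (l : ℕ) (h x : Fin n → ℝ) (S : Finset ι) (a : ι → ℝ)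
    (f : ι → (Fin n → ℝ) → ℝ) {C : ℝ} (hf : ∀ i ∈ S, |diff l h (f i) x| ≤ C) :
    |diff l h (fun y => ∑ i ∈ S, a i * f i y) x| ≤ (∑ i ∈ S, |a i|) * C := by
  have e : diff l h (fun y => ∑ i ∈ S, a i * f i y) x = ∑ i ∈ S, a i * diff l h (f i) x := by
    simp only [diff_eq, Finset.mul_sum]
    rw [Finset.sum_comm]
    exact Finset.sum_congr rfl fun i _ => Finset.sum_congr rfl fun j _ => by ring
  rw [e, Finset.sum_mul]
  refine (Finset.abs_sum_le_sum_abs _ _).trans (Finset.sum_le_sum fun i hi => ?_)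
  rw [abs_mul]
  exact mul_le_mul_of_nonneg_left (hf i hi) (abs_nonneg _)

lemma exists_abs_diff_tpoly_le (n l : ℕ) (B : ℝ) : ∃ C : ℝ, 0 ≤ C ∧
    ∀ (c : (Fin n → Fin l) → ℝ) (x h : Fin n → ℝ) (ρ : ℝ), 0 ≤ ρ → ρ ≤ 1 → (∀ i, |x i| ≤ B) →
      (∀ i, |h i| ≤ ρ) → |diff l h (tpoly c) x| ≤ C * ‖c‖ * ρ ^ l := by
  obtain ⟨M, hM⟩ : ∃ M : ℝ, M = |B| + l + 1 := ⟨_, rfl⟩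
  have hM1 : 1 ≤ M := by rw [hM]; have := abs_nonneg B; have : (0 : ℝ) ≤ l := by positivity
                         linarith
  have hlin : ∀ (x h ρ : ℝ), 0 ≤ ρ → ρ ≤ 1 → |x| ≤ B → |h| ≤ ρ →
      WindowBound l 0 ρ M (fun s : ℕ => x + s * h) := by
    intro x h ρ hρ0 hρ1 hx hh i hi s' _ hs'
    have e1 : fwdDiff 1 (fun s : ℕ => x + s * h) = fun _ => h := by
      ext s; simp only [fwdDiff]; push_cast; ring
    have e2 : fwdDiff 1 (fun _ : ℕ => h) = fun _ => 0 := by ext; simp [fwdDiff]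
    have e3 : ∀ i, (fwdDiff 1)^[i] (fun _ : ℕ => (0 : ℝ)) = fun _ => 0 := by
      intro i
      induction i with
      | zero => rfl
      | succ i ih => rw [Function.iterate_succ_apply', ih]; ext; simp [fwdDiff]
    match i with
    | 0 =>
      simp only [Function.iterate_zero, id, pow_zero, mul_one]
      have h1 : |(s' : ℝ) * h| ≤ l := by
        rw [abs_mul, Nat.abs_cast]
        have : (s' : ℝ) ≤ l := by exact_mod_cast (by omega : s' ≤ l)
        calc (s' : ℝ) * |h| ≤ l * 1 := mul_le_mul this (hh.trans hρ1) (abs_nonneg _) (by positivity)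
          _ = l := mul_one _
      refine (abs_add_le _ _).trans ?_
      rw [hM]
      linarith [le_abs_self B]
    | 1 =>
      simp only [Function.iterate_one, e1, pow_one]
      calc |h| ≤ ρ := hh
        _ ≤ M * ρ := le_mul_of_one_le_left hρ0 hM1
    | i + 2 =>
      rw [Function.iterate_add_apply, show (fwdDiff 1)^[2] (fun s : ℕ => x + s * h) = fun _ => 0 by
        rw [Function.iterate_succ_apply, Function.iterate_one, e1, e2], e3]
      simp only [abs_zero]; positivity
  obtain ⟨A, hA⟩ : ∃ A : ℝ, A = (2 ^ l * M) ^ l := ⟨_, rfl⟩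
  have hA1 : 1 ≤ 2 ^ l * M := by
    have : (1 : ℝ) ≤ 2 ^ l := one_le_pow₀ (by norm_num)
    nlinarith
  have hA0 : 0 ≤ A := by rw [hA]; positivity
  refine ⟨Fintype.card (Fin n → Fin l) * (2 ^ l * A) ^ n, by positivity,
    fun c x h ρ hρ0 hρ1 hx hh => ?_⟩
  have hpow : ∀ (b : Fin n → Fin l) (i : Fin n),
      WindowBound l 0 ρ A (fun s : ℕ => (x i + s * h i) ^ (b i : ℕ)) := by
    intro b i k hk s' h1 h2
    have h3 := WindowBound.prod hρ0 (by linarith : (0 : ℝ) ≤ M) (Finset.range (b i : ℕ))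
      (fun _ _ => hlin (x i) (h i) ρ hρ0 hρ1 (hx i) (hh i)) k hk s' h1 h2
    simp only [Finset.prod_const, Finset.card_range] at h3
    refine h3.trans (mul_le_mul_of_nonneg_right ?_ (by positivity))
    rw [hA]
    exact pow_le_pow_right₀ hA1 (b i).2.le
  have hmono : ∀ b : Fin n → Fin l, |diff l h (fun y => ∏ i, y i ^ (b i : ℕ)) x| ≤
      (2 ^ l * A) ^ n * ρ ^ l := by
    intro b
    have h3 := WindowBound.prod hρ0 hA0 Finset.univ (fun i _ => hpow b i) l le_rfl 0 le_rfl le_rfl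
    rw [Finset.card_univ, Fintype.card_fin] at h3
    rw [diff_eq_fwdDiff]
    exact h3
  have h4 := abs_diff_sum_le l h x Finset.univ c (fun b y => ∏ i, y i ^ (b i : ℕ))
    (fun b _ => hmono b)
  have e : tpoly c = fun y => ∑ b, c b * ∏ i, y i ^ (b i : ℕ) := by ext y; rfl
  rw [e]
  refine h4.trans ?_
  have h5 : ∑ b, |c b| ≤ Fintype.card (Fin n → Fin l) * ‖c‖ := by
    refine (Finset.sum_le_sum fun b _ => norm_le_pi_norm c b).trans ?_
    simp
  calc _ ≤ (Fintype.card (Fin n → Fin l) * ‖c‖) * ((2 ^ l * A) ^ n * ρ ^ l) :=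
        mul_le_mul_of_nonneg_right h5 (by positivity)
    _ = _ := by ring

/-! ### Tensor product splines -/

/-- The half-open unit cube. -/
def hcube (n : ℕ) : Set (Fin n → ℝ) := {x | ∀ i, 0 ≤ x i ∧ x i < 1}

lemma ucube_subset_hcube (n : ℕ) : ucube n ⊆ hcube n := fun _ hx i =>
  ⟨((mem_ucube.1 hx) i).1.le, ((mem_ucube.1 hx) i).2⟩

/-- The index of the half-open dyadic cube of generation `k` containing `x`. -/
def cell {n : ℕ} (k : ℕ) (x : Fin n → ℝ) : Fin n → ℤ := fun i => ⌊2 ^ k * x i⌋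

/-- The affine map of the unit cube onto the dyadic cube of generation `k` with index `m`. -/
def dyadicMap {n : ℕ} (k : ℕ) (m : Fin n → ℤ) (x : Fin n → ℝ) : Fin n → ℝ :=
  fun i => (x i + m i) / 2 ^ k

lemma two_pow_mul_dyadicMap {n : ℕ} (k : ℕ) (m : Fin n → ℤ) (x : Fin n → ℝ) (i : Fin n) :
    2 ^ k * dyadicMap k m x i = x i + m i := by
  rw [dyadicMap]; field_simp

lemma cell_dyadicMap {n : ℕ} (k : ℕ) (m : Fin n → ℤ) {x : Fin n → ℝ} (hx : x ∈ hcube n) :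
    cell k (dyadicMap k m x) = m := by
  ext i
  rw [cell, two_pow_mul_dyadicMap, Int.floor_add_intCast, Int.floor_eq_zero_iff.2 (hx i), zero_add]

lemma exists_dyadicMap_eq {n : ℕ} (k : ℕ) (y : Fin n → ℝ) :
    ∃ x ∈ hcube n, dyadicMap k (cell k y) x = y := by
  refine ⟨fun i => 2 ^ k * y i - cell k y i, fun i => ⟨?_, ?_⟩, ?_⟩
  · exact sub_nonneg.2 (Int.floor_le _)
  · exact sub_lt_iff_lt_add'.2 (Int.lt_floor_add_one _)
  · ext i
    rw [dyadicMap, sub_add_cancel]; field_simp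

lemma bsplineCube_dyadicMap {n : ℕ} (l k : ℕ) (m m' : Fin n → ℤ) (x : Fin n → ℝ) :
    bsplineCube l k m' (dyadicMap k m x) = ∏ i, bspline l (x i + (m i - m' i : ℤ)) := by
  refine Finset.prod_congr rfl fun i _ => ?_
  rw [mul_sub, two_pow_mul_dyadicMap]
  congr 1
  push_cast
  field_simp
  ring

lemma bspline_support {l : ℕ} (hl : 1 ≤ l) {t : ℝ} (h : bspline l t ≠ 0) : 0 ≤ t ∧ t < l := by
  constructor
  · by_contra h'; exact h (bspline_of_neg (not_le.1 h'))
  · by_contra h'; exact h (bspline_of_ge hl (not_lt.1 h'))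

lemma exists_eq_sub_of_bsplineCube_ne_zero {n : ℕ} {l : ℕ} (hl : 1 ≤ l) {k : ℕ} {m m' : Fin n → ℤ}
    {x : Fin n → ℝ} (hx : x ∈ hcube n) (h : bsplineCube l k m' (dyadicMap k m x) ≠ 0) :
    ∃ a : Fin n → Fin l, m' = fun i => m i - ((a i : ℕ) : ℤ) := by
  rw [bsplineCube_dyadicMap] at h
  have h1 : ∀ i, 0 ≤ m i - m' i ∧ m i - m' i < l := by
    intro i
    have h2 := bspline_support hl (fun h0 => h (Finset.prod_eq_zero (Finset.mem_univ i) h0))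
    have hxi := hx i
    constructor
    · by_contra hneg
      have : ((m i - m' i : ℤ) : ℝ) ≤ -1 := by exact_mod_cast (by omega : m i - m' i ≤ -1)
      linarith
    · have : ((m i - m' i : ℤ) : ℝ) < l := by linarith
      exact_mod_cast this
  refine ⟨fun i => ⟨(m i - m' i).toNat, by have := h1 i; omega⟩, ?_⟩
  ext i
  have := h1 i
  simp only
  omega

lemma sub_cast_injective {n l : ℕ} (m : Fin n → ℤ) :
    Function.Injective fun (a : Fin n → Fin l) (i : Fin n) => m i - ((a i : ℕ) : ℤ) := by
  intro a b h
  ext i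
  have := congrFun h i
  simp only at this
  omega

/-- A tensor product of polynomials. -/
def prodC {n : ℕ} (l : ℕ) (p : Fin n → Polynomial ℝ) : (Fin n → Fin l) → ℝ :=
  fun b => ∏ i, (p i).coeff (b i)

lemma tpoly_prodC {n l : ℕ} {p : Fin n → Polynomial ℝ} (hp : ∀ i, (p i).natDegree < l)
    (x : Fin n → ℝ) : tpoly (prodC l p) x = ∏ i, (p i).eval (x i) := tpoly_prod p hp x

/-- The tensor product of the functionals `lam`. -/
def lamC {n : ℕ} (l : ℕ) : ((Fin n → Fin l) → ℝ) →ₗ[ℝ] ℝ :=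
  ∑ b : Fin n → Fin l, (∏ i, lam l (Polynomial.X ^ (b i : ℕ))) • LinearMap.proj b

lemma lamC_apply {n l : ℕ} (c : (Fin n → Fin l) → ℝ) :
    lamC l c = ∑ b : Fin n → Fin l, (∏ i, lam l (Polynomial.X ^ (b i : ℕ))) * c b := by
  simp [lamC, LinearMap.sum_apply]

lemma lamC_prodC {n l : ℕ} {p : Fin n → Polynomial ℝ} (hp : ∀ i, (p i).natDegree < l) :
    lamC l (prodC l p) = ∏ i, lam l (p i) := by
  have h : ∀ i, lam l (p i) = ∑ j : Fin l, lam l (Polynomial.X ^ (j : ℕ)) * (p i).coeff j := by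
    intro i
    conv_lhs => rw [(p i).as_sum_range' l (hp i), map_sum, Finset.sum_range]
    refine Finset.sum_congr rfl fun j _ => ?_
    rw [← Polynomial.C_mul_X_pow_eq_monomial, ← Polynomial.smul_eq_C_mul, map_smul, smul_eq_mul,
      mul_comm]
  simp_rw [h]
  rw [Finset.prod_univ_sum, Fintype.piFinset_univ, lamC_apply]
  simp [prodC, Finset.prod_mul_distrib]

lemma exists_abs_lamC_le (n l : ℕ) : ∃ C : ℝ, 0 ≤ C ∧ ∀ c : (Fin n → Fin l) → ℝ,
    |lamC l c| ≤ C * ‖c‖ := by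
  refine ⟨∑ b : Fin n → Fin l, |∏ i, lam l (Polynomial.X ^ (b i : ℕ))|,
    Finset.sum_nonneg fun _ _ => abs_nonneg _, fun c => ?_⟩
  rw [lamC_apply, Finset.sum_mul]
  refine (Finset.abs_sum_le_sum_abs _ _).trans (Finset.sum_le_sum fun b _ => ?_)
  rw [abs_mul]
  exact mul_le_mul_of_nonneg_left (norm_le_pi_norm c b) (abs_nonneg _)

/-- The coefficients of the polynomial with which `∏ bspline l (xᵢ + aᵢ)` coincides on the unit
cube. -/
def pieceC {n : ℕ} (l : ℕ) (a : Fin n → Fin l) : (Fin n → Fin l) → ℝ :=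
  prodC l fun i => piece l (a i)

/-- The polynomial with which a spline coincides on a cell, in the coordinates of the cell. -/
def localC {n l : ℕ} (β : (Fin n → ℤ) → ℝ) (m : Fin n → ℤ) : (Fin n → Fin l) → ℝ :=
  ∑ a : Fin n → Fin l, β (fun i => m i - ((a i : ℕ) : ℤ)) • pieceC l a

lemma tpoly_pieceC {n l : ℕ} (hl : 1 ≤ l) (a : Fin n → Fin l) {x : Fin n → ℝ} (hx : x ∈ hcube n) :
    tpoly (pieceC l a) x = ∏ i, bspline l (x i + ((a i : ℕ) : ℤ)) := by
  rw [pieceC, tpoly_prodC fun i => natDegree_piece_lt hl _]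
  refine Finset.prod_congr rfl fun i _ => ?_
  rw [Int.cast_natCast, bspline_add_natCast l _ (hx i).1 (hx i).2]

lemma splineOf_dyadicMap {n l : ℕ} (hl : 1 ≤ l) (k : ℕ) (β : (Fin n → ℤ) → ℝ) (m : Fin n → ℤ)
    {x : Fin n → ℝ} (hx : x ∈ hcube n) :
    splineOf l k β (dyadicMap k m x) = tpoly (localC (l := l) β m) x := by
  classical
  rw [splineOf, tsum_eq_sum (s := Finset.univ.image fun (a : Fin n → Fin l) (i : Fin n) =>
    m i - ((a i : ℕ) : ℤ)), Finset.sum_image (fun a _ b _ h => sub_cast_injective m h), localC, tpoly_sum]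
  · refine Finset.sum_congr rfl fun a _ => ?_
    rw [tpoly_smul, tpoly_pieceC hl a hx, bsplineCube_dyadicMap]
    simp
  · intro m' hm'
    by_contra h
    obtain ⟨a, ha⟩ := exists_eq_sub_of_bsplineCube_ne_zero hl hx (right_ne_zero_of_mul h)
    exact hm' (Finset.mem_image.2 ⟨a, Finset.mem_univ _, ha.symm⟩)

lemma lamC_localC {n l : ℕ} (hl : 1 ≤ l) (β : (Fin n → ℤ) → ℝ) (m : Fin n → ℤ) :
    lamC l (localC (l := l) β m) = β m := by
  have h : ∀ a : Fin n → Fin l, lamC l (pieceC l a) = if a = fun _ => ⟨0, hl⟩ then 1 else 0 := by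
    intro a
    rw [pieceC, lamC_prodC fun i => natDegree_piece_lt hl _]
    simp only [lam_piece hl (Fin.is_lt _)]
    split_ifs with h0
    · subst h0; simp
    · obtain ⟨i, hi⟩ := Function.ne_iff.1 h0
      refine Finset.prod_eq_zero (Finset.mem_univ i) (if_neg fun h => hi (Fin.ext h))
  rw [localC, map_sum]
  simp only [map_smul, h, smul_eq_mul, mul_ite, mul_one, mul_zero, Finset.sum_ite_eq',
    Finset.mem_univ, if_true, Nat.cast_zero, sub_zero]

lemma localC_sub {n l : ℕ} (β β' : (Fin n → ℤ) → ℝ) (m : Fin n → ℤ) :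
    localC (l := l) (fun m => β m - β' m) m = localC β m - localC β' m := by
  simp only [localC, sub_smul, Finset.sum_sub_distrib]

lemma splineOf_sub {n l : ℕ} (hl : 1 ≤ l) (k : ℕ) (β β' : (Fin n → ℤ) → ℝ) (y : Fin n → ℝ) :
    splineOf l k (fun m => β m - β' m) y = splineOf l k β y - splineOf l k β' y := by
  obtain ⟨m, x, hx, rfl⟩ : ∃ m, ∃ x ∈ hcube n, dyadicMap k m x = y := ⟨_, exists_dyadicMap_eq k y⟩
  rw [splineOf_dyadicMap hl k _ _ hx, splineOf_dyadicMap hl k _ _ hx, splineOf_dyadicMap hl k _ _ hx,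
    localC_sub, tpoly_sub]

lemma shiftC_prodC {n l : ℕ} (hl : 1 ≤ l) {p : Fin n → Polynomial ℝ}
    (hp : ∀ i, (p i).natDegree < l) (v : Fin n → ℝ) :
    shiftC v (prodC l p) = prodC l fun i => (p i).comp (Polynomial.X + Polynomial.C (v i)) := by
  refine tpoly_injective hl fun x => ?_
  rw [tpoly_shiftC, tpoly_prodC hp, tpoly_prodC]
  · simp [Polynomial.eval_comp]
  · intro i
    rw [Polynomial.natDegree_comp, Polynomial.natDegree_X_add_C, mul_one]
    exact hp i

lemma eq_sum_smul_prodC {n l : ℕ} (c : (Fin n → Fin l) → ℝ) :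
    c = ∑ b, c b • prodC l fun i => Polynomial.X ^ (b i : ℕ) := by
  ext b'
  rw [Finset.sum_apply, Finset.sum_eq_single b']
  · simp [prodC]
  · intro b _ hb
    obtain ⟨i, hi⟩ := Function.ne_iff.1 hb
    rw [Pi.smul_apply, prodC, Finset.prod_eq_zero (Finset.mem_univ i), smul_zero]
    rw [Polynomial.coeff_X_pow, if_neg fun h => hi (Fin.ext h.symm)]
  · simp

/-- Reproduction of polynomials by splines. -/
lemma eq_sum_lamC_shiftC {n l : ℕ} (hl : 1 ≤ l) (c : (Fin n → Fin l) → ℝ) :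
    c = ∑ a : Fin n → Fin l, lamC l (shiftC (fun i => -((a i : ℕ) : ℝ)) c) • pieceC l a := by
  have hX : ∀ b : Fin n → Fin l, ∀ i, (Polynomial.X ^ (b i : ℕ) : Polynomial ℝ).natDegree < l :=
    fun b i => by rw [Polynomial.natDegree_X_pow]; exact (b i).2
  have hmono : ∀ b : Fin n → Fin l, prodC l (fun i => Polynomial.X ^ (b i : ℕ)) =
      ∑ a : Fin n → Fin l, lamC l (shiftC (fun i => -((a i : ℕ) : ℝ))
        (prodC l fun i => Polynomial.X ^ (b i : ℕ))) • pieceC l a := by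
    intro b
    refine tpoly_injective hl fun x => ?_
    rw [tpoly_prodC (hX b), tpoly_sum]
    have h : ∀ i, (Polynomial.X ^ (b i : ℕ) : Polynomial ℝ).eval (x i) = ∑ a : Fin l,
        lam l ((Polynomial.X ^ (b i : ℕ)).comp (Polynomial.X + Polynomial.C (-((a : ℕ) : ℝ)))) *
          (piece l a).eval (x i) := by
      intro i
      have := eval_add_eq_sum_lam (hX b i) (x i) 0
      rw [add_zero, Finset.sum_range] at this
      simpa only [zero_sub] using this
    simp_rw [h]
    rw [Finset.prod_univ_sum, Fintype.piFinset_univ]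
    refine Finset.sum_congr rfl fun a _ => ?_
    rw [tpoly_smul, shiftC_prodC hl (hX b), lamC_prodC, pieceC,
      tpoly_prodC fun i => natDegree_piece_lt hl _, Finset.prod_mul_distrib]
    intro i
    rw [Polynomial.natDegree_comp, Polynomial.natDegree_X_add_C, mul_one]
    exact hX b i
  have hlin : ∀ (v : Fin n → ℝ) (S : Finset (Fin n → Fin l)) (f : (Fin n → Fin l) → (Fin n → Fin l) → ℝ),
      shiftC v (∑ b ∈ S, c b • f b) = ∑ b ∈ S, c b • shiftC v (f b) := by
    intro v S f
    refine tpoly_injective hl fun x => ?_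
    rw [tpoly_shiftC, tpoly_sum, tpoly_sum]
    exact Finset.sum_congr rfl fun b _ => by rw [tpoly_smul, tpoly_smul, tpoly_shiftC]
  have hc := eq_sum_smul_prodC c
  calc c = ∑ b, c b • prodC l (fun i => Polynomial.X ^ (b i : ℕ)) := hc
    _ = ∑ b, c b • ∑ a : Fin n → Fin l, lamC l (shiftC (fun i => -((a i : ℕ) : ℝ))
        (prodC l fun i => Polynomial.X ^ (b i : ℕ))) • pieceC l a :=
        Finset.sum_congr rfl fun b _ => by rw [← hmono b]
    _ = ∑ a : Fin n → Fin l, lamC l (shiftC (fun i => -((a i : ℕ) : ℝ))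
        (∑ b, c b • prodC l fun i => Polynomial.X ^ (b i : ℕ))) • pieceC l a := by
        simp only [hlin, map_sum, map_smul, Finset.sum_smul, Finset.smul_sum, smul_eq_mul, mul_smul]
        exact Finset.sum_comm
    _ = _ := by rw [← hc]

/-! ### The two-scale relation for splines -/

/-- The coefficients of the two-scale relation. -/
def refineCoeff {n : ℕ} (l : ℕ) (e : Fin n → ℤ) : ℝ :=
  ∏ i, if 0 ≤ e i then (l.choose (e i).toNat : ℝ) / 2 ^ (l - 1) else 0

lemma exists_of_refineCoeff_ne_zero {n l : ℕ} {e : Fin n → ℤ} (h : refineCoeff l e ≠ 0) :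
    ∃ j : Fin n → Fin (l + 1), e = fun i => ((j i : ℕ) : ℤ) := by
  have h1 : ∀ i, 0 ≤ e i ∧ e i ≤ l := by
    intro i
    have h2 := Finset.prod_ne_zero_iff.1 h i (Finset.mem_univ i)
    by_cases h0 : 0 ≤ e i
    · refine ⟨h0, ?_⟩
      by_contra hlt
      rw [if_pos h0, Nat.choose_eq_zero_of_lt (by omega)] at h2
      simp at h2
    · rw [if_neg h0] at h2; exact absurd rfl h2
  refine ⟨fun i => ⟨(e i).toNat, by have := h1 i; omega⟩, ?_⟩
  ext i
  have := h1 i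
  simp only
  omega

lemma bsplineCube_refine {n l : ℕ} (k : ℕ) (m : Fin n → ℤ) (x : Fin n → ℝ) :
    bsplineCube l k m x = ∑' M : Fin n → ℤ,
      refineCoeff l (fun i => M i - 2 * m i) * bsplineCube l (k + 1) M x := by
  classical
  rw [tsum_eq_sum (s := Finset.univ.image fun (j : Fin n → Fin (l + 1)) (i : Fin n) =>
    2 * m i + ((j i : ℕ) : ℤ)), Finset.sum_image]
  · rw [bsplineCube]
    have h : ∀ i, bspline l (2 ^ k * (x i - (m i : ℝ) / 2 ^ k)) = ∑ j : Fin (l + 1),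
        ((l.choose j : ℝ) / 2 ^ (l - 1)) *
          bspline l (2 * (2 ^ k * (x i - (m i : ℝ) / 2 ^ k)) - (j : ℕ)) := fun i => by
      rw [bspline_refine, Finset.sum_range]
    simp_rw [h]
    rw [Finset.prod_univ_sum, Fintype.piFinset_univ]
    refine Finset.sum_congr rfl fun j _ => ?_
    rw [Finset.prod_mul_distrib, refineCoeff, bsplineCube]
    congr 1
    · refine Finset.prod_congr rfl fun i _ => ?_
      rw [add_sub_cancel_left, if_pos (by positivity), Int.toNat_natCast]
    · refine Finset.prod_congr rfl fun i _ => ?_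
      congr 1
      push_cast
      rw [pow_succ]; field_simp; ring
  · intro a _ b _ h
    ext i
    have := congrFun h i
    beta_reduce at this
    omega
  · intro M hM
    by_contra h
    obtain ⟨j, hj⟩ := exists_of_refineCoeff_ne_zero (left_ne_zero_of_mul h)
    refine hM (Finset.mem_image.2 ⟨j, Finset.mem_univ _, ?_⟩)
    ext i
    have := congrFun hj i
    beta_reduce at this ⊢
    omega

lemma exists_splineOf_succ_eq {n l : ℕ} (hl : 1 ≤ l) (k : ℕ) (β : (Fin n → ℤ) → ℝ) :
    ∃ β' : (Fin n → ℤ) → ℝ, splineOf l (k + 1) β' = splineOf l k β := by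
  classical
  refine ⟨fun M => ∑' m, β m * refineCoeff l (fun i => M i - 2 * m i), ?_⟩
  ext y
  obtain ⟨x, hx, hxy⟩ := exists_dyadicMap_eq (k + 1) y
  have hfin : (Function.support (Function.uncurry fun (M m : Fin n → ℤ) =>
      β m * refineCoeff l (fun i => M i - 2 * m i) * bsplineCube l (k + 1) M y)).Finite := by
    have hA : (Set.range fun (p : (Fin n → Fin l) × (Fin n → Fin (l + 1))) =>
        (((fun i => cell (k + 1) y i - ((p.1 i : ℕ) : ℤ)),
          (fun i => (cell (k + 1) y i - ((p.1 i : ℕ) : ℤ) - ((p.2 i : ℕ) : ℤ)) / 2)) :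
            (Fin n → ℤ) × (Fin n → ℤ))).Finite := Set.finite_range _
    refine hA.subset ?_
    rintro ⟨M, m⟩ h
    simp only [Function.mem_support, Function.uncurry] at h
    have h1 := right_ne_zero_of_mul h
    rw [← hxy] at h1
    obtain ⟨a, ha⟩ := exists_eq_sub_of_bsplineCube_ne_zero hl hx h1
    obtain ⟨j, hj⟩ := exists_of_refineCoeff_ne_zero (right_ne_zero_of_mul (left_ne_zero_of_mul h))
    refine ⟨(a, j), ?_⟩
    refine Prod.ext ha.symm ?_
    ext i
    have e1 := congrFun ha i
    have e2 := congrFun hj i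
    simp only at e1 e2 ⊢
    omega
  have hsum := summable_of_hasFiniteSupport (L := SummationFilter.unconditional _) hfin
  rw [splineOf, splineOf]
  calc _ = ∑' M, ∑' m, β m * refineCoeff l (fun i => M i - 2 * m i) * bsplineCube l (k + 1) M y :=
        tsum_congr fun M => by rw [tsum_mul_right]
    _ = ∑' m, ∑' M, β m * refineCoeff l (fun i => M i - 2 * m i) * bsplineCube l (k + 1) M y :=
        (Summable.tsum_comm hsum).symm
    _ = _ := tsum_congr fun m => by
        rw [bsplineCube_refine, ← tsum_mul_left]
        exact tsum_congr fun M => mul_assoc _ _ _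

/-! ### Differences of splines -/

lemma bsplineCube_dyadicMap_eq_zero {n : ℕ} {l : ℕ} (hl : 1 ≤ l) {k R : ℕ} {m e : Fin n → ℤ}
    {x : Fin n → ℝ} (hx : ∀ i, |x i| ≤ R) (he : ∃ i, (R + l : ℕ) < |e i|) :
    bsplineCube l k (m + e) (dyadicMap k m x) = 0 := by
  obtain ⟨i, hi⟩ := he
  rw [bsplineCube_dyadicMap]
  refine Finset.prod_eq_zero (Finset.mem_univ i) ?_
  have hxi := abs_le.1 (hx i)
  have e1 : (m i - (m + e) i : ℤ) = -e i := by simp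
  rw [e1]
  rcases lt_abs.1 hi with h | h
  · refine bspline_of_neg ?_
    have : ((R + l : ℕ) : ℝ) < e i := by exact_mod_cast h
    push_cast at this ⊢
    have h0 : (0 : ℝ) ≤ l := by positivity
    linarith
  · refine bspline_of_ge hl ?_
    have : ((R + l : ℕ) : ℝ) < -e i := by exact_mod_cast h
    push_cast at this ⊢
    linarith

/-- The integer points of the cube of half side `R`. -/
def intBox (n R : ℕ) : Finset (Fin n → ℤ) := Fintype.piFinset fun _ => Finset.Icc (-(R : ℤ)) R

lemma mem_intBox {n R : ℕ} {e : Fin n → ℤ} : e ∈ intBox n R ↔ ∀ i, |e i| ≤ R := by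
  simp [intBox, Fintype.mem_piFinset, abs_le]

lemma splineOf_dyadicMap_eq_sum {n l : ℕ} (hl : 1 ≤ l) (k R : ℕ) (β : (Fin n → ℤ) → ℝ)
    (m : Fin n → ℤ) {x : Fin n → ℝ} (hx : ∀ i, |x i| ≤ R) :
    splineOf l k β (dyadicMap k m x) =
      ∑ e ∈ intBox n (R + l), β (m + e) * ∏ i, bspline l (x i - e i) := by
  classical
  rw [splineOf, tsum_eq_sum (s := (intBox n (R + l)).image fun e => m + e),
    Finset.sum_image (fun a _ b _ h => add_left_cancel h)]
  · refine Finset.sum_congr rfl fun e _ => ?_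
    rw [bsplineCube_dyadicMap]
    congr 1
    refine Finset.prod_congr rfl fun i _ => ?_
    congr 1
    simp [sub_eq_add_neg]
  · intro M hM
    have : M = m + (M - m) := by abel
    rw [this, bsplineCube_dyadicMap_eq_zero hl hx, mul_zero]
    by_contra hcon
    push Not at hcon
    exact hM (Finset.mem_image.2 ⟨M - m, mem_intBox.2 hcon, this.symm⟩)

lemma diff_congr {n : ℕ} {l : ℕ} {h x : Fin n → ℝ} {f g : (Fin n → ℝ) → ℝ}
    (hfg : ∀ j ≤ l, f (x + (j : ℝ) • h) = g (x + (j : ℝ) • h)) : diff l h f x = diff l h g x :=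
  Finset.sum_congr rfl fun j hj => by rw [hfg j (Nat.lt_succ_iff.1 (Finset.mem_range.1 hj))]

lemma abs_add_smul_le {n : ℕ} {l R : ℕ} {x h : Fin n → ℝ} (hx : ∀ i, |x i| ≤ R)
    (hh : ∀ i, |h i| ≤ 1) {j : ℕ} (hj : j ≤ l) (i : Fin n) :
    |(x + (j : ℝ) • h) i| ≤ (R + l : ℕ) := by
  have h1 : |(j : ℝ) * h i| ≤ l := by
    rw [abs_mul, Nat.abs_cast]
    have : (j : ℝ) ≤ l := by exact_mod_cast hj
    calc (j : ℝ) * |h i| ≤ l * 1 := mul_le_mul this (hh i) (abs_nonneg _) (by positivity)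
      _ = l := mul_one _
  push_cast
  exact (abs_add_le _ _).trans (add_le_add (hx i) h1)

/-- Differences of a spline: `l - 1` orders of smoothness everywhere. -/
lemma exists_abs_diff_splineOf_le (n : ℕ) {l : ℕ} (hl : 1 ≤ l) (R : ℕ) : ∃ C : ℝ, 0 ≤ C ∧
    ∀ (k : ℕ) (β : (Fin n → ℤ) → ℝ) (m : Fin n → ℤ) (x h : Fin n → ℝ) (ρ : ℝ), 0 ≤ ρ → ρ ≤ 1 →
      (∀ i, |x i| ≤ R) → (∀ i, |h i| ≤ ρ) →
      |diff l h (fun y => splineOf l k β (dyadicMap k m y)) x| ≤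
        C * ρ ^ (l - 1) * ∑ e ∈ intBox n (R + l + l), |β (m + e)| := by
  obtain ⟨C, hC0, hC⟩ := exists_abs_diff_prod_bspline_le n hl
  refine ⟨C, hC0, fun k β m x h ρ hρ0 hρ1 hx hh => ?_⟩
  rw [diff_congr (g := fun (y : Fin n → ℝ) => ∑ e ∈ intBox n (R + l + l), β (m + e) *
    ∏ i, bspline l (y i - e i)) fun j hj => splineOf_dyadicMap_eq_sum hl k (R + l) β m
    fun i => abs_add_smul_le hx (fun i => (hh i).trans hρ1) hj i]
  refine (abs_diff_sum_le l h x (intBox n (R + l + l)) (fun e => β (m + e))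
    (fun (e : Fin n → ℤ) (y : Fin n → ℝ) => ∏ i, bspline l (y i - e i))
    fun e _ => hC x (fun i => (e i : ℝ)) h ρ hρ0 hρ1 hh).trans (le_of_eq (mul_comm _ _))

lemma exists_norm_localC_le (n : ℕ) (l : ℕ) : ∃ C : ℝ, 0 ≤ C ∧
    ∀ (β : (Fin n → ℤ) → ℝ) (m : Fin n → ℤ),
      ‖localC (l := l) β m‖ ≤ C * ∑ e ∈ intBox n l, |β (m + e)| := by
  classical
  refine ⟨∑ a : Fin n → Fin l, ‖pieceC l a‖, Finset.sum_nonneg fun _ _ => norm_nonneg _,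
    fun β m => ?_⟩
  rw [localC, Finset.sum_mul]
  refine (norm_sum_le _ _).trans (Finset.sum_le_sum fun a _ => ?_)
  rw [norm_smul, mul_comm]
  refine mul_le_mul_of_nonneg_left ?_ (norm_nonneg _)
  have h1 : (fun i => m i - ((a i : ℕ) : ℤ)) = m + fun i => -((a i : ℕ) : ℤ) := by
    ext i; simp [sub_eq_add_neg]
  rw [h1, Real.norm_eq_abs]
  refine Finset.single_le_sum (f := fun e : Fin n → ℤ => |β (m + e)|) (fun _ _ => abs_nonneg _)
    (mem_intBox.2 fun i => ?_)
  rw [abs_neg, Nat.abs_cast]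
  exact_mod_cast (a i).2.le

/-- Differences of a spline: `l` orders of smoothness inside the cells. -/
lemma exists_abs_diff_splineOf_cell_le (n : ℕ) {l : ℕ} (hl : 1 ≤ l) : ∃ C : ℝ, 0 ≤ C ∧
    ∀ (k : ℕ) (β : (Fin n → ℤ) → ℝ) (m : Fin n → ℤ) (x h : Fin n → ℝ) (ρ : ℝ), 0 ≤ ρ → ρ ≤ 1 →
      (∀ j ≤ l, x + (j : ℝ) • h ∈ hcube n) → (∀ i, |h i| ≤ ρ) →
      |diff l h (fun y => splineOf l k β (dyadicMap k m y)) x| ≤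
        C * ρ ^ l * ∑ e ∈ intBox n l, |β (m + e)| := by
  obtain ⟨C, hC0, hC⟩ := exists_abs_diff_tpoly_le n l 1
  obtain ⟨C', hC'0, hC'⟩ := exists_norm_localC_le n l
  refine ⟨C * C', by positivity, fun k β m x h ρ hρ0 hρ1 hx hh => ?_⟩
  rw [diff_congr (g := tpoly (localC β m)) fun j hj => splineOf_dyadicMap hl k β m (hx j hj)]
  have hx0 : x ∈ hcube n := by simpa using hx 0 (Nat.zero_le _)
  refine (hC _ x h ρ hρ0 hρ1 (fun i => ?_) hh).trans ?_
  · rw [abs_of_nonneg (hx0 i).1]; exact (hx0 i).2.le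
  · calc C * ‖localC (l := l) β m‖ * ρ ^ l ≤ C * (C' * ∑ e ∈ intBox n l, |β (m + e)|) * ρ ^ l := by
          gcongr; exact hC' β m
      _ = _ := by ring

/-! ### The functional `quasiCoeff` on polynomials -/

/-- A sum of tensor products of polynomials. -/
def sumProd {n : ℕ} {ι : Type} [Fintype ι] (c : ι → ℝ) (Q : ι → Fin n → Polynomial ℝ)
    (y : Fin n → ℝ) : ℝ := ∑ b, c b * ∏ i, (Q b i).eval (y i)

lemma lineDeriv_sumProd {n : ℕ} {ι : Type} [Fintype ι] (c : ι → ℝ) (Q : ι → Fin n → Polynomial ℝ)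
    (i : Fin n) (y : Fin n → ℝ) :
    lineDeriv ℝ (sumProd c Q) y (Pi.single i 1 : Fin n → ℝ) =
      sumProd c (fun b => Function.update (Q b) i (Polynomial.derivative (Q b i))) y := by
  have hfun : ∀ t : ℝ, sumProd c Q (y + t • (Pi.single i 1 : Fin n → ℝ)) =
      ∑ b, c b * ((Q b i).eval (y i + t) *
        ∏ j ∈ Finset.univ.erase i, (Q b j).eval (y j)) := by
    intro t
    refine Finset.sum_congr rfl fun b _ => ?_
    rw [← Finset.mul_prod_erase _ _ (Finset.mem_univ i)]
    congr 2
    · simp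
    · refine Finset.prod_congr rfl fun j hj => ?_
      simp [Pi.single_eq_of_ne (Finset.ne_of_mem_erase hj)]
  rw [lineDeriv]
  simp_rw [hfun]
  have hd : HasDerivAt (fun t : ℝ => ∑ b, c b * ((Q b i).eval (y i + t) *
        ∏ j ∈ Finset.univ.erase i, (Q b j).eval (y j)))
      (∑ b, c b * ((Polynomial.derivative (Q b i)).eval (y i + 0) *
        ∏ j ∈ Finset.univ.erase i, (Q b j).eval (y j))) 0 := by
    refine HasDerivAt.fun_sum fun b _ => HasDerivAt.const_mul _ (HasDerivAt.mul_const ?_ _)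
    exact ((Q b i).hasDerivAt (y i + 0)).comp_const_add (y i) 0
  rw [hd.deriv, sumProd]
  refine Finset.sum_congr rfl fun b _ => ?_
  rw [← Finset.mul_prod_erase Finset.univ (fun j => _) (Finset.mem_univ i)]
  congr 2
  · simp
  · refine Finset.prod_congr rfl fun j hj => ?_
    rw [Function.update_of_ne (Finset.ne_of_mem_erase hj)]

lemma iterate_lineDeriv_eqOn {n : ℕ} {ι : Type} [Fintype ι] (c : ι → ℝ)
    {U : Set (Fin n → ℝ)} (hU : IsOpen U) (i : Fin n) (k : ℕ) :
    ∀ {Q : ι → Fin n → Polynomial ℝ} {f : (Fin n → ℝ) → ℝ}, Set.EqOn f (sumProd c Q) U →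
      Set.EqOn ((fun (g' : (Fin n → ℝ) → ℝ) (x : Fin n → ℝ) =>
          lineDeriv ℝ g' x (Pi.single i 1 : Fin n → ℝ))^[k] f)
        (sumProd c fun b => Function.update (Q b) i (Polynomial.derivative^[k] (Q b i))) U := by
  induction k with
  | zero => intro Q f h; simpa using h
  | succ k ih =>
    intro Q f h
    rw [Function.iterate_succ_apply]
    have h1 : Set.EqOn (fun (x : Fin n → ℝ) => lineDeriv ℝ f x (Pi.single i 1 : Fin n → ℝ))
        (sumProd c fun b => Function.update (Q b) i (Polynomial.derivative (Q b i))) U := by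
      intro x hx
      have : f =ᶠ[nhds x] sumProd c Q := Filter.eventuallyEq_of_mem (hU.mem_nhds hx) h
      beta_reduce
      rw [this.lineDeriv_eq, lineDeriv_sumProd]
    refine (ih h1).trans fun x _ => ?_
    simp

lemma multiDeriv_eqOn {n : ℕ} {ι : Type} [Fintype ι] (c : ι → ℝ) {U : Set (Fin n → ℝ)}
    (hU : IsOpen U) (ν : Fin n → ℕ) {Q : ι → Fin n → Polynomial ℝ} {f : (Fin n → ℝ) → ℝ}
    (h : Set.EqOn f (sumProd c Q) U) :
    Set.EqOn (multiDeriv ν f)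
      (sumProd c fun b i => Polynomial.derivative^[ν i] (Q b i)) U := by
  classical
  have key : ∀ L : List (Fin n), L.Nodup → Set.EqOn (L.foldr
      (fun i g => (fun (g' : (Fin n → ℝ) → ℝ) (x : Fin n → ℝ) =>
        lineDeriv ℝ g' x (Pi.single i 1 : Fin n → ℝ))^[ν i] g) f)
      (sumProd c fun b i => if i ∈ L then Polynomial.derivative^[ν i] (Q b i) else Q b i) U := by
    intro L
    induction L with
    | nil => intro _; simpa using h
    | cons i L ih =>
      intro hL
      rw [List.nodup_cons] at hL
      rw [List.foldr_cons]
      refine (iterate_lineDeriv_eqOn c hU i (ν i) (ih hL.2)).trans fun x _ => ?_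
      congr 1
      ext b j : 2
      by_cases hj : j = i
      · subst hj; simp [hL.1]
      · simp [hj]
  have := key (List.finRange n) (List.nodup_finRange n)
  simpa [multiDeriv] using this

lemma iterate_derivative_comp_linear (P : Polynomial ℝ) (a b : ℝ) (j : ℕ) :
    Polynomial.derivative^[j] (P.comp (Polynomial.C a * Polynomial.X + Polynomial.C b)) =
      Polynomial.C (a ^ j) *
        (Polynomial.derivative^[j] P).comp (Polynomial.C a * Polynomial.X + Polynomial.C b) := by
  induction j with
  | zero => simp
  | succ j ih =>
    rw [Function.iterate_succ_apply', ih, Function.iterate_succ_apply', Polynomial.derivative_C_mul,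
      Polynomial.derivative_comp]
    simp [pow_succ]
    ring

lemma iteratedDeriv_polynomial (P : Polynomial ℝ) (j : ℕ) :
    iteratedDeriv j (fun t : ℝ => P.eval t) = fun t => (Polynomial.derivative^[j] P).eval t := by
  induction j with
  | zero => simp
  | succ j ih =>
    rw [iteratedDeriv_succ, ih, Function.iterate_succ_apply']
    ext t
    exact Polynomial.deriv _

lemma quasiCoeff₁_mul {l : ℕ} (k : ℕ) (m : ℤ) {ν : ℕ} (hν : ν < l) :
    quasiCoeff₁ l k m ν * (2 ^ k) ^ ν = (-1) ^ (l - 1 - ν) / ((l - 1).factorial : ℝ) *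
      (Polynomial.derivative^[l - 1 - ν] (knotPoly l)).eval (1 / 2) := by
  have hfun : (fun t : ℝ => ∏ j ∈ Finset.Icc 1 (l - 1), (((m : ℝ) + (j : ℝ)) / 2 ^ k - t)) =
      fun t => (Polynomial.C ((1 / 2 ^ k) ^ (l - 1)) * (knotPoly l).comp
        (Polynomial.C (2 ^ k : ℝ) * Polynomial.X + Polynomial.C (-(m : ℝ)))).eval t := by
    ext t
    rw [Polynomial.eval_mul, Polynomial.eval_comp, eval_knotPoly, Polynomial.eval_C]
    have : ((1 / 2 ^ k : ℝ)) ^ (l - 1) = ∏ j ∈ Finset.Icc 1 (l - 1), (1 / 2 ^ k : ℝ) := by simp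
    rw [this, ← Finset.prod_mul_distrib]
    refine Finset.prod_congr rfl fun j _ => ?_
    simp
    field_simp
    ring
  rw [quasiCoeff₁, hfun, iteratedDeriv_polynomial]
  beta_reduce
  rw [Polynomial.iterate_derivative_C_mul, iterate_derivative_comp_linear]
  simp only [Polynomial.eval_mul, Polynomial.eval_C, Polynomial.eval_comp, Polynomial.eval_add,
    Polynomial.eval_X]
  have e1 : (2 ^ k : ℝ) * (((m : ℝ) + 1 / 2) / 2 ^ k) + -(m : ℝ) = 1 / 2 := by
    field_simp; ring
  have e2 : ((1 / 2 ^ k : ℝ)) ^ (l - 1) * ((2 ^ k) ^ (l - 1 - ν) * (2 ^ k) ^ ν) = 1 := by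
    rw [← pow_add, Nat.sub_add_cancel (by omega), ← mul_pow]
    simp
  rw [e1]
  linear_combination ((-1) ^ (l - 1 - ν) / ((l - 1).factorial : ℝ) *
      (Polynomial.derivative^[l - 1 - ν] (knotPoly l)).eval (1 / 2)) * e2

lemma isOpen_dyadicCube {n : ℕ} (k : ℕ) (m : Fin n → ℤ) : IsOpen (dyadicCube k m) := by
  have : dyadicCube k m = Set.univ.pi fun i => Set.Ioo ((m i : ℝ) / 2 ^ k) (((m i : ℝ) + 1) / 2 ^ k) := by
    ext x; simp [dyadicCube, Set.mem_pi]
  rw [this]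
  exact isOpen_set_pi Set.finite_univ fun i _ => isOpen_Ioo

lemma dyadicMap_mem_dyadicCube {n : ℕ} (k : ℕ) (m : Fin n → ℤ) {x : Fin n → ℝ} :
    dyadicMap k m x ∈ dyadicCube k m ↔ x ∈ ucube n := by
  rw [mem_ucube]
  refine forall_congr' fun i => ?_
  rw [dyadicMap, div_lt_div_iff_of_pos_right (by positivity),
    div_lt_div_iff_of_pos_right (by positivity)]
  constructor <;> rintro ⟨h1, h2⟩ <;> constructor <;> linarith

/-- The functional `quasiCoeff` in the coordinates of the cell. -/
lemma quasiCoeff_eq_lamC {n l : ℕ} (k : ℕ) (m : Fin n → ℤ) {f : (Fin n → ℝ) → ℝ}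
    (c : (Fin n → Fin l) → ℝ) (hf : ∀ x ∈ ucube n, f (dyadicMap k m x) = tpoly c x) :
    quasiCoeff l k m f = lamC l c := by
  have hlin : ∀ (y : ℝ) (i : Fin n) (b : Fin n → Fin l), (((Polynomial.X ^ (b i : ℕ)).comp
      (Polynomial.C (2 ^ k : ℝ) * Polynomial.X + Polynomial.C (-(m i : ℝ)))) : Polynomial ℝ).eval y =
        (2 ^ k * y - m i) ^ (b i : ℕ) := by
    intro y i b
    simp [sub_eq_add_neg]
  have hEq : Set.EqOn f (sumProd c fun (b : Fin n → Fin l) i => (Polynomial.X ^ (b i : ℕ)).comp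
      (Polynomial.C (2 ^ k : ℝ) * Polynomial.X + Polynomial.C (-(m i : ℝ)))) (dyadicCube k m) := by
    intro y hy
    have e : dyadicMap k m (fun i => 2 ^ k * y i - m i) = y := by
      ext i; rw [dyadicMap]; field_simp; ring
    rw [← e] at hy
    have := hf _ ((dyadicMap_mem_dyadicCube k m).1 hy)
    rw [e] at this
    rw [this, tpoly, sumProd]
    simp_rw [hlin]
  have hcent : dyadicCentre k m = dyadicMap k m (fun _ => 1 / 2) := by
    ext i; rw [dyadicCentre, dyadicMap, add_comm]
  have hmem : dyadicCentre k m ∈ dyadicCube k m := by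
    rw [hcent, dyadicMap_mem_dyadicCube, mem_ucube]; intro i; norm_num
  have h1 : ∀ ν : Fin n → Fin l, multiDeriv (fun i => (ν i : ℕ)) f (dyadicCentre k m) =
      ∑ b, c b * ∏ i, ((2 ^ k) ^ (ν i : ℕ) *
        (Polynomial.derivative^[(ν i : ℕ)] (Polynomial.X ^ (b i : ℕ) : Polynomial ℝ)).eval (1 / 2)) := by
    intro ν
    rw [multiDeriv_eqOn c (isOpen_dyadicCube k m) _ hEq hmem, sumProd]
    refine Finset.sum_congr rfl fun b _ => ?_
    congr 1
    refine Finset.prod_congr rfl fun i _ => ?_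
    rw [iterate_derivative_comp_linear]
    simp only [Polynomial.eval_mul, Polynomial.eval_C, Polynomial.eval_comp, Polynomial.eval_add,
      Polynomial.eval_X]
    congr 2
    rw [dyadicCentre]; field_simp; ring
  rw [quasiCoeff, lamC_apply]
  simp_rw [h1, Finset.mul_sum]
  rw [Finset.sum_comm]
  refine Finset.sum_congr rfl fun b _ => ?_
  have h2 : ∀ i, lam l (Polynomial.X ^ (b i : ℕ)) = ∑ ν : Fin l, quasiCoeff₁ l k (m i) ν *
      ((2 ^ k) ^ (ν : ℕ) *
        (Polynomial.derivative^[(ν : ℕ)] (Polynomial.X ^ (b i : ℕ) : Polynomial ℝ)).eval (1 / 2)) := by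
    intro i
    rw [lam_apply, Finset.sum_range]
    refine Finset.sum_congr rfl fun ν _ => ?_
    rw [← mul_assoc, quasiCoeff₁_mul k (m i) ν.2]
  simp_rw [h2]
  rw [Finset.prod_univ_sum, Fintype.piFinset_univ, Finset.sum_mul]
  refine Finset.sum_congr rfl fun ν _ => ?_
  rw [Finset.prod_mul_distrib (f := fun i => quasiCoeff₁ l k (m i) (ν i))]
  ring

/-! ### Dyadic scaling -/

lemma measurable_dyadicMap {n : ℕ} (k : ℕ) (m : Fin n → ℤ) : Measurable (dyadicMap k m) := by
  unfold dyadicMap; fun_prop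

lemma dyadicMap_eq_smul {n : ℕ} (k : ℕ) (m : Fin n → ℤ) : dyadicMap k m =
    (fun y : Fin n → ℝ => ((2 ^ k : ℝ)⁻¹) • y) ∘ fun x => x + fun i => (m i : ℝ) := by
  ext x i; simp [dyadicMap, div_eq_inv_mul]

lemma measurableEmbedding_dyadicMap {n : ℕ} (k : ℕ) (m : Fin n → ℤ) :
    MeasurableEmbedding (dyadicMap k m) := by
  rw [dyadicMap_eq_smul]
  exact (measurableEmbedding_const_smul₀ (by positivity)).comp (measurableEmbedding_addRight _)

lemma map_dyadicMap {n : ℕ} (k : ℕ) (m : Fin n → ℤ) :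
    Measure.map (dyadicMap k m) volume = ENNReal.ofReal ((2 ^ k) ^ n) • volume := by
  rw [dyadicMap_eq_smul, ← Measure.map_map (by fun_prop) (by fun_prop), map_add_right_eq_self,
    Measure.map_addHaar_smul _ (by positivity)]
  congr 2
  rw [Module.finrank_fin_fun, ← inv_pow, inv_inv, abs_of_nonneg (by positivity)]

lemma map_restrict_dyadicMap {n : ℕ} (k : ℕ) (m : Fin n → ℤ) (A : Set (Fin n → ℝ)) :
    Measure.map (dyadicMap k m) (volume.restrict (dyadicMap k m ⁻¹' A)) =
      ENNReal.ofReal ((2 ^ k) ^ n) • volume.restrict A := by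
  rw [← (measurableEmbedding_dyadicMap k m).restrict_map, map_dyadicMap, Measure.restrict_smul]

lemma preimage_dyadicMap_dyadicCube {n : ℕ} (k : ℕ) (m : Fin n → ℤ) :
    dyadicMap k m ⁻¹' dyadicCube k m = ucube n := by
  ext x; exact dyadicMap_mem_dyadicCube k m

lemma eLpNorm_dyadicMap {n : ℕ} (k : ℕ) (m : Fin n → ℤ) (f : (Fin n → ℝ) → ℝ) (r : ℝ≥0∞)
    (A : Set (Fin n → ℝ)) :
    eLpNorm (fun x => f (dyadicMap k m x)) r (volume.restrict (dyadicMap k m ⁻¹' A)) =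
      (2 : ℝ≥0∞) ^ ((k : ℝ) * n * (r⁻¹).toReal) * eLpNorm f r (volume.restrict A) := by
  have h := (measurableEmbedding_dyadicMap k m).eLpNorm_map_measure (g := f) (p := r)
    (μ := volume.restrict (dyadicMap k m ⁻¹' A))
  rw [map_restrict_dyadicMap, eLpNorm_smul_measure_of_ne_zero] at h
  · have h2 : ENNReal.ofReal ((2 ^ k) ^ n) = (2 : ℝ≥0∞) ^ ((k : ℝ) * n) := by
      rw [ENNReal.rpow_mul, ENNReal.rpow_natCast, ENNReal.rpow_natCast, ENNReal.ofReal_pow (by positivity),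
        ENNReal.ofReal_pow (by positivity), ENNReal.ofReal_ofNat]
    rw [h2, ← ENNReal.rpow_mul, smul_eq_mul, one_div] at h
    exact h.symm
  · simp

lemma diff_dyadicMap {n : ℕ} (l k : ℕ) (m : Fin n → ℤ) (f : (Fin n → ℝ) → ℝ) (h x : Fin n → ℝ) :
    diff l (dyadicMap k 0 h) f (dyadicMap k m x) = diff l h (fun y => f (dyadicMap k m y)) x := by
  refine Finset.sum_congr rfl fun j _ => ?_
  congr 2
  ext i
  simp [dyadicMap]
  ring

lemma avgDiff_dyadicMap {n : ℕ} (l k : ℕ) (r : ℝ≥0∞) (m : Fin n → ℤ) (f : (Fin n → ℝ) → ℝ)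
    (x : Fin n → ℝ) :
    avgDiff l r f (dyadicMap k m x) (2 / 2 ^ k) =
      avgDiff l r (fun y => f (dyadicMap k m y)) x 2 := by
  have hp1 : dyadicMap k 0 ⁻¹' (cube (0 : Fin n → ℝ) (2 * (2 / 2 ^ k))) = cube 0 (2 * 2) := by
    ext h
    refine forall_congr' fun i => ?_
    have e : dyadicMap k 0 h i = h i / 2 ^ k := by simp [dyadicMap]
    rw [e, Pi.zero_apply, sub_zero, sub_zero, abs_div, abs_of_pos (by positivity : (0 : ℝ) < 2 ^ k),
      mul_div_assoc, div_right_comm, ← mul_div_assoc, div_lt_div_iff_of_pos_right (by positivity)]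
    norm_num
  have hp2 : dyadicMap k m ⁻¹' (cube (dyadicMap k m x) (2 / 2 ^ k)) = cube x 2 := by
    ext y
    refine forall_congr' fun i => ?_
    rw [dyadicMap, dyadicMap, ← sub_div, abs_div, abs_of_pos (by positivity : (0 : ℝ) < 2 ^ k),
      div_right_comm, div_lt_div_iff_of_pos_right (by positivity)]
    simp
  have hemb : MeasurableEmbedding (Prod.map (dyadicMap k (0 : Fin n → ℤ)) (dyadicMap k m)) :=
    (measurableEmbedding_dyadicMap k 0).prodMap (measurableEmbedding_dyadicMap k m)
  have hm := hemb.eLpNorm_map_measure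
    (g := fun z : (Fin n → ℝ) × (Fin n → ℝ) => diff l z.1 f z.2) (p := r)
    (μ := (ENNReal.ofReal (2 ^ (2 * n)))⁻¹ •
      (volume.restrict (cube (0 : Fin n → ℝ) (2 * 2))).prod (volume.restrict (cube x 2)))
  rw [avgDiff, avgDiff]
  have hL : ((fun z : (Fin n → ℝ) × (Fin n → ℝ) => diff l z.1 f z.2) ∘
      Prod.map (dyadicMap k (0 : Fin n → ℤ)) (dyadicMap k m)) =
      fun z => diff l z.1 (fun y => f (dyadicMap k m y)) z.2 := by
    ext z; exact diff_dyadicMap l k m f z.1 z.2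
  rw [hL] at hm
  rw [← hm]
  congr 1
  rw [Measure.map_smul, ← Measure.map_prod_map _ _ (measurable_dyadicMap _ _) (measurable_dyadicMap _ _),
    ← hp1, ← hp2, map_restrict_dyadicMap, map_restrict_dyadicMap, Measure.prod_smul_left,
    Measure.prod_smul_right, smul_smul, smul_smul]
  congr 1
  rw [← ENNReal.ofReal_inv_of_pos (by positivity), ← ENNReal.ofReal_inv_of_pos (by positivity),
    ← ENNReal.ofReal_mul (by positivity), ← ENNReal.ofReal_mul (by positivity)]
  congr 1
  rw [pow_mul, pow_mul, div_pow, div_pow, inv_div, mul_assoc, ← mul_pow, ← pow_two, div_eq_inv_mul]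

/-! ### Sequence norms -/

lemma rpow_sum_le {ι : Type} (S : Finset ι) (a : ι → ℝ≥0∞) {s : ℝ} (hs : 0 < s) :
    (∑ i ∈ S, a i) ^ s ≤ (S.card : ℝ≥0∞) ^ s * ∑ i ∈ S, a i ^ s := by
  rcases S.eq_empty_or_nonempty with rfl | hS
  · simp [ENNReal.zero_rpow_of_pos hs]
  · obtain ⟨i, hi, hmax⟩ := Finset.exists_max_image S a hS
    calc (∑ i ∈ S, a i) ^ s ≤ (S.card * a i) ^ s := by
          refine ENNReal.rpow_le_rpow ?_ hs.le
          have := Finset.sum_le_card_nsmul S a (a i) hmax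
          simpa [nsmul_eq_mul] using this
      _ = (S.card : ℝ≥0∞) ^ s * a i ^ s := ENNReal.mul_rpow_of_nonneg _ _ hs.le
      _ ≤ _ := by
          refine mul_le_mul' le_rfl ?_
          exact Finset.single_le_sum (f := fun i => a i ^ s) (fun _ _ => zero_le) hi

lemma toReal_pos' {q : ℝ≥0∞} (hq : q ≠ 0) (hq' : q ≠ ∞) : 0 < q.toReal := ENNReal.toReal_pos hq hq'

lemma lqNorm_top {ι : Type} (a : ι → ℝ≥0∞) : lqNorm ∞ a = ⨆ i, a i := if_pos rfl

lemma lqNorm_of_ne_top {ι : Type} {q : ℝ≥0∞} (hq : q ≠ ∞) (a : ι → ℝ≥0∞) :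
    lqNorm q a = (∑' i, a i ^ q.toReal) ^ (1 / q.toReal) := if_neg hq

lemma lqNorm_rpow {ι : Type} {q : ℝ≥0∞} (hq : q ≠ 0) (hq' : q ≠ ∞) (a : ι → ℝ≥0∞) :
    lqNorm q a ^ q.toReal = ∑' i, a i ^ q.toReal := by
  rw [lqNorm_of_ne_top hq', ← ENNReal.rpow_mul, one_div,
    inv_mul_cancel₀ (toReal_pos' hq hq').ne', ENNReal.rpow_one]

lemma lqNorm_mono {ι : Type} {q : ℝ≥0∞} {a b : ι → ℝ≥0∞} (h : ∀ i, a i ≤ b i) :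
    lqNorm q a ≤ lqNorm q b := by
  by_cases hq : q = ∞
  · subst hq; rw [lqNorm_top, lqNorm_top]; exact iSup_mono h
  · rw [lqNorm_of_ne_top hq, lqNorm_of_ne_top hq]
    refine ENNReal.rpow_le_rpow (ENNReal.tsum_le_tsum fun i => ?_) (by positivity)
    exact ENNReal.rpow_le_rpow (h i) ENNReal.toReal_nonneg

lemma lqNorm_const_mul {ι : Type} {q : ℝ≥0∞} (hq0 : q ≠ 0) (c : ℝ≥0∞) (a : ι → ℝ≥0∞) :
    lqNorm q (fun i => c * a i) = c * lqNorm q a := by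
  by_cases hq : q = ∞
  · subst hq; rw [lqNorm_top, lqNorm_top, ENNReal.mul_iSup]
  · have h0 := toReal_pos' hq0 hq
    rw [lqNorm_of_ne_top hq, lqNorm_of_ne_top hq]
    simp_rw [ENNReal.mul_rpow_of_nonneg _ _ h0.le]
    rw [ENNReal.tsum_mul_left, ENNReal.mul_rpow_of_nonneg _ _ (by positivity), ← ENNReal.rpow_mul,
      one_div, mul_inv_cancel₀ h0.ne', ENNReal.rpow_one]

lemma lqNorm_comp_le {ι κ : Type} {q : ℝ≥0∞} {f : ι → κ} (hf : Function.Injective f)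
    (a : κ → ℝ≥0∞) : lqNorm q (fun i => a (f i)) ≤ lqNorm q a := by
  by_cases hq : q = ∞
  · subst hq; rw [lqNorm_top, lqNorm_top]
    exact iSup_le fun i => le_iSup a (f i)
  · rw [lqNorm_of_ne_top hq, lqNorm_of_ne_top hq]
    refine ENNReal.rpow_le_rpow ?_ (by positivity)
    exact ENNReal.tsum_comp_le_tsum_of_injective hf fun i => a i ^ q.toReal

lemma le_lqNorm {ι : Type} {q : ℝ≥0∞} (hq0 : q ≠ 0) (a : ι → ℝ≥0∞) (i : ι) : a i ≤ lqNorm q a := by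
  by_cases hq : q = ∞
  · subst hq; rw [lqNorm_top]; exact le_iSup a i
  · have h0 := toReal_pos' hq0 hq
    rw [lqNorm_of_ne_top hq, one_div, ENNReal.le_rpow_inv_iff h0]
    exact ENNReal.le_tsum (f := fun i => a i ^ q.toReal) i

/-- A constant in the quasi-triangle inequality of `l_q` for `N` summands. -/
def lqC (q : ℝ≥0∞) (N : ℕ) : ℝ≥0 := (max 1 (N : ℝ≥0)) * (max 1 (N : ℝ≥0)) ^ (1 / q.toReal)

lemma one_le_lqC (q : ℝ≥0∞) (N : ℕ) : 1 ≤ lqC q N :=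
  one_le_mul (le_max_left _ _) (NNReal.one_le_rpow (le_max_left _ _) (by positivity))

lemma lqNorm_sum_le {ι κ : Type} {q : ℝ≥0∞} (hq0 : q ≠ 0) (S : Finset κ) (a : κ → ι → ℝ≥0∞) :
    lqNorm q (fun j => ∑ i ∈ S, a i j) ≤ lqC q S.card * ∑ i ∈ S, lqNorm q (a i) := by
  by_cases hq : q = ∞
  · subst hq
    have h1 : (1 : ℝ≥0∞) ≤ lqC ∞ S.card := by exact_mod_cast one_le_lqC _ _
    refine le_trans ?_ (le_mul_of_one_le_left zero_le h1)
    rw [lqNorm_top]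
    refine iSup_le fun j => Finset.sum_le_sum fun i _ => ?_
    rw [lqNorm_top]; exact le_iSup (a i) j
  · have h0 := toReal_pos' hq0 hq
    set M : ℝ≥0∞ := ((max 1 (S.card : ℝ≥0) : ℝ≥0) : ℝ≥0∞) with hM
    have hcard : (S.card : ℝ≥0∞) ≤ M := by
      rw [hM]; exact_mod_cast le_max_right 1 (S.card : ℝ≥0)
    have h1 : ∑' j, (∑ i ∈ S, a i j) ^ q.toReal ≤ M ^ q.toReal *
        ∑ i ∈ S, lqNorm q (a i) ^ q.toReal := by
      calc ∑' j, (∑ i ∈ S, a i j) ^ q.toReal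
          ≤ ∑' j, M ^ q.toReal * ∑ i ∈ S, a i j ^ q.toReal :=
            ENNReal.tsum_le_tsum fun j => (rpow_sum_le S (fun i => a i j) h0).trans
              (mul_le_mul' (ENNReal.rpow_le_rpow hcard h0.le) le_rfl)
        _ = M ^ q.toReal * ∑ i ∈ S, lqNorm q (a i) ^ q.toReal := by
            rw [ENNReal.tsum_mul_left, Summable.tsum_finsetSum fun _ _ => ENNReal.summable]
            simp_rw [lqNorm_rpow hq0 hq]
    rw [lqNorm_of_ne_top hq]
    calc _ ≤ (M ^ q.toReal * ∑ i ∈ S, lqNorm q (a i) ^ q.toReal) ^ (1 / q.toReal) :=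
          ENNReal.rpow_le_rpow h1 (by positivity)
      _ = M * (∑ i ∈ S, lqNorm q (a i) ^ q.toReal) ^ (1 / q.toReal) := by
          rw [ENNReal.mul_rpow_of_nonneg _ _ (by positivity), ← ENNReal.rpow_mul, mul_one_div_cancel h0.ne',
            ENNReal.rpow_one]
      _ ≤ M * (M ^ (1 / q.toReal) * ∑ i ∈ S, lqNorm q (a i)) := by
          refine mul_le_mul' le_rfl ((rpow_sum_le S _ (by positivity)).trans ?_)
          refine mul_le_mul' (ENNReal.rpow_le_rpow hcard (by positivity)) (le_of_eq ?_)
          refine Finset.sum_congr rfl fun i _ => ?_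
          rw [← ENNReal.rpow_mul, mul_one_div_cancel h0.ne', ENNReal.rpow_one]
      _ = _ := by
          rw [lqC, ENNReal.coe_mul, ENNReal.coe_rpow_of_nonneg _ (by positivity), mul_assoc]

lemma lqNorm_add_le {ι : Type} {q : ℝ≥0∞} (hq0 : q ≠ 0) (a b : ι → ℝ≥0∞) :
    lqNorm q (fun j => a j + b j) ≤ lqC q 2 * (lqNorm q a + lqNorm q b) := by
  have := lqNorm_sum_le hq0 (Finset.univ : Finset (Fin 2)) ![a, b]
  simpa using this

lemma lqNorm_cons_le {q : ℝ≥0∞} (hq0 : q ≠ 0) (a : ℕ → ℝ≥0∞) :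
    lqNorm q a ≤ lqC q 2 * (a 0 + lqNorm q fun k => a (k + 1)) := by
  have h : lqNorm q a ≤ lqNorm q (fun k : ℕ => (if k = 0 then a 0 else 0) + if k = 0 then 0 else a k) :=
    lqNorm_mono fun k => by split_ifs with h <;> simp [h]
  refine h.trans ((lqNorm_add_le hq0 _ _).trans (mul_le_mul' le_rfl (add_le_add ?_ ?_)))
  · by_cases hq : q = ∞
    · subst hq; rw [lqNorm_top]
      exact iSup_le fun k => by split_ifs <;> simp
    · have h0 := toReal_pos' hq0 hq
      rw [lqNorm_of_ne_top hq, tsum_eq_single 0 fun k hk => by simp [hk, h0], if_pos rfl,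
        ← ENNReal.rpow_mul, mul_one_div_cancel h0.ne', ENNReal.rpow_one]
  · by_cases hq : q = ∞
    · subst hq; rw [lqNorm_top, lqNorm_top]
      refine iSup_le fun k => ?_
      cases k with
      | zero => simp
      | succ k => exact le_iSup (fun k => a (k + 1)) k
    · have h0 := toReal_pos' hq0 hq
      rw [lqNorm_of_ne_top hq, lqNorm_of_ne_top hq, tsum_eq_zero_add' ENNReal.summable]
      simp [h0]

/-- Sums over neighbours in weighted sequence norms. -/
lemma lqNorm_neighbour_le {n : ℕ} {p : ℝ≥0∞} (hp : p ≠ 0) (R : ℕ) (D C : ℝ≥0)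
    {τ F G : (Fin n → ℤ) → ℝ≥0∞} (hτ : ∀ m, ∀ e ∈ intBox n R, τ m ≤ D * τ (m + e))
    (hG : ∀ m, G m ≤ C * ∑ e ∈ intBox n R, F (m + e)) :
    lqNorm p (fun m => τ m * G m) ≤
      (lqC p (intBox n R).card * (C * D * (intBox n R).card) : ℝ≥0) *
        lqNorm p (fun m => τ m * F m) := by
  have h1 : ∀ m, τ m * G m ≤ ∑ e ∈ intBox n R, (C * D : ℝ≥0∞) * (τ (m + e) * F (m + e)) := by
    intro m
    calc τ m * G m ≤ τ m * (C * ∑ e ∈ intBox n R, F (m + e)) := mul_le_mul' le_rfl (hG m)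
      _ = ∑ e ∈ intBox n R, C * (τ m * F (m + e)) := by
          rw [Finset.mul_sum, Finset.mul_sum]
          exact Finset.sum_congr rfl fun e _ => by ring
      _ ≤ _ := Finset.sum_le_sum fun e he => by
          calc C * (τ m * F (m + e)) ≤ C * (D * τ (m + e) * F (m + e)) :=
                mul_le_mul' le_rfl (mul_le_mul' (hτ m e he) le_rfl)
            _ = _ := by ring
  refine (lqNorm_mono h1).trans ((lqNorm_sum_le hp (intBox n R)
    fun e m => (C * D : ℝ≥0∞) * (τ (m + e) * F (m + e))).trans ?_)
  rw [ENNReal.coe_mul, mul_assoc]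
  refine mul_le_mul' le_rfl ?_
  calc ∑ e ∈ intBox n R, lqNorm p (fun m => (C * D : ℝ≥0∞) * (τ (m + e) * F (m + e)))
      ≤ ∑ _e ∈ intBox n R, (C * D : ℝ≥0∞) * lqNorm p (fun m => τ m * F m) := by
        refine Finset.sum_le_sum fun e _ => ?_
        rw [lqNorm_const_mul hp]
        refine mul_le_mul' le_rfl ?_
        exact lqNorm_comp_le (add_left_injective e) fun m => τ m * F m
    _ = _ := by
        rw [Finset.sum_const, nsmul_eq_mul]; push_cast; ring

/-! ### Norms over cells -/

/-- The scaled `L_r`-norm over a dyadic cube. -/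
def cellNorm {n : ℕ} (r : ℝ≥0∞) (k : ℕ) (f : (Fin n → ℝ) → ℝ) (m : Fin n → ℤ) : ℝ≥0∞ :=
  eLpNorm (fun x => f (dyadicMap k m x)) r (volume.restrict (ucube n))

lemma cellNorm_eq {n : ℕ} (r : ℝ≥0∞) (k : ℕ) (f : (Fin n → ℝ) → ℝ) (m : Fin n → ℤ) :
    cellNorm r k f m = (2 : ℝ≥0∞) ^ ((k : ℝ) * n * (r⁻¹).toReal) *
      eLpNorm f r (volume.restrict (dyadicCube k m)) := by
  rw [cellNorm, ← preimage_dyadicMap_dyadicCube k m, eLpNorm_dyadicMap]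

lemma approxError_eq {n : ℕ} (p r : ℝ≥0∞) (τ : ℕ → (Fin n → ℤ) → ℝ≥0∞) (k : ℕ)
    (φ S : (Fin n → ℝ) → ℝ) :
    approxError p r τ k φ S = lqNorm p fun m => τ k m * cellNorm r k (fun x => φ x - S x) m := by
  rw [approxError]
  simp_rw [cellNorm_eq]

lemma initialTerm_eq {n : ℕ} (p r : ℝ≥0∞) (τ : ℕ → (Fin n → ℤ) → ℝ≥0∞) (φ : (Fin n → ℝ) → ℝ) :
    initialTerm p r τ φ = lqNorm p fun m => τ 0 m * cellNorm r 0 φ m := by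
  rw [initialTerm]
  simp_rw [cellNorm_eq]
  simp

lemma ae_restrict_ucube_of_hcube {n : ℕ} {P : (Fin n → ℝ) → Prop} (h : ∀ y ∈ hcube n, P y) :
    ∀ᵐ x ∂(volume.restrict (ucube n)), P x :=
  (ae_restrict_iff' (measurableSet_ucube n)).2 (ae_of_all _ fun _ hx => h _ (ucube_subset_hcube n hx))

lemma cellNorm_splineOf {n l : ℕ} (hl : 1 ≤ l) (r : ℝ≥0∞) (k : ℕ) (β : (Fin n → ℤ) → ℝ)
    (m : Fin n → ℤ) : cellNorm r k (splineOf l k β) m =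
      eLpNorm (tpoly (localC (l := l) β m)) r (volume.restrict (ucube n)) :=
  eLpNorm_congr_ae (ae_restrict_ucube_of_hcube fun x hx => splineOf_dyadicMap hl k β m hx)

lemma cellNorm_sub_splineOf {n l : ℕ} (hl : 1 ≤ l) (r : ℝ≥0∞) (k : ℕ) (φ : (Fin n → ℝ) → ℝ)
    (β : (Fin n → ℤ) → ℝ) (m : Fin n → ℤ) :
    cellNorm r k (fun x => φ x - splineOf l k β x) m =
      eLpNorm (fun x => φ (dyadicMap k m x) - tpoly (localC (l := l) β m) x) r
        (volume.restrict (ucube n)) :=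
  eLpNorm_congr_ae (ae_restrict_ucube_of_hcube fun x hx => by
    beta_reduce; rw [splineOf_dyadicMap hl k β m hx])

lemma measurable_cell {n : ℕ} (k : ℕ) : Measurable (cell k : (Fin n → ℝ) → Fin n → ℤ) := by
  unfold cell; fun_prop

lemma splineOf_eq_tpoly {n l : ℕ} (hl : 1 ≤ l) (k : ℕ) (β : (Fin n → ℤ) → ℝ) (y : Fin n → ℝ) :
    splineOf l k β y = tpoly (localC (l := l) β (cell k y)) (fun i => 2 ^ k * y i - cell k y i) := by
  obtain ⟨m, x, hx, rfl⟩ : ∃ m, ∃ x ∈ hcube n, dyadicMap k m x = y := ⟨_, exists_dyadicMap_eq k y⟩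
  rw [splineOf_dyadicMap hl k β m hx, cell_dyadicMap k m hx]
  congr 1
  ext i
  rw [two_pow_mul_dyadicMap, add_sub_cancel_right]

lemma measurable_splineOf {n l : ℕ} (hl : 1 ≤ l) (k : ℕ) (β : (Fin n → ℤ) → ℝ) :
    Measurable (splineOf (n := n) l k β) := by
  have h1 : Measurable fun z : (Fin n → ℤ) × (Fin n → ℝ) =>
      tpoly (localC (l := l) β z.1) (fun i => 2 ^ k * z.2 i - z.1 i) := by
    refine measurable_from_prod_countable_right fun m => ?_
    have h2 : Measurable fun (y : Fin n → ℝ) (i : Fin n) => 2 ^ k * y i - (m i : ℝ) := by fun_prop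
    exact (measurable_tpoly (localC (l := l) β m)).comp h2
  have h3 : Measurable fun y : Fin n → ℝ => (cell k y, y) := (measurable_cell k).prodMk measurable_id
  have h4 := h1.comp h3
  refine (congrArg Measurable (funext fun y => ?_)).mp h4
  exact (splineOf_eq_tpoly hl k β y).symm

lemma zero_mem_intBox (n R : ℕ) : (0 : Fin n → ℤ) ∈ intBox n R :=
  mem_intBox.2 fun i => by simp

/-- The coefficients of a spline are controlled by its local norms. -/
lemma exists_abs_coeff_le (n l : ℕ) (hl : 1 ≤ l) {r : ℝ≥0∞} (hr : r ≠ 0) : ∃ C : ℝ≥0,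
    ∀ c : (Fin n → Fin l) → ℝ,
      ENNReal.ofReal |lamC l c| ≤ C * eLpNorm (tpoly c) r (volume.restrict (ucube n)) := by
  obtain ⟨C₁, hC₁0, hC₁⟩ := exists_abs_lamC_le n l
  obtain ⟨C₂, hC₂⟩ := exists_norm_le_eLpNorm_tpoly n l hl hr one_pos 0
  refine ⟨C₁.toNNReal * C₂, fun c => ?_⟩
  calc ENNReal.ofReal |lamC l c| ≤ ENNReal.ofReal (C₁ * ‖c‖) := ENNReal.ofReal_le_ofReal (hC₁ c)
    _ = C₁.toNNReal * ENNReal.ofReal ‖c‖ := by rw [ENNReal.ofReal_mul hC₁0]; rfl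
    _ ≤ C₁.toNNReal * (C₂ * eLpNorm (tpoly c) r (volume.restrict (box 0 1))) :=
        mul_le_mul' le_rfl (hC₂ 0 (fun i => by simp) c)
    _ = _ := by rw [ENNReal.coe_mul, mul_assoc]; rfl

/-- The norm of a spline on a cell is controlled by the neighbouring coefficients. -/
lemma exists_eLpNorm_localC_le (n l : ℕ) (r : ℝ≥0∞) : ∃ C : ℝ≥0,
    ∀ (β : (Fin n → ℤ) → ℝ) (m : Fin n → ℤ),
      eLpNorm (tpoly (localC (l := l) β m)) r (volume.restrict (ucube n)) ≤
        C * ∑ e ∈ intBox n l, ENNReal.ofReal |β (m + e)| := by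
  obtain ⟨C₁, hC₁⟩ := eLpNorm_tpoly_le n l r
  obtain ⟨C₂, hC₂0, hC₂⟩ := exists_norm_localC_le n l
  refine ⟨C₁ * C₂.toNNReal, fun β m => ?_⟩
  calc _ ≤ C₁ * ENNReal.ofReal ‖localC (l := l) β m‖ := hC₁ _
    _ ≤ C₁ * ENNReal.ofReal (C₂ * ∑ e ∈ intBox n l, |β (m + e)|) :=
        mul_le_mul' le_rfl (ENNReal.ofReal_le_ofReal (hC₂ β m))
    _ = _ := by
        rw [ENNReal.ofReal_mul hC₂0, ENNReal.ofReal_sum_of_nonneg fun _ _ => abs_nonneg _,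
          ENNReal.coe_mul, mul_assoc]; rfl

/-- Almost best local approximations, in the coordinates of the cell. -/
lemma IsAlmostBest.exists_tpoly {n l : ℕ} (hl : 1 ≤ l) {r : ℝ≥0∞} {A : ℝ} {φ : (Fin n → ℝ) → ℝ}
    {k : ℕ} {m : Fin n → ℤ} {P : MvPolynomial (Fin n) ℝ}
    (h : IsAlmostBest l r A φ (dyadicCube k m) P) :
    ∃ c : (Fin n → Fin l) → ℝ, (∀ x, MvPolynomial.eval (dyadicMap k m x) P = tpoly c x) ∧
      ∀ c' : (Fin n → Fin l) → ℝ,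
        eLpNorm (fun x => φ (dyadicMap k m x) - tpoly c x) r (volume.restrict (ucube n)) ≤
          ENNReal.ofReal A *
            eLpNorm (fun x => φ (dyadicMap k m x) - tpoly c' x) r (volume.restrict (ucube n)) := by
  obtain ⟨c₀, rfl⟩ := exists_toMv hl h.1
  refine ⟨affC ((2 ^ k)⁻¹) (fun i => m i / 2 ^ k) c₀, fun x => ?_, fun c' => ?_⟩
  · rw [eval_toMv, tpoly_affC]
    congr 1; ext i; rw [dyadicMap]; ring
  · have e1 : ∀ x, tpoly (affC ((2 ^ k)⁻¹) (fun i => m i / 2 ^ k) c₀) x =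
        MvPolynomial.eval (dyadicMap k m x) (toMv c₀) := fun x => by
      rw [eval_toMv, tpoly_affC]
      congr 1; ext i; rw [dyadicMap]; ring
    have e2 : ∀ x, tpoly c' x = MvPolynomial.eval (dyadicMap k m x)
        (toMv (affC (2 ^ k) (fun i => -(m i : ℝ)) c')) := fun x => by
      rw [eval_toMv, tpoly_affC]
      congr 1; ext i; rw [two_pow_mul_dyadicMap]; ring
    simp_rw [e1, e2]
    rw [← preimage_dyadicMap_dyadicCube k m]
    rw [eLpNorm_dyadicMap k m (fun y => φ y - MvPolynomial.eval y (toMv c₀)),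
      eLpNorm_dyadicMap k m (fun y => φ y - MvPolynomial.eval y _), mul_left_comm]
    refine mul_le_mul' le_rfl (h.2.trans (mul_le_mul' le_rfl ?_))
    exact iInf₂_le _ (degreeOf_toMv hl _)

lemma piecewisePoly_dyadicMap {n : ℕ} (k : ℕ) (P : (Fin n → ℤ) → MvPolynomial (Fin n) ℝ)
    (m : Fin n → ℤ) {x : Fin n → ℝ} (hx : x ∈ ucube n) :
    piecewisePoly k P (dyadicMap k m x) = MvPolynomial.eval (dyadicMap k m x) (P m) := by
  rw [piecewisePoly, tsum_eq_single m]
  · exact Set.indicator_of_mem ((dyadicMap_mem_dyadicCube k m).2 hx) _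
  · intro m' hm'
    refine Set.indicator_of_notMem (fun h => hm' ?_) _
    have e : dyadicMap k m x = dyadicMap k m' (fun i => x i + m i - m' i) := by
      ext i; simp [dyadicMap]
    rw [e, dyadicMap_mem_dyadicCube] at h
    rw [← cell_dyadicMap k m' (ucube_subset_hcube n h), ← e, cell_dyadicMap k m (ucube_subset_hcube n hx)]

lemma le_mul_bestSpline {n l : ℕ} {p r : ℝ≥0∞} {τ : ℕ → (Fin n → ℤ) → ℝ≥0∞} {k : ℕ}
    {φ : (Fin n → ℝ) → ℝ} {X : ℝ≥0∞} {C : ℝ≥0}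
    (h : ∀ S ∈ splineSpace n l k, X ≤ C * approxError p r τ k φ S) :
    X ≤ C * bestSpline l p r τ k φ := by
  by_cases hC : C = 0
  · have := h (splineOf l k 0) ⟨0, rfl⟩
    subst hC
    simpa using this
  · have hC' : (C : ℝ≥0∞) ≠ 0 := by exact_mod_cast hC
    rw [mul_comm, ← ENNReal.div_le_iff hC' ENNReal.coe_ne_top, bestSpline]
    refine le_iInf₂ fun S hS => ?_
    rw [ENNReal.div_le_iff hC' ENNReal.coe_ne_top, mul_comm]
    exact h S hS

/-- The quasi-interpolant is an almost best spline approximation. -/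
lemma exists_approxError_quasiApprox_le (n l : ℕ) (hl : 1 ≤ l) {p r : ℝ≥0∞} (hp : p ≠ 0) (hr : r ≠ 0)
    (D : ℝ≥0) (A : ℝ) : ∃ C : ℝ≥0, ∀ (τ : ℕ → (Fin n → ℤ) → ℝ≥0∞) (k : ℕ)
      (_ : ∀ m, ∀ e ∈ intBox n l, τ k m ≤ D * τ k (m + e)) (φ : (Fin n → ℝ) → ℝ) (_ : Measurable φ)
      (P : (Fin n → ℤ) → MvPolynomial (Fin n) ℝ)
      (_ : ∀ m, IsAlmostBest l r A φ (dyadicCube k m) (P m)),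
      approxError p r τ k φ (quasiApprox l k P) ≤ C * bestSpline l p r τ k φ := by
  obtain ⟨C₁, hC₁⟩ := exists_abs_coeff_le n l hl hr
  obtain ⟨C₂, hC₂⟩ := exists_eLpNorm_localC_le n l r
  set K : ℝ≥0 := quasiC r 1 * (1 + C₂ * (C₁ * (quasiC r 1 * (1 + A.toNNReal)))) with hK
  refine ⟨lqC p (intBox n l).card * (K * D * (intBox n l).card), fun τ k hτ φ hφ P hP => ?_⟩
  refine le_mul_bestSpline fun S hS => ?_
  obtain ⟨β, rfl⟩ := hS
  choose c hc hcb using fun m => (hP m).exists_tpoly hl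
  rw [approxError_eq, approxError_eq]
  refine lqNorm_neighbour_le hp l D K hτ fun m => ?_
  set F := cellNorm r k (fun x => φ x - splineOf l k β x) with hF
  have hα : ∀ m, quasiCoeff l k m (piecewisePoly k P) = lamC l (c m) := fun m =>
    quasiCoeff_eq_lamC k m (c m) fun x hx => by rw [piecewisePoly_dyadicMap k P m hx, hc]
  have hmeas : ∀ m, Measurable fun x => φ (dyadicMap k m x) := fun m => hφ.comp (measurable_dyadicMap k m)
  have hdiff : ∀ m', ENNReal.ofReal |lamC l (c m') - β m'| ≤
      C₁ * (quasiC r 1 * ((1 + A.toNNReal) * F m')) := by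
    intro m'
    rw [← lamC_localC hl β m', ← map_sub]
    refine (hC₁ _).trans (mul_le_mul' le_rfl ?_)
    have e : tpoly (c m' - localC β m') = fun x => (φ (dyadicMap k m' x) - tpoly (localC (l := l) β m') x) -
        (φ (dyadicMap k m' x) - tpoly (c m') x) := by
      ext x; rw [tpoly_sub]; ring
    rw [e]
    refine (eLpNorm_sub_le_quasi r ((hmeas m').sub (measurable_tpoly _)).aestronglyMeasurable
      ((hmeas m').sub (measurable_tpoly _)).aestronglyMeasurable).trans (mul_le_mul' le_rfl ?_)
    rw [add_mul, one_mul, hF, cellNorm_sub_splineOf hl]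
    exact add_le_add le_rfl (hcb m' _)
  have e : ∀ x ∈ hcube n, φ (dyadicMap k m x) - quasiApprox l k P (dyadicMap k m x) =
      (φ (dyadicMap k m x) - tpoly (localC (l := l) β m) x) -
        tpoly (localC (l := l) (fun m => lamC l (c m) - β m) m) x := by
    intro x hx
    rw [quasiApprox, quasiInterpolant, splineOf_dyadicMap hl k _ m hx, localC_sub, tpoly_sub]
    simp_rw [hα]
    ring
  rw [cellNorm, eLpNorm_congr_ae (ae_restrict_ucube_of_hcube e)]
  refine (eLpNorm_sub_le_quasi r ((hmeas m).sub (measurable_tpoly _)).aestronglyMeasurable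
      (measurable_tpoly _).aestronglyMeasurable).trans ?_
  rw [hK, ENNReal.coe_mul, mul_assoc]
  refine mul_le_mul' le_rfl ?_
  rw [ENNReal.coe_add, add_mul, ENNReal.coe_one, one_mul]
  refine add_le_add ?_ ?_
  · refine (cellNorm_sub_splineOf hl r k φ β m).symm.le.trans ?_
    have := Finset.single_le_sum (f := fun e : Fin n → ℤ => F (m + e)) (fun _ _ => zero_le)
      (zero_mem_intBox n l)
    simpa using this
  · refine (hC₂ _ m).trans ?_
    rw [ENNReal.coe_mul, mul_assoc]
    refine mul_le_mul' le_rfl ?_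
    rw [Finset.mul_sum]
    refine (Finset.sum_le_sum fun e _ => (hdiff _).trans (le_of_eq ?_))
    push_cast
    ring

/-! ### Decomposition of weighted norms over dyadic cubes -/

lemma measurableSet_dyadicCube {n : ℕ} (k : ℕ) (m : Fin n → ℤ) : MeasurableSet (dyadicCube k m) :=
  (isOpen_dyadicCube k m).measurableSet

lemma exists_mem_ucube_eq_dyadicMap {n : ℕ} {k : ℕ} {m : Fin n → ℤ} {y : Fin n → ℝ}
    (hy : y ∈ dyadicCube k m) : ∃ x ∈ ucube n, dyadicMap k m x = y := by
  have e : dyadicMap k m (fun i => 2 ^ k * y i - m i) = y := by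
    ext i; rw [dyadicMap]; field_simp; ring
  refine ⟨_, ?_, e⟩
  rwa [← dyadicMap_mem_dyadicCube k m, e]

lemma cell_eq_of_mem_dyadicCube {n : ℕ} {k : ℕ} {m : Fin n → ℤ} {y : Fin n → ℝ}
    (hy : y ∈ dyadicCube k m) : cell k y = m := by
  obtain ⟨x, hx, rfl⟩ := exists_mem_ucube_eq_dyadicMap hy
  exact cell_dyadicMap k m (ucube_subset_hcube n hx)

lemma pairwise_disjoint_dyadicCube {n : ℕ} (k : ℕ) :
    Pairwise (Function.onFun Disjoint (dyadicCube k : (Fin n → ℤ) → Set (Fin n → ℝ))) := by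
  intro m m' hm
  refine Set.disjoint_left.2 fun y hy hy' => hm ?_
  rw [← cell_eq_of_mem_dyadicCube hy, cell_eq_of_mem_dyadicCube hy']

lemma ae_exists_mem_dyadicCube {n : ℕ} (k : ℕ) :
    ∀ᵐ y : Fin n → ℝ, y ∈ dyadicCube k (cell k y) := by
  have h : ∀ (i : Fin n) (z : ℤ), ∀ᵐ y : Fin n → ℝ, y i ≠ (z : ℝ) / 2 ^ k := by
    intro i z
    have := (Measure.ae_eval_ne (μ := fun _ : Fin n => (volume : Measure ℝ)) i ((z : ℝ) / 2 ^ k))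
    rwa [← volume_pi] at this
  have h2 : ∀ᵐ y : Fin n → ℝ, ∀ (i : Fin n) (z : ℤ), y i ≠ (z : ℝ) / 2 ^ k :=
    ae_all_iff.2 fun i => ae_all_iff.2 (h i)
  filter_upwards [h2] with y hy i
  have h3 : ((cell k y i : ℤ) : ℝ) ≤ 2 ^ k * y i := Int.floor_le _
  have h4 : 2 ^ k * y i < cell k y i + 1 := Int.lt_floor_add_one _
  constructor
  · rw [div_lt_iff₀' (by positivity)]
    refine lt_of_le_of_ne h3 fun h => hy i (cell k y i) ?_
    rw [h]; field_simp
  · rwa [lt_div_iff₀' (by positivity)]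

lemma eLpNorm_ennreal_rpow {α : Type} [MeasurableSpace α] {μ : Measure α} {p : ℝ≥0∞} (hp : p ≠ 0)
    (hp' : p ≠ ∞) (f : α → ℝ≥0∞) : eLpNorm f p μ ^ p.toReal = ∫⁻ x, f x ^ p.toReal ∂μ := by
  rw [eLpNorm_eq_lintegral_rpow_enorm_toReal hp hp', ← ENNReal.rpow_mul, one_div,
    inv_mul_cancel₀ (toReal_pos' hp hp').ne', ENNReal.rpow_one]
  simp

lemma eLpNorm_weight_rpow {α : Type} [MeasurableSpace α] {μ : Measure α} {p : ℝ≥0∞} (hp : p ≠ 0)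
    (hp' : p ≠ ∞) {t : α → ℝ} (ht : ∀ x, 0 < t x) :
    eLpNorm t p μ ^ p.toReal = ∫⁻ x, ENNReal.ofReal (t x) ^ p.toReal ∂μ := by
  rw [eLpNorm_eq_lintegral_rpow_enorm_toReal hp hp', ← ENNReal.rpow_mul, one_div,
    inv_mul_cancel₀ (toReal_pos' hp hp').ne', ENNReal.rpow_one]
  simp_rw [Real.enorm_eq_ofReal (ht _).le]

lemma lqNorm_le_eLpNorm {n : ℕ} {p : ℝ≥0∞} (hp : p ≠ 0) (hp' : p ≠ ∞) (k : ℕ)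
    {t : (Fin n → ℝ) → ℝ} (ht : IsWeight t) {G : (Fin n → ℝ) → ℝ≥0∞} {I : (Fin n → ℤ) → ℝ≥0∞}
    (h : ∀ m, ∀ x ∈ dyadicCube k m, I m ≤ G x) :
    lqNorm p (fun m => eLpNorm t p (volume.restrict (dyadicCube k m)) * I m) ≤
      eLpNorm (fun x => ENNReal.ofReal (t x) * G x) p volume := by
  have h0 := toReal_pos' hp hp'
  rw [← ENNReal.rpow_le_rpow_iff h0, lqNorm_rpow hp hp', eLpNorm_ennreal_rpow hp hp']
  have hm : Measurable fun x => ENNReal.ofReal (t x) ^ p.toReal := ht.1.ennreal_ofReal.pow_const _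
  calc ∑' m, (eLpNorm t p (volume.restrict (dyadicCube k m)) * I m) ^ p.toReal
      ≤ ∑' m, ∫⁻ x in dyadicCube k m, (ENNReal.ofReal (t x) * G x) ^ p.toReal := by
        refine ENNReal.tsum_le_tsum fun m => ?_
        rw [ENNReal.mul_rpow_of_nonneg _ _ h0.le, eLpNorm_weight_rpow hp hp' ht.2,
          ← lintegral_mul_const _ hm]
        refine lintegral_mono_ae ((ae_restrict_iff' (measurableSet_dyadicCube k m)).2
          (ae_of_all _ fun x hx => ?_))
        rw [← ENNReal.mul_rpow_of_nonneg _ _ h0.le]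
        exact ENNReal.rpow_le_rpow (mul_le_mul' le_rfl (h m x hx)) h0.le
    _ = ∫⁻ x in ⋃ m, dyadicCube k m, (ENNReal.ofReal (t x) * G x) ^ p.toReal :=
        (lintegral_iUnion (measurableSet_dyadicCube k) (pairwise_disjoint_dyadicCube k) _).symm
    _ ≤ _ := setLIntegral_le_lintegral _ _

lemma eLpNorm_le_lqNorm {n : ℕ} {p : ℝ≥0∞} (hp : p ≠ 0) (hp' : p ≠ ∞) (k : ℕ)
    {t : (Fin n → ℝ) → ℝ} (ht : IsWeight t) {G : (Fin n → ℝ) → ℝ≥0∞} {I : (Fin n → ℤ) → ℝ≥0∞}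
    (h : ∀ m, ∀ x ∈ dyadicCube k m, G x ≤ I m) :
    eLpNorm (fun x => ENNReal.ofReal (t x) * G x) p volume ≤
      lqNorm p (fun m => eLpNorm t p (volume.restrict (dyadicCube k m)) * I m) := by
  have h0 := toReal_pos' hp hp'
  rw [← ENNReal.rpow_le_rpow_iff h0, lqNorm_rpow hp hp', eLpNorm_ennreal_rpow hp hp']
  have hm : Measurable fun x => ENNReal.ofReal (t x) ^ p.toReal := ht.1.ennreal_ofReal.pow_const _
  have hae : (⋃ m, dyadicCube k m : Set (Fin n → ℝ)) =ᵐ[volume] Set.univ := by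
    rw [Filter.eventuallyEq_univ]
    filter_upwards [ae_exists_mem_dyadicCube k] with y hy
    exact Set.mem_iUnion.2 ⟨_, hy⟩
  calc ∫⁻ x, (ENNReal.ofReal (t x) * G x) ^ p.toReal
      = ∫⁻ x in ⋃ m, dyadicCube k m, (ENNReal.ofReal (t x) * G x) ^ p.toReal := by
        rw [Measure.restrict_congr_set hae, Measure.restrict_univ]
    _ = ∑' m, ∫⁻ x in dyadicCube k m, (ENNReal.ofReal (t x) * G x) ^ p.toReal :=
        lintegral_iUnion (measurableSet_dyadicCube k) (pairwise_disjoint_dyadicCube k) _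
    _ ≤ _ := by
        refine ENNReal.tsum_le_tsum fun m => ?_
        rw [ENNReal.mul_rpow_of_nonneg _ _ h0.le, eLpNorm_weight_rpow hp hp' ht.2,
          ← lintegral_mul_const _ hm]
        refine lintegral_mono_ae ((ae_restrict_iff' (measurableSet_dyadicCube k m)).2
          (ae_of_all _ fun x hx => ?_))
        rw [← ENNReal.mul_rpow_of_nonneg _ _ h0.le]
        exact ENNReal.rpow_le_rpow (mul_le_mul' le_rfl (h m x hx)) h0.le

/-! ### Spline approximation by averaged differences -/

/-- The infimum over a cell of the averaged differences. -/
def cellDiff {n : ℕ} (l : ℕ) (r : ℝ≥0∞) (k : ℕ) (φ : (Fin n → ℝ) → ℝ) (m : Fin n → ℤ) : ℝ≥0∞ :=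
  ⨅ x ∈ ucube n, avgDiff l r (fun y => φ (dyadicMap k m y)) x 2

lemma le_mul_iInf₂ {α : Type} {s : Set α} (hs : s.Nonempty) {X : ℝ≥0∞} {C : ℝ≥0} {f : α → ℝ≥0∞}
    (h : ∀ x ∈ s, X ≤ C * f x) : X ≤ C * ⨅ x ∈ s, f x := by
  by_cases hC : C = 0
  · obtain ⟨x, hx⟩ := hs
    have := h x hx
    subst hC
    simpa using this
  · have hC' : (C : ℝ≥0∞) ≠ 0 := by exact_mod_cast hC
    rw [mul_comm, ← ENNReal.div_le_iff hC' ENNReal.coe_ne_top]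
    refine le_iInf₂ fun S hS => ?_
    rw [ENNReal.div_le_iff hC' ENNReal.coe_ne_top, mul_comm]
    exact h S hS

lemma ucube_nonempty (n : ℕ) : (ucube n).Nonempty :=
  ⟨fun _ => 1 / 2, mem_ucube.2 fun i => by norm_num⟩

lemma dyadicMap_add_single {n : ℕ} (k : ℕ) (m : Fin n → ℤ) (i : Fin n) (x : Fin n → ℝ) :
    dyadicMap k m (x + (Pi.single i 1 : Fin n → ℝ)) = dyadicMap k (m + Pi.single i 1) x := by
  ext j
  by_cases hj : j = i
  · subst hj; simp [dyadicMap]; ring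
  · simp [dyadicMap, Pi.single_eq_of_ne hj]

lemma sum_comp_le_sum_intBox {n l : ℕ} (F : (Fin n → ℤ) → ℝ≥0∞) (a : Fin n → Fin (l + 1)) :
    ∑ b : Fin n → Fin (l + 1), F (fun i => ((b i : ℕ) : ℤ) - ((a i : ℕ) : ℤ)) ≤
      ∑ e ∈ intBox n l, F e := by
  classical
  rw [← Finset.sum_image (s := Finset.univ) (f := F)
    (g := fun (b : Fin n → Fin (l + 1)) (i : Fin n) => ((b i : ℕ) : ℤ) - ((a i : ℕ) : ℤ))]
  · refine Finset.sum_le_sum_of_subset fun e he => ?_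
    obtain ⟨b, -, rfl⟩ := Finset.mem_image.1 he
    refine mem_intBox.2 fun i => abs_le.2 ⟨?_, ?_⟩
    · have := (a i).2; omega
    · have := (b i).2; omega
  · intro b _ b' _ h
    ext i
    have := congrFun h i
    beta_reduce at this
    omega

lemma exists_spline_cellNorm_sub_le (n l : ℕ) (hl : 1 ≤ l) {r : ℝ≥0∞} (hr : r ≠ 0) :
    ∃ C : ℝ≥0, ∀ (k : ℕ) (φ : (Fin n → ℝ) → ℝ), Measurable φ →
      (∀ m, eLpNorm (fun x => φ (dyadicMap k m x)) r (volume.restrict (ucube n)) ≠ ∞) →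
      ∃ β : (Fin n → ℤ) → ℝ, ∀ m, cellNorm r k (fun x => φ x - splineOf l k β x) m ≤
        C * ∑ e ∈ intBox n l, cellDiff l r k φ (m + e) := by
  obtain ⟨C₁, hC₁⟩ := exists_tpoly_sub_le_avgDiff n l hl hr
  obtain ⟨C₂, hC₂⟩ := exists_norm_sub_shiftC_le n l hl hr
  obtain ⟨C₃, hC₃⟩ := exists_norm_sub_shiftC_chain n l hl l
  obtain ⟨C₄, hC₄0, hC₄⟩ := exists_norm_shiftC_le n l l
  obtain ⟨C₅, hC₅0, hC₅⟩ := exists_abs_lamC_le n l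
  obtain ⟨C₆, hC₆⟩ := eLpNorm_tpoly_le n l r
  set K₁ : ℝ≥0 := C₂ * (1 + C₁ + C₁) with hK₁
  set K₂ : ℝ≥0 := ∑ a : Fin n → Fin l, C₅.toNNReal * C₄.toNNReal * C₃ * ‖pieceC l a‖₊ with hK₂
  refine ⟨quasiC r 1 * (C₁ + C₆ * (K₂ * K₁)), fun k φ hφ hfin => ?_⟩
  have hmeas : ∀ m, Measurable fun x => φ (dyadicMap k m x) := fun m => hφ.comp (measurable_dyadicMap k m)
  choose c hc using fun m => hC₁ (fun x => φ (dyadicMap k m x)) (hmeas m) (hfin m)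
  set I := cellDiff l r k φ with hI
  have hcI : ∀ m, eLpNorm (fun x => φ (dyadicMap k m x) - tpoly (c m) x) r
      (volume.restrict (ucube n)) ≤ C₁ * I m := fun m => le_mul_iInf₂ (ucube_nonempty n) (hc m)
  have hadj : ∀ (m : Fin n → ℤ) (i : Fin n),
      ENNReal.ofReal ‖c (m + Pi.single i 1) - shiftC (Pi.single i 1) (c m)‖ ≤
        K₁ * I m + K₁ * I (m + Pi.single i 1) := by
    intro m i
    have h1 : ENNReal.ofReal ‖c (m + Pi.single i 1) - shiftC (Pi.single i 1) (c m)‖ ≤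
        C₂ * (I m + C₁ * I m + C₁ * I (m + Pi.single i 1)) := by
      have h2 : ∀ x ∈ ucube n,
          ENNReal.ofReal ‖c (m + Pi.single i 1) - shiftC (Pi.single i 1) (c m)‖ ≤
          C₂ * (avgDiff l r (fun y => φ (dyadicMap k m y)) x 2 +
            (C₁ * I m + C₁ * I (m + Pi.single i 1))) := by
        intro x hx
        refine (hC₂ _ (hmeas m) i (c m) (c (m + Pi.single i 1)) x hx).trans ?_
        rw [add_assoc]
        refine mul_le_mul' le_rfl (add_le_add le_rfl (add_le_add (hcI m) ?_))
        simp_rw [dyadicMap_add_single]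
        exact hcI _
      refine (le_mul_iInf₂ (ucube_nonempty n) h2).trans (mul_le_mul' le_rfl ?_)
      rw [add_assoc, hI, cellDiff]
      have : Nonempty (ucube n) := (ucube_nonempty n).to_subtype
      rw [iInf_subtype', iInf_subtype', ENNReal.iInf_add]
    refine h1.trans ?_
    have h3 : (C₂ : ℝ≥0∞) * (I m + C₁ * I m + C₁ * I (m + Pi.single i 1)) =
        C₂ * (1 + C₁) * I m + C₂ * C₁ * I (m + Pi.single i 1) := by ring
    rw [h3, hK₁]
    push_cast
    refine add_le_add (mul_le_mul' (mul_le_mul' le_rfl ?_) le_rfl)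
      (mul_le_mul' (mul_le_mul' le_rfl ?_) le_rfl)
    · exact le_self_add
    · exact le_add_self
  have hchain := hC₃ c (fun m => K₁ * I m) hadj
  have hcoef : ∀ (m : Fin n → ℤ) (a : Fin n → Fin l),
      ENNReal.ofReal |lamC l (c fun i => m i - ((a i : ℕ) : ℤ)) -
        lamC l (shiftC (fun i => -((a i : ℕ) : ℝ)) (c m))| ≤
      (C₅.toNNReal * C₄.toNNReal * C₃ : ℝ≥0) * (K₁ * ∑ e ∈ intBox n l, I (m + e)) := by
    intro m a
    set M : Fin n → ℤ := fun i => m i - ((a i : ℕ) : ℤ) with hM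
    set a' : Fin n → Fin (l + 1) := fun i => (a i).castSucc with ha'
    have e1 : (M + fun i => ((a' i : ℕ) : ℤ)) = m := by ext i; simp [hM, ha']
    have e2 : (fun i => ((a' i : ℕ) : ℝ)) + (fun i => -((a i : ℕ) : ℝ)) = 0 := by
      ext i; simp [ha']
    have h1 := hchain M a'
    rw [e1] at h1
    have h2 : c M - shiftC (fun i => -((a i : ℕ) : ℝ)) (c m) =
        -shiftC (fun i => -((a i : ℕ) : ℝ)) (c m - shiftC (fun i => ((a' i : ℕ) : ℝ)) (c M)) := by
      rw [shiftC_sub hl, shiftC_shiftC hl, e2, shiftC_zero hl, neg_sub]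
    have h3 : |lamC l (c M) - lamC l (shiftC (fun i => -((a i : ℕ) : ℝ)) (c m))| ≤
        C₅ * (C₄ * ‖c m - shiftC (fun i => ((a' i : ℕ) : ℝ)) (c M)‖) := by
      rw [← map_sub, h2]
      refine (hC₅ _).trans (mul_le_mul_of_nonneg_left ?_ hC₅0)
      rw [norm_neg]
      refine hC₄ _ (fun i => ?_) _
      rw [abs_neg, Nat.abs_cast]
      exact_mod_cast (a i).2.le
    refine (ENNReal.ofReal_le_ofReal h3).trans ?_
    rw [ENNReal.ofReal_mul hC₅0, ENNReal.ofReal_mul hC₄0, ENNReal.coe_mul, ENNReal.coe_mul, mul_assoc,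
      mul_assoc]
    refine mul_le_mul' le_rfl (mul_le_mul' le_rfl (h1.trans (mul_le_mul' le_rfl ?_)))
    rw [← Finset.mul_sum]
    refine mul_le_mul' le_rfl ?_
    refine le_trans (le_of_eq ?_) (sum_comp_le_sum_intBox (fun e => I (m + e)) a')
    refine Finset.sum_congr rfl fun b _ => ?_
    congr 1
    ext i
    simp [hM, ha']
    ring
  refine ⟨fun m => lamC l (c m), fun m => ?_⟩
  rw [cellNorm_sub_splineOf hl]
  have hnorm : ENNReal.ofReal ‖localC (l := l) (fun m => lamC l (c m)) m - c m‖ ≤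
      K₂ * (K₁ * ∑ e ∈ intBox n l, I (m + e)) := by
    have e1 : localC (l := l) (fun m => lamC l (c m)) m - c m = ∑ a : Fin n → Fin l,
        (lamC l (c fun i => m i - ((a i : ℕ) : ℤ)) -
          lamC l (shiftC (fun i => -((a i : ℕ) : ℝ)) (c m))) • pieceC l a := by
      conv_lhs => rw [eq_sum_lamC_shiftC hl (c m)]
      rw [localC, ← Finset.sum_sub_distrib]
      exact Finset.sum_congr rfl fun a _ => (sub_smul _ _ _).symm
    rw [e1]
    refine (ENNReal.ofReal_le_ofReal (norm_sum_le _ _)).trans ?_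
    rw [ENNReal.ofReal_sum_of_nonneg fun _ _ => norm_nonneg _, hK₂, ENNReal.ofNNReal_finsetSum,
      Finset.sum_mul]
    refine Finset.sum_le_sum fun a _ => ?_
    rw [norm_smul, ENNReal.ofReal_mul (norm_nonneg _), Real.norm_eq_abs, ENNReal.coe_mul,
      mul_right_comm]
    refine mul_le_mul' (hcoef m a) (le_of_eq ?_)
    rw [ofReal_norm, enorm_eq_nnnorm]
  have e : (fun x => φ (dyadicMap k m x) - tpoly (localC (l := l) (fun m => lamC l (c m)) m) x) =
      fun x => (φ (dyadicMap k m x) - tpoly (c m) x) -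
        tpoly (localC (l := l) (fun m => lamC l (c m)) m - c m) x := by
    ext x; rw [tpoly_sub]; ring
  rw [e]
  refine (eLpNorm_sub_le_quasi r ((hmeas m).sub (measurable_tpoly _)).aestronglyMeasurable
      (measurable_tpoly _).aestronglyMeasurable).trans ?_
  rw [ENNReal.coe_mul, mul_assoc]
  refine mul_le_mul' le_rfl ?_
  rw [ENNReal.coe_add, add_mul]
  refine add_le_add ?_ ?_
  · refine (hcI m).trans (mul_le_mul' le_rfl ?_)
    have := Finset.single_le_sum (f := fun e : Fin n → ℤ => I (m + e)) (fun _ _ => zero_le)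
      (zero_mem_intBox n l)
    simpa using this
  · refine (hC₆ _).trans ?_
    rw [ENNReal.coe_mul, mul_assoc, ENNReal.coe_mul, mul_assoc]
    exact mul_le_mul' le_rfl hnorm

lemma cellDiff_le {n : ℕ} (l : ℕ) (r : ℝ≥0∞) (k : ℕ) (φ : (Fin n → ℝ) → ℝ) (m : Fin n → ℤ)
    {y : Fin n → ℝ} (hy : y ∈ dyadicCube k m) : cellDiff l r k φ m ≤ avgDiff l r φ y (2 / 2 ^ k) := by
  obtain ⟨x, hx, rfl⟩ := exists_mem_ucube_eq_dyadicMap hy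
  rw [avgDiff_dyadicMap]
  exact iInf₂_le x hx

lemma MemLpLoc.cellNorm_ne_top {n : ℕ} {r : ℝ≥0∞} {φ : (Fin n → ℝ) → ℝ} (h : MemLpLoc φ r) (k : ℕ)
    (m : Fin n → ℤ) : cellNorm r k φ m ≠ ∞ := by
  rw [cellNorm_eq]
  refine ENNReal.mul_ne_top (ENNReal.rpow_ne_top_of_nonneg (by positivity) (by simp)) ?_
  have hK : IsCompact (Set.Icc (fun i => (m i : ℝ) / 2 ^ k) (fun i : Fin n => ((m i : ℝ) + 1) / 2 ^ k)) :=
    isCompact_Icc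
  refine ne_top_of_le_ne_top (h _ hK).eLpNorm_ne_top (eLpNorm_mono_measure _ (Measure.restrict_mono ?_ le_rfl))
  intro y hy
  exact ⟨fun i => (hy i).1.le, fun i => (hy i).2.le⟩

/-- `s^l_k` is bounded by the averaged differences. -/
lemma exists_bestSpline_le (n l : ℕ) (hl : 1 ≤ l) {p r : ℝ≥0∞} (hp : p ≠ 0) (hp' : p ≠ ∞)
    (hr : r ≠ 0) (D : ℝ≥0) : ∃ C : ℝ≥0, ∀ (τ : ℕ → (Fin n → ℤ) → ℝ≥0∞) (k : ℕ)
      (_ : ∀ m, ∀ e ∈ intBox n l, τ k m ≤ D * τ k (m + e)) (t : (Fin n → ℝ) → ℝ) (_ : IsWeight t)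
      (_ : ∀ m, eLpNorm t p (volume.restrict (dyadicCube k m)) = τ k m)
      (φ : (Fin n → ℝ) → ℝ) (_ : Measurable φ) (_ : MemLpLoc φ r),
      bestSpline l p r τ k φ ≤
        C * eLpNorm (fun x => ENNReal.ofReal (t x) * avgDiff l r φ x (2 / 2 ^ k)) p volume := by
  obtain ⟨K, hK⟩ := exists_spline_cellNorm_sub_le n l hl hr
  refine ⟨lqC p (intBox n l).card * (K * D * (intBox n l).card),
    fun τ k hτ t ht htτ φ hφ hφl => ?_⟩
  obtain ⟨β, hβ⟩ := hK k φ hφ fun m => hφl.cellNorm_ne_top k m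
  refine (iInf₂_le (splineOf l k β) ⟨β, rfl⟩).trans ?_
  rw [approxError_eq]
  refine (lqNorm_neighbour_le hp l D K hτ hβ).trans (mul_le_mul' le_rfl ?_)
  simp_rw [← htτ]
  exact lqNorm_le_eLpNorm hp hp' k ht fun m x hx => cellDiff_le l r k φ m hx

lemma initialTerm_le {n : ℕ} {p r : ℝ≥0∞} (hp : p ≠ 0) (hp' : p ≠ ∞)
    (τ : ℕ → (Fin n → ℤ) → ℝ≥0∞) {t : (Fin n → ℝ) → ℝ} (ht : IsWeight t)
    (htτ : ∀ m, eLpNorm t p (volume.restrict (dyadicCube 0 m)) = τ 0 m) (φ : (Fin n → ℝ) → ℝ) :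
    initialTerm p r τ φ ≤
      eLpNorm (fun x => ENNReal.ofReal (t x) * eLpNorm φ r (volume.restrict (cube x 2))) p volume := by
  rw [initialTerm]
  simp_rw [← htτ]
  refine lqNorm_le_eLpNorm hp hp' 0 ht fun m x hx => ?_
  refine eLpNorm_mono_measure _ (Measure.restrict_mono (fun y hy i => ?_) le_rfl)
  have h1 := hx i
  have h2 := hy i
  simp only [pow_zero, div_one] at h1 h2
  rw [abs_lt]
  constructor <;> linarith

lemma splineOf_zero {n l : ℕ} (k : ℕ) : splineOf (n := n) l k (fun _ => 0) = fun _ => 0 := by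
  ext y; simp [splineOf]

lemma bestSpline_zero_le {n l : ℕ} (p r : ℝ≥0∞) (τ : ℕ → (Fin n → ℤ) → ℝ≥0∞)
    (φ : (Fin n → ℝ) → ℝ) : bestSpline l p r τ 0 φ ≤ initialTerm p r τ φ := by
  refine (iInf₂_le (splineOf l 0 fun _ => 0) ⟨_, rfl⟩).trans ?_
  rw [approxError_eq, initialTerm_eq, splineOf_zero]
  simp

/-- The first inequality between the functional of best approximations and the Besov norm. -/
lemma exists_N₁_le_besovNorm (n l : ℕ) (hl : 1 ≤ l) {p q r : ℝ≥0∞} (hp : p ≠ 0) (hp' : p ≠ ∞)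
    (hq : q ≠ 0) (hr : r ≠ 0) (D : ℝ≥0) : ∃ C : ℝ≥0, ∀ (τ : ℕ → (Fin n → ℤ) → ℝ≥0∞)
      (_ : ∀ k m, ∀ e ∈ intBox n l, τ k m ≤ D * τ k (m + e)) (t : ℕ → (Fin n → ℝ) → ℝ)
      (_ : ∀ k, IsWeight (t k)) (_ : ∀ k m, assoc p t k m = τ k m)
      (φ : (Fin n → ℝ) → ℝ) (_ : Measurable φ) (_ : MemLpLoc φ r),
      N₁ l p q r τ φ ≤ C * besovNorm l p q r t φ := by
  obtain ⟨K, hK⟩ := exists_bestSpline_le n l hl hp hp' hr D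
  refine ⟨lqC q 2 * (1 + lqC q 2 * (1 + K)), fun τ hτ t ht htτ φ hφ hφl => ?_⟩
  rw [N₁, besovNorm]
  set X := lqNorm q fun k : ℕ =>
      eLpNorm (fun x => ENNReal.ofReal (t (k + 1) x) * avgDiff l r φ x (2 / 2 ^ (k + 1))) p volume
  set Y := eLpNorm (fun x => ENNReal.ofReal (t 0 x) * eLpNorm φ r (volume.restrict (cube x 2))) p volume
  have h0 : initialTerm p r τ φ ≤ Y := initialTerm_le hp hp' τ (ht 0) (htτ 0) φ
  have h1 : lqNorm q (fun k => bestSpline l p r τ k φ) ≤ lqC q 2 * (Y + K * X) := by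
    refine (lqNorm_cons_le hq _).trans (mul_le_mul' le_rfl
      (add_le_add ((bestSpline_zero_le p r τ φ).trans h0) ?_))
    rw [← lqNorm_const_mul hq]
    exact lqNorm_mono fun k => hK τ (k + 1) (hτ _) (t (k + 1)) (ht _) (htτ _) φ hφ hφl
  refine (lqNorm_cons_le hq _).trans ?_
  rw [ENNReal.coe_mul, mul_assoc]
  refine mul_le_mul' le_rfl ?_
  calc _ ≤ Y + lqC q 2 * (Y + K * X) := add_le_add h0 h1
    _ ≤ (X + Y) + lqC q 2 * ((X + Y) + K * (X + Y)) := by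
        refine add_le_add le_add_self (mul_le_mul' le_rfl (add_le_add le_add_self
          (mul_le_mul' le_rfl le_self_add)))
    _ = _ := by push_cast; ring

/-- The functionals of best approximations and of quasi-interpolants are equivalent. -/
lemma exists_N₁_le_N₂_le (n l : ℕ) (hl : 1 ≤ l) {p q r : ℝ≥0∞} (hp : p ≠ 0)
    (hq : q ≠ 0) (hr : r ≠ 0) (D : ℝ≥0) (A : ℝ) : ∃ C : ℝ≥0, ∀ (τ : ℕ → (Fin n → ℤ) → ℝ≥0∞)
      (_ : ∀ k m, ∀ e ∈ intBox n l, τ k m ≤ D * τ k (m + e))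
      (φ : (Fin n → ℝ) → ℝ) (_ : Measurable φ) (P : ℕ → (Fin n → ℤ) → MvPolynomial (Fin n) ℝ)
      (_ : ∀ k m, IsAlmostBest l r A φ (dyadicCube k m) (P k m)),
      N₁ l p q r τ φ ≤ C * N₂ l p q r τ P φ ∧ N₂ l p q r τ P φ ≤ C * N₁ l p q r τ φ := by
  obtain ⟨K, hK⟩ := exists_approxError_quasiApprox_le n l hl hp hr D A
  refine ⟨max (lqC q 2) (K + 1), fun τ hτ φ hφ P hP => ⟨?_, ?_⟩⟩
  · refine (lqNorm_cons_le hq _).trans (mul_le_mul' (by exact_mod_cast le_max_left _ _) ?_)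
    rw [N₂, add_comm]
    refine add_le_add (lqNorm_mono fun k => ?_) le_rfl
    exact iInf₂_le _ ⟨_, rfl⟩
  · refine le_trans ?_ (mul_le_mul' (ENNReal.coe_le_coe.2 (le_max_right (lqC q 2) (K + 1))) le_rfl)
    rw [N₂, ENNReal.coe_add, add_mul]
    refine add_le_add ?_ ?_
    · refine (lqNorm_mono fun k => hK τ k (hτ k) φ hφ (P k) (hP k)).trans ?_
      rw [lqNorm_const_mul hq]
      refine mul_le_mul' le_rfl ?_
      rw [N₁]
      exact lqNorm_comp_le (f := fun k : ℕ => k + 1) (add_left_injective 1) (fun j : ℕ => match j with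
        | 0 => initialTerm p r τ φ
        | k + 1 => bestSpline l p r τ k φ)
    · rw [ENNReal.coe_one, one_mul, N₁]
      exact le_lqNorm hq (fun j : ℕ => match j with
        | 0 => initialTerm p r τ φ
        | k + 1 => bestSpline l p r τ k φ) 0

/-! ### Averaged differences of sums of splines -/

lemma dyadicMap_dyadicMap_zero {n : ℕ} (k : ℕ) (m e : Fin n → ℤ) (x : Fin n → ℝ) :
    dyadicMap k m (dyadicMap 0 e x) = dyadicMap k (m + e) x := by
  ext i; simp [dyadicMap]; ring

lemma cellNorm_dyadicMap {n : ℕ} (r : ℝ≥0∞) (k : ℕ) (φ : (Fin n → ℝ) → ℝ) (m e : Fin n → ℤ) :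
    cellNorm r 0 (fun y => φ (dyadicMap k m y)) e = cellNorm r k φ (m + e) := by
  rw [cellNorm, cellNorm]
  simp_rw [dyadicMap_dyadicMap_zero]

lemma eLpNorm_le_sum_cellNorm {n : ℕ} (r : ℝ≥0∞) (R : ℕ) {f : (Fin n → ℝ) → ℝ} (hf : Measurable f)
    {A : Set (Fin n → ℝ)} (hA : MeasurableSet A) (hAR : ∀ x ∈ A, ∀ i, -(R : ℝ) < x i ∧ x i < R) :
    eLpNorm f r (volume.restrict A) ≤
      quasiC r (intBox n R).card * ∑ e ∈ intBox n R, cellNorm r 0 f e := by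
  refine (eLpNorm_restrict_le_sum r (intBox n R) (B := fun e => dyadicCube 0 e) hA
    (fun e _ => measurableSet_dyadicCube 0 e) ?_ hf).trans (le_of_eq ?_)
  · filter_upwards [ae_exists_mem_dyadicCube (n := n) 0] with y hy hyA
    refine ⟨_, mem_intBox.2 fun i => ?_, hy⟩
    have h1 := hAR y hyA i
    have h2 := hy i
    simp only [pow_zero, div_one] at h2
    rw [abs_le]
    constructor
    · have : ((-(R : ℤ) : ℤ) : ℝ) < ((cell 0 y i + 1 : ℤ) : ℝ) := by push_cast; linarith
      have := Int.cast_lt.1 this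
      omega
    · have : ((cell 0 y i : ℤ) : ℝ) < ((R : ℤ) : ℝ) := by push_cast; linarith
      exact (Int.cast_lt.1 this).le
  · simp_rw [cellNorm_eq]
    simp

lemma measurableSet_cube {n : ℕ} (c : Fin n → ℝ) (a : ℝ) : MeasurableSet (cube c a) := by
  have : cube c a = ⋂ i, {x | |x i - c i| < a / 2} := by ext; simp [cube]
  rw [this]
  exact MeasurableSet.iInter fun i => measurableSet_lt (by fun_prop) measurable_const

lemma mem_cube_two {n : ℕ} {x y : Fin n → ℝ} (hx : x ∈ ucube n) (hy : y ∈ cube x 2) (i : Fin n) :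
    -1 < y i ∧ y i < 2 := by
  have h1 := mem_ucube.1 hx i
  have h2 := abs_lt.1 (hy i)
  constructor <;> linarith

lemma volume_cube_eq {n : ℕ} (c : Fin n → ℝ) (a : ℝ) : volume (cube c a) = ENNReal.ofReal a ^ n := by
  have : cube c a = box (fun i => c i - a / 2) a := by
    ext x
    refine forall_congr' fun i => ?_
    rw [abs_lt]
    constructor <;> rintro ⟨h1, h2⟩ <;> constructor <;> linarith
  rw [this, volume_box]

lemma exists_avgDiff_le_sum_cellNorm (n l : ℕ) {r : ℝ≥0∞} (hr : r ≠ 0) : ∃ C : ℝ≥0,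
    ∀ (f : (Fin n → ℝ) → ℝ), Measurable f → ∀ x ∈ ucube n,
      avgDiff l r f x 2 ≤ C * ∑ e ∈ intBox n (2 * l + 3), cellNorm r 0 f e := by
  set κ : ℝ≥0∞ := (ENNReal.ofReal (2 ^ (2 * n)))⁻¹ with hκ
  have hκ0 : κ ≠ 0 := by simp [hκ]
  have hκt : κ ≠ ∞ := by
    rw [hκ]; simp
  set V : ℝ≥0∞ := (ENNReal.ofReal (2 * 2) ^ n) ^ (1 / r.toReal) with hV
  set Q : ℝ≥0 := quasiC r (intBox n (2 * l + 3)).card with hQ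
  set D : ℝ≥0∞ := κ ^ (1 / r).toReal * (quasiC r (Finset.range (l + 1)).card *
    ∑ j ∈ Finset.range (l + 1), ENNReal.ofReal (l.choose j) * (V * Q)) with hD
  have hDt : D ≠ ∞ := by
    have hVt : V ≠ ∞ := ENNReal.rpow_ne_top_of_nonneg (by positivity)
      (ENNReal.pow_ne_top ENNReal.ofReal_ne_top)
    refine ENNReal.mul_ne_top (ENNReal.rpow_ne_top_of_nonneg ENNReal.toReal_nonneg hκt)
      (ENNReal.mul_ne_top ENNReal.coe_ne_top (ENNReal.sum_ne_top.2 fun j _ => ?_))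
    exact ENNReal.mul_ne_top ENNReal.ofReal_ne_top (ENNReal.mul_ne_top hVt ENNReal.coe_ne_top)
  obtain ⟨C, hC⟩ := exists_coe_eq hDt
  refine ⟨C, fun f hf x hx => ?_⟩
  set X := ∑ e ∈ intBox n (2 * l + 3), cellNorm r 0 f e with hX
  rw [avgDiff, eLpNorm_smul_measure_of_ne_zero hκ0, smul_eq_mul, hC, hD, mul_assoc, mul_assoc]
  refine mul_le_mul' le_rfl ?_
  have hmeas : ∀ j : ℕ, Measurable fun z : (Fin n → ℝ) × (Fin n → ℝ) => f (z.2 + (j : ℝ) • z.1) :=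
    fun j => hf.comp (by fun_prop)
  refine (eLpNorm_le_of_abs_le_sum r (Finset.range (l + 1)) (fun j : ℕ => (l.choose j : ℝ))
    (f := fun (j : ℕ) (z : (Fin n → ℝ) × (Fin n → ℝ)) => f (z.2 + (j : ℝ) • z.1))
    (fun j _ => by positivity) (fun j _ => (hmeas j).aestronglyMeasurable)
    (ae_of_all _ fun z => ?_)).trans ?_
  · refine (Finset.abs_sum_le_sum_abs _ _).trans (Finset.sum_le_sum fun j _ => ?_)
    rw [abs_mul, abs_mul, abs_pow, abs_neg, abs_one, one_pow, mul_one, Nat.abs_cast]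
  · refine mul_le_mul' le_rfl ?_
    rw [Finset.sum_mul]
    refine Finset.sum_le_sum fun j hj => ?_
    rw [mul_assoc, mul_assoc]
    refine mul_le_mul' le_rfl ?_
    rw [← eLpNorm_comp_measurePreserving (hmeas j).aestronglyMeasurable
      (Measure.measurePreserving_swap (μ := volume.restrict (cube x 2))
        (ν := volume.restrict (cube (0 : Fin n → ℝ) (2 * 2))))]
    refine (eLpNorm_prod_le hr (F := fun z : (Fin n → ℝ) × (Fin n → ℝ) => f (z.1 + (j : ℝ) • z.2))
      (X := Q * X) (hf.comp (by fun_prop)) ?_).trans (le_of_eq ?_)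
    · refine (ae_restrict_iff' (measurableSet_cube _ _)).2 (ae_of_all _ fun h hh => ?_)
      refine (eLpNorm_translate_le (B := {y | ∀ i, -((2 * l + 3 : ℕ) : ℝ) < y i ∧ y i < (2 * l + 3 : ℕ)})
        ((j : ℝ) • h) (fun y hy i => ?_) hf r).trans (eLpNorm_le_sum_cellNorm r _ hf ?_ fun y hy => hy)
      · have h1 := mem_cube_two hx hy i
        have h2 := abs_lt.1 (hh i)
        simp only [Pi.zero_apply, sub_zero] at h2
        have hjl : (j : ℝ) ≤ l := by exact_mod_cast Nat.lt_succ_iff.1 (Finset.mem_range.1 hj)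
        have hj0 : (0 : ℝ) ≤ j := by positivity
        have e : (y + (j : ℝ) • h) i = y i + j * h i := rfl
        rw [e]
        push_cast
        constructor <;> nlinarith
      · have : {y : Fin n → ℝ | ∀ i, -((2 * l + 3 : ℕ) : ℝ) < y i ∧ y i < (2 * l + 3 : ℕ)} =
          ⋂ i, {y : Fin n → ℝ | -((2 * l + 3 : ℕ) : ℝ) < y i ∧ y i < (2 * l + 3 : ℕ)} := by
          ext; simp only [Set.mem_iInter]; rfl
        rw [this]
        refine MeasurableSet.iInter fun i => ?_
        exact (measurableSet_lt measurable_const (measurable_pi_apply i)).inter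
          (measurableSet_lt (measurable_pi_apply i) measurable_const)
    · rw [Measure.restrict_apply_univ, volume_cube_eq, hV]

lemma exists_avgDiff_le_of_bound (n l : ℕ) (r : ℝ≥0∞) : ∃ C : ℝ≥0,
    ∀ (g : (Fin n → ℝ) → ℝ) (B : ℝ), ∀ x ∈ ucube n,
      (∀ y h : Fin n → ℝ, (∀ i, -1 < y i ∧ y i < 2) → (∀ i, |h i| ≤ 2) → |diff l h g y| ≤ B) →
      avgDiff l r g x 2 ≤ C * ENNReal.ofReal B := by
  set V : ℝ≥0∞ := (ENNReal.ofReal (2 ^ (2 * n)))⁻¹ *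
    (ENNReal.ofReal (2 * 2) ^ n * ENNReal.ofReal 2 ^ n) with hV
  have hVt : V ≠ ∞ := ENNReal.mul_ne_top (by simp)
    (ENNReal.mul_ne_top (ENNReal.pow_ne_top ENNReal.ofReal_ne_top) (ENNReal.pow_ne_top ENNReal.ofReal_ne_top))
  obtain ⟨C, hC⟩ := exists_coe_eq (ENNReal.rpow_ne_top_of_nonneg (inv_nonneg.2 ENNReal.toReal_nonneg) hVt :
    V ^ (r.toReal)⁻¹ ≠ ∞)
  refine ⟨C, fun g B x hx hB => ?_⟩
  rw [avgDiff, hC]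
  refine (eLpNorm_le_of_ae_bound (C := B) ?_).trans (le_of_eq ?_)
  · refine Measure.ae_smul_measure ?_ _
    rw [Measure.prod_restrict]
    refine (ae_restrict_iff' ((measurableSet_cube _ _).prod (measurableSet_cube _ _))).2
      (ae_of_all _ fun z hz => ?_)
    refine hB z.2 z.1 (mem_cube_two hx hz.2) fun i => ?_
    have := hz.1 i
    rw [Pi.zero_apply, sub_zero] at this
    linarith
  · rw [Measure.smul_apply, ← Set.univ_prod_univ, Measure.prod_prod, Measure.restrict_apply_univ,
      Measure.restrict_apply_univ, volume_cube_eq, volume_cube_eq, smul_eq_mul]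

lemma diff_sub {n : ℕ} (l : ℕ) (h x : Fin n → ℝ) (f g : (Fin n → ℝ) → ℝ) :
    diff l h (fun y => f y - g y) x = diff l h f x - diff l h g x := by
  simp only [diff, mul_sub, Finset.sum_sub_distrib]

lemma avgDiff_le_add {n : ℕ} (l : ℕ) (r : ℝ≥0∞) {f g : (Fin n → ℝ) → ℝ} (hf : Measurable f)
    (hg : Measurable g) (x : Fin n → ℝ) (a : ℝ) : avgDiff l r f x a ≤
      quasiC r 1 * (avgDiff l r (fun y => f y - g y) x a + avgDiff l r g x a) := by
  have e : (fun z : (Fin n → ℝ) × (Fin n → ℝ) => diff l z.1 f z.2) =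
      fun z => diff l z.1 (fun y => f y - g y) z.2 + diff l z.1 g z.2 := by
    ext z; rw [diff_sub]; ring
  rw [avgDiff, e]
  exact eLpNorm_add_le_quasi r (measurable_diff_prod l (hf.sub hg)).aestronglyMeasurable
    (measurable_diff_prod l hg).aestronglyMeasurable

/-- The index of the ancestor, `i` generations earlier, of a dyadic cube. -/
def anc {n : ℕ} (i : ℕ) (m : Fin n → ℤ) : Fin n → ℤ := fun c => m c / 2 ^ i

/-- The cells of generation `i` in a unit cell which are far from its boundary. -/
def IsInner {n : ℕ} (l i : ℕ) (m : Fin n → ℤ) : Prop :=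
  ∀ c, 2 * (l : ℤ) + 1 ≤ m c % 2 ^ i ∧ m c % 2 ^ i + 2 * l + 2 ≤ 2 ^ i

open Classical in
/-- The decay of the differences of splines on the cells `i` generations later. -/
def cellRate {n : ℕ} (l i : ℕ) (m : Fin n → ℤ) : ℝ≥0 :=
  if IsInner l i m then (1 / 2) ^ (i * l) else (1 / 2) ^ (i * (l - 1))

lemma dyadicMap_eq_anc {n : ℕ} (j i : ℕ) (m : Fin n → ℤ) (x : Fin n → ℝ) :
    dyadicMap (j + i) m x =
      dyadicMap j (anc i m) fun c => (x c + ((m c % 2 ^ i : ℤ) : ℝ)) / 2 ^ i := by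
  ext c
  have h : (m c : ℝ) = 2 ^ i * ((m c / 2 ^ i : ℤ) : ℝ) + ((m c % 2 ^ i : ℤ) : ℝ) := by
    exact_mod_cast (Int.mul_ediv_add_emod (m c) (2 ^ i)).symm
  simp only [dyadicMap, anc]
  rw [h, pow_add]
  field_simp
  ring

lemma diff_affine {n : ℕ} (l : ℕ) (s : ℝ) (v h y : Fin n → ℝ) (g : (Fin n → ℝ) → ℝ) :
    diff l h (fun x => g fun c => (x c + v c) / s) y =
      diff l (fun c => h c / s) g (fun c => (y c + v c) / s) := by
  refine Finset.sum_congr rfl fun j _ => congrArg _ (congrArg g (funext fun c => ?_))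
  simp
  ring

lemma intBox_mono (n : ℕ) {R R' : ℕ} (h : R ≤ R') : intBox n R ⊆ intBox n R' := fun _ he =>
  mem_intBox.2 fun i => (mem_intBox.1 he i).trans (by exact_mod_cast h)

/-- Differences of a spline of generation `j` at the scale of generation `j + i`. -/
lemma exists_abs_diff_splineOf_cellRate_le (n : ℕ) {l : ℕ} (hl : 1 ≤ l) : ∃ C : ℝ, 0 ≤ C ∧
    ∀ (j i : ℕ) (b : (Fin n → ℤ) → ℝ) (m : Fin n → ℤ) (y h : Fin n → ℝ), 1 ≤ i →
      (∀ c, -1 < y c ∧ y c < 2) → (∀ c, |h c| ≤ 2) →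
      |diff l h (fun x => splineOf l j b (dyadicMap (j + i) m x)) y| ≤
        C * cellRate l i m * ∑ e ∈ intBox n (2 * l + 3), |b (anc i m + e)| := by
  obtain ⟨C₁, hC₁0, hC₁⟩ := exists_abs_diff_splineOf_le n hl 2
  obtain ⟨C₂, hC₂0, hC₂⟩ := exists_abs_diff_splineOf_cell_le n hl
  refine ⟨C₁ * 2 ^ (l - 1) + C₂ * 2 ^ l, by positivity, fun j i b m y h hi hy hh => ?_⟩
  have hpow : (2 : ℝ) ≤ 2 ^ i := by
    calc (2 : ℝ) = 2 ^ 1 := (pow_one _).symm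
      _ ≤ 2 ^ i := pow_le_pow_right₀ (by norm_num) hi
  have hpos : (0 : ℝ) < 2 ^ i := by positivity
  have hfun : (fun x => splineOf l j b (dyadicMap (j + i) m x)) = fun x =>
      (fun u => splineOf l j b (dyadicMap j (anc i m) u))
        (fun c => (x c + ((m c % 2 ^ i : ℤ) : ℝ)) / 2 ^ i) := by
    ext x; rw [dyadicMap_eq_anc]
  rw [hfun, diff_affine l (2 ^ i) (fun c => ((m c % 2 ^ i : ℤ) : ℝ)) h y
    (fun u => splineOf l j b (dyadicMap j (anc i m) u))]
  have hρ0 : (0 : ℝ) ≤ 2 / 2 ^ i := by positivity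
  have hρ1 : (2 : ℝ) / 2 ^ i ≤ 1 := by rw [div_le_one hpos]; exact hpow
  have hmod : ∀ c, (0 : ℝ) ≤ ((m c % 2 ^ i : ℤ) : ℝ) ∧ ((m c % 2 ^ i : ℤ) : ℝ) ≤ 2 ^ i - 1 := by
    intro c
    constructor
    · exact_mod_cast Int.emod_nonneg _ (by positivity)
    · have h1 := Int.emod_lt_of_pos (m c) (b := 2 ^ i) (by positivity)
      have h2 : m c % 2 ^ i ≤ 2 ^ i - 1 := by omega
      exact_mod_cast h2
  have hh' : ∀ c, |h c / 2 ^ i| ≤ 2 / 2 ^ i := fun c => by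
    rw [abs_div, abs_of_pos hpos]
    exact div_le_div_of_nonneg_right (hh c) hpos.le
  have hρpow : ∀ s : ℕ, ((2 : ℝ) / 2 ^ i) ^ s = 2 ^ s * (1 / 2) ^ (i * s) := fun s => by
    rw [div_pow, pow_mul, one_div, inv_pow, inv_pow, div_eq_mul_inv]
  set B := ∑ e ∈ intBox n (2 * l + 3), |b (anc i m + e)| with hB
  have hB0 : 0 ≤ B := Finset.sum_nonneg fun _ _ => abs_nonneg _
  have hsub : ∀ R ≤ 2 * l + 3, ∑ e ∈ intBox n R, |b (anc i m + e)| ≤ B := fun R hR =>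
    Finset.sum_le_sum_of_subset_of_nonneg (intBox_mono n hR) fun _ _ _ => abs_nonneg _
  by_cases hin : IsInner l i m
  · have hrate : ((cellRate l i m : ℝ≥0) : ℝ) = (1 / 2) ^ (i * l) := by
      rw [cellRate, if_pos hin]; push_cast; rfl
    rw [hrate]
    refine (hC₂ j b (anc i m) _ _ (2 / 2 ^ i) hρ0 hρ1 (fun s hs c => ?_) hh').trans ?_
    · have h1 := hin c
      have h2 : (2 * (l : ℝ) + 1) ≤ ((m c % 2 ^ i : ℤ) : ℝ) := by exact_mod_cast h1.1
      have h3 : ((m c % 2 ^ i : ℤ) : ℝ) + 2 * l + 2 ≤ 2 ^ i := by exact_mod_cast h1.2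
      have hsl : (s : ℝ) ≤ l := by exact_mod_cast hs
      have hs0 : (0 : ℝ) ≤ s := by positivity
      have h4 := abs_le.1 (hh c)
      have h5 := hy c
      have e : ((fun c => (y c + ((m c % 2 ^ i : ℤ) : ℝ)) / 2 ^ i) +
          (s : ℝ) • (fun c => h c / 2 ^ i) : Fin n → ℝ) c =
          (y c + ((m c % 2 ^ i : ℤ) : ℝ) + s * h c) / 2 ^ i := by
        simp only [Pi.add_apply, Pi.smul_apply, smul_eq_mul]; ring
      rw [e]
      constructor
      · refine div_nonneg ?_ hpos.le; nlinarith
      · rw [div_lt_one hpos]; nlinarith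
    · rw [hρpow]
      calc C₂ * (2 ^ l * (1 / 2) ^ (i * l)) * ∑ e ∈ intBox n l, |b (anc i m + e)|
          ≤ C₂ * (2 ^ l * (1 / 2) ^ (i * l)) * B :=
            mul_le_mul_of_nonneg_left (hsub l (by omega)) (by positivity)
        _ = (C₂ * 2 ^ l) * (1 / 2) ^ (i * l) * B := by ring
        _ ≤ _ := by gcongr; exact le_add_of_nonneg_left (by positivity)
  · have hrate : ((cellRate l i m : ℝ≥0) : ℝ) = (1 / 2) ^ (i * (l - 1)) := by
      rw [cellRate, if_neg hin]; push_cast; rfl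
    rw [hrate]
    refine (hC₁ j b (anc i m) _ _ (2 / 2 ^ i) hρ0 hρ1 (fun c => ?_) hh').trans ?_
    · have h5 := hy c
      have h6 := hmod c
      rw [abs_le]
      constructor
      · rw [le_div_iff₀ hpos]; push_cast; nlinarith
      · rw [div_le_iff₀ hpos]; push_cast; nlinarith
    · rw [hρpow]
      calc C₁ * (2 ^ (l - 1) * (1 / 2) ^ (i * (l - 1))) * ∑ e ∈ intBox n (2 + l + l), |b (anc i m + e)|
          ≤ C₁ * (2 ^ (l - 1) * (1 / 2) ^ (i * (l - 1))) * B :=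
            mul_le_mul_of_nonneg_left (hsub _ (by omega)) (by positivity)
        _ = (C₁ * 2 ^ (l - 1)) * (1 / 2) ^ (i * (l - 1)) * B := by ring
        _ ≤ _ := by gcongr; exact le_add_of_nonneg_right (by positivity)

lemma diff_sum {n : ℕ} {ι : Type} (l : ℕ) (h x : Fin n → ℝ) (S : Finset ι)
    (f : ι → (Fin n → ℝ) → ℝ) :
    diff l h (fun y => ∑ i ∈ S, f i y) x = ∑ i ∈ S, diff l h (f i) x := by
  simp only [diff, Finset.mul_sum]
  exact Finset.sum_comm

/-- Averaged differences of a function at the scale of generation `k + 1`, in terms of a multilevel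
spline decomposition. -/
lemma exists_avgDiff_le_sum_cellRate (n : ℕ) {l : ℕ} (hl : 1 ≤ l) {r : ℝ≥0∞} (hr : r ≠ 0) :
    ∃ C : ℝ≥0, ∀ (φ : (Fin n → ℝ) → ℝ), Measurable φ → ∀ (k : ℕ) (b : ℕ → (Fin n → ℤ) → ℝ)
      (m : Fin n → ℤ), ∀ y ∈ dyadicCube (k + 1) m,
      avgDiff l r φ y (2 / 2 ^ (k + 1)) ≤
        C * (∑ e ∈ intBox n (2 * l + 3), cellNorm r (k + 1)
            (fun x => φ x - ∑ j ∈ Finset.range (k + 1), splineOf l j (b j) x) (m + e) +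
          ∑ j ∈ Finset.range (k + 1), cellRate l (k + 1 - j) m *
            ∑ e ∈ intBox n (2 * l + 3), ENNReal.ofReal |b j (anc (k + 1 - j) m + e)|) := by
  obtain ⟨C₁, hC₁⟩ := exists_avgDiff_le_sum_cellNorm n l hr
  obtain ⟨C₂, hC₂⟩ := exists_avgDiff_le_of_bound n l r
  obtain ⟨C₃, hC₃0, hC₃⟩ := exists_abs_diff_splineOf_cellRate_le n hl
  refine ⟨quasiC r 1 * (C₁ + C₂ * C₃.toNNReal), fun φ hφ k b m y hy => ?_⟩
  obtain ⟨x, hx, rfl⟩ := exists_mem_ucube_eq_dyadicMap hy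
  rw [avgDiff_dyadicMap]
  have hS : Measurable fun x : Fin n → ℝ => ∑ j ∈ Finset.range (k + 1), splineOf l j (b j) x :=
    Finset.measurable_fun_sum _ fun j _ => measurable_splineOf hl j (b j)
  have hφ' : Measurable fun x => φ (dyadicMap (k + 1) m x) := hφ.comp (measurable_dyadicMap _ _)
  have hS' : Measurable fun x : Fin n → ℝ => ∑ j ∈ Finset.range (k + 1),
    splineOf l j (b j) (dyadicMap (k + 1) m x) := hS.comp (measurable_dyadicMap _ _)
  refine (avgDiff_le_add l r hφ' hS' x 2).trans ?_
  rw [ENNReal.coe_mul, mul_assoc]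
  refine mul_le_mul' le_rfl ?_
  have h1 := hC₁ _ (hφ'.sub hS') x hx
  have e1 : ∀ e, cellNorm r 0 ((fun x => φ (dyadicMap (k + 1) m x)) - fun x =>
      ∑ j ∈ Finset.range (k + 1), splineOf l j (b j) (dyadicMap (k + 1) m x)) e =
      cellNorm r (k + 1) (fun x => φ x - ∑ j ∈ Finset.range (k + 1), splineOf l j (b j) x) (m + e) :=
    fun e => by rw [← cellNorm_dyadicMap]; rfl
  simp_rw [e1] at h1
  have h2 := hC₂ (fun x => ∑ j ∈ Finset.range (k + 1), splineOf l j (b j) (dyadicMap (k + 1) m x))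
    (∑ j ∈ Finset.range (k + 1), C₃ * cellRate l (k + 1 - j) m *
      ∑ e ∈ intBox n (2 * l + 3), |b j (anc (k + 1 - j) m + e)|) x hx (fun y h hy hh => by
      rw [diff_sum]
      refine (Finset.abs_sum_le_sum_abs _ _).trans (Finset.sum_le_sum fun j hj => ?_)
      have hj' : j + (k + 1 - j) = k + 1 := by have := Finset.mem_range.1 hj; omega
      have := hC₃ j (k + 1 - j) (b j) m y h (by have := Finset.mem_range.1 hj; omega) hy hh
      rwa [hj'] at this)
  refine (add_le_add h1 h2).trans ?_
  rw [ENNReal.coe_add, add_mul]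
  refine add_le_add (mul_le_mul' le_rfl le_self_add) ?_
  rw [ENNReal.coe_mul, mul_assoc]
  refine mul_le_mul' le_rfl ?_
  rw [ENNReal.ofReal_sum_of_nonneg fun j _ => by positivity]
  refine le_trans ?_ (mul_le_mul' le_rfl le_add_self)
  rw [Finset.mul_sum]
  refine Finset.sum_le_sum fun j _ => le_of_eq ?_
  rw [ENNReal.ofReal_mul (by positivity), ENNReal.ofReal_mul hC₃0,
    ENNReal.ofReal_sum_of_nonneg fun _ _ => abs_nonneg _, ENNReal.ofReal_coe_nnreal, mul_assoc]
  rfl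

/-! ### Geometrically decaying sums in sequence spaces -/

lemma tsum_mul_rpow_le (c y : ℕ → ℝ≥0∞) {s : ℝ} (hs : 0 < s) :
    (∑' i, c i * y i) ^ s ≤ (∑' i, c i) ^ s * ∑' i, y i ^ s := by
  set Y := (∑' i, y i ^ s) ^ (1 / s) with hY
  have h : ∀ i, y i ≤ Y := fun i => by
    rw [hY, one_div, ENNReal.le_rpow_inv_iff hs]
    exact ENNReal.le_tsum (f := fun i => y i ^ s) i
  calc (∑' i, c i * y i) ^ s ≤ ((∑' i, c i) * Y) ^ s := by
        refine ENNReal.rpow_le_rpow ?_ hs.le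
        rw [← ENNReal.tsum_mul_right]
        exact ENNReal.tsum_le_tsum fun i => mul_le_mul' le_rfl (h i)
    _ = _ := by
        rw [ENNReal.mul_rpow_of_nonneg _ _ hs.le, hY, ← ENNReal.rpow_mul, one_div_mul_cancel hs.ne',
          ENNReal.rpow_one]

lemma exists_lqNorm_tsum_le {q : ℝ≥0∞} (hq0 : q ≠ 0) {ω : ℝ≥0} (hω0 : 0 < ω) (hω1 : ω < 1) :
    ∃ C : ℝ≥0, ∀ {ι : Type} (a : ℕ → ι → ℝ≥0∞) (Z : ℕ → ℝ≥0∞),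
      (∀ i, lqNorm q (a i) ≤ ((ω : ℝ≥0∞) ^ 3) ^ i * Z i) →
      lqNorm q (fun x => ∑' i, a i x) ≤ C * ∑' i, (ω : ℝ≥0∞) ^ i * Z i := by
  have hωt : (ω : ℝ≥0∞) ≠ ∞ := ENNReal.coe_ne_top
  have hωz : (ω : ℝ≥0∞) ≠ 0 := by exact_mod_cast hω0.ne'
  have hωlt : (ω : ℝ≥0∞) < 1 := by exact_mod_cast hω1
  by_cases hq : q = ∞
  · subst hq
    refine ⟨1, fun a Z h => ?_⟩
    rw [lqNorm_top, ENNReal.coe_one, one_mul]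
    refine iSup_le fun x => ENNReal.tsum_le_tsum fun i => ?_
    calc a i x ≤ lqNorm ∞ (a i) := le_lqNorm (by simp) _ _
      _ ≤ ((ω : ℝ≥0∞) ^ 3) ^ i * Z i := h i
      _ ≤ _ := by
          refine mul_le_mul' (pow_le_pow_left' ?_ i) le_rfl
          exact pow_le_of_le_one zero_le hωlt.le (by norm_num)
  · have h0 := toReal_pos' hq0 hq
    set s := q.toReal with hs
    have hK : ∑' i, (ω : ℝ≥0∞) ^ i ≠ ∞ := by
      rw [ENNReal.tsum_geometric]
      exact ENNReal.inv_ne_top.2 (tsub_pos_of_lt hωlt).ne'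
    have hKs : ∑' i, ((ω : ℝ≥0∞) ^ s) ^ i ≠ ∞ := by
      rw [ENNReal.tsum_geometric]
      exact ENNReal.inv_ne_top.2 (tsub_pos_of_lt (ENNReal.rpow_lt_one hωlt h0)).ne'
    obtain ⟨K, hK'⟩ := exists_coe_eq hK
    obtain ⟨L, hL'⟩ := exists_coe_eq (ENNReal.rpow_ne_top_of_nonneg (by positivity) hKs :
      (∑' i, ((ω : ℝ≥0∞) ^ s) ^ i) ^ (1 / s) ≠ ∞)
    refine ⟨K * L, fun {ι} a Z h => ?_⟩
    set T := ∑' i, (ω : ℝ≥0∞) ^ i * Z i with hT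
    have hle : ∑' x, (∑' i, a i x) ^ s ≤ K ^ s * ((∑' i, ((ω : ℝ≥0∞) ^ s) ^ i) * T ^ s) := by
      calc ∑' x, (∑' i, a i x) ^ s
          ≤ ∑' x, K ^ s * ∑' i, ((((ω : ℝ≥0∞) ^ i)⁻¹) * a i x) ^ s := by
            refine ENNReal.tsum_le_tsum fun x => ?_
            rw [hK']
            refine le_trans (le_of_eq ?_) (tsum_mul_rpow_le (fun i => (ω : ℝ≥0∞) ^ i)
              (fun i => ((ω : ℝ≥0∞) ^ i)⁻¹ * a i x) h0)
            congr 1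
            refine tsum_congr fun i => ?_
            rw [← mul_assoc, ENNReal.mul_inv_cancel (pow_ne_zero _ hωz) (ENNReal.pow_ne_top hωt), one_mul]
        _ = K ^ s * ∑' i, (((ω : ℝ≥0∞) ^ i)⁻¹ * lqNorm q (a i)) ^ s := by
            rw [ENNReal.tsum_mul_left, ENNReal.tsum_comm]
            congr 1
            refine tsum_congr fun i => ?_
            rw [ENNReal.mul_rpow_of_nonneg _ _ h0.le, lqNorm_rpow hq0 hq, ← ENNReal.tsum_mul_left]
            exact tsum_congr fun x => ENNReal.mul_rpow_of_nonneg _ _ h0.le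
        _ ≤ K ^ s * ∑' i, ((ω : ℝ≥0∞) ^ s) ^ i * T ^ s := by
            refine mul_le_mul' le_rfl (ENNReal.tsum_le_tsum fun i => ?_)
            have h1 : ((ω : ℝ≥0∞) ^ i)⁻¹ * lqNorm q (a i) ≤ (ω : ℝ≥0∞) ^ i * T := by
              calc ((ω : ℝ≥0∞) ^ i)⁻¹ * lqNorm q (a i)
                  ≤ ((ω : ℝ≥0∞) ^ i)⁻¹ * (((ω : ℝ≥0∞) ^ 3) ^ i * Z i) := mul_le_mul' le_rfl (h i)
                _ = (((ω : ℝ≥0∞) ^ i)⁻¹ * (ω : ℝ≥0∞) ^ i) * ((ω : ℝ≥0∞) ^ i * ((ω : ℝ≥0∞) ^ i * Z i)) := by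
                    ring
                _ = (ω : ℝ≥0∞) ^ i * ((ω : ℝ≥0∞) ^ i * Z i) := by
                    rw [ENNReal.inv_mul_cancel (pow_ne_zero _ hωz) (ENNReal.pow_ne_top hωt), one_mul]
                _ ≤ _ := mul_le_mul' le_rfl (ENNReal.le_tsum (f := fun i => (ω : ℝ≥0∞) ^ i * Z i) i)
            refine (ENNReal.rpow_le_rpow h1 h0.le).trans (le_of_eq ?_)
            rw [ENNReal.mul_rpow_of_nonneg _ _ h0.le, ← ENNReal.rpow_natCast, ← ENNReal.rpow_natCast,
              ← ENNReal.rpow_mul, ← ENNReal.rpow_mul, mul_comm s]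
        _ = _ := by rw [ENNReal.tsum_mul_right]
    rw [lqNorm_of_ne_top hq, ← hs]
    refine (ENNReal.rpow_le_rpow hle (by positivity)).trans (le_of_eq ?_)
    rw [ENNReal.mul_rpow_of_nonneg _ _ (by positivity), ENNReal.mul_rpow_of_nonneg _ _ (by positivity),
      ← ENNReal.rpow_mul, ← ENNReal.rpow_mul, mul_one_div_cancel h0.ne', ENNReal.rpow_one,
      ENNReal.rpow_one, ENNReal.coe_mul, hL', mul_assoc]

lemma lqNorm_shift_le (q : ℝ≥0∞) (hq0 : q ≠ 0) (i : ℕ) (G : ℕ → ℝ≥0∞) :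
    lqNorm q (fun k => if i ≤ k then G (k - i) else 0) ≤ lqNorm q G := by
  by_cases hq : q = ∞
  · subst hq
    rw [lqNorm_top, lqNorm_top]
    refine iSup_le fun k => ?_
    split_ifs
    · exact le_iSup G _
    · exact zero_le
  · have h0 := toReal_pos' hq0 hq
    rw [lqNorm_of_ne_top hq, lqNorm_of_ne_top hq]
    refine ENNReal.rpow_le_rpow (le_of_eq ?_) (by positivity)
    rw [← Summable.sum_add_tsum_nat_add' (k := i) (f := fun k => (if i ≤ k then G (k - i) else 0) ^ q.toReal)
      ENNReal.summable, Finset.sum_eq_zero, zero_add]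
    · simp
    · intro k hk
      rw [if_neg (by have := Finset.mem_range.1 hk; omega), ENNReal.zero_rpow_of_pos h0]

lemma exists_le_pow_three {θ : ℝ≥0} (h : θ < 1) : ∃ ω : ℝ≥0, 0 < ω ∧ ω < 1 ∧ θ ≤ ω ^ 3 := by
  refine ⟨(max θ (1 / 2)) ^ (1 / 3 : ℝ), ?_, ?_, ?_⟩
  · exact NNReal.rpow_pos (lt_max_of_lt_right (by norm_num))
  · exact NNReal.rpow_lt_one (max_lt h (by rw [← NNReal.coe_lt_coe]; norm_num)) (by norm_num)
  · rw [← NNReal.rpow_natCast, ← NNReal.rpow_mul]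
    norm_num

/-! ### Passing to descendants -/

lemma anc_sub_mem {n : ℕ} (i j : ℕ) (m : Fin n → ℤ) :
    dyadicCube (j + i) m ⊆ dyadicCube j (anc i m) := by
  intro y hy
  obtain ⟨x, hx, rfl⟩ := exists_mem_ucube_eq_dyadicMap hy
  rw [dyadicMap_eq_anc, dyadicMap_mem_dyadicCube, mem_ucube]
  intro c
  have h1 := mem_ucube.1 hx c
  have hpos : (0 : ℝ) < 2 ^ i := by positivity
  have h2 : (0 : ℝ) ≤ ((m c % 2 ^ i : ℤ) : ℝ) := by
    exact_mod_cast Int.emod_nonneg _ (by positivity)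
  have h3 : ((m c % 2 ^ i : ℤ) : ℝ) + 1 ≤ 2 ^ i := by
    have := Int.emod_lt_of_pos (m c) (b := 2 ^ i) (by positivity)
    exact_mod_cast (by omega : m c % 2 ^ i + 1 ≤ 2 ^ i)
  constructor
  · apply div_pos _ hpos; linarith
  · rw [div_lt_one hpos]; linarith

lemma exists_cellNorm_succ_le (n : ℕ) (r : ℝ≥0∞) : ∃ C : ℝ≥0, ∀ (j : ℕ) (f : (Fin n → ℝ) → ℝ)
    (m : Fin n → ℤ), cellNorm r (j + 1) f m ≤ C * cellNorm r j f (anc 1 m) := by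
  obtain ⟨C, hC⟩ := exists_coe_eq (ENNReal.rpow_ne_top_of_nonneg (by positivity) (by simp) :
    (2 : ℝ≥0∞) ^ ((n : ℝ) * (r⁻¹).toReal) ≠ ∞)
  refine ⟨C, fun j f m => ?_⟩
  rw [cellNorm_eq, cellNorm_eq, hC, ← mul_assoc, ← ENNReal.rpow_add _ _ (by norm_num) (by norm_num)]
  refine mul_le_mul' (le_of_eq ?_) (eLpNorm_mono_measure _ (Measure.restrict_mono (anc_sub_mem 1 j m) le_rfl))
  congr 1
  push_cast
  ring

lemma tsum_eq_tsum_fiber {α β : Type} (g : α → β) (f : α → ℝ≥0∞) :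
    ∑' a, f a = ∑' b, ∑' a : {a // g a = b}, f a.1 := by
  rw [← (Equiv.sigmaFiberEquiv g).tsum_eq]
  exact ENNReal.tsum_sigma' _

lemma lqNorm_anc_le {n l : ℕ} {p : ℝ≥0∞} (hp : p ≠ 0) (hp' : p ≠ ∞) {C θ : ℝ≥0}
    {τ : ℕ → (Fin n → ℤ) → ℝ≥0∞}
    (hτ : ∀ (j i : ℕ) (M : Fin n → ℤ), ∑' m : {m : Fin n → ℤ // anc i m = M},
      (τ (j + i) m.1 * cellRate l i m.1) ^ p.toReal ≤ (C * θ ^ i * τ j M) ^ p.toReal)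
    (j i : ℕ) (H : (Fin n → ℤ) → ℝ≥0∞) :
    lqNorm p (fun m => τ (j + i) m * (cellRate l i m * H (anc i m))) ≤
      C * θ ^ i * lqNorm p (fun M => τ j M * H M) := by
  have h0 := toReal_pos' hp hp'
  rw [← lqNorm_const_mul hp, ← ENNReal.rpow_le_rpow_iff h0, lqNorm_rpow hp hp', lqNorm_rpow hp hp',
    tsum_eq_tsum_fiber (anc i)]
  refine ENNReal.tsum_le_tsum fun M => ?_
  calc ∑' m : {m : Fin n → ℤ // anc i m = M},
        (τ (j + i) m.1 * (cellRate l i m.1 * H (anc i m.1))) ^ p.toReal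
      = (∑' m : {m : Fin n → ℤ // anc i m = M}, (τ (j + i) m.1 * cellRate l i m.1) ^ p.toReal) *
          H M ^ p.toReal := by
        rw [← ENNReal.tsum_mul_right]
        refine tsum_congr fun m => ?_
        rw [m.2, ← mul_assoc, ENNReal.mul_rpow_of_nonneg _ _ h0.le]
    _ ≤ (C * θ ^ i * τ j M) ^ p.toReal * H M ^ p.toReal := mul_le_mul' (hτ j i M) le_rfl
    _ = _ := by rw [← ENNReal.mul_rpow_of_nonneg _ _ h0.le, mul_assoc]

lemma one_le_mul_cellRate {n : ℕ} (l i : ℕ) (m : Fin n → ℤ) :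
    (1 : ℝ≥0) ≤ 2 ^ (i * l) * cellRate l i m := by
  have h : ((1 / 2 : ℝ≥0)) ^ (i * l) ≤ cellRate l i m := by
    rw [cellRate]
    split_ifs
    · exact le_rfl
    · exact pow_le_pow_of_le_one zero_le (by rw [← NNReal.coe_le_coe]; norm_num)
        (Nat.mul_le_mul_left _ (Nat.sub_le _ _))
  calc (1 : ℝ≥0) = 2 ^ (i * l) * (1 / 2) ^ (i * l) := by rw [← mul_pow]; simp
    _ ≤ _ := mul_le_mul' le_rfl h

/-! ### The multilevel estimate -/

lemma exists_splineOf_sub_eq {n l : ℕ} (hl : 1 ≤ l) (β : ℕ → (Fin n → ℤ) → ℝ) :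
    ∃ b : ℕ → (Fin n → ℤ) → ℝ, b 0 = β 0 ∧ ∀ j, splineOf l (j + 1) (b (j + 1)) =
      fun x => splineOf l (j + 1) (β (j + 1)) x - splineOf l j (β j) x := by
  choose β' hβ' using fun j => exists_splineOf_succ_eq hl j (β j)
  refine ⟨fun j => match j with
    | 0 => β 0
    | j + 1 => fun m => β (j + 1) m - β' j m, rfl, fun j => ?_⟩
  ext y
  rw [splineOf_sub hl, hβ']

lemma sum_splineOf_eq {n l : ℕ} {β b : ℕ → (Fin n → ℤ) → ℝ} (h0 : b 0 = β 0)
    (h : ∀ j, splineOf l (j + 1) (b (j + 1)) =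
      fun x => splineOf l (j + 1) (β (j + 1)) x - splineOf l j (β j) x) (k : ℕ) (x : Fin n → ℝ) :
    ∑ j ∈ Finset.range (k + 1), splineOf l j (b j) x = splineOf l k (β k) x := by
  induction k with
  | zero => simp [h0]
  | succ k ih => rw [Finset.sum_range_succ, ih, h]; ring

/-- The errors of a sequence of splines against which the coefficients of the differences of
successive splines are measured. -/
def stepError {n : ℕ} (l : ℕ) (r : ℝ≥0∞) (φ : (Fin n → ℝ) → ℝ) (β : ℕ → (Fin n → ℤ) → ℝ) (j : ℕ)
    (m : Fin n → ℤ) : ℝ≥0∞ :=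
  cellNorm r j (fun x => φ x - splineOf l j (β j) x) m +
    match j with
    | 0 => cellNorm r 0 φ m
    | j + 1 => cellNorm r (j + 1) (fun x => φ x - splineOf l j (β j) x) m

lemma cellNorm_sub_le {n : ℕ} (r : ℝ≥0∞) (k : ℕ) {f g : (Fin n → ℝ) → ℝ} (hf : Measurable f)
    (hg : Measurable g) (m : Fin n → ℤ) : cellNorm r k (fun x => f x - g x) m ≤
      quasiC r 1 * (cellNorm r k f m + cellNorm r k g m) :=
  eLpNorm_sub_le_quasi r (hf.comp (measurable_dyadicMap k m)).aestronglyMeasurable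
    (hg.comp (measurable_dyadicMap k m)).aestronglyMeasurable

lemma exists_abs_coeff_le_stepError (n l : ℕ) (hl : 1 ≤ l) {r : ℝ≥0∞} (hr : r ≠ 0) : ∃ C : ℝ≥0,
    ∀ (φ : (Fin n → ℝ) → ℝ), Measurable φ → ∀ β b : ℕ → (Fin n → ℤ) → ℝ, b 0 = β 0 →
      (∀ j, splineOf l (j + 1) (b (j + 1)) =
        fun x => splineOf l (j + 1) (β (j + 1)) x - splineOf l j (β j) x) →
      ∀ j m, ENNReal.ofReal |b j m| ≤ C * stepError l r φ β j m := by
  obtain ⟨C, hC⟩ := exists_abs_coeff_le n l hl hr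
  refine ⟨C * quasiC r 1, fun φ hφ β b h0 h j m => ?_⟩
  have hS := fun j => measurable_splineOf hl j (β j)
  have h1 : ENNReal.ofReal |b j m| ≤ C * cellNorm r j (splineOf l j (b j)) m := by
    rw [cellNorm_splineOf hl, ← lamC_localC hl (b j) m]
    simpa only [lamC_localC hl] using hC (localC (b j) m)
  rw [ENNReal.coe_mul, mul_assoc]
  refine h1.trans (mul_le_mul' le_rfl ?_)
  cases j with
  | zero =>
    have e : splineOf l 0 (b 0) = fun x => φ x - (φ x - splineOf l 0 (β 0) x) := by
      ext x; rw [h0]; ring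
    rw [e]
    refine (cellNorm_sub_le r 0 hφ (hφ.sub (hS 0)) m).trans (mul_le_mul' le_rfl ?_)
    rw [add_comm]; exact le_rfl
  | succ j =>
    have e : splineOf l (j + 1) (b (j + 1)) = fun x => (φ x - splineOf l j (β j) x) -
        (φ x - splineOf l (j + 1) (β (j + 1)) x) := by
      rw [h]; ext x; ring
    rw [e]
    refine (cellNorm_sub_le r (j + 1) (hφ.sub (hS j)) (hφ.sub (hS (j + 1))) m).trans
      (mul_le_mul' le_rfl ?_)
    rw [add_comm]; exact le_rfl

/-- The previous errors. -/
def prevError (E : ℕ → ℝ≥0∞) (X : ℝ≥0∞) : ℕ → ℝ≥0∞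
  | 0 => X
  | j + 1 => E j

lemma sum_range_eq_tsum (k : ℕ) (f : ℕ → ℝ≥0∞) :
    ∑ j ∈ Finset.range (k + 1), f j = ∑' i, if i ≤ k then f (k - i) else 0 := by
  rw [← Finset.sum_range_reflect, tsum_eq_sum (s := Finset.range (k + 1))]
  · refine Finset.sum_congr rfl fun i hi => ?_
    rw [if_pos (Nat.lt_succ_iff.1 (Finset.mem_range.1 hi))]
    congr 1
  · intro i hi
    rw [if_neg fun h => hi (Finset.mem_range.2 (Nat.lt_succ_iff.2 h))]

section
variable {n l : ℕ} {p r : ℝ≥0∞} {D C₀ θ : ℝ≥0} {τ : ℕ → (Fin n → ℤ) → ℝ≥0∞}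

lemma exists_lqNorm_cellNorm_succ_le (n l : ℕ) {p : ℝ≥0∞} (r : ℝ≥0∞) (hp : p ≠ 0) (hp' : p ≠ ∞)
    (C₀ θ : ℝ≥0) (hθ1 : θ < 1) : ∃ C : ℝ≥0, ∀ (τ : ℕ → (Fin n → ℤ) → ℝ≥0∞)
      (_ : ∀ (j i : ℕ) (M : Fin n → ℤ), ∑' m : {m : Fin n → ℤ // anc i m = M},
        (τ (j + i) m.1 * cellRate l i m.1) ^ p.toReal ≤ (C₀ * θ ^ i * τ j M) ^ p.toReal)
      (j : ℕ) (f : (Fin n → ℝ) → ℝ),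
      lqNorm p (fun m => τ (j + 1) m * cellNorm r (j + 1) f m) ≤
        C * lqNorm p (fun m => τ j m * cellNorm r j f m) := by
  obtain ⟨C, hC⟩ := exists_cellNorm_succ_le n r
  refine ⟨2 ^ (1 * l) * C * C₀, fun τ hτ j f => ?_⟩
  have h1 : ∀ m, τ (j + 1) m * cellNorm r (j + 1) f m ≤ (2 ^ (1 * l) * C : ℝ≥0) *
      (τ (j + 1) m * (cellRate l 1 m * cellNorm r j f (anc 1 m))) := by
    intro m
    have h2 : (1 : ℝ≥0∞) ≤ (2 ^ (1 * l) : ℝ≥0) * (cellRate l 1 m : ℝ≥0) := by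
      exact_mod_cast one_le_mul_cellRate l 1 m
    calc τ (j + 1) m * cellNorm r (j + 1) f m
        ≤ ((2 ^ (1 * l) : ℝ≥0) * (cellRate l 1 m : ℝ≥0)) *
          (τ (j + 1) m * (C * cellNorm r j f (anc 1 m))) :=
          (le_mul_of_one_le_left zero_le h2).trans
            (mul_le_mul' le_rfl (mul_le_mul' le_rfl (hC j f m)))
      _ = _ := by rw [ENNReal.coe_mul]; ring
  refine (lqNorm_mono h1).trans ?_
  rw [lqNorm_const_mul hp, ENNReal.coe_mul (2 ^ (1 * l) * C), mul_assoc]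
  refine mul_le_mul' le_rfl ((lqNorm_anc_le hp hp' hτ j 1 _).trans (mul_le_mul' ?_ le_rfl))
  have : (θ : ℝ≥0∞) ≤ 1 := by exact_mod_cast hθ1.le
  rw [pow_one]
  exact mul_le_of_le_one_right zero_le this

end

/-- The functional of averaged differences is bounded by the errors of a sequence of splines. -/
lemma exists_lqNorm_avgDiff_le (n : ℕ) {l : ℕ} (hl : 1 ≤ l) {p q r : ℝ≥0∞} (hp : p ≠ 0) (hp' : p ≠ ∞)
    (hq : q ≠ 0) (hr : r ≠ 0) (D C₀ θ : ℝ≥0) (hθ1 : θ < 1) :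
    ∃ C : ℝ≥0, ∀ (τ : ℕ → (Fin n → ℤ) → ℝ≥0∞)
      (_ : ∀ k m, ∀ e ∈ intBox n (2 * l + 3), τ k m ≤ D * τ k (m + e))
      (_ : ∀ (j i : ℕ) (M : Fin n → ℤ), ∑' m : {m : Fin n → ℤ // anc i m = M},
        (τ (j + i) m.1 * cellRate l i m.1) ^ p.toReal ≤ (C₀ * θ ^ i * τ j M) ^ p.toReal)
      (t : ℕ → (Fin n → ℝ) → ℝ) (_ : ∀ k, IsWeight (t k)) (_ : ∀ k m, assoc p t k m = τ k m)
      (φ : (Fin n → ℝ) → ℝ) (_ : Measurable φ) (β : ℕ → (Fin n → ℤ) → ℝ),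
      lqNorm q (fun k : ℕ => eLpNorm (fun x => ENNReal.ofReal (t (k + 1) x) *
          avgDiff l r φ x (2 / 2 ^ (k + 1))) p volume) ≤
        C * (lqNorm q (fun k => approxError p r τ k φ (splineOf l k (β k))) +
          initialTerm p r τ φ) := by
  obtain ⟨ω, hω0, hω1, hθω⟩ := exists_le_pow_three hθ1
  obtain ⟨ϑ, hϑ0, hϑ1, hωϑ⟩ := exists_le_pow_three hω1
  obtain ⟨C₁, hC₁⟩ := exists_avgDiff_le_sum_cellRate n hl hr
  obtain ⟨C₂, hC₂⟩ := exists_lqNorm_cellNorm_succ_le n l r hp hp' C₀ θ hθ1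
  obtain ⟨C₃, hC₃⟩ := exists_abs_coeff_le_stepError n l hl hr
  obtain ⟨C₄, hC₄⟩ := exists_lqNorm_tsum_le hp hω0 hω1
  obtain ⟨C₅, hC₅⟩ := exists_lqNorm_tsum_le hq hϑ0 hϑ1
  set Kn : ℝ≥0 := lqC p (intBox n (2 * l + 3)).card * (1 * D * (intBox n (2 * l + 3)).card) with hKn
  set Kb : ℝ≥0 := lqC p (intBox n (2 * l + 3)).card * (C₃ * D * (intBox n (2 * l + 3)).card) with hKb
  set Kg : ℝ≥0 := lqC p 2 * (1 + C₂) with hKg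
  have hϑlt : (ϑ : ℝ≥0∞) < 1 := by exact_mod_cast hϑ1
  have hΘ : ∑' i, (ϑ : ℝ≥0∞) ^ i ≠ ∞ := by
    rw [ENNReal.tsum_geometric]
    exact ENNReal.inv_ne_top.2 (tsub_pos_of_lt hϑlt).ne'
  obtain ⟨Θ, hΘ'⟩ := exists_coe_eq hΘ
  refine ⟨C₁ * lqC p 2 * (lqC q 2 * (Kn * C₂ + C₄ * (C₀ * Kb * Kg) * (C₅ * Θ * (lqC q 2 * (1 + lqC q 2))))),
    fun τ hτ1 hτ2 t ht htτ φ hφ β => ?_⟩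
  obtain ⟨b, hb0, hb⟩ := exists_splineOf_sub_eq hl β
  set E := fun k => approxError p r τ k φ (splineOf l k (β k)) with hE
  set X := initialTerm p r τ φ with hX
  set G : ℕ → ℝ≥0∞ := fun j => E j + prevError E X j with hG
  -- the step errors
  have hF : ∀ j, lqNorm p (fun m => τ j m * stepError l r φ β j m) ≤ Kg * G j := by
    intro j
    have h1 : lqNorm p (fun m => τ j m * stepError l r φ β j m) ≤
        lqC p 2 * (E j + (1 + C₂) * prevError E X j) := by
      simp only [stepError]
      simp_rw [mul_add (τ j _)]
      refine (lqNorm_add_le hp _ _).trans (mul_le_mul' le_rfl (add_le_add ?_ ?_))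
      · rw [hE]; simp only [approxError_eq]; exact le_rfl
      · cases j with
        | zero =>
          simp only [prevError, hX, initialTerm_eq]
          exact le_mul_of_one_le_left zero_le le_self_add
        | succ j =>
          refine (hC₂ τ hτ2 j _).trans (mul_le_mul' le_add_self (le_of_eq ?_))
          simp only [prevError, hE, approxError_eq]
    refine h1.trans ?_
    rw [hKg, ENNReal.coe_mul, mul_assoc]
    refine mul_le_mul' le_rfl ?_
    rw [hG, mul_add]
    push_cast
    exact add_le_add (le_mul_of_one_le_left zero_le le_self_add) le_rfl
  have hB : ∀ j, lqNorm p (fun M => τ j M * ∑ e ∈ intBox n (2 * l + 3), ENNReal.ofReal |b j (M + e)|) ≤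
      Kb * (Kg * G j) := by
    intro j
    refine (lqNorm_neighbour_le hp (2 * l + 3) D C₃ (hτ1 j) (F := stepError l r φ β j) fun M => ?_).trans
      (mul_le_mul' le_rfl (hF j))
    rw [Finset.mul_sum]
    exact Finset.sum_le_sum fun e _ => hC₃ φ hφ β b hb0 hb j _
  -- one generation
  have hA : ∀ k, eLpNorm (fun x => ENNReal.ofReal (t (k + 1) x) *
      avgDiff l r φ x (2 / 2 ^ (k + 1))) p volume ≤ (C₁ * lqC p 2 : ℝ≥0) * (Kn * C₂ * E k +
        (C₄ * (C₀ * Kb * Kg) : ℝ≥0) * ∑' i, (ω : ℝ≥0∞) ^ i * if i ≤ k then G (k - i) else 0) := by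
    intro k
    refine (eLpNorm_le_lqNorm hp hp' (k + 1) (ht (k + 1)) fun m x hx => hC₁ φ hφ k b m x hx).trans ?_
    have e1 : ∀ m, eLpNorm (t (k + 1)) p (volume.restrict (dyadicCube (k + 1) m)) = τ (k + 1) m :=
      htτ (k + 1)
    simp_rw [e1, mul_left_comm _ (C₁ : ℝ≥0∞)]
    rw [lqNorm_const_mul hp, ENNReal.coe_mul, mul_assoc]
    refine mul_le_mul' le_rfl ?_
    simp_rw [mul_add (τ (k + 1) _)]
    refine (lqNorm_add_le hp _ _).trans (mul_le_mul' le_rfl (add_le_add ?_ ?_))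
    · have h1 := lqNorm_neighbour_le hp (2 * l + 3) D 1 (hτ1 (k + 1)) (F := cellNorm r (k + 1)
        (fun x => φ x - ∑ j ∈ Finset.range (k + 1), splineOf l j (b j) x)) (fun m => by
          rw [ENNReal.coe_one, one_mul])
      refine h1.trans ?_
      rw [← hKn, mul_assoc]
      refine mul_le_mul' le_rfl ?_
      simp_rw [sum_splineOf_eq hb0 hb]
      refine (hC₂ τ hτ2 k _).trans (le_of_eq ?_)
      simp only [hE, approxError_eq]
    · have e2 : ∀ m, τ (k + 1) m * ∑ j ∈ Finset.range (k + 1), cellRate l (k + 1 - j) m *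
          ∑ e ∈ intBox n (2 * l + 3), ENNReal.ofReal |b j (anc (k + 1 - j) m + e)| =
          ∑' i, if i ≤ k then τ (k - i + (i + 1)) m * (cellRate l (i + 1) m *
            ∑ e ∈ intBox n (2 * l + 3), ENNReal.ofReal |b (k - i) (anc (i + 1) m + e)|) else 0 := by
        intro m
        rw [sum_range_eq_tsum, ← ENNReal.tsum_mul_left]
        refine tsum_congr fun i => ?_
        split_ifs with hi
        · have h3 : k - i + (i + 1) = k + 1 := by omega
          have h4 : k + 1 - (k - i) = i + 1 := by omega
          rw [h3, h4]
        · rw [mul_zero]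
      simp_rw [e2]
      refine (hC₄ (fun i m => if i ≤ k then τ (k - i + (i + 1)) m * (cellRate l (i + 1) m *
            ∑ e ∈ intBox n (2 * l + 3), ENNReal.ofReal |b (k - i) (anc (i + 1) m + e)|) else 0)
          (fun i => (C₀ * Kb * Kg : ℝ≥0) * if i ≤ k then G (k - i) else 0) fun i => ?_).trans
            (le_of_eq ?_)
      · split_ifs with hi
        · refine (lqNorm_anc_le hp hp' hτ2 (k - i) (i + 1)
            (fun M => ∑ e ∈ intBox n (2 * l + 3), ENNReal.ofReal |b (k - i) (M + e)|)).trans ?_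
          have h5 : (θ : ℝ≥0∞) ^ (i + 1) ≤ ((ω : ℝ≥0∞) ^ 3) ^ i := by
            have h6 : (θ : ℝ≥0∞) ≤ (ω : ℝ≥0∞) ^ 3 := by exact_mod_cast hθω
            have h7 : (θ : ℝ≥0∞) ≤ 1 := by exact_mod_cast hθ1.le
            rw [pow_succ]
            exact (mul_le_of_le_one_right zero_le h7).trans (pow_le_pow_left' h6 i)
          calc C₀ * (θ : ℝ≥0∞) ^ (i + 1) * lqNorm p (fun M => τ (k - i) M *
                ∑ e ∈ intBox n (2 * l + 3), ENNReal.ofReal |b (k - i) (M + e)|)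
              ≤ C₀ * ((ω : ℝ≥0∞) ^ 3) ^ i * (Kb * (Kg * G (k - i))) :=
                mul_le_mul' (mul_le_mul' le_rfl h5) (hB (k - i))
            _ = _ := by push_cast; ring
        · have h8 := lqNorm_const_mul hp 0 (fun _ : Fin n → ℤ => (0 : ℝ≥0∞))
          rw [zero_mul, zero_mul] at h8
          rw [h8]; exact zero_le
      · rw [← ENNReal.tsum_mul_left, ← ENNReal.tsum_mul_left]
        refine tsum_congr fun i => ?_
        push_cast
        ring
  -- summation over the generations
  have hsum : lqNorm q (fun k => ∑' i, (ω : ℝ≥0∞) ^ i * if i ≤ k then G (k - i) else 0) ≤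
      C₅ * Θ * lqNorm q G := by
    refine (hC₅ (fun i k => (ω : ℝ≥0∞) ^ i * if i ≤ k then G (k - i) else 0)
      (fun _ => lqNorm q G) fun i => ?_).trans (le_of_eq ?_)
    · rw [lqNorm_const_mul hq]
      refine mul_le_mul' (pow_le_pow_left' ?_ i) (lqNorm_shift_le q hq i G)
      exact_mod_cast hωϑ
    · rw [ENNReal.tsum_mul_right, ← hΘ', mul_assoc]
  have hGE : lqNorm q G ≤ (lqC q 2 * (1 + lqC q 2) : ℝ≥0) * (lqNorm q E + X) := by
    refine (lqNorm_add_le hq _ _).trans ?_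
    rw [ENNReal.coe_mul, mul_assoc]
    refine mul_le_mul' le_rfl ?_
    rw [ENNReal.coe_add, ENNReal.coe_one, add_mul, one_mul]
    refine add_le_add le_self_add ((lqNorm_cons_le hq _).trans (mul_le_mul' le_rfl ?_))
    rw [add_comm]
    exact le_rfl
  refine (lqNorm_mono hA).trans ?_
  rw [lqNorm_const_mul hq]
  refine (mul_le_mul' le_rfl (lqNorm_add_le hq _ _)).trans ?_
  rw [lqNorm_const_mul hq, lqNorm_const_mul hq]
  calc _ ≤ ((C₁ * lqC p 2 : ℝ≥0) : ℝ≥0∞) * (lqC q 2 * (Kn * C₂ * (lqNorm q E + X) +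
        (C₄ * (C₀ * Kb * Kg) : ℝ≥0) * (C₅ * Θ * ((lqC q 2 * (1 + lqC q 2) : ℝ≥0) *
          (lqNorm q E + X))))) := by
        refine mul_le_mul' le_rfl (mul_le_mul' le_rfl (add_le_add
          (mul_le_mul' le_rfl le_self_add) (mul_le_mul' le_rfl ?_)))
        exact hsum.trans (mul_le_mul' le_rfl hGE)
    _ = _ := by push_cast; ring

lemma exists_eLpNorm_initial_le (n : ℕ) {p : ℝ≥0∞} (r : ℝ≥0∞) (hp : p ≠ 0) (hp' : p ≠ ∞) (D : ℝ≥0) :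
    ∃ C : ℝ≥0, ∀ (τ : ℕ → (Fin n → ℤ) → ℝ≥0∞) (_ : ∀ m, ∀ e ∈ intBox n 2, τ 0 m ≤ D * τ 0 (m + e))
      (t : (Fin n → ℝ) → ℝ) (_ : IsWeight t)
      (_ : ∀ m, eLpNorm t p (volume.restrict (dyadicCube 0 m)) = τ 0 m) (φ : (Fin n → ℝ) → ℝ)
      (_ : Measurable φ),
      eLpNorm (fun x => ENNReal.ofReal (t x) * eLpNorm φ r (volume.restrict (cube x 2))) p volume ≤
        C * initialTerm p r τ φ := by
  refine ⟨lqC p (intBox n 2).card * (quasiC r (intBox n 2).card * D * (intBox n 2).card),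
    fun τ hτ t ht htτ φ hφ => ?_⟩
  rw [initialTerm_eq]
  refine (eLpNorm_le_lqNorm hp hp' 0 ht (I := fun m => quasiC r (intBox n 2).card *
    ∑ e ∈ intBox n 2, cellNorm r 0 φ (m + e)) fun m y hy => ?_).trans ?_
  · obtain ⟨x, hx, rfl⟩ := exists_mem_ucube_eq_dyadicMap hy
    have h1 : cube (dyadicMap 0 m x) 2 = dyadicMap 0 (-m) ⁻¹' (cube x 2) := by
      ext z
      refine forall_congr' fun i => ?_
      simp only [dyadicMap, pow_zero, div_one, Pi.neg_apply, Int.cast_neg]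
      rw [show z i - (x i + m i) = z i + -(m i : ℝ) - x i by ring]
    have h2 := eLpNorm_dyadicMap 0 (-m) (fun y => φ (dyadicMap 0 m y)) r (cube x 2)
    have h3 : ∀ z : Fin n → ℝ, dyadicMap 0 m (dyadicMap 0 (-m) z) = z := fun z => by
      ext i; simp [dyadicMap]
    simp_rw [h3] at h2
    rw [h1, h2]
    simp only [Nat.cast_zero, zero_mul, ENNReal.rpow_zero, one_mul]
    refine (eLpNorm_le_sum_cellNorm r 2 (hφ.comp (measurable_dyadicMap 0 m)) (measurableSet_cube _ _)
      fun z hz i => ?_).trans (le_of_eq ?_)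
    · have := mem_cube_two hx hz i
      push_cast
      constructor <;> linarith
    · congr 1
      exact Finset.sum_congr rfl fun e _ => cellNorm_dyadicMap r 0 φ m e
  · simp_rw [htτ]
    exact lqNorm_neighbour_le hp 2 D _ hτ fun m => le_rfl

lemma lqNorm_two_pow_ne_top {q : ℝ≥0∞} (hq0 : q ≠ 0) :
    lqNorm q (fun k : ℕ => (2⁻¹ : ℝ≥0∞) ^ k) ≠ ∞ := by
  by_cases hq : q = ∞
  · subst hq
    rw [lqNorm_top]
    refine ne_top_of_le_ne_top ENNReal.one_ne_top (iSup_le fun k => ?_)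
    exact pow_le_one' (by simp) k
  · have h0 := toReal_pos' hq0 hq
    rw [lqNorm_of_ne_top hq]
    refine ENNReal.rpow_ne_top_of_nonneg (by positivity) ?_
    have e : ∀ k : ℕ, ((2⁻¹ : ℝ≥0∞) ^ k) ^ q.toReal = ((2⁻¹ : ℝ≥0∞) ^ q.toReal) ^ k := fun k => by
      rw [← ENNReal.rpow_natCast, ← ENNReal.rpow_natCast, ← ENNReal.rpow_mul, ← ENNReal.rpow_mul, mul_comm]
    simp_rw [e]
    rw [ENNReal.tsum_geometric]
    exact ENNReal.inv_ne_top.2 (tsub_pos_of_lt (ENNReal.rpow_lt_one (by simp) h0)).ne'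

lemma le_of_forall_le_add_mul {x a b : ℝ≥0∞} (hb : b ≠ ∞)
    (h : ∀ ε : ℝ≥0, 0 < ε → x ≤ a + ε * b) : x ≤ a := by
  refine ENNReal.le_of_forall_pos_le_add fun ε hε _ => ?_
  obtain ⟨b', rfl⟩ := exists_coe_eq hb
  refine (h (ε / (b' + 1)) (by positivity)).trans (add_le_add le_rfl ?_)
  rw [← ENNReal.coe_mul]
  refine ENNReal.coe_le_coe.2 ?_
  rw [div_mul_eq_mul_div, div_le_iff₀ (by positivity)]
  exact mul_le_mul' le_rfl le_self_add

lemma initialTerm_le_N₁ {n : ℕ} (l : ℕ) (p : ℝ≥0∞) {q : ℝ≥0∞} (hq : q ≠ 0) (r : ℝ≥0∞)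
    (τ : ℕ → (Fin n → ℤ) → ℝ≥0∞) (φ : (Fin n → ℝ) → ℝ) :
    initialTerm p r τ φ ≤ N₁ l p q r τ φ :=
  le_lqNorm hq (fun j : ℕ => match j with
    | 0 => initialTerm p r τ φ
    | k + 1 => bestSpline l p r τ k φ) 0

lemma lqNorm_bestSpline_le_N₁ {n : ℕ} (l : ℕ) (p q r : ℝ≥0∞)
    (τ : ℕ → (Fin n → ℤ) → ℝ≥0∞) (φ : (Fin n → ℝ) → ℝ) :
    lqNorm q (fun k => bestSpline l p r τ k φ) ≤ N₁ l p q r τ φ :=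
  lqNorm_comp_le (f := fun k : ℕ => k + 1) (add_left_injective 1) (fun j : ℕ => match j with
    | 0 => initialTerm p r τ φ
    | k + 1 => bestSpline l p r τ k φ)

/-- The Besov norm is bounded by the functional of best approximations. -/
lemma exists_besovNorm_le_N₁ (n : ℕ) {l : ℕ} (hl : 1 ≤ l) {p q r : ℝ≥0∞} (hp : p ≠ 0) (hp' : p ≠ ∞)
    (hq : q ≠ 0) (hr : r ≠ 0) (D C₀ θ : ℝ≥0) (hθ1 : θ < 1) :
    ∃ C : ℝ≥0, ∀ (τ : ℕ → (Fin n → ℤ) → ℝ≥0∞)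
      (_ : ∀ k m, ∀ e ∈ intBox n (2 * l + 3), τ k m ≤ D * τ k (m + e))
      (_ : ∀ (j i : ℕ) (M : Fin n → ℤ), ∑' m : {m : Fin n → ℤ // anc i m = M},
        (τ (j + i) m.1 * cellRate l i m.1) ^ p.toReal ≤ (C₀ * θ ^ i * τ j M) ^ p.toReal)
      (t : ℕ → (Fin n → ℝ) → ℝ) (_ : ∀ k, IsWeight (t k)) (_ : ∀ k m, assoc p t k m = τ k m)
      (φ : (Fin n → ℝ) → ℝ) (_ : Measurable φ),
      besovNorm l p q r t φ ≤ C * N₁ l p q r τ φ := by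
  obtain ⟨C₁, hC₁⟩ := exists_lqNorm_avgDiff_le n hl hp hp' hq hr D C₀ θ hθ1
  obtain ⟨C₂, hC₂⟩ := exists_eLpNorm_initial_le n r hp hp' D
  refine ⟨C₁ * (lqC q 2 + 1) + C₂ + 1, fun τ hτ1 hτ2 t ht htτ φ hφ => ?_⟩
  set N := N₁ l p q r τ φ with hN
  by_cases hfin : N = ∞
  · rw [hfin, ENNReal.mul_top (by positivity)]
    exact le_top
  have hs : ∀ k, bestSpline l p r τ k φ ≠ ∞ := fun k =>
    ne_top_of_le_ne_top hfin ((le_lqNorm hq (fun k => bestSpline l p r τ k φ) k).trans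
      (lqNorm_bestSpline_le_N₁ l p q r τ φ))
  have hinit : initialTerm p r τ φ ≤ N := initialTerm_le_N₁ l p hq r τ φ
  have h1 : lqNorm q (fun k : ℕ => eLpNorm (fun x => ENNReal.ofReal (t (k + 1) x) *
      avgDiff l r φ x (2 / 2 ^ (k + 1))) p volume) ≤ C₁ * (lqC q 2 + 1) * N := by
    refine le_of_forall_le_add_mul (b := C₁ * lqC q 2 * lqNorm q (fun k : ℕ => (2⁻¹ : ℝ≥0∞) ^ k))
      (ENNReal.mul_ne_top (ENNReal.mul_ne_top ENNReal.coe_ne_top ENNReal.coe_ne_top)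
        (lqNorm_two_pow_ne_top hq)) fun ε hε => ?_
    have hβ : ∀ k, ∃ β : (Fin n → ℤ) → ℝ, approxError p r τ k φ (splineOf l k β) ≤
        bestSpline l p r τ k φ + ε * (2⁻¹ : ℝ≥0∞) ^ k := by
      intro k
      have hpos : (ε : ℝ≥0∞) * (2⁻¹ : ℝ≥0∞) ^ k ≠ 0 :=
        mul_ne_zero (by exact_mod_cast hε.ne') (pow_ne_zero _ (by simp))
      have hlt := ENNReal.lt_add_right (hs k) hpos
      conv_lhs at hlt => rw [bestSpline]
      obtain ⟨S, hS⟩ := iInf_lt_iff.1 hlt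
      obtain ⟨⟨β, rfl⟩, hβ⟩ := iInf_lt_iff.1 hS
      exact ⟨β, hβ.le⟩
    choose β hβ using hβ
    refine (hC₁ τ hτ1 hτ2 t ht htτ φ hφ β).trans ?_
    have h2 : lqNorm q (fun k => approxError p r τ k φ (splineOf l k (β k))) ≤
        lqC q 2 * (N + ε * lqNorm q (fun k : ℕ => (2⁻¹ : ℝ≥0∞) ^ k)) := by
      refine (lqNorm_mono hβ).trans ((lqNorm_add_le hq _ _).trans (mul_le_mul' le_rfl ?_))
      rw [lqNorm_const_mul hq]
      exact add_le_add (lqNorm_bestSpline_le_N₁ l p q r τ φ) le_rfl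
    calc _ ≤ C₁ * (lqC q 2 * (N + ε * lqNorm q (fun k : ℕ => (2⁻¹ : ℝ≥0∞) ^ k)) + N) :=
          mul_le_mul' le_rfl (add_le_add h2 hinit)
      _ = _ := by ring
  have h3 := hC₂ τ (fun m e he => hτ1 0 m e (intBox_mono n (by omega) he)) (t 0) (ht 0) (htτ 0) φ hφ
  rw [besovNorm]
  calc _ ≤ C₁ * (lqC q 2 + 1) * N + C₂ * N := add_le_add h1 (h3.trans (mul_le_mul' le_rfl hinit))
    _ ≤ C₁ * (lqC q 2 + 1) * N + C₂ * N + N := le_self_add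
    _ = _ := by push_cast; ring

/-! ### Invariance under changes on null sets -/

lemma MemLpLoc.aemeasurable {n : ℕ} {r : ℝ≥0∞} {φ : (Fin n → ℝ) → ℝ} (h : MemLpLoc φ r) :
    AEMeasurable φ volume := by
  have h1 : AEMeasurable φ (volume.restrict (⋃ k : ℕ, Metric.closedBall (0 : Fin n → ℝ) k)) :=
    aemeasurable_iUnion_iff.2 fun k =>
      (h _ (isCompact_closedBall 0 (k : ℝ))).aestronglyMeasurable.aemeasurable
  rwa [Metric.iUnion_closedBall_nat, Measure.restrict_univ] at h1

lemma MemLpLoc.congr {n : ℕ} {r : ℝ≥0∞} {φ ψ : (Fin n → ℝ) → ℝ} (h : MemLpLoc φ r)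
    (hφ : φ =ᵐ[volume] ψ) : MemLpLoc ψ r := fun K hK =>
  (h K hK).ae_eq (ae_restrict_of_ae hφ)

lemma avgDiff_congr {n : ℕ} (l : ℕ) (r : ℝ≥0∞) {φ ψ : (Fin n → ℝ) → ℝ} (h : φ =ᵐ[volume] ψ)
    (c : Fin n → ℝ) (a : ℝ) : avgDiff l r φ c a = avgDiff l r ψ c a := by
  obtain ⟨N, hN, hNm, hN0⟩ := exists_measurable_superset_of_null h
  have hprod : ∀ j : ℕ, ∀ᵐ z : (Fin n → ℝ) × (Fin n → ℝ),
      φ (z.2 + (j : ℝ) • z.1) = ψ (z.2 + (j : ℝ) • z.1) := by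
    intro j
    have hS : MeasurableSet {z : (Fin n → ℝ) × (Fin n → ℝ) | z.2 + (j : ℝ) • z.1 ∈ N} :=
      (show Measurable fun z : (Fin n → ℝ) × (Fin n → ℝ) => z.2 + (j : ℝ) • z.1 by fun_prop) hNm
    have h0 : (volume : Measure ((Fin n → ℝ) × (Fin n → ℝ)))
        {z : (Fin n → ℝ) × (Fin n → ℝ) | z.2 + (j : ℝ) • z.1 ∈ N} = 0 := by
      rw [Measure.volume_eq_prod, Measure.measure_prod_null hS]
      refine Filter.Eventually.of_forall fun v => ?_
      have e : (Prod.mk v ⁻¹' {z : (Fin n → ℝ) × (Fin n → ℝ) | z.2 + (j : ℝ) • z.1 ∈ N}) =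
          (fun y => y + (j : ℝ) • v) ⁻¹' N := rfl
      beta_reduce
      rw [e, measure_preimage_add_right, hN0]
      rfl
    refine measure_mono_null (fun z hz => hN ?_) h0
    exact hz
  rw [avgDiff, avgDiff]
  refine eLpNorm_congr_ae (Measure.ae_smul_measure ?_ _)
  rw [Measure.prod_restrict, ← Measure.volume_eq_prod]
  refine ae_restrict_of_ae ?_
  filter_upwards [ae_all_iff.2 hprod] with z hz
  exact diff_congr fun j _ => hz j

lemma besovNorm_congr {n : ℕ} (l : ℕ) (p q r : ℝ≥0∞) (t : ℕ → (Fin n → ℝ) → ℝ)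
    {φ ψ : (Fin n → ℝ) → ℝ} (h : φ =ᵐ[volume] ψ) :
    besovNorm l p q r t φ = besovNorm l p q r t ψ := by
  have h1 : ∀ x : Fin n → ℝ, eLpNorm φ r (volume.restrict (cube x 2)) =
      eLpNorm ψ r (volume.restrict (cube x 2)) := fun x => eLpNorm_congr_ae (ae_restrict_of_ae h)
  simp only [besovNorm, avgDiff_congr l r h, h1]

lemma eLpNorm_sub_congr {n : ℕ} (r : ℝ≥0∞) {φ ψ : (Fin n → ℝ) → ℝ} (h : φ =ᵐ[volume] ψ)
    (g : (Fin n → ℝ) → ℝ) (A : Set (Fin n → ℝ)) :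
    eLpNorm (fun x => φ x - g x) r (volume.restrict A) =
      eLpNorm (fun x => ψ x - g x) r (volume.restrict A) :=
  eLpNorm_congr_ae (ae_restrict_of_ae (h.mono fun x hx => by beta_reduce; rw [hx]))

lemma approxError_congr {n : ℕ} (p r : ℝ≥0∞) (τ : ℕ → (Fin n → ℤ) → ℝ≥0∞) (k : ℕ)
    {φ ψ : (Fin n → ℝ) → ℝ} (h : φ =ᵐ[volume] ψ) (S : (Fin n → ℝ) → ℝ) :
    approxError p r τ k φ S = approxError p r τ k ψ S := by
  simp only [approxError, eLpNorm_sub_congr r h]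

lemma initialTerm_congr {n : ℕ} (p r : ℝ≥0∞) (τ : ℕ → (Fin n → ℤ) → ℝ≥0∞)
    {φ ψ : (Fin n → ℝ) → ℝ} (h : φ =ᵐ[volume] ψ) :
    initialTerm p r τ φ = initialTerm p r τ ψ := by
  have h1 : ∀ m : Fin n → ℤ, eLpNorm φ r (volume.restrict (dyadicCube 0 m)) =
      eLpNorm ψ r (volume.restrict (dyadicCube 0 m)) := fun m => eLpNorm_congr_ae (ae_restrict_of_ae h)
  simp only [initialTerm, h1]

lemma N₁_congr {n : ℕ} (l : ℕ) (p q r : ℝ≥0∞) (τ : ℕ → (Fin n → ℤ) → ℝ≥0∞)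
    {φ ψ : (Fin n → ℝ) → ℝ} (h : φ =ᵐ[volume] ψ) : N₁ l p q r τ φ = N₁ l p q r τ ψ := by
  simp only [N₁, initialTerm_congr p r τ h, bestSpline, approxError_congr p r τ _ h]

lemma N₂_congr {n : ℕ} (l : ℕ) (p q r : ℝ≥0∞) (τ : ℕ → (Fin n → ℤ) → ℝ≥0∞)
    (P : ℕ → (Fin n → ℤ) → MvPolynomial (Fin n) ℝ) {φ ψ : (Fin n → ℝ) → ℝ} (h : φ =ᵐ[volume] ψ) :
    N₂ l p q r τ P φ = N₂ l p q r τ P ψ := by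
  simp only [N₂, initialTerm_congr p r τ h, approxError_congr p r τ _ h]

lemma IsAlmostBest.congr {n l : ℕ} {r : ℝ≥0∞} {A : ℝ} {φ ψ : (Fin n → ℝ) → ℝ}
    {Q : Set (Fin n → ℝ)} {P : MvPolynomial (Fin n) ℝ} (hP : IsAlmostBest l r A φ Q P)
    (h : φ =ᵐ[volume] ψ) : IsAlmostBest l r A ψ Q P := by
  refine ⟨hP.1, ?_⟩
  have := hP.2
  simpa only [eLpNorm_sub_congr r h] using this

/-! ### Local doubling for weights in the local class `A_∞` -/

section Doubling

variable {ι : Type}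

lemma cube_eq_pi (c : ι → ℝ) (b : ℝ) :
    cube c b = Set.univ.pi fun i => Set.Ioo (c i - b / 2) (c i + b / 2) := by
  ext x
  simp only [cube, Set.mem_pi, Set.mem_univ, true_imp_iff, Set.mem_Ioo]
  refine forall_congr' fun i => ?_
  rw [abs_lt]
  constructor <;> rintro ⟨h1, h2⟩ <;> constructor <;> linarith

lemma cube_subset_Icc (c : ι → ℝ) (b : ℝ) :
    cube c b ⊆ Set.Icc (fun i => c i - b / 2) (fun i => c i + b / 2) := by
  intro x hx
  rw [cube_eq_pi] at hx
  exact ⟨fun i => (hx i trivial).1.le, fun i => (hx i trivial).2.le⟩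

variable [Fintype ι]

lemma measurableSet_cube' (c : ι → ℝ) (b : ℝ) : MeasurableSet (cube c b) := by
  rw [cube_eq_pi]
  exact MeasurableSet.univ_pi fun i => measurableSet_Ioo

lemma volume_real_cube (c : ι → ℝ) {b : ℝ} (hb : 0 ≤ b) :
    volume.real (cube c b) = b ^ Fintype.card ι := by
  rw [cube_eq_pi, Measure.real, Real.volume_pi_Ioo, ENNReal.toReal_prod]
  simp [hb]

/-- Comparison of a weight on neighbouring small cubes. -/
lemma AInftyLoc.exists_shift_le {w : (ι → ℝ) → ℝ} (hw : AInftyLoc w) (hpos : ∀ x, 0 ≤ w x) :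
    ∃ a : ℝ, 0 < a ∧ ∃ ε : ℝ, 0 < ε ∧ ∃ K : ℝ≥0, ∀ (c c' : ι → ℝ) (b : ℝ), 0 < b → b ≤ a →
      (∀ i, |c i - c' i| ≤ ε * b) →
      ∫⁻ x in cube c b, ENNReal.ofReal (w x) ≤ K * ∫⁻ x in cube c' b, ENNReal.ofReal (w x) := by
  obtain ⟨hloc, a, ha, α, hα0, hα1, K, hK⟩ := hw
  set N := Fintype.card ι with hN
  set ε : ℝ := (1 - α) / (N + 1) with hε
  have hN1 : (0 : ℝ) < N + 1 := by positivity
  have hε0 : 0 < ε := div_pos (by linarith) hN1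
  have hε1 : ε ≤ 1 := by
    rw [hε, div_le_one hN1]
    have : (0 : ℝ) ≤ N := by positivity
    linarith
  have hεN : ε * (N + 1) = 1 - α := div_mul_cancel₀ _ hN1.ne'
  refine ⟨a, ha, ε, hε0, K.toNNReal, fun c c' b hb hba hcc => ?_⟩
  set F := cube (fun i => (c i + c' i) / 2) ((1 - ε) * b) with hF
  have hFc : ∀ x ∈ F, ∀ i, |x i - c i| < b / 2 ∧ |x i - c' i| < b / 2 := by
    intro x hx i
    have h1 := abs_lt.1 (hx i)
    have h2 := abs_le.1 (hcc i)
    dsimp only at h1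
    rw [abs_lt, abs_lt]
    refine ⟨⟨?_, ?_⟩, ?_, ?_⟩ <;> nlinarith
  have hFv : α * volume.real (cube c b) ≤ volume.real F := by
    rw [volume_real_cube c hb.le, hF, volume_real_cube _ (mul_nonneg (by linarith) hb.le), mul_pow, ← hN]
    refine mul_le_mul_of_nonneg_right ?_ (by positivity)
    have := one_add_mul_le_pow (a := -ε) (by linarith) N
    have h3 : (1 + -ε) = 1 - ε := by ring
    rw [h3] at this
    nlinarith
  have hint : IntegrableOn w (cube c b) := by
    refine (hloc.integrableOn_isCompact (k := Set.Icc (fun i => c i - b / 2) (fun i => c i + b / 2))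
      isCompact_Icc).mono_set (cube_subset_Icc c b)
  have hFsub : F ⊆ cube c b := fun x hx i => (hFc x hx i).1
  have h := hK c b hb hba F (measurableSet_cube' _ _) hFsub hFv
  have e1 : ENNReal.ofReal (∫ x in cube c b, w x) = ∫⁻ x in cube c b, ENNReal.ofReal (w x) :=
    ofReal_integral_eq_lintegral_ofReal hint (ae_of_all _ hpos)
  have e2 : ENNReal.ofReal (∫ x in F, w x) = ∫⁻ x in F, ENNReal.ofReal (w x) :=
    ofReal_integral_eq_lintegral_ofReal (hint.mono_set hFsub) (ae_of_all _ hpos)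
  rw [← e1]
  calc ENNReal.ofReal (∫ x in cube c b, w x) ≤ ENNReal.ofReal (K * ∫ x in F, w x) :=
        ENNReal.ofReal_le_ofReal h
    _ ≤ ENNReal.ofReal K * ENNReal.ofReal (∫ x in F, w x) := by
        rw [ENNReal.ofReal_mul' (integral_nonneg fun x => hpos x)]
    _ = K.toNNReal * ∫⁻ x in F, ENNReal.ofReal (w x) := by rw [e2]; rfl
    _ ≤ _ := mul_le_mul' le_rfl (lintegral_mono_set fun x hx i => (hFc x hx i).2)

lemma AInftyLoc.exists_chain_le {w : (ι → ℝ) → ℝ} (hw : AInftyLoc w) (hpos : ∀ x, 0 ≤ w x) :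
    ∃ a : ℝ, 0 < a ∧ ∀ L : ℝ, 0 ≤ L → ∃ K : ℝ≥0, ∀ (c c' : ι → ℝ) (b : ℝ), 0 < b → b ≤ a →
      (∀ i, |c i - c' i| ≤ L * b) →
      ∫⁻ x in cube c b, ENNReal.ofReal (w x) ≤ K * ∫⁻ x in cube c' b, ENNReal.ofReal (w x) := by
  obtain ⟨a, ha, ε, hε0, K, hK⟩ := hw.exists_shift_le hpos
  refine ⟨a, ha, fun L hL => ?_⟩
  obtain ⟨T, hT⟩ := exists_nat_gt (L / ε)
  have hT0 : (0 : ℝ) < T := lt_of_le_of_lt (by positivity) hT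
  refine ⟨K ^ T, fun c c' b hb hba hcc => ?_⟩
  have hstep : ∀ s : ℕ, ∫⁻ x in cube c b, ENNReal.ofReal (w x) ≤ (K : ℝ≥0∞) ^ s *
      ∫⁻ x in cube (fun i => c i + (s / T : ℝ) * (c' i - c i)) b, ENNReal.ofReal (w x) := by
    intro s
    induction s with
    | zero => simp
    | succ s ih =>
      refine ih.trans ?_
      rw [pow_succ, mul_assoc]
      refine mul_le_mul' le_rfl (hK _ _ b hb hba fun i => ?_)
      have e : c i + (s / T : ℝ) * (c' i - c i) - (c i + ((s + 1 : ℕ) / T : ℝ) * (c' i - c i)) =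
          (c i - c' i) / T := by push_cast; ring
      rw [e, abs_div, abs_of_pos hT0, div_le_iff₀ hT0]
      refine (hcc i).trans ?_
      rw [div_lt_iff₀ hε0] at hT
      nlinarith
  have := hstep T
  have e : (fun i => c i + (T / T : ℝ) * (c' i - c i)) = c' := by
    ext i; rw [div_self hT0.ne']; ring
  rw [e] at this
  rw [ENNReal.coe_pow]
  exact this

/-- The mass of bounded sets at scale `ρ` is controlled by the mass of any nearby cube of comparable
size. -/
lemma AInftyLoc.exists_le_cube {w : (ι → ℝ) → ℝ} (hw : AInftyLoc w) (hpos : ∀ x, 0 ≤ w x) {κ : ℝ}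
    (hκ : 0 < κ) (L : ℝ) (hL : 0 ≤ L) :
    ∃ ϑ : ℝ, 0 < ϑ ∧ ϑ ≤ κ ∧ ∃ K : ℝ≥0, ∀ ρ : ℝ, 0 < ρ → ρ ≤ 1 →
      ∀ (c₀ c : ι → ℝ) (A : Set (ι → ℝ)), (∀ x ∈ A, ∀ i, |x i - c₀ i| ≤ ρ) →
        (∀ i, |c₀ i - c i| ≤ L * ρ) →
        ∫⁻ x in A, ENNReal.ofReal (w x) ≤ K * ∫⁻ x in cube c (ϑ * ρ), ENNReal.ofReal (w x) := by
  classical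
  obtain ⟨a, ha, hchain⟩ := hw.exists_chain_le hpos
  set ϑ := min a κ with hϑ
  have hϑ0 : 0 < ϑ := lt_min ha hκ
  have hϑκ : ϑ ≤ κ := min_le_right _ _
  obtain ⟨Z, hZ⟩ := exists_nat_gt (2 / ϑ + 1)
  obtain ⟨K, hK⟩ := hchain (L / ϑ + Z) (by positivity)
  set S : Finset (ι → ℤ) := Fintype.piFinset fun _ => Finset.Icc (-(Z : ℤ)) Z with hS
  refine ⟨ϑ, hϑ0, hϑκ, S.card * K, fun ρ hρ hρ1 c₀ c A hA hc => ?_⟩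
  set b := ϑ * ρ with hb
  have hb0 : 0 < b := mul_pos hϑ0 hρ
  have hba : b ≤ a := by
    calc b ≤ ϑ * 1 := mul_le_mul_of_nonneg_left hρ1 hϑ0.le
      _ ≤ a := by rw [mul_one]; exact min_le_left _ _
  have hcov : A ⊆ ⋃ z ∈ S, cube (fun i => c₀ i + b / 2 * z i) b := by
    intro x hx
    have hround : ∀ i, |(x i - c₀ i) / (b / 2) - round ((x i - c₀ i) / (b / 2))| ≤ 1 / 2 := fun i =>
      abs_sub_round _
    refine Set.mem_iUnion₂.2 ⟨fun i => round ((x i - c₀ i) / (b / 2)), ?_, fun i => ?_⟩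
    · refine Fintype.mem_piFinset.2 fun i => Finset.mem_Icc.2 (abs_le.1 ?_)
      have h1 : |(x i - c₀ i) / (b / 2)| ≤ 2 / ϑ := by
        rw [abs_div, abs_of_pos (by positivity : (0 : ℝ) < b / 2), div_le_div_iff₀ (by positivity) hϑ0]
        have := hA x hx i
        rw [hb]
        nlinarith
      have h2 : |((round ((x i - c₀ i) / (b / 2)) : ℤ) : ℝ)| < Z := by
        have h3 := abs_le.1 (hround i)
        have h4 := abs_le.1 h1
        rw [abs_lt]
        constructor <;> linarith
      have h5 : ((|round ((x i - c₀ i) / (b / 2))| : ℤ) : ℝ) < ((Z : ℤ) : ℝ) := by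
        push_cast; exact h2
      exact (Int.cast_lt.1 h5).le
    · have e : x i - (c₀ i + b / 2 * (round ((x i - c₀ i) / (b / 2)) : ℤ)) =
          (b / 2) * ((x i - c₀ i) / (b / 2) - round ((x i - c₀ i) / (b / 2))) := by
        field_simp; ring
      dsimp only
      rw [e, abs_mul, abs_of_pos (by positivity : (0 : ℝ) < b / 2)]
      have := hround i
      nlinarith
  calc ∫⁻ x in A, ENNReal.ofReal (w x)
      ≤ ∫⁻ x in ⋃ z ∈ S, cube (fun i => c₀ i + b / 2 * z i) b, ENNReal.ofReal (w x) :=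
        lintegral_mono_set hcov
    _ ≤ ∑ z ∈ S, ∫⁻ x in cube (fun i => c₀ i + b / 2 * z i) b, ENNReal.ofReal (w x) := by
        have h := lintegral_mono' (f := fun x => ENNReal.ofReal (w x))
          (Measure.restrict_biUnion_le (μ := volume)
            (S.countable_toSet) (s := fun z : ι → ℤ => cube (fun i => c₀ i + b / 2 * z i) b)) le_rfl
        refine h.trans (le_of_eq ?_)
        rw [lintegral_sum_measure]
        exact Finset.tsum_subtype S fun z => ∫⁻ x in cube (fun i => c₀ i + b / 2 * z i) b,
          ENNReal.ofReal (w x)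
    _ ≤ ∑ _z ∈ S, K * ∫⁻ x in cube c b, ENNReal.ofReal (w x) := by
        refine Finset.sum_le_sum fun z hz => hK _ _ b hb0 hba fun i => ?_
        have h1 := Finset.mem_Icc.1 (Fintype.mem_piFinset.1 hz i)
        have h2 : |(z i : ℝ)| ≤ Z := by
          rw [abs_le]; exact ⟨by exact_mod_cast h1.1, by exact_mod_cast h1.2⟩
        have e : c₀ i + b / 2 * z i - c i = (c₀ i - c i) + b / 2 * z i := by ring
        rw [e]
        refine (abs_add_le _ _).trans ?_
        rw [abs_mul, abs_of_pos (by positivity : (0 : ℝ) < b / 2)]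
        have h3 : L / ϑ * b = L * ρ := by rw [hb]; field_simp
        have h4 := hc i
        have h5 : b / 2 * |(z i : ℝ)| ≤ b * Z := by
          have : (0 : ℝ) ≤ Z := by positivity
          nlinarith
        nlinarith
    _ = _ := by
        rw [Finset.sum_const, nsmul_eq_mul]; push_cast; ring

end Doubling

/-! ### The weights `s` -/

lemma LocY.exists_translate_le {n : ℕ} {α₁ α₂ α₃ : ℝ} {s : ℕ → (Fin n → ℝ) → ℝ}
    (hs : LocY α₁ α₂ α₃ s) (R : ℕ) : ∃ D : ℝ≥0, ∀ (k : ℕ) (x v : Fin n → ℝ),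
      (∀ i, |v i| ≤ R / 2 ^ k) → s k x ≤ D * s k (x + v) := by
  set T : ℕ := R * (n + 1) + 1 with hT
  refine ⟨((2 : ℝ) ^ α₃).toNNReal ^ T, fun k x v hv => ?_⟩
  have hT0 : (0 : ℝ) < T := by rw [hT]; positivity
  have hstep : ∀ j : ℕ, s k x ≤ ((2 : ℝ) ^ α₃) ^ j * s k (x + (j / T : ℝ) • v) := by
    intro j
    induction j with
    | zero => simp
    | succ j ih =>
      refine ih.trans ?_
      rw [pow_succ, mul_assoc]
      refine mul_le_mul_of_nonneg_left (hs.2.2 k _ _ ?_) (by positivity)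
      have e : (x + (j / T : ℝ) • v) - (x + ((j + 1 : ℕ) / T : ℝ) • v) = (-(1 / T : ℝ)) • v := by
        ext i; simp; ring
      rw [e, euclNorm]
      refine Real.sqrt_le_iff.2 ⟨by positivity, ?_⟩
      have h1 : ∀ i, ((-(1 / T : ℝ)) • v) i ^ 2 ≤ (R / 2 ^ k / T) ^ 2 := by
        intro i
        refine sq_le_sq' ?_ ?_
        · have := abs_le.1 (hv i)
          simp only [Pi.smul_apply, smul_eq_mul]
          rw [show -(1 / (T : ℝ)) * v i = -(v i / T) by ring, neg_le_neg_iff]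
          exact div_le_div_of_nonneg_right this.2 hT0.le
        · have := abs_le.1 (hv i)
          simp only [Pi.smul_apply, smul_eq_mul]
          rw [show -(1 / (T : ℝ)) * v i = (-v i) / T by ring]
          exact div_le_div_of_nonneg_right (by linarith) hT0.le
      refine (Finset.sum_le_sum fun i _ => h1 i).trans ?_
      rw [Finset.sum_const, Finset.card_univ, Fintype.card_fin, nsmul_eq_mul]
      have h2 : (n : ℝ) * (R / 2 ^ k / T) ^ 2 = (n * R ^ 2 / T ^ 2) * (1 / 2 ^ k) ^ 2 := by
        field_simp
      rw [h2]
      refine mul_le_of_le_one_left (by positivity) ?_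
      rw [div_le_one (by positivity)]
      have h3 : (T : ℝ) = R * (n + 1) + 1 := by rw [hT]; push_cast; ring
      rw [h3]
      have hn : (0 : ℝ) ≤ n := by positivity
      have hR : (0 : ℝ) ≤ R := by positivity
      have h4 : (n : ℝ) * R ^ 2 ≤ (R * (n + 1)) ^ 2 := by
        have : (n : ℝ) ≤ (n + 1) ^ 2 := by nlinarith
        nlinarith [mul_le_mul_of_nonneg_right this (sq_nonneg (R : ℝ))]
      nlinarith [mul_nonneg hR hn]
  have := hstep T
  rw [div_self hT0.ne', one_smul] at this
  rw [NNReal.coe_pow, Real.coe_toNNReal _ (by positivity)]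
  exact this

lemma eLpNorm_mono_const_mul {n : ℕ} {μ : Measure (Fin n → ℝ)} (p : ℝ≥0∞) {f g : (Fin n → ℝ) → ℝ}
    (D : ℝ≥0) (hf : ∀ x, 0 ≤ f x) (h : ∀ x, f x ≤ D * g x) :
    eLpNorm f p μ ≤ D * eLpNorm g p μ := by
  have h1 : eLpNorm f p μ ≤ eLpNorm (fun x => (D : ℝ) * g x) p μ := by
    refine eLpNorm_mono_real fun x => ?_
    rw [Real.norm_eq_abs, abs_of_nonneg (hf x)]
    exact h x
  rw [eLpNorm_const_mul_real, NNReal.abs_eq, ENNReal.ofReal_coe_nnreal] at h1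
  exact h1

lemma LocY.exists_assoc_le_neighbour {n : ℕ} {α₁ α₂ α₃ : ℝ} {s : ℕ → (Fin n → ℝ) → ℝ}
    (hs : LocY α₁ α₂ α₃ s) (p : ℝ≥0∞) (R : ℕ) : ∃ D : ℝ≥0, ∀ (k : ℕ) (m : Fin n → ℤ),
      ∀ e ∈ intBox n R, assoc p s k m ≤ D * assoc p s k (m + e) := by
  obtain ⟨D, hD⟩ := hs.exists_translate_le R
  refine ⟨D, fun k m e he => ?_⟩
  set v : Fin n → ℝ := fun i => e i / 2 ^ k with hv
  have hvR : ∀ i, |v i| ≤ R / 2 ^ k := fun i => by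
    rw [hv, abs_div, abs_of_pos (by positivity : (0 : ℝ) < 2 ^ k)]
    refine div_le_div_of_nonneg_right ?_ (by positivity)
    have := mem_intBox.1 he i
    have h2 : ((|e i| : ℤ) : ℝ) ≤ ((R : ℤ) : ℝ) := Int.cast_le.2 this
    push_cast at h2
    exact h2
  refine (eLpNorm_mono_const_mul p D (g := fun x => s k (x + v)) (fun x => ((hs.1 k).2 x).le)
    fun x => hD k x v hvR).trans (mul_le_mul' le_rfl ?_)
  refine eLpNorm_translate_le (A := dyadicCube k m) (B := dyadicCube k (m + e)) v
    (fun x hx i => ?_) (hs.1 k).1 p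
  have h1 := hx i
  have h2 : (x + v) i = x i + e i / 2 ^ k := rfl
  have h3 : (((m + e) i : ℤ) : ℝ) = m i + e i := by push_cast [Pi.add_apply]; rfl
  rw [h2, h3]
  constructor
  · have : ((m i : ℝ) + e i) / 2 ^ k = m i / 2 ^ k + e i / 2 ^ k := by ring
    rw [this]; linarith [h1.1]
  · have : ((m i : ℝ) + e i + 1) / 2 ^ k = (m i + 1) / 2 ^ k + e i / 2 ^ k := by ring
    rw [this]; linarith [h1.2]

lemma LocY.exists_assoc_le_anc {n : ℕ} {α₁ α₂ α₃ : ℝ} {s : ℕ → (Fin n → ℝ) → ℝ}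
    (hs : LocY α₁ α₂ α₃ s) (p : ℝ≥0∞) : ∃ C : ℝ≥0, ∀ (j i : ℕ) (m : Fin n → ℤ),
      assoc p s (j + i) m ≤ C * ENNReal.ofReal ((2 : ℝ) ^ (α₂ * i)) * assoc p s j (anc i m) := by
  obtain ⟨C, hC0, hC⟩ := hs.2.1
  refine ⟨C.toNNReal, fun j i m => ?_⟩
  have h1 : ∀ x, s (j + i) x ≤ (C.toNNReal * ((2 : ℝ) ^ (α₂ * i)).toNNReal : ℝ≥0) * s j x := by
    intro x
    have h2 := (hC j (j + i) (by omega) x).2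
    rw [div_le_iff₀ ((hs.1 j).2 x)] at h2
    rw [NNReal.coe_mul, Real.coe_toNNReal _ hC0.le, Real.coe_toNNReal _ (by positivity)]
    have e : α₂ * (((j + i : ℕ) : ℝ) - j) = α₂ * i := by push_cast; ring
    rwa [e] at h2
  refine (eLpNorm_mono_const_mul p _ (fun x => ((hs.1 (j + i)).2 x).le) h1).trans ?_
  rw [ENNReal.coe_mul]
  exact mul_le_mul' le_rfl (eLpNorm_mono_measure _ (Measure.restrict_mono (anc_sub_mem i j m) le_rfl))

/-! ### The weight `γ` -/

section Gamma

variable {n d : ℕ} {p : ℝ≥0∞} {γ : (Fin n ⊕ Fin d → ℝ) → ℝ}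

lemma gammaHat_rpow (hp : p ≠ 0) (hp' : p ≠ ∞) (hγ : IsWeight γ) (k : ℕ) (m : Fin n → ℤ) :
    gammaHat p γ k m ^ p.toReal = ∫⁻ z in layer d k m, ENNReal.ofReal (γ z ^ p.toReal) := by
  rw [gammaHat, eLpNorm_weight_rpow hp hp' hγ.2]
  simp_rw [ENNReal.ofReal_rpow_of_pos (hγ.2 _)]

lemma measurable_euclNorm {ι : Type} [Fintype ι] : Measurable (euclNorm : (ι → ℝ) → ℝ) := by
  unfold euclNorm; fun_prop

lemma abs_le_euclNorm {ι : Type} [Fintype ι] (x : ι → ℝ) (i : ι) : |x i| ≤ euclNorm x := by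
  rw [euclNorm, ← Real.sqrt_sq_eq_abs]
  exact Real.sqrt_le_sqrt (Finset.single_le_sum (f := fun i => x i ^ 2) (fun _ _ => sq_nonneg _)
    (Finset.mem_univ i))

lemma measurableSet_layer (k : ℕ) (m : Fin n → ℤ) : MeasurableSet (layer d k m) := by
  have h1 : MeasurableSet {z : Fin n ⊕ Fin d → ℝ | (fun i => z (Sum.inl i)) ∈ dyadicCube k m} :=
    (show Measurable fun (z : Fin n ⊕ Fin d → ℝ) (i : Fin n) => z (Sum.inl i) by fun_prop)
      (measurableSet_dyadicCube k m)
  have h2 : Measurable fun z : Fin n ⊕ Fin d → ℝ => euclNorm (fun i => z (Sum.inr i)) :=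
    measurable_euclNorm.comp (by fun_prop)
  exact h1.inter ((MeasurableSet.const _).union
    ((measurableSet_lt h2 measurable_const).inter (measurableSet_le measurable_const h2)))

/-- The centre of a cube, as a point of the larger space. -/
def extCentre (d k : ℕ) (m : Fin n → ℤ) : Fin n ⊕ Fin d → ℝ
  | Sum.inl i => dyadicCentre k m i
  | Sum.inr _ => 0

lemma abs_sub_extCentre_le {k : ℕ} {m : Fin n → ℤ} {z : Fin n ⊕ Fin d → ℝ}
    (h1 : (fun i => z (Sum.inl i)) ∈ dyadicCube k m)
    (h2 : d = 0 ∨ euclNorm (fun i => z (Sum.inr i)) < 1 / 2 ^ k) (i : Fin n ⊕ Fin d) :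
    |z i - extCentre d k m i| ≤ 1 / 2 ^ k := by
  rcases i with i | i
  · have h := h1 i
    have h3 : dyadicCentre k m i = m i / 2 ^ k + 1 / 2 * (1 / 2 ^ k) := by rw [dyadicCentre]; ring
    have h4 : ((m i : ℝ) + 1) / 2 ^ k = m i / 2 ^ k + 1 / 2 ^ k := by ring
    have h5 : (0 : ℝ) < 1 / 2 ^ k := by positivity
    rw [h4] at h
    simp only [extCentre]
    rw [h3, abs_le]
    constructor <;> linarith [h.1, h.2]
  · simp only [extCentre, sub_zero]
    rcases h2 with h2 | h2
    · subst h2; exact i.elim0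
    · exact (abs_le_euclNorm (fun i => z (Sum.inr i)) i).trans h2.le

open Classical in
/-- The centre of a cube contained in a layer. -/
def layerCentre (d k : ℕ) (m : Fin n → ℤ) : Fin n ⊕ Fin d → ℝ
  | Sum.inl i => dyadicCentre k m i
  | Sum.inr i => if (i : ℕ) = 0 then 3 / 4 * (1 / 2 ^ k) else 0

lemma cube_layerCentre_subset {ϑ : ℝ} (hϑ : 0 < ϑ) (hϑ1 : ϑ ≤ 1 / (8 * (d + 1))) (k : ℕ)
    (m : Fin n → ℤ) : cube (layerCentre d k m) (ϑ * (1 / 2 ^ k)) ⊆ layer d k m := by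
  intro z hz
  set ρ : ℝ := 1 / 2 ^ k with hρ
  have hρ0 : 0 < ρ := by positivity
  have hd0 : (0 : ℝ) ≤ d := by positivity
  have hϑd : ϑ * (d + 1) ≤ 1 / 8 := by
    rw [le_div_iff₀ (by positivity)] at hϑ1; linarith
  have hϑ8 : ϑ ≤ 1 / 8 := by nlinarith
  have hb : ϑ * ρ ≤ 1 / 8 * ρ := mul_le_mul_of_nonneg_right hϑ8 hρ0.le
  refine ⟨fun i => ?_, ?_⟩
  · have h := abs_lt.1 (hz (Sum.inl i))
    simp only [layerCentre] at h
    have h3 : dyadicCentre k m i = m i / 2 ^ k + 1 / 2 * ρ := by rw [dyadicCentre, hρ]; ring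
    have h4 : ((m i : ℝ) + 1) / 2 ^ k = m i / 2 ^ k + ρ := by rw [hρ]; ring
    rw [h3] at h
    rw [h4]
    constructor <;> linarith [h.1, h.2]
  · rcases Nat.eq_zero_or_pos d with hd | hd
    · exact Or.inl hd
    · right
      have h0 := abs_lt.1 (hz (Sum.inr ⟨0, hd⟩))
      simp only [layerCentre, if_true] at h0
      constructor
      · rw [euclNorm]
        refine (Real.sqrt_lt' hρ0).2 ?_
        have hle : ∀ i : Fin d, z (Sum.inr i) ^ 2 ≤
            (if i = ⟨0, hd⟩ then (7 / 8 * ρ) ^ 2 else 0) + (ϑ * ρ) ^ 2 := by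
          intro i
          have hi := abs_lt.1 (hz (Sum.inr i))
          simp only [layerCentre] at hi
          by_cases hi0 : i = ⟨0, hd⟩
          · subst hi0
            rw [if_pos rfl]
            simp only [if_true] at hi
            have : z (Sum.inr ⟨0, hd⟩) ^ 2 ≤ (7 / 8 * ρ) ^ 2 :=
              sq_le_sq' (by linarith [hi.1]) (by linarith [hi.2])
            nlinarith [sq_nonneg (ϑ * ρ)]
          · rw [if_neg hi0, zero_add]
            rw [if_neg fun h => hi0 (Fin.ext h)] at hi
            exact sq_le_sq' (by nlinarith [hi.1]) (by nlinarith [hi.2])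
        refine lt_of_le_of_lt (Finset.sum_le_sum fun i _ => hle i) ?_
        rw [Finset.sum_add_distrib, Finset.sum_ite_eq' Finset.univ, if_pos (Finset.mem_univ _),
          Finset.sum_const, Finset.card_univ, Fintype.card_fin, nsmul_eq_mul]
        have h5 : (d : ℝ) * (ϑ * ρ) ^ 2 ≤ 1 / 64 * ρ ^ 2 := by
          have : (d : ℝ) * ϑ ^ 2 ≤ 1 / 64 := by nlinarith
          nlinarith [sq_nonneg ρ]
        nlinarith [sq_nonneg ρ, mul_pos hρ0 hρ0]
      · refine le_trans ?_ (abs_le_euclNorm _ ⟨0, hd⟩)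
        refine le_trans ?_ (le_abs_self _)
        have : (1 : ℝ) / 2 ^ (k + 1) = 1 / 2 * ρ := by rw [hρ, pow_succ]; field_simp
        rw [this]
        linarith [h0.1]

/-- The mass of a neighbourhood of a layer is controlled by the mass of any neighbouring layer. -/
lemma exists_lintegral_le_layer (hγA : AInftyLoc fun z => γ z ^ p.toReal) (hγ : IsWeight γ) (R : ℕ) :
    ∃ K : ℝ≥0, ∀ (k : ℕ) (m e : Fin n → ℤ) (_ : e ∈ intBox n R) (A : Set (Fin n ⊕ Fin d → ℝ)),
      (∀ z ∈ A, (fun i => z (Sum.inl i)) ∈ dyadicCube k m ∧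
        (d = 0 ∨ euclNorm (fun i => z (Sum.inr i)) < 1 / 2 ^ k)) →
      ∫⁻ z in A, ENNReal.ofReal (γ z ^ p.toReal) ≤
        K * ∫⁻ z in layer d k (m + e), ENNReal.ofReal (γ z ^ p.toReal) := by
  obtain ⟨ϑ, hϑ0, hϑ1, K, hK⟩ := hγA.exists_le_cube (fun z => Real.rpow_nonneg (hγ.2 z).le _)
    (κ := 1 / (8 * (d + 1))) (by positivity) (R + 1) (by positivity)
  refine ⟨K, fun k m e he A hA => ?_⟩
  have hρ1 : (1 : ℝ) / 2 ^ k ≤ 1 := by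
    rw [div_le_one (by positivity)]; exact one_le_pow₀ (by norm_num)
  refine (hK (1 / 2 ^ k) (by positivity) hρ1 (extCentre d k m) (layerCentre d k (m + e)) A
    (fun z hz i => abs_sub_extCentre_le (hA z hz).1 (hA z hz).2 i) fun i => ?_).trans
    (mul_le_mul' le_rfl (lintegral_mono_set (cube_layerCentre_subset hϑ0 hϑ1 k (m + e))))
  have hρ0 : (0 : ℝ) < 1 / 2 ^ k := by positivity
  have hR0 : (0 : ℝ) ≤ R := by positivity
  rcases i with i | i
  · simp only [extCentre, layerCentre, dyadicCentre]
    have h2 : ((|e i| : ℤ) : ℝ) ≤ ((R : ℤ) : ℝ) := Int.cast_le.2 (mem_intBox.1 he i)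
    push_cast at h2
    have h3 : ((m i : ℝ) + 1 / 2) / 2 ^ k - ((((m + e) i : ℤ) : ℝ) + 1 / 2) / 2 ^ k =
        -(e i) * (1 / 2 ^ k) := by push_cast [Pi.add_apply]; ring
    rw [h3, abs_mul, abs_neg, abs_of_pos hρ0]
    nlinarith
  · simp only [extCentre, layerCentre]
    split_ifs
    · rw [zero_sub, abs_neg, abs_of_pos (by positivity)]; nlinarith
    · rw [sub_zero, abs_zero]; positivity

lemma exists_gammaHat_le_neighbour (hp : p ≠ 0) (hp' : p ≠ ∞)
    (hγA : AInftyLoc fun z => γ z ^ p.toReal) (hγ : IsWeight γ) (R : ℕ) :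
    ∃ D : ℝ≥0, ∀ (k : ℕ) (m : Fin n → ℤ), ∀ e ∈ intBox n R,
      gammaHat p γ k m ≤ D * gammaHat p γ k (m + e) := by
  obtain ⟨K, hK⟩ := exists_lintegral_le_layer hγA hγ R
  have h0 := toReal_pos' hp hp'
  refine ⟨K ^ (1 / p.toReal), fun k m e he => ?_⟩
  rw [← ENNReal.rpow_le_rpow_iff h0, ENNReal.mul_rpow_of_nonneg _ _ h0.le,
    ENNReal.coe_rpow_of_nonneg _ (by positivity), ← ENNReal.rpow_mul, one_div_mul_cancel h0.ne',
    ENNReal.rpow_one, gammaHat_rpow hp hp' hγ, gammaHat_rpow hp hp' hγ]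
  exact hK k m e he _ fun z hz => ⟨hz.1, hz.2.imp_right fun h => h.1⟩

lemma decayExponent_zero (hp : p ≠ 0) (hp' : p ≠ ∞)
    (hγA : AInftyLoc fun z => γ z ^ p.toReal) (hγ : IsWeight γ) : DecayExponent p γ 0 := by
  obtain ⟨K, hK⟩ := exists_lintegral_le_layer hγA hγ 0
  refine ⟨K + 1, by positivity, fun k j hkj m => ?_⟩
  simp_rw [gammaHat_rpow hp hp' hγ]
  have hdisj : Pairwise (Function.onFun Disjoint fun m' : {m' : Fin n → ℤ //
      dyadicCube j m' ⊆ dyadicCube k m} => layer d j m'.1) := by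
    intro m₁ m₂ hm
    refine Set.disjoint_left.2 fun z hz₁ hz₂ => ?_
    exact Set.disjoint_left.1 (pairwise_disjoint_dyadicCube j (fun h => hm (Subtype.ext h)))
      hz₁.1 hz₂.1
  have hU := lintegral_iUnion (μ := volume)
    (fun m' : {m' : Fin n → ℤ // dyadicCube j m' ⊆ dyadicCube k m} =>
      measurableSet_layer (d := d) j m'.1) hdisj (fun z => ENNReal.ofReal (γ z ^ p.toReal))
  refine hU.symm.le.trans ((hK k m 0 (zero_mem_intBox n 0) _ fun z hz => ?_).trans ?_)
  · obtain ⟨m', hm'⟩ := Set.mem_iUnion.1 hz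
    refine ⟨m'.2 hm'.1, hm'.2.imp_right fun h => h.1.trans_le ?_⟩
    exact one_div_le_one_div_of_le (by positivity) (pow_le_pow_right₀ (by norm_num) hkj)
  · rw [add_zero, mul_zero, Real.rpow_zero, mul_one]
    refine mul_le_mul' ?_ le_rfl
    rw [ENNReal.ofReal_add (by positivity) (by norm_num), ENNReal.ofReal_coe_nnreal]
    exact le_self_add

lemma subsetExponent_zero : SubsetExponent p γ 0 := by
  refine ⟨1, one_pos, fun k j _ m G hG => ?_⟩
  rw [Real.rpow_zero, mul_one, ENNReal.ofReal_one, one_mul]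
  classical
  calc ∑ m' ∈ G, gammaHat p γ j m' ^ p.toReal
      = ∑ m' ∈ G.subtype (fun m' => dyadicCube j m' ⊆ dyadicCube k m),
          gammaHat p γ j m'.1 ^ p.toReal := by
        rw [Finset.sum_subtype_of_mem (fun m' => gammaHat p γ j m' ^ p.toReal) hG]
    _ ≤ _ := ENNReal.sum_le_tsum _

lemma exists_mem_sSup_sub_lt {S : Set ℝ} {x : ℝ} (hx : x ∈ S) (hx0 : 0 ≤ x) {ε : ℝ} (hε : 0 < ε) :
    ∃ y ∈ S, sSup S - ε < y := by
  by_cases h : BddAbove S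
  · exact exists_lt_of_lt_csSup ⟨x, hx⟩ (by linarith)
  · rw [Real.sSup_of_not_bddAbove h]
    exact ⟨x, hx, by linarith⟩

/-- Exponents close to `delta₁` and `delta₂`. -/
lemma exists_exponents (hp : p ≠ 0) (hp' : p ≠ ∞)
    (hγA : AInftyLoc fun z => γ z ^ p.toReal) (hγ : IsWeight γ) {l α₂ : ℝ}
    (hα₂ : α₂ < min l (l - 1 + delta₂ p γ / p.toReal) + d * delta₁ p γ / p.toReal) :
    ∃ δ δ' : ℝ, 0 ≤ δ ∧ DecayExponent p γ δ ∧ 0 ≤ δ' ∧ SubsetExponent p γ δ' ∧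
      α₂ < min l (l - 1 + δ' / p.toReal) + d * δ / p.toReal := by
  have h0 := toReal_pos' hp hp'
  set P := p.toReal with hP
  set g := min l (l - 1 + delta₂ p γ / P) + d * delta₁ p γ / P - α₂ with hg
  have hg0 : 0 < g := by rw [hg]; linarith
  set ε := g * P / (d + 2) with hε
  have hd : (0 : ℝ) ≤ d := by positivity
  have hε0 : 0 < ε := by positivity
  obtain ⟨δ, ⟨hδ0, hδ⟩, hδε⟩ := exists_mem_sSup_sub_lt
    (S := {δ | 0 ≤ δ ∧ DecayExponent p γ δ}) ⟨le_rfl, decayExponent_zero hp hp' hγA hγ⟩ le_rfl hε0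
  obtain ⟨δ', ⟨hδ'0, hδ'⟩, hδ'ε⟩ := exists_mem_sSup_sub_lt
    (S := {δ | 0 ≤ δ ∧ SubsetExponent p γ δ}) ⟨le_rfl, subsetExponent_zero⟩ le_rfl hε0
  refine ⟨δ, δ', hδ0, hδ, hδ'0, hδ', ?_⟩
  have h1 : delta₁ p γ - ε < δ := hδε
  have h2 : delta₂ p γ - ε < δ' := hδ'ε
  have hεP : ε / P * (d + 2) = g := by rw [hε]; field_simp
  have hεP0 : 0 < ε / P := by positivity
  have h3 : delta₂ p γ / P - ε / P < δ' / P := by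
    rw [← sub_div]; exact div_lt_div_of_pos_right h2 h0
  have h4 : d * delta₁ p γ / P - d * (ε / P) ≤ d * δ / P := by
    rw [← mul_div_assoc, ← sub_div, ← mul_sub]
    exact div_le_div_of_nonneg_right (mul_le_mul_of_nonneg_left h1.le hd) h0.le
  have h5 : min l (l - 1 + delta₂ p γ / P) - ε / P ≤ min l (l - 1 + δ' / P) := by
    refine le_min ?_ ?_
    · linarith [min_le_left l (l - 1 + delta₂ p γ / P)]
    · linarith [min_le_right l (l - 1 + delta₂ p γ / P)]
  nlinarith

end Gamma

/-! ### The weighted decay over descendants of a cell -/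

lemma dyadicCube_eq_cube {n : ℕ} (k : ℕ) (m : Fin n → ℤ) :
    dyadicCube k m = cube (dyadicCentre k m) (1 / 2 ^ k) := by
  ext x
  refine forall_congr' fun i => ?_
  rw [abs_lt, dyadicCentre]
  have h1 : ((m i : ℝ) + 1) / 2 ^ k = m i / 2 ^ k + 1 / 2 ^ k := by ring
  have h2 : ((m i : ℝ) + 1 / 2) / 2 ^ k = m i / 2 ^ k + 1 / 2 ^ k / 2 := by ring
  rw [h1, h2]
  constructor <;> rintro ⟨h, h'⟩ <;> constructor <;> linarith

lemma volume_real_dyadicCube {n : ℕ} (k : ℕ) (m : Fin n → ℤ) :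
    volume.real (dyadicCube k m) = (1 / 2 ^ k) ^ n := by
  rw [dyadicCube_eq_cube, volume_real_cube _ (by positivity), Fintype.card_fin]

lemma dyadicCube_subset_iff {n : ℕ} {i j : ℕ} {m M : Fin n → ℤ} :
    dyadicCube (j + i) m ⊆ dyadicCube j M ↔ anc i m = M := by
  refine ⟨fun h => ?_, fun h => h ▸ anc_sub_mem i j m⟩
  have hx : dyadicMap (j + i) m (fun _ => 1 / 2) ∈ dyadicCube (j + i) m := by
    rw [dyadicMap_mem_dyadicCube, mem_ucube]; intro i; norm_num
  rw [← cell_eq_of_mem_dyadicCube (anc_sub_mem i j m hx), cell_eq_of_mem_dyadicCube (h hx)]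

/-- The multi-indices of the descendants of `M`, `i` generations later, that are close to the
boundary in the coordinate `c`. -/
def boundaryDesc {n : ℕ} (l i : ℕ) (M : Fin n → ℤ) (c : Fin n) : Finset (Fin n → ℤ) :=
  Fintype.piFinset fun c' => if c' = c then
    Finset.Ico (2 ^ i * M c) (2 ^ i * M c + (2 * l + 1)) ∪
      Finset.Ico (2 ^ i * M c + 2 ^ i - (2 * l + 1)) (2 ^ i * M c + 2 ^ i)
    else Finset.Ico (2 ^ i * M c') (2 ^ i * M c' + 2 ^ i)

lemma card_boundaryDesc_le {n : ℕ} (l i : ℕ) (M : Fin n → ℤ) (c : Fin n) :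
    (boundaryDesc l i M c).card ≤ (4 * l + 2) * (2 ^ i) ^ (n - 1) := by
  rw [boundaryDesc, Fintype.card_piFinset, ← Finset.mul_prod_erase _ _ (Finset.mem_univ c)]
  refine Nat.mul_le_mul ?_ (le_of_eq ?_)
  · rw [if_pos rfl]
    refine (Finset.card_union_le _ _).trans ?_
    rw [Int.card_Ico, Int.card_Ico]
    omega
  · rw [Finset.prod_congr rfl (g := fun _ => 2 ^ i), Finset.prod_const,
      Finset.card_erase_of_mem (Finset.mem_univ c), Finset.card_univ, Fintype.card_fin]
    intro c' hc'
    rw [if_neg (Finset.ne_of_mem_erase hc'), Int.card_Ico, add_sub_cancel_left]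
    exact_mod_cast Int.toNat_natCast (2 ^ i)

open Classical in
/-- The descendants of `M`, `i` generations later, that are not inner. -/
def nonInnerDesc {n : ℕ} (l i : ℕ) (M : Fin n → ℤ) : Finset (Fin n → ℤ) :=
  (Finset.univ.biUnion (boundaryDesc l i M)).filter fun m => anc i m = M

lemma card_nonInnerDesc_le {n : ℕ} (l i : ℕ) (M : Fin n → ℤ) :
    (nonInnerDesc l i M).card ≤ n * ((4 * l + 2) * (2 ^ i) ^ (n - 1)) := by
  classical
  refine (Finset.card_filter_le _ _).trans (Finset.card_biUnion_le.trans ?_)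
  refine (Finset.sum_le_sum fun c _ => card_boundaryDesc_le l i M c).trans ?_
  simp

lemma anc_eq_of_mem_nonInnerDesc {n l i : ℕ} {M m : Fin n → ℤ} (h : m ∈ nonInnerDesc l i M) :
    anc i m = M := (Finset.mem_filter.1 h).2

lemma mem_nonInnerDesc {n l i : ℕ} {M m : Fin n → ℤ} (h : anc i m = M) (hm : ¬ IsInner l i m) :
    m ∈ nonInnerDesc l i M := by
  refine Finset.mem_filter.2 ⟨?_, h⟩
  rw [IsInner] at hm
  push Not at hm
  obtain ⟨c, hc⟩ := hm
  refine Finset.mem_biUnion.2 ⟨c, Finset.mem_univ _, Fintype.mem_piFinset.2 fun c' => ?_⟩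
  have hM : ∀ c, m c = 2 ^ i * M c + m c % 2 ^ i := fun c => by
    rw [← h, anc]; exact (Int.mul_ediv_add_emod _ _).symm
  have h0 := fun c => Int.emod_nonneg (m c) (b := 2 ^ i) (by positivity)
  have h1 := fun c => Int.emod_lt_of_pos (m c) (b := 2 ^ i) (by positivity)
  split_ifs with hcc
  · subst hcc
    have e1 := hM c'
    have e2 := h0 c'
    have e3 := h1 c'
    rw [Finset.mem_union, Finset.mem_Ico, Finset.mem_Ico]
    generalize m c' % 2 ^ i = ρ at *
    generalize 2 ^ i * M c' = σ at *
    generalize (2 : ℤ) ^ i = ω at *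
    by_cases hρ : 2 * (l : ℤ) + 1 ≤ ρ
    · right
      have := hc hρ
      omega
    · left
      omega
  · have e1 := hM c'
    have e2 := h0 c'
    have e3 := h1 c'
    rw [Finset.mem_Ico]
    generalize m c' % 2 ^ i = ρ at *
    generalize 2 ^ i * M c' = σ at *
    omega

lemma volume_real_nonInnerDesc_le {n : ℕ} (hn : 1 ≤ n) (l i j : ℕ) (M : Fin n → ℤ) :
    volume.real (⋃ m ∈ nonInnerDesc l i M, dyadicCube (j + i) m) / volume.real (dyadicCube j M) ≤
      n * (4 * l + 2) * (1 / 2) ^ i := by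
  rw [div_le_iff₀ (by rw [volume_real_dyadicCube]; positivity)]
  refine (measureReal_biUnion_finset_le _ _).trans ?_
  simp_rw [volume_real_dyadicCube]
  rw [Finset.sum_const, nsmul_eq_mul]
  have h := card_nonInnerDesc_le l i M
  have h' : ((nonInnerDesc l i M).card : ℝ) ≤ n * ((4 * l + 2) * (2 ^ i) ^ (n - 1)) := by
    exact_mod_cast h
  refine (mul_le_mul_of_nonneg_right h' (by positivity)).trans (le_of_eq ?_)
  obtain ⟨n, rfl⟩ : ∃ n', n = n' + 1 := ⟨n - 1, by omega⟩
  rw [Nat.add_sub_cancel, pow_add 2 j i, ← one_div_mul_one_div, mul_pow,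
    pow_succ (1 / 2 ^ i : ℝ)]
  have : ((2 : ℝ) ^ i) ^ n * (1 / 2 ^ i) ^ n = 1 := by
    rw [← mul_pow, mul_one_div_cancel (by positivity), one_pow]
  rw [one_div_pow (2 : ℝ) i]
  linear_combination ((n + 1 : ℕ) : ℝ) * (4 * l + 2) * (1 / 2 ^ i) * (1 / 2 ^ j) ^ (n + 1) * this

lemma tsum_mul_cellRate_rpow_le {n : ℕ} (l i : ℕ) (P : ℝ) (M : Fin n → ℤ)
    (f : (Fin n → ℤ) → ℝ≥0∞) :
    ∑' m : {m : Fin n → ℤ // anc i m = M}, f m.1 * (cellRate l i m.1 : ℝ≥0∞) ^ P ≤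
      (((1 / 2 : ℝ≥0) ^ (i * l) : ℝ≥0) : ℝ≥0∞) ^ P * ∑' m : {m : Fin n → ℤ // anc i m = M}, f m.1 +
        (((1 / 2 : ℝ≥0) ^ (i * (l - 1)) : ℝ≥0) : ℝ≥0∞) ^ P * ∑ m ∈ nonInnerDesc l i M, f m := by
  classical
  set u : ℝ≥0∞ := (((1 / 2 : ℝ≥0) ^ (i * l) : ℝ≥0) : ℝ≥0∞) ^ P with hu
  set v : ℝ≥0∞ := (((1 / 2 : ℝ≥0) ^ (i * (l - 1)) : ℝ≥0) : ℝ≥0∞) ^ P with hv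
  have h1 : ∀ m : {m : Fin n → ℤ // anc i m = M}, f m.1 * (cellRate l i m.1 : ℝ≥0∞) ^ P ≤
      u * f m.1 + v * (if m.1 ∈ nonInnerDesc l i M then f m.1 else 0) := by
    intro m
    by_cases hm : IsInner l i m.1
    · rw [cellRate, if_pos hm, mul_comm]; exact le_self_add
    · rw [cellRate, if_neg hm, if_pos (mem_nonInnerDesc m.2 hm), mul_comm]; exact le_add_self
  refine (ENNReal.tsum_le_tsum h1).trans ?_
  rw [ENNReal.tsum_add, ENNReal.tsum_mul_left, ENNReal.tsum_mul_left]
  refine add_le_add le_rfl (mul_le_mul' le_rfl ?_)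
  refine (ENNReal.tsum_comp_le_tsum_of_injective Subtype.val_injective
    (fun m => if m ∈ nonInnerDesc l i M then f m else 0)).trans ?_
  rw [tsum_eq_sum (s := nonInnerDesc l i M) fun m hm => if_neg hm]
  exact (Finset.sum_congr rfl fun m hm => if_pos hm).le

lemma coe_half_pow_rpow {a : ℕ} {P : ℝ} (hP : 0 ≤ P) :
    (((1 / 2 : ℝ≥0) ^ a : ℝ≥0) : ℝ≥0∞) ^ P = ENNReal.ofReal ((2 : ℝ) ^ (-(a * P))) := by
  rw [← ENNReal.coe_rpow_of_nonneg _ hP, ENNReal.ofReal, ENNReal.coe_inj]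
  ext
  rw [Real.coe_toNNReal _ (by positivity), NNReal.coe_rpow, NNReal.coe_pow, Real.rpow_neg (by norm_num),
    Real.rpow_mul (by norm_num), Real.rpow_natCast, ← Real.inv_rpow (by positivity)]
  push_cast
  rw [one_div, inv_pow]

/-- The decay of the masses of the layers, weighted with `cellRate`. -/
lemma exists_tsum_gammaHat_le {n d l : ℕ} (hn : 1 ≤ n) (hl : 1 ≤ l) {p : ℝ≥0∞} (hp : p ≠ 0)
    (hp' : p ≠ ∞) {γ : (Fin n ⊕ Fin d → ℝ) → ℝ} {δ δ' : ℝ} (hδ : DecayExponent p γ δ) (hδ'0 : 0 ≤ δ')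
    (hδ' : SubsetExponent p γ δ') : ∃ B : ℝ, 0 < B ∧ ∀ (j i : ℕ) (M : Fin n → ℤ),
      ∑' m : {m : Fin n → ℤ // anc i m = M},
        gammaHat p γ (j + i) m.1 ^ p.toReal * (cellRate l i m.1 : ℝ≥0∞) ^ p.toReal ≤
      ENNReal.ofReal (B * (2 : ℝ) ^ (-(i * (min (l : ℝ) (l - 1 + δ' / p.toReal) * p.toReal + d * δ)))) *
        gammaHat p γ j M ^ p.toReal := by
  obtain ⟨C₁, hC₁0, hC₁⟩ := hδ
  obtain ⟨C₂, hC₂0, hC₂⟩ := hδ'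
  have h0 := toReal_pos' hp hp'
  set P := p.toReal with hP
  set V : ℝ := n * (4 * l + 2) with hV
  have hV0 : 0 < V := by positivity
  set μ := min (l : ℝ) (l - 1 + δ' / P) with hμ
  refine ⟨(1 + C₂ * V ^ δ') * C₁, by positivity, fun j i M => ?_⟩
  have hsub : ∑' m : {m : Fin n → ℤ // dyadicCube (j + i) m ⊆ dyadicCube j M},
      gammaHat p γ (j + i) m.1 ^ P =
      ∑' m : {m : Fin n → ℤ // anc i m = M}, gammaHat p γ (j + i) m.1 ^ P :=
    (Equiv.subtypeEquivRight fun m => dyadicCube_subset_iff (i := i) (j := j) (m := m)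
      (M := M)).tsum_eq (fun m : {m : Fin n → ℤ // anc i m = M} => gammaHat p γ (j + i) m.1 ^ P)
  have h1 := hC₁ j (j + i) (by omega) M
  have h2 := hC₂ j (j + i) (by omega) M (nonInnerDesc l i M) fun m hm =>
    dyadicCube_subset_iff.2 (anc_eq_of_mem_nonInnerDesc hm)
  rw [hsub] at h1 h2
  refine (tsum_mul_cellRate_rpow_le l i P M fun m => gammaHat p γ (j + i) m ^ P).trans ?_
  set Z := ∑' m : {m : Fin n → ℤ // anc i m = M}, gammaHat p γ (j + i) m.1 ^ P with hZ
  rw [coe_half_pow_rpow h0.le, coe_half_pow_rpow h0.le]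
  have hbase : (2 : ℝ) ^ (-(i * (μ * P))) ≥ (2 : ℝ) ^ (-(((i * l : ℕ) : ℝ) * P)) := by
    refine Real.rpow_le_rpow_of_exponent_le (by norm_num) ?_
    have : μ ≤ l := min_le_left _ _
    push_cast
    have h3 : (i : ℝ) * (μ * P) ≤ i * (l * P) :=
      mul_le_mul_of_nonneg_left (mul_le_mul_of_nonneg_right this h0.le) (by positivity)
    linarith
  have hbase' : (2 : ℝ) ^ (-(((i * (l - 1) : ℕ) : ℝ) * P)) *
      (volume.real (⋃ m ∈ nonInnerDesc l i M, dyadicCube (j + i) m) /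
        volume.real (dyadicCube j M)) ^ δ' ≤ V ^ δ' * (2 : ℝ) ^ (-(i * (μ * P))) := by
    have h3 : (volume.real (⋃ m ∈ nonInnerDesc l i M, dyadicCube (j + i) m) /
        volume.real (dyadicCube j M)) ^ δ' ≤ V ^ δ' * (2 : ℝ) ^ (-(i * δ')) := by
      refine (Real.rpow_le_rpow (by positivity) (volume_real_nonInnerDesc_le hn l i j M)
        hδ'0).trans (le_of_eq ?_)
      rw [Real.mul_rpow hV0.le (by positivity), ← neg_mul, Real.rpow_mul (by norm_num),
        Real.rpow_neg (by norm_num), Real.rpow_natCast, one_div, inv_pow]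
    refine (mul_le_mul_of_nonneg_left h3 (by positivity)).trans ?_
    rw [mul_left_comm, ← Real.rpow_add (by norm_num)]
    refine mul_le_mul_of_nonneg_left (Real.rpow_le_rpow_of_exponent_le (by norm_num) ?_)
      (by positivity)
    have h4 : μ * P ≤ (l - 1) * P + δ' := by
      have := mul_le_mul_of_nonneg_right (min_le_right (l : ℝ) (l - 1 + δ' / P)) h0.le
      rw [add_mul, div_mul_cancel₀ _ h0.ne'] at this
      exact this
    have h5 := mul_le_mul_of_nonneg_left h4 (by positivity : (0 : ℝ) ≤ i)
    push_cast [Nat.cast_sub hl]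
    linarith
  have h6 : ENNReal.ofReal ((2 : ℝ) ^ (-(((i * (l - 1) : ℕ) : ℝ) * P))) *
      ∑ m ∈ nonInnerDesc l i M, gammaHat p γ (j + i) m ^ P ≤
      ENNReal.ofReal (C₂ * V ^ δ' * (2 : ℝ) ^ (-(i * (μ * P)))) * Z := by
    refine (mul_le_mul' le_rfl h2).trans ?_
    rw [← mul_assoc, ← ENNReal.ofReal_mul (by positivity)]
    refine mul_le_mul' (ENNReal.ofReal_le_ofReal ?_) le_rfl
    calc _ = C₂ * ((2 : ℝ) ^ (-(((i * (l - 1) : ℕ) : ℝ) * P)) *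
          (volume.real (⋃ m ∈ nonInnerDesc l i M, dyadicCube (j + i) m) /
            volume.real (dyadicCube j M)) ^ δ') := by ring
      _ ≤ C₂ * (V ^ δ' * (2 : ℝ) ^ (-(i * (μ * P)))) := mul_le_mul_of_nonneg_left hbase' hC₂0.le
      _ = _ := by ring
  calc _ ≤ ENNReal.ofReal ((2 : ℝ) ^ (-(i * (μ * P)))) * Z +
        ENNReal.ofReal (C₂ * V ^ δ' * (2 : ℝ) ^ (-(i * (μ * P)))) * Z :=
      add_le_add (mul_le_mul' (ENNReal.ofReal_le_ofReal hbase) le_rfl) h6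
    _ = ENNReal.ofReal ((1 + C₂ * V ^ δ') * (2 : ℝ) ^ (-(i * (μ * P)))) * Z := by
      rw [← add_mul, ← ENNReal.ofReal_add (by positivity) (by positivity)]
      congr 2; ring
    _ ≤ ENNReal.ofReal ((1 + C₂ * V ^ δ') * (2 : ℝ) ^ (-(i * (μ * P)))) *
        (ENNReal.ofReal (C₁ * (2 : ℝ) ^ (((j : ℝ) - ((j + i : ℕ) : ℝ)) * d * δ)) *
          gammaHat p γ j M ^ P) := mul_le_mul' le_rfl h1
    _ = _ := by
      rw [← mul_assoc, ← ENNReal.ofReal_mul (by positivity)]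
      congr 2
      have e : (-(i * (μ * P + d * δ)) : ℝ) =
          -(i * (μ * P)) + ((j : ℝ) - ((j + i : ℕ) : ℝ)) * d * δ := by push_cast; ring
      rw [e, Real.rpow_add (by norm_num)]
      ring

lemma exists_tsum_assoc_mul_gammaHat_le {n d l : ℕ} (hn : 1 ≤ n) (hl : 1 ≤ l) {p : ℝ≥0∞} (hp : p ≠ 0)
    (hp' : p ≠ ∞) {α₁ α₂ α₃ : ℝ} {s : ℕ → (Fin n → ℝ) → ℝ} (hs : LocY α₁ α₂ α₃ s)
    {γ : (Fin n ⊕ Fin d → ℝ) → ℝ} (hγ : IsWeight γ) (hγA : AInftyLoc fun z => γ z ^ p.toReal)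
    (hα₂ : α₂ < min (l : ℝ) (l - 1 + delta₂ p γ / p.toReal) + d * delta₁ p γ / p.toReal) :
    ∃ C θ : ℝ≥0, θ < 1 ∧ ∀ (j i : ℕ) (M : Fin n → ℤ), ∑' m : {m : Fin n → ℤ // anc i m = M},
      (assoc p s (j + i) m.1 * gammaHat p γ (j + i) m.1 * cellRate l i m.1) ^ p.toReal ≤
        (C * θ ^ i * (assoc p s j M * gammaHat p γ j M)) ^ p.toReal := by
  have h0 := toReal_pos' hp hp'
  obtain ⟨δ, δ', -, hδ, hδ'0, hδ', hlt⟩ := exists_exponents hp hp' hγA hγ hα₂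
  obtain ⟨B, hB0, hB⟩ := exists_tsum_gammaHat_le hn hl hp hp' hδ hδ'0 hδ'
  obtain ⟨C₁, hC₁⟩ := hs.exists_assoc_le_anc p
  set P := p.toReal with hP
  set μ := min (l : ℝ) (l - 1 + δ' / P) with hμ
  set g := μ + d * δ / P - α₂ with hg
  refine ⟨C₁ * B.toNNReal ^ (1 / P), (2 : ℝ≥0) ^ (-g),
    NNReal.rpow_lt_one_of_one_lt_of_neg (by norm_num) (by linarith), fun j i M => ?_⟩
  set a := assoc p s j M with ha
  have h1 : ∀ m : {m : Fin n → ℤ // anc i m = M},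
      (assoc p s (j + i) m.1 * gammaHat p γ (j + i) m.1 * cellRate l i m.1) ^ P ≤
      (C₁ * ENNReal.ofReal ((2 : ℝ) ^ (α₂ * i)) * a) ^ P *
        (gammaHat p γ (j + i) m.1 ^ P * (cellRate l i m.1 : ℝ≥0∞) ^ P) := by
    intro m
    rw [mul_assoc, ENNReal.mul_rpow_of_nonneg _ _ h0.le, ENNReal.mul_rpow_of_nonneg (gammaHat _ _ _ _) _ h0.le]
    refine mul_le_mul' (ENNReal.rpow_le_rpow ?_ h0.le) le_rfl
    have := hC₁ j i m.1
    rwa [m.2] at this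
  refine (ENNReal.tsum_le_tsum h1).trans ?_
  rw [ENNReal.tsum_mul_left]
  refine (mul_le_mul' le_rfl (hB j i M)).trans (le_of_eq ?_)
  have h2 : ENNReal.ofReal (B * (2 : ℝ) ^ (-(i * (μ * P + d * δ)))) =
      (((B.toNNReal ^ (1 / P) * (2 : ℝ≥0) ^ (-(i * (μ + d * δ / P))) : ℝ≥0)) : ℝ≥0∞) ^ P := by
    rw [← ENNReal.coe_rpow_of_nonneg _ h0.le, NNReal.mul_rpow, ← NNReal.rpow_mul, ← NNReal.rpow_mul,
      one_div_mul_cancel h0.ne', NNReal.rpow_one, ENNReal.ofReal, ENNReal.coe_inj]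
    ext
    rw [Real.coe_toNNReal _ (by positivity), NNReal.coe_mul, Real.coe_toNNReal _ hB0.le,
      NNReal.coe_rpow]
    congr 2
    field_simp
  have h3 : ENNReal.ofReal ((2 : ℝ) ^ (α₂ * i)) = (((2 : ℝ≥0) ^ (α₂ * i) : ℝ≥0) : ℝ≥0∞) := by
    rw [ENNReal.ofReal, ENNReal.coe_inj]
    ext
    rw [Real.coe_toNNReal _ (by positivity), NNReal.coe_rpow]
    rfl
  have h4 : (2 : ℝ≥0) ^ (α₂ * i) * (2 : ℝ≥0) ^ (-(i * (μ + d * δ / P))) = ((2 : ℝ≥0) ^ (-g)) ^ i := by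
    rw [← NNReal.rpow_add (by norm_num), ← NNReal.rpow_mul_natCast]
    congr 1
    rw [hg]; ring
  rw [h2, h3, ← ENNReal.mul_rpow_of_nonneg _ _ h0.le, ← ENNReal.mul_rpow_of_nonneg _ _ h0.le,
    ← ENNReal.coe_pow, ← h4]
  congr 1
  push_cast
  ring

lemma exists_assoc_mul_gammaHat_le_neighbour {n d : ℕ} {p : ℝ≥0∞} (hp : p ≠ 0)
    (hp' : p ≠ ∞) {α₁ α₂ α₃ : ℝ} {s : ℕ → (Fin n → ℝ) → ℝ} (hs : LocY α₁ α₂ α₃ s)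
    {γ : (Fin n ⊕ Fin d → ℝ) → ℝ} (hγ : IsWeight γ) (hγA : AInftyLoc fun z => γ z ^ p.toReal)
    (R : ℕ) : ∃ D : ℝ≥0, ∀ (k : ℕ) (m : Fin n → ℤ), ∀ e ∈ intBox n R,
      assoc p s k m * gammaHat p γ k m ≤ D * (assoc p s k (m + e) * gammaHat p γ k (m + e)) := by
  obtain ⟨D₁, h₁⟩ := hs.exists_assoc_le_neighbour p R
  obtain ⟨D₂, h₂⟩ := exists_gammaHat_le_neighbour hp hp' hγA hγ R
  refine ⟨D₁ * D₂, fun k m e he => (mul_le_mul' (h₁ k m e he) (h₂ k m e he)).trans (le_of_eq ?_)⟩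
  push_cast
  ring

end VarBesov

end

theorem corollary4p1 (n d l : ℕ) (hn : 1 ≤ n) (hl : 1 ≤ l)
    (p q r : ℝ≥0∞) (hp : 0 < p) (hp' : p ≠ ∞) (hq : 0 < q) (hr : 0 < r)
    (α₁ α₂ α₃ : ℝ) (hα₃ : 0 ≤ α₃)
    (s : ℕ → (Fin n → ℝ) → ℝ) (hs : VarBesov.LocY α₁ α₂ α₃ s)
    (γ : (Fin n ⊕ Fin d → ℝ) → ℝ) (hγ : VarBesov.IsWeight γ)
    (hγA : VarBesov.AInftyLoc (fun z => γ z ^ p.toReal))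
    (hα₂ : α₂ < min (l : ℝ) ((l : ℝ) - 1 + VarBesov.delta₂ p γ / p.toReal) +
      d * VarBesov.delta₁ p γ / p.toReal)
    (τ : ℕ → (Fin n → ℤ) → ℝ≥0∞)
    (hτ : ∀ k m, τ k m = VarBesov.assoc p s k m * VarBesov.gammaHat p γ k m)
    (A : ℝ) (hA : 1 ≤ A) :
    ∃ C : ℝ≥0, ∀ t : ℕ → (Fin n → ℝ) → ℝ, (∀ k, VarBesov.IsWeight (t k)) →
      (∀ k m, VarBesov.assoc p t k m = τ k m) →
      ∀ φ : (Fin n → ℝ) → ℝ, VarBesov.MemLpLoc φ r →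
        (VarBesov.MemBesov l p q r t φ ↔ VarBesov.N₁ l p q r τ φ < ∞) ∧
        VarBesov.N₁ l p q r τ φ ≤ C * VarBesov.besovNorm l p q r t φ ∧
        VarBesov.besovNorm l p q r t φ ≤ C * VarBesov.N₁ l p q r τ φ ∧
        ∀ P : ℕ → (Fin n → ℤ) → MvPolynomial (Fin n) ℝ,
          (∀ k m, VarBesov.IsAlmostBest l r A φ (VarBesov.dyadicCube k m) (P k m)) →
          VarBesov.N₁ l p q r τ φ ≤ C * VarBesov.N₂ l p q r τ P φ ∧
          VarBesov.N₂ l p q r τ P φ ≤ C * VarBesov.N₁ l p q r τ φ := by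
  obtain ⟨D, hD⟩ := VarBesov.exists_assoc_mul_gammaHat_le_neighbour hp.ne' hp' hs hγ hγA (2 * l + 3)
  obtain ⟨C₀, θ, hθ, hdecay⟩ := VarBesov.exists_tsum_assoc_mul_gammaHat_le hn hl hp.ne' hp' hs hγ hγA hα₂
  simp_rw [← hτ] at hD hdecay
  have hDl : ∀ (k : ℕ) (m : Fin n → ℤ), ∀ e ∈ VarBesov.intBox n l, τ k m ≤ D * τ k (m + e) :=
    fun k m e he => hD k m e (VarBesov.intBox_mono n (by omega) he)
  obtain ⟨C₁, hC₁⟩ := VarBesov.exists_N₁_le_besovNorm n l hl hp.ne' hp' hq.ne' hr.ne' D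
  obtain ⟨C₂, hC₂⟩ := VarBesov.exists_besovNorm_le_N₁ n hl hp.ne' hp' hq.ne' hr.ne' D C₀ θ hθ
  obtain ⟨C₃, hC₃⟩ := VarBesov.exists_N₁_le_N₂_le n l hl hp.ne' hq.ne' hr.ne' D A
  have hle : ∀ {x y : ℝ≥0∞} {c c' : ℝ≥0}, c ≤ c' → x ≤ c * y → x ≤ c' * y := fun hc h =>
    h.trans (mul_le_mul' (ENNReal.coe_le_coe.2 hc) le_rfl)
  refine ⟨C₁ + C₂ + C₃, fun t ht htτ φ hφ => ?_⟩
  obtain ⟨ψ, hψ, hφψ⟩ := hφ.aemeasurable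
  have h1 : VarBesov.N₁ l p q r τ φ ≤ C₁ * VarBesov.besovNorm l p q r t φ := by
    rw [VarBesov.N₁_congr l p q r τ hφψ, VarBesov.besovNorm_congr l p q r t hφψ]
    exact hC₁ τ hDl t ht htτ ψ hψ (hφ.congr hφψ)
  have h2 : VarBesov.besovNorm l p q r t φ ≤ C₂ * VarBesov.N₁ l p q r τ φ := by
    rw [VarBesov.N₁_congr l p q r τ hφψ, VarBesov.besovNorm_congr l p q r t hφψ]
    exact hC₂ τ hD hdecay t ht htτ ψ hψ
  refine ⟨⟨fun h => h1.trans_lt (ENNReal.mul_lt_top ENNReal.coe_lt_top h.2),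
    fun h => ⟨hφ, h2.trans_lt (ENNReal.mul_lt_top ENNReal.coe_lt_top h)⟩⟩,
    hle (by rw [add_assoc]; exact le_self_add) h1,
    hle (le_add_self.trans le_self_add) h2, fun P hP => ?_⟩
  have h3 : VarBesov.N₁ l p q r τ φ ≤ C₃ * VarBesov.N₂ l p q r τ P φ ∧
      VarBesov.N₂ l p q r τ P φ ≤ C₃ * VarBesov.N₁ l p q r τ φ := by
    rw [VarBesov.N₁_congr l p q r τ hφψ, VarBesov.N₂_congr l p q r τ P hφψ]
    exact hC₃ τ hDl ψ hψ P fun k m => (hP k m).congr hφψ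
  exact ⟨hle le_add_self h3.1, hle le_add_self h3.2⟩
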